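/- Let $X$ be a smooth (Hausdorff, second countable) manifold of dimension $N=n+m$, $n\ge 1$. Let $\mathrm{Imm}\,T^r_nX$ be the manifold of $r$-jets $j^r_0\gamma$ at $0\in\mathbb R^n$ of immersions $\gamma$ into $X$, let $L^r_n$ be the group of $r$-jets of local diffeomorphisms of $(\mathbb R^n,0)$, acting by composition, and let $\rho:\mathrm{Imm}\,T^r_nX\to P^r_nX=\mathrm{Imm}\,T^r_nX/L^r_n$. A chart of $X$ with coordinates split as $(x^i,y^\sigma)$, $1\le i\le n$, $1\le\sigma\le m$, induces, where $\det\mathbf x\neq 0$, $\mathbf x=(x^i_j)=(\partial (x^i\circ\gamma)/\partial t^j)$, a chart $(x^i,y^\sigma_I)_{|I|\le r}$ of $P^r_nX$, given by $y^\sigma_{iI}=(\mathbf x^{-1})^j_i\,d_jy^\sigma_I$ ($d_j$ the formal derivative). In it put $\Delta^{j_1\dots j_k}_\sigma=\frac{r_1!\cdots r_n!}{k!}\,\partial/\partial y^\sigma_{j_1\dots j_k}$ ($r_i$ the multiplicity of $i$ in $j_1,\dots,j_k$), $D_i=\partial/\partial x^i+\sum_{|J|\le r-1}y^\sigma_{iJ}\Delta^J_\sigma$,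 $\omega^\sigma_J=dy^\sigma_J-y^\sigma_{iJ}dx^i$ ($|J|\le r-1$), $\theta_0=dx^1\wedge\dots\wedge dx^n$; sums over $I,J,\dots$ are over tuples of indices. A form of degree $q>n$ on $P^r_nX$ is called contact if in every such chart it is a finite sum of terms $\omega^{\sigma_1}_{J_1}\wedge\dots\wedge\omega^{\sigma_p}_{J_p}\wedge d\omega^{\nu_1}_{I_1}\wedge\dots\wedge d\omega^{\nu_l}_{I_l}\wedge\Phi$ with $p+l=q-n+1$, $|J_a|\le r-1$, $|I_b|=r-1$ and $\Phi$ smooth; these forms are denoted $\Omega^r_{q(c)}(PX)\subset\Omega^r_q(PX)$. Let $s\ge 1$, $t\ge 2s$, and let $\mathcal T=\mathcal T_A\,dx^A$ be a homogeneous differential equation on $\mathrm{Imm}\,T^s_nX$: a smooth $1$-form of this local shape such that $(\phi_a)^*\mathcal T=\det(a)\,\mathcal T$ for every $a\in L^s_n$ ($\phi_a$ the right action) and $(j^s\gamma)^*\mathcal T=0$ for every immersion $\gamma$. In each chart let $T_\sigma$ be the associated functions on the chart domain in $P^s_nX$, determined by $\mathcal T_\sigma=\det(\mathbf x)\,T_\sigma\circ\rho$;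 they are well defined and smooth. For $|I|\le s$ define on the chart domain in $P^t_nX$ $$H^I_{\sigma\nu}(T)=\Delta^I_\nu T_\sigma-(-1)^{|I|}\sum_{|J|\le s-|I|}(-1)^{|J|}\binom{|I|+|J|}{|I|}D_J\Delta^{IJ}_\sigma T_\nu .$$ (1) Let $(x^i,y^\sigma)$ and $(\bar x^i,\bar y^\sigma)$ be two overlapping charts, $Q^l_p=D_p\bar x^l$, $P^j_iQ^l_j=\delta^l_i$, $\mathcal J=\det(Q)$, $P^\nu_\sigma=\Delta_\sigma\bar y^\nu-\bar y^\nu_i\,\Delta_\sigma\bar x^i$. Then on the overlap of the corresponding chart domains in $P^t_nX$ $$H_{\sigma\nu}(T)=\mathcal J P^\alpha_\sigma\sum_{|J|\le s}\left[\Delta_\nu\bar y^\beta_J-P^i_j(D_i\bar y^\beta_J)(\Delta_\nu\bar x^j)\right]\bar H^J_{\alpha\beta}(\bar T),$$ $$H^I_{\sigma\nu}(T)=\mathcal J P^\alpha_\sigma\sum_{|I|\le|J|\le s}\left(\Delta^I_\nu\bar y^\beta_J\right)\bar H^J_{\alpha\beta}(\bar T),\qquad 1\le|I|\le s .$$ (2)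 There is a unique class $[H(T)]\in\Omega^t_{n+2}(PX)/\Omega^t_{n+2(c)}(PX)$ on $P^t_nX$ such that, in every such chart, each representative of it differs by a contact $(n+2)$-form from $$H(T)=\sum_{|I|\le s}H^I_{\sigma\nu}(T)\,\omega^\nu_I\wedge\omega^\sigma\wedge\theta_0 .$$ -/

import Mathlib

open scoped Manifold ContDiff Topology

noncomputable section

namespace HelmholtzSonin

/-! ## Partial derivatives and multi-indices

A tuple of indices `j₁, …, j_k ∈ {1, …, n}` is a list (or a function `Fin k → Fin n`); since all
quantities below are symmetric in such indices, coordinates are labelled by multisets. -/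

/-- `∂f/∂tʲ` for a real function on `ℝⁿ`. -/
def pderiv {n : ℕ} (j : Fin n) (f : (Fin n → ℝ) → ℝ) : (Fin n → ℝ) → ℝ :=
  fun t => fderiv ℝ f t (Pi.single j 1)

/-- The iterated partial derivative `∂ᵏf/∂tʲ¹…∂tʲᵏ`. -/
def pderivs {n : ℕ} : List (Fin n) → ((Fin n → ℝ) → ℝ) → (Fin n → ℝ) → ℝ
  | [], f => f
  | j :: l, f => pderiv j (pderivs l f)

/-- Symmetric multi-indices `I` with `|I| ≤ r`. -/
abbrev MIdx (n r : ℕ) : Type := {I : Multiset (Fin n) // I.card ≤ r}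

instance (n r : ℕ) : Fintype (MIdx n r) :=
  Fintype.ofInjective
    (fun I : MIdx n r =>
      (⟨⟨I.1.card, Nat.lt_succ_of_le I.2⟩, ⟨I.1, rfl⟩⟩ : Σ k : Fin (r + 1), Sym (Fin n) k))
    (by
      intro I J h
      have hc : (⟨I.1.card, Nat.lt_succ_of_le I.2⟩ : Fin (r + 1))
          = ⟨J.1.card, Nat.lt_succ_of_le J.2⟩ := congrArg Sigma.fst h
      have key : ∀ p q : (Σ k : Fin (r + 1), Sym (Fin n) k), p = q → p.2.1 = q.2.1 := by
        rintro p q rfl; rfl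
      exact Subtype.ext (key _ _ h))

/-- A multi-index written as a nondecreasing tuple `j₁ ≤ j₂ ≤ … ≤ j_k`. -/
def sorted {n : ℕ} (I : Multiset (Fin n)) : List (Fin n) := I.sort (· ≤ ·)

/-! ## Regular velocities, the differential group, and the Grassmann manifold

`X` is a manifold of dimension `N = n + m`, modelled on `ℝ^N`. -/

section Geometry

variable (n m : ℕ) (X : Type*) [TopologicalSpace X] [ChartedSpace (Fin (n + m) → ℝ) X]

/-- Germs at `0 ∈ ℝⁿ` of smooth immersions into `X` (represented by a map on all of `ℝⁿ` of which
only the restriction to a neighbourhood of `0` is used). -/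
structure ImmGerm where
  toFun : (Fin n → ℝ) → X
  smooth : ∃ U ∈ 𝓝 (0 : Fin n → ℝ),
    ContMDiffOn 𝓘(ℝ, Fin n → ℝ) 𝓘(ℝ, Fin (n + m) → ℝ) ∞ toFun U
  immersion : Function.Injective
    (mfderiv 𝓘(ℝ, Fin n → ℝ) 𝓘(ℝ, Fin (n + m) → ℝ) toFun 0)

/-- The charts of the manifold `X`: all the charts compatible with the given atlas. -/
def IsChart (ψ : OpenPartialHomeomorph X (Fin (n + m) → ℝ)) : Prop :=
  ψ ∈ IsManifold.maximalAtlas 𝓘(ℝ, Fin (n + m) → ℝ) ∞ X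

/-- `γ` and `δ` have the same `r`-jet at `0`: the same target, and the same partial derivatives up
to order `r` at `0` in the charts around the target (by the chain rule it does not matter whether
this is asked of one chart or of all of them). -/
def JetEq (r : ℕ) (γ δ : ImmGerm n m X) : Prop :=
  γ.toFun 0 = δ.toFun 0 ∧
    ∀ ψ : OpenPartialHomeomorph X (Fin (n + m) → ℝ), IsChart n m X ψ → γ.toFun 0 ∈ ψ.source →
      ∀ k ≤ r, iteratedFDeriv ℝ k (fun t => ψ (γ.toFun t)) 0
        = iteratedFDeriv ℝ k (fun t => ψ (δ.toFun t)) 0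

/-- Equality of `r`-jets as an equivalence relation. -/
def jetSetoid (r : ℕ) : Setoid (ImmGerm n m X) where
  r := JetEq n m X r
  iseqv :=
    { refl := fun _ => ⟨rfl, fun _ _ _ _ _ => rfl⟩
      symm := fun h => ⟨h.1.symm, fun ψ hψ hs k hk => (h.2 ψ hψ (h.1 ▸ hs) k hk).symm⟩
      trans := fun h h' => ⟨h.1.trans h'.1, fun ψ hψ hs k hk =>
        (h.2 ψ hψ hs k hk).trans (h'.2 ψ hψ (h.1 ▸ hs) k hk)⟩ }

/-- `Imm T^r_n X`, the set of regular `(r,n)`-velocities `j^r_0 γ`. -/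
def Velocity (r : ℕ) : Type _ := Quotient (jetSetoid n m X r)

variable {n m X}

/-- The `r`-jet `j^r_0 γ`. -/
def jet (r : ℕ) (γ : ImmGerm n m X) : Velocity n m X r := Quotient.mk (jetSetoid n m X r) γ

/-- The target `γ(0)` of a velocity. -/
def Velocity.base {r : ℕ} (v : Velocity n m X r) : X :=
  Quotient.lift (s := jetSetoid n m X r) (fun γ : ImmGerm n m X => γ.toFun 0) (fun _ _ h => h.1) v

/-- Germs at `0` of local diffeomorphisms of `ℝⁿ` fixing `0`; their `r`-jets make up the
differential group `L^r_n`. -/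
structure Reparam (n : ℕ) where
  toFun : (Fin n → ℝ) → (Fin n → ℝ)
  smooth : ∃ U ∈ 𝓝 (0 : Fin n → ℝ), ContDiffOn ℝ ∞ toFun U
  map_zero : toFun 0 = 0
  det_ne_zero : (fderiv ℝ toFun 0).det ≠ 0

/-- `det(a) = det(aⁱⱼ)` for `a = j^r_0 α`, `r ≥ 1`. -/
def Reparam.det {n : ℕ} (α : Reparam n) : ℝ := (fderiv ℝ α.toFun 0).det

/-- The germ of `δ` is that of `γ ∘ α`, so that `j^r_0 δ = (j^r_0 γ) · (j^r_0 α)`. -/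
def IsComp (γ : ImmGerm n m X) (α : Reparam n) (δ : ImmGerm n m X) : Prop :=
  δ.toFun =ᶠ[𝓝 0] γ.toFun ∘ α.toFun

variable (n m X) in
/-- The Grassmann manifold `P^r_n X = Imm T^r_n X / L^r_n` as a set: `(r,n)`-contact elements. -/
def Grassmann (r : ℕ) : Type _ :=
  Quot (fun v w : Velocity n m X r =>
    ∃ (γ δ : ImmGerm n m X) (α : Reparam n), IsComp γ α δ ∧ jet r γ = v ∧ jet r δ = w)

/-- The projection `ρ^r_n : Imm T^r_n X → P^r_n X`. -/
def rho {r : ℕ} (v : Velocity n m X r) : Grassmann n m X r := Quot.mk _ v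

/-! ## Adapted charts -/

variable (n m X) in
/-- A chart `ψ = (x^A)` of `X` with a splitting of its `n + m` coordinates into `n` coordinates
`xⁱ` (`e ∘ inl`) and `m` coordinates `y^σ` (`e ∘ inr`). -/
structure AChart where
  ψ : OpenPartialHomeomorph X (Fin (n + m) → ℝ)
  isChart : IsChart n m X ψ
  e : Fin n ⊕ Fin m ≃ Fin (n + m)

namespace AChart

variable (c : AChart n m X)

/-- `xⁱ ∘ γ`. -/
def xFun (γ : ImmGerm n m X) (i : Fin n) : (Fin n → ℝ) → ℝ :=
  fun t => c.ψ (γ.toFun t) (c.e (Sum.inl i))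

/-- The matrix `𝐱 = (xⁱ_j)` along `γ`, `xⁱ_j = ∂(xⁱ ∘ γ)/∂tʲ`. -/
def xMat (γ : ImmGerm n m X) (t : Fin n → ℝ) : Matrix (Fin n) (Fin n) ℝ :=
  Matrix.of fun i j => pderiv j (c.xFun γ i) t

/-- `det(𝐱)` at `j^r_0 γ`. -/
def detX (γ : ImmGerm n m X) : ℝ := (c.xMat γ 0).det

/-- The functions `y^σ_I` along the prolongation of `γ`, by the recurrence `y^σ = x^σ`,
`y^σ_{iI} = zʲ_i d_j y^σ_I`, where `(zʲ_i) = 𝐱⁻¹`; along the prolongation of `γ` the formal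
derivative `d_j` is `∂/∂tʲ`. -/
def yFun (γ : ImmGerm n m X) (σ : Fin m) : List (Fin n) → (Fin n → ℝ) → ℝ
  | [] => fun t => c.ψ (γ.toFun t) (c.e (Sum.inr σ))
  | i :: l => fun t => ∑ j, (c.xMat γ t)⁻¹ j i * pderiv j (yFun γ σ l) t

/-- `j^r_0 γ` (`r ≥ 1`) lies in the domain `W` of the adapted chart. -/
def InDom (γ : ImmGerm n m X) : Prop := γ.toFun 0 ∈ c.ψ.source ∧ c.detX γ ≠ 0

end AChart

end Geometry

/-! ## The coordinate space of `P^r_n X` -/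

/-- The space of coordinates `(xⁱ, y^σ_I)`, `|I| ≤ r`. -/
abbrev Coord (n m r : ℕ) : Type := (Fin n → ℝ) × (Fin m → MIdx n r → ℝ)

section Coordinates

variable {n m r : ℕ}

/-- The coordinate differential `dxⁱ`. -/
def dx (i : Fin n) : Coord n m r →ₗ[ℝ] ℝ :=
  (LinearMap.proj i : (Fin n → ℝ) →ₗ[ℝ] ℝ) ∘ₗ LinearMap.fst ℝ _ _

/-- The coordinate differential `dy^σ_I` (zero if `|I| > r`). It is also the linear coordinate
function `y^σ_I`. -/
def dy (σ : Fin m) (I : Multiset (Fin n)) : Coord n m r →ₗ[ℝ] ℝ :=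
  if h : I.card ≤ r then
    (LinearMap.proj (⟨I, h⟩ : MIdx n r) : (MIdx n r → ℝ) →ₗ[ℝ] ℝ) ∘ₗ
      (LinearMap.proj σ : (Fin m → MIdx n r → ℝ) →ₗ[ℝ] (MIdx n r → ℝ)) ∘ₗ LinearMap.snd ℝ _ _
  else 0

/-- The unit vector `∂/∂y^σ_I` (zero if `|I| > r`). -/
def ey (σ : Fin m) (I : Multiset (Fin n)) : Coord n m r :=
  if h : I.card ≤ r then (0, Pi.single σ (Pi.single (⟨I, h⟩ : MIdx n r) 1)) else 0

/-- `Δ^{j₁…j_k}_σ = (r₁! ⋯ r_n! / k!) ∂/∂y^σ_{j₁…j_k}`, where `r_i` is the number of times that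
`i` occurs among `j₁, …, j_k`. -/
def Del (σ : Fin m) (l : List (Fin n)) (f : Coord n m r → ℝ) : Coord n m r → ℝ :=
  fun k => ((∏ i, ((l.count i).factorial : ℝ)) / (l.length.factorial : ℝ))
    * fderiv ℝ f k (ey σ (l : Multiset (Fin n)))

/-- The vector `∂/∂xⁱ + ∑_{|J| ≤ r-1} y^σ_{iJ} Δ^J_σ` at the point `k`. (Summing over tuples `J`
with the weights of `Δ^J_σ` is summing over multisets `J` without weights.) -/
def totalVec (i : Fin n) (k : Coord n m r) : Coord n m r :=
  (Pi.single i 1, fun σ J => if J.1.card < r then dy σ (i ::ₘ J.1) k else 0)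

/-- The total derivative `D_i`. -/
def D (i : Fin n) (f : Coord n m r → ℝ) : Coord n m r → ℝ :=
  fun k => fderiv ℝ f k (totalVec i k)

/-- `D_I = D_{j₁} ⋯ D_{j_k}`. -/
def Ds : List (Fin n) → (Coord n m r → ℝ) → Coord n m r → ℝ
  | [], f => f
  | j :: l, f => D j (Ds l f)

/-- The projection `P^t_n X → P^s_n X`, `s ≤ t`, in coordinates. -/
def truncate {s t : ℕ} (h : s ≤ t) (k : Coord n m t) : Coord n m s :=
  (k.1, fun σ I => k.2 σ ⟨I.1, I.2.trans h⟩)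

/-- The Lie-Euler operators for functions of order `s`:
`E^I_σ(L) = ∑_{|J| ≤ s - |I|} (-1)^{|J|} (|I|+|J| choose |I|) D_J Δ^{IJ}_σ L`. -/
def lieEuler (s : ℕ) (σ : Fin m) (I : List (Fin n)) (L : Coord n m r → ℝ) : Coord n m r → ℝ :=
  fun k => ∑ j ∈ Finset.range (s + 1 - I.length), ∑ J : Fin j → Fin n,
    (-1 : ℝ) ^ j * ((I.length + j).choose I.length : ℝ)
      * Ds (List.ofFn J) (Del σ (I ++ List.ofFn J) L) k

/-- The Helmholtz-Sonin expressions
`H^I_{σν}(T) = Δ^I_ν T_σ - (-1)^{|I|} E^I_σ(T_ν)`, `|I| ≤ s`, of functions `T_σ` of order `s`, as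
functions of order `t ≥ 2s`. -/
def HS {s t : ℕ} (h : s ≤ t) (T : Fin m → Coord n m s → ℝ) (σ ν : Fin m) (I : List (Fin n)) :
    Coord n m t → ℝ :=
  fun k => Del ν I (fun k' => T σ (truncate h k')) k
    - (-1 : ℝ) ^ I.length * lieEuler s σ I (fun k' => T ν (truncate h k')) k

/-! ## Differential forms on the coordinate space -/

/-- Exterior product of alternating forms. -/
def wedge {V : Type*} [AddCommGroup V] [Module ℝ V] {a b q : ℕ} (h : a + b = q)
    (α : V [⋀^Fin a]→ₗ[ℝ] ℝ) (β : V [⋀^Fin b]→ₗ[ℝ] ℝ) : V [⋀^Fin q]→ₗ[ℝ] ℝ :=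
  ((TensorProduct.lid ℝ ℝ).toLinearMap.compAlternatingMap (α.domCoprod β)).domDomCongr
    (finSumFinEquiv.trans (finCongr h))

/-- A linear functional as an alternating 1-form. -/
def oneForm {V : Type*} [AddCommGroup V] [Module ℝ V] (α : V →ₗ[ℝ] ℝ) : V [⋀^Fin 1]→ₗ[ℝ] ℝ :=
  AlternatingMap.ofSubsingleton ℝ V ℝ (0 : Fin 1) α

/-- `q`-forms on the coordinate space. -/
abbrev CForm (n m r q : ℕ) : Type := Coord n m r → (Coord n m r) [⋀^Fin q]→ₗ[ℝ] ℝ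

/-- Smoothness of a form on a set. -/
def SmoothFormOn {q : ℕ} (U : Set (Coord n m r)) (β : CForm n m r q) : Prop :=
  ∀ v : Fin q → Coord n m r, ContDiffOn ℝ ∞ (fun k => β k v) U

/-- The contact 1-forms `ω^σ_J = dy^σ_J - y^σ_{iJ} dxⁱ`, `|J| ≤ r - 1`. -/
def omega (σ : Fin m) (J : Multiset (Fin n)) (k : Coord n m r) : Coord n m r →ₗ[ℝ] ℝ :=
  dy σ J - ∑ i, dy σ (i ::ₘ J) k • dx i

/-- The 2-forms `dω^σ_J = - ∑_i dy^σ_{iJ} ∧ dxⁱ`, `|J| ≤ r - 1`. -/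
def dOmega (σ : Fin m) (J : Multiset (Fin n)) : (Coord n m r) [⋀^Fin 2]→ₗ[ℝ] ℝ :=
  - ∑ i, wedge (rfl : 1 + 1 = 2) (oneForm (dy σ (i ::ₘ J))) (oneForm (dx i))

/-- `θ₀ = dx¹ ∧ ⋯ ∧ dxⁿ`. -/
def theta0 : (Coord n m r) [⋀^Fin n]→ₗ[ℝ] ℝ :=
  (Matrix.detRowAlternating : (Fin n → ℝ) [⋀^Fin n]→ₗ[ℝ] ℝ).compLinearMap (LinearMap.fst ℝ _ _)

/-- `ContactOrder U d q β`: on `U` the `q`-form `β` is a finite sum of terms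
`ω^{σ₁}_{J₁} ∧ ⋯ ∧ ω^{σ_p}_{J_p} ∧ dω^{ν₁}_{I₁} ∧ ⋯ ∧ dω^{ν_s}_{I_s} ∧ Φ` with `p + s = d`,
`|J_a| ≤ r - 1`, `|I_b| = r - 1`, and smooth forms `Φ` (no terms if the degree of `Φ` would be
negative). -/
inductive ContactOrder (U : Set (Coord n m r)) : ℕ → (q : ℕ) → CForm n m r q → Prop
  | base {q : ℕ} (β : CForm n m r q) (hβ : SmoothFormOn U β) : ContactOrder U 0 q β
  | omega_wedge {d a q : ℕ} (h : 1 + a = q) (σ : Fin m) (J : Multiset (Fin n)) (hJ : J.card + 1 ≤ r)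
      (β : CForm n m r a) (hβ : ContactOrder U d a β) :
      ContactOrder U (d + 1) q (fun k => wedge h (oneForm (omega σ J k)) (β k))
  | dOmega_wedge {d a q : ℕ} (h : 2 + a = q) (σ : Fin m) (I : Multiset (Fin n)) (hI : I.card + 1 = r)
      (β : CForm n m r a) (hβ : ContactOrder U d a β) :
      ContactOrder U (d + 1) q (fun k => wedge h (dOmega σ I) (β k))
  | zero (d q : ℕ) : ContactOrder U d q 0
  | add {d q : ℕ} (β β' : CForm n m r q) (hβ : ContactOrder U d q β)
      (hβ' : ContactOrder U d q β') : ContactOrder U d q (β + β')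
  | neg {d q : ℕ} (β : CForm n m r q) (hβ : ContactOrder U d q β) : ContactOrder U d q (-β)
  | congr {d q : ℕ} (β β' : CForm n m r q) (hU : Set.EqOn β β' U)
      (hβ : ContactOrder U d q β) : ContactOrder U d q β'

/-- Strongly contact forms of degree `q = n + d > n`: there are `p + s = q - n + 1` contact factors
in each term. -/
def StronglyContactOn (U : Set (Coord n m r)) {d : ℕ} (β : CForm n m r (n + d)) : Prop :=
  ContactOrder U (d + 1) (n + d) β

/-- The local form `∑_{|I| ≤ s} H^I_{σν}(T) ω^ν_I ∧ ω^σ ∧ θ₀`, summed over tuples `I` and over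
`σ, ν`. -/
def HSForm {s t : ℕ} (h : s ≤ t) (T : Fin m → Coord n m s → ℝ) : CForm n m t (n + 2) :=
  fun k => ∑ j ∈ Finset.range (s + 1), ∑ I : Fin j → Fin n, ∑ σ, ∑ ν,
    HS h T σ ν (List.ofFn I) k •
      wedge (by omega : 1 + (1 + n) = n + 2)
        (oneForm (omega ν (List.ofFn I : Multiset (Fin n)) k))
        (wedge rfl (oneForm (omega σ 0 k)) theta0)

end Coordinates

/-! ## Charts, chart changes and differential forms on `P^r_n X`, `r ≥ 1` -/

section Forms

variable {n m : ℕ} {X : Type*} [TopologicalSpace X] [ChartedSpace (Fin (n + m) → ℝ) X]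

/-- A representative of a contact element. -/
def Grassmann.rep {r : ℕ} (p : Grassmann n m X r) : ImmGerm n m X :=
  Quotient.out (s := jetSetoid n m X r) (Quot.out p)

namespace AChart

variable (c c' : AChart n m X) (r : ℕ)

/-- The functions `(xⁱ, y^σ_I)`, `|I| ≤ r`, at `j^r_0 γ`. -/
def coordGerm (γ : ImmGerm n m X) : Coord n m r :=
  (fun i => c.xFun γ i 0, fun σ I => c.yFun γ σ (sorted I.1) 0)

/-- The domain `ρ(W)` of the adapted chart on `P^r_n X`. -/
def dom : Set (Grassmann n m X r) := {p | ∃ γ, c.InDom γ ∧ rho (jet r γ) = p}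

/-- The adapted chart `(xⁱ, y^σ_I)` on `ρ(W) ⊆ P^r_n X`. The `y^σ_I` depend on the `r`-jet only and
are invariant under `L^r_n`, so the choice of the representative is immaterial. -/
def coord (p : Grassmann n m X r) : Coord n m r := c.coordGerm r p.rep

/-- The image of the adapted chart, an open subset of the coordinate space. -/
def image : Set (Coord n m r) := c.coord r '' c.dom r

/-- The part of the image of the chart `c` that corresponds to the overlap with `c'`. -/
def overlap : Set (Coord n m r) := c.coord r '' (c.dom r ∩ c'.dom r)

open Classical in
/-- The chart change `(xⁱ, y^σ_I) ↦ (x̄ⁱ, ȳ^σ_I)` from `c` to `c'`, i.e. `c'.coord ∘ c.coord⁻¹`. -/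
def change (k : Coord n m r) : Coord n m r :=
  if h : ∃ p ∈ c.dom r, c.coord r p = k then c'.coord r h.choose else 0

/-- `x̄ʲ` as a function of the coordinates of `c`. -/
def xBar (j : Fin n) : Coord n m r → ℝ := fun k => (c.change c' r k).1 j

/-- `ȳ^ν_J` as a function of the coordinates of `c`. -/
def yBar (ν : Fin m) (J : List (Fin n)) : Coord n m r → ℝ :=
  fun k => dy ν (J : Multiset (Fin n)) (c.change c' r k)

/-- The matrix `Qˡ_p = D_p x̄ˡ`. -/
def Q (k : Coord n m r) : Matrix (Fin n) (Fin n) ℝ :=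
  Matrix.of fun l p => D p (c.xBar c' r l) k

/-- The inverse matrix, `Pʲ_i Qˡ_j = δˡ_i`; the entry `(j, i)` is `Pʲ_i`. -/
def Pmat (k : Coord n m r) : Matrix (Fin n) (Fin n) ℝ := (c.Q c' r k)⁻¹

/-- `𝓙 = det(D_i x̄ʲ)`. -/
def J (k : Coord n m r) : ℝ := (c.Q c' r k).det

/-- `P^ν_σ = Δ_σ ȳ^ν - ȳ^ν_i Δ_σ x̄ⁱ`. -/
def P (ν σ : Fin m) (k : Coord n m r) : ℝ :=
  Del σ [] (c.yBar c' r ν []) k - ∑ i, c.yBar c' r ν [i] k * Del σ [] (c.xBar c' r i) k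

end AChart

variable (n m X) in
/-- `Ω^r_q(P X)`: smooth differential `q`-forms on `P^r_n X`, given by their local expressions in
the adapted charts, which are related by pull-back along the chart changes (and are put equal to
zero outside the image of the chart). -/
def Form (r q : ℕ) : AddSubgroup (AChart n m X → CForm n m r q) where
  carrier := {β | (∀ c, SmoothFormOn (c.image r) (β c)) ∧
    (∀ c c' : AChart n m X, ∀ k ∈ c.overlap c' r,
      β c k = (β c' (c.change c' r k)).compLinearMap
        (fderiv ℝ (c.change c' r) k : Coord n m r →ₗ[ℝ] Coord n m r)) ∧
    ∀ c, ∀ k ∉ c.image r, β c k = 0}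
  add_mem' := by
    rintro β β' ⟨h1, h2, h3⟩ ⟨h1', h2', h3'⟩
    refine ⟨fun c v => (h1 c v).add (h1' c v), fun c c' k hk => ?_, fun c k hk => ?_⟩
    · ext v
      simp [h2 c c' k hk, h2' c c' k hk]
    · simp [h3 c k hk, h3' c k hk]
  zero_mem' := by
    refine ⟨fun c v => contDiffOn_const, fun c c' k hk => ?_, fun c k hk => rfl⟩
    ext v
    simp
  neg_mem' := by
    rintro β ⟨h1, h2, h3⟩
    refine ⟨fun c v => (h1 c v).neg, fun c c' k hk => ?_, fun c k hk => ?_⟩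
    · ext v
      simp [h2 c c' k hk]
    · simp [h3 c k hk]

variable (n m X) in
/-- `Ω^r_{n+d (c)}(P X)`, `d ≥ 1`: the strongly contact forms of degree `n + d`. -/
def ContactForm (r d : ℕ) : AddSubgroup (Form n m X r (n + d)) where
  carrier := {β | ∀ c : AChart n m X, StronglyContactOn (c.image r) (β.1 c)}
  add_mem' := by
    intro β β' h h' c
    exact ContactOrder.add (β.1 c) (β'.1 c) (h c) (h' c)
  zero_mem' := by
    intro c
    exact ContactOrder.zero (d + 1) (n + d)
  neg_mem' := by
    intro β h c
    exact ContactOrder.neg (β.1 c) (h c)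

/-! ## Differential equations on `Imm T^s_n X` -/

/-- The coordinates `x^A_J`, `|J| ≤ s`, of `j^s_0 γ` in the chart associated with `ψ`. -/
def jetCoord (ψ : OpenPartialHomeomorph X (Fin (n + m) → ℝ)) (s : ℕ) (γ : ImmGerm n m X) :
    Fin (n + m) → MIdx n s → ℝ :=
  fun A J => pderivs (sorted J.1) (fun t => ψ (γ.toFun t) A) 0

/-- The components `𝒯_A` in a chart `ψ = (x^A)` of a covector-valued map `𝒯`: the value of
`𝒯(v)` on the coordinate vector `∂/∂x^A`. -/
def component {s : ℕ}
    (T : (v : Velocity n m X s) → TangentSpace 𝓘(ℝ, Fin (n + m) → ℝ) v.base →L[ℝ] ℝ)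
    (ψ : OpenPartialHomeomorph X (Fin (n + m) → ℝ)) (A : Fin (n + m)) (v : Velocity n m X s) : ℝ :=
  T v (ContinuousLinearMap.inverse
    (mfderiv 𝓘(ℝ, Fin (n + m) → ℝ) 𝓘(ℝ, Fin (n + m) → ℝ) ψ v.base) (Pi.single A (1 : ℝ)))

variable (n m X) in
/-- A differential equation on `Imm T^s_n X`: a smooth 1-form with local expression `𝒯_A dx^A`,
that is, a smooth map assigning to a velocity a covector of `X` at its target. -/
structure DiffEq (s : ℕ) where
  form : (v : Velocity n m X s) → TangentSpace 𝓘(ℝ, Fin (n + m) → ℝ) v.base →L[ℝ] ℝ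
  smooth : ∀ ψ : OpenPartialHomeomorph X (Fin (n + m) → ℝ), IsChart n m X ψ → ∀ A,
    ∃ F : (Fin (n + m) → MIdx n s → ℝ) → ℝ,
      ContDiffOn ℝ ∞ F (jetCoord ψ s '' {γ | γ.toFun 0 ∈ ψ.source}) ∧
      ∀ γ : ImmGerm n m X, γ.toFun 0 ∈ ψ.source →
        component form ψ A (jet s γ) = F (jetCoord ψ s γ)

namespace DiffEq

variable {s : ℕ} (T : DiffEq n m X s)

/-- Homogeneity: `(φ_a)^* 𝒯 = det(a) 𝒯` for all `a ∈ L^s_n` (the right action does not move the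
target), and `(j^s γ)^* 𝒯 = 0` for all immersions `γ` (stated at the source `0`, to which every
other point of the domain of an immersion is brought by a translation). -/
structure IsHomogeneous : Prop where
  equivariant : ∀ (γ δ : ImmGerm n m X) (α : Reparam n), IsComp γ α δ →
    ∀ u : Fin (n + m) → ℝ, T.form (jet s δ) u = α.det * T.form (jet s γ) u
  pullback_eq_zero : ∀ (γ : ImmGerm n m X) (w : Fin n → ℝ),
    T.form (jet s γ)
      (mfderiv 𝓘(ℝ, Fin n → ℝ) 𝓘(ℝ, Fin (n + m) → ℝ) γ.toFun 0 w) = 0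

open Classical in
/-- The associated non-homogeneous equation `T_σ` in the adapted chart `c`, a function on the image
of `c` in `P^s_n X`, by `𝒯_σ = det(𝐱) T_σ ∘ ρ`. -/
def nonhom (c : AChart n m X) (σ : Fin m) (k : Coord n m s) : ℝ :=
  if h : ∃ γ, c.InDom γ ∧ c.coordGerm s γ = k then
    component T.form c.ψ (c.e (Sum.inr σ)) (jet s h.choose) / c.detX h.choose
  else 0

end DiffEq

end Forms

end HelmholtzSonin

end

open scoped Manifold ContDiff Topology

noncomputable section

namespace HelmholtzSonin

/-! ## Moving frames of commuting derivations -/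

section Algebra

variable {R : Type*} [CommRing R] [Algebra ℝ R] {n : ℕ}

/-! Formula (1) expresses the naturality of an operator. Along a section y = u(x) let L be the
linearization of T, (Lφ)_σ = ∑ Δ^I_ν T_σ · d_I φ^ν. The Leibniz rule, applied to the formal adjoint
L*, produces the signs and binomial coefficients of the Lie-Euler operators
(`sum_neg_one_pow_tupleSum_ders`), so the H^I_{σν}(T) are exactly the coefficients of L − L*.
Integration by parts gives ∫ ∑ ((Lφ)_σ ψ^σ − (Lψ)_σ φ^σ) = ∫ ∑ ((L − L*)φ)_σ ψ^σ for compactly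
supported ψ. For the family u + aφ + bψ the left integrand is the antisymmetrized variation ∂_a(T_σ
ψ^σ) − ∂_b(T_σ φ^σ), in which no adjoint occurs and which can be computed in either chart.

In the second chart, homogeneity gives T_σ = 𝓙 P^α_σ T̄_α (`nonhom_change`). For a variation e the
sum P^α_σ e(y^σ) is δȳ^α, where δ = e − e(x̄ⁱ) d̄_i is the variation at fixed x̄ and d̄_i = Pʲ_i d_j
(`sum_P_mul`). Hence T_σ e(y^σ) = 𝓙 T̄_α δȳ^α. Replacing e by δ across the factor 𝓙 costs only terms
𝓙 d̄_i(…) (`derivation_jacobian_mul`), and 𝓙 d̄_i w is itself a divergence in the old coordinates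
(`jacobian_mul_dbar`, the Piola identity). So the integration by parts can be repeated in the frame
d̄_i, and L − L* and its barred counterpart agree after pairing with ψ, up to divergences
(`helmOp_change_mem`). This part is pure algebra: commuting derivations of a commutative ring, an
ideal C of admissible test functions and a subgroup N of null elements. In the application the ring
consists of the smooth functions of (x, a, b) on an open set, C of those with compactly supported
restriction to a = b = 0, and N of the elements of C whose restriction has integral zero.

Since ψ is arbitrary, the two operators agree pointwise (`helmDefect_jetSec_eq_zero`). Since a
section may pass through any point of the coordinate space and φ may have any jet there, their
coefficients agree (`helmDefect_ey_eq_zero`, `HS_change`). The functions x̄ have order 0 and ȳ_J has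
order at most |J|, which removes terms when |I| ≥ 1.

Before this, the charts themselves need an analysis. Every immersion in a chart domain can be
reparametrized as a graph, and up to its r-jet as a polynomial graph. This gives the image of a
chart, its injectivity, the smoothness of chart changes with the recurrence ȳ_{iI} = Pʲ_i D_j ȳ_I,
and the existence and smoothness of T_σ.

For (2), the contact forms transform with the same coefficients as in (1) (`omega_change`), so ∑ H ω
∧ ω ∧ Λ has the same expression in all charts if Λ is multiplied by 𝓙. The form θ₀ has this
behaviour only modulo the ω^σ. It is therefore replaced by Λ, which is θ₀ composed with the
orthogonal projection onto the contact n-plane for a Riemannian metric on X; this transforms exactly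
(`horVol_change`). The difference Λ − θ₀ vanishes where all ω^σ vanish, so it is a sum of multiples
of the ω^τ, and the error has three contact factors (`stronglyContactOn_helmForm`). Uniqueness
follows by subtracting two representatives. -/

/-- A derivation in the span of a frame is zero if it kills functions with invertible Jacobian. -/
theorem span_coeff_eq_zero {d : Fin n → Derivation ℝ R R} {x : Fin n → R}
    {P : Matrix (Fin n) (Fin n) R} (hP : P * Matrix.of (fun l p => d p (x l)) = 1)
    {a : Fin n → R} (ha : ∀ l, ∑ k, a k * d k (x l) = 0) (k : Fin n) : a k = 0 := by
  have h1 : ∑ l, P k l * ∑ p, a p * d p (x l) = a k := by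
    have : ∀ l, P k l * ∑ p, a p * d p (x l) = ∑ p, a p * (P k l * d p (x l)) := by
      intro l; rw [Finset.mul_sum]; exact Finset.sum_congr rfl fun p _ => by ring
    rw [Finset.sum_congr rfl fun l _ => this l, Finset.sum_comm]
    have h2 : ∀ p, ∑ l, P k l * d p (x l) = (1 : Matrix (Fin n) (Fin n) R) k p := by
      intro p; rw [← hP]; rfl
    simp [← Finset.mul_sum, h2, Matrix.one_apply]
  rw [← h1]; simp [ha]

/-- As d₁, d₂ and all d_k commute with each other, the second-order terms of the commutator [D₁, D₂]
cancel and it lies in the span of the d_k. An element of this span that kills the x^l is zero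
because their Jacobian is invertible. -/
theorem comm_of_comm_on_coords {d : Fin n → Derivation ℝ R R} {x : Fin n → R}
    {P : Matrix (Fin n) (Fin n) R} (hP : P * Matrix.of (fun l p => d p (x l)) = 1)
    (hd : ∀ i j f, d i (d j f) = d j (d i f))
    {d₁ d₂ D₁ D₂ : Derivation ℝ R R} (h₁ : ∀ k f, d₁ (d k f) = d k (d₁ f))
    (h₂ : ∀ k f, d₂ (d k f) = d k (d₂ f)) (h₁₂ : ∀ f, d₁ (d₂ f) = d₂ (d₁ f))
    {a b : Fin n → R} (hD₁ : ∀ f, D₁ f = d₁ f + ∑ k, a k * d k f)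
    (hD₂ : ∀ f, D₂ f = d₂ f + ∑ k, b k * d k f) (hx : ∀ l, D₁ (D₂ (x l)) = D₂ (D₁ (x l)))
    (f : R) : D₁ (D₂ f) = D₂ (D₁ f) := by
  have key : ∀ f, D₁ (D₂ f) - D₂ (D₁ f) = ∑ k, (D₁ (b k) - D₂ (a k)) * d k f := by
    intro f
    have e₁ : D₁ (D₂ f) = d₁ (d₂ f) + ∑ k, a k * d k (d₂ f) + ∑ k, D₁ (b k) * d k f
        + ∑ k, b k * d k (d₁ f) + ∑ k, ∑ l, a l * b k * d k (d l f) := by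
      rw [hD₂ f, map_add, map_sum, hD₁ (d₂ f)]
      simp only [Derivation.leibniz, smul_eq_mul, Finset.sum_add_distrib]
      have : ∑ k, b k * D₁ (d k f) = ∑ k, b k * d k (d₁ f)
          + ∑ k, ∑ l, a l * b k * d k (d l f) := by
        rw [← Finset.sum_add_distrib]
        refine Finset.sum_congr rfl fun k _ => ?_
        rw [hD₁, mul_add, h₁, Finset.mul_sum]
        congr 1
        exact Finset.sum_congr rfl fun l _ => by rw [hd l k]; ring
      rw [this, Finset.sum_congr rfl fun k _ => mul_comm (d k f) (D₁ (b k))]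
      ring
    have e₂ : D₂ (D₁ f) = d₂ (d₁ f) + ∑ k, b k * d k (d₁ f) + ∑ k, D₂ (a k) * d k f
        + ∑ k, a k * d k (d₂ f) + ∑ k, ∑ l, a k * b l * d k (d l f) := by
      rw [hD₁ f, map_add, map_sum, hD₂ (d₁ f)]
      simp only [Derivation.leibniz, smul_eq_mul, Finset.sum_add_distrib]
      have : ∑ k, a k * D₂ (d k f) = ∑ k, a k * d k (d₂ f)
          + ∑ k, ∑ l, a k * b l * d k (d l f) := by
        rw [← Finset.sum_add_distrib]
        refine Finset.sum_congr rfl fun k _ => ?_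
        rw [hD₂, mul_add, h₂, Finset.mul_sum]
        congr 1
        exact Finset.sum_congr rfl fun l _ => by rw [hd l k]; ring
      rw [this, Finset.sum_congr rfl fun k _ => mul_comm (d k f) (D₂ (a k))]
      ring
    have e₃ : ∑ k, ∑ l, a l * b k * d k (d l f) = ∑ k, ∑ l, a k * b l * d k (d l f) := by
      rw [Finset.sum_comm]
      exact Finset.sum_congr rfl fun k _ => Finset.sum_congr rfl fun l _ => by rw [hd]
    rw [e₁, e₂, h₁₂, e₃]
    simp only [sub_mul, Finset.sum_sub_distrib]
    ring
  have hz : ∀ k, D₁ (b k) - D₂ (a k) = 0 := by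
    refine span_coeff_eq_zero hP fun l => ?_
    rw [← key, hx, sub_self]
  have := key f
  simp only [hz, zero_mul, Finset.sum_const_zero] at this
  exact sub_eq_zero.mp this

theorem derivation_sum_apply {ι : Type*} (t : Finset ι) (g : ι → Derivation ℝ R R) (f : R) :
    (∑ i ∈ t, g i) f = ∑ i ∈ t, g i f := by
  classical
  induction t using Finset.induction_on with
  | empty => simp
  | insert a t ha ih => rw [Finset.sum_insert ha, Finset.sum_insert ha, Derivation.add_apply, ih]

/-- The derivations `∂̄_i = P^k_i ∂_k`. -/
def dbar (d : Fin n → Derivation ℝ R R) (P : Matrix (Fin n) (Fin n) R) (i : Fin n) :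
    Derivation ℝ R R := ∑ k, P k i • d k

theorem dbar_apply (d : Fin n → Derivation ℝ R R) (P : Matrix (Fin n) (Fin n) R) (i : Fin n)
    (f : R) : dbar d P i f = ∑ k, P k i * d k f := by
  simp [dbar, derivation_sum_apply]

/-- The derivation `δ = e - e(x^i) ∂̄_i`. -/
def delta (d : Fin n → Derivation ℝ R R) (P : Matrix (Fin n) (Fin n) R) (x : Fin n → R)
    (e : Derivation ℝ R R) : Derivation ℝ R R := e - ∑ i, e (x i) • dbar d P i

theorem delta_apply (d : Fin n → Derivation ℝ R R) (P : Matrix (Fin n) (Fin n) R) (x : Fin n → R)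
    (e : Derivation ℝ R R) (f : R) :
    delta d P x e f = e f - ∑ i, e (x i) * dbar d P i f := by
  simp [delta, derivation_sum_apply]

section Frame

variable {d : Fin n → Derivation ℝ R R} {x : Fin n → R} {P : Matrix (Fin n) (Fin n) R}
  (hP : P * Matrix.of (fun l p => d p (x l)) = 1) (hd : ∀ i j f, d i (d j f) = d j (d i f))

include hP in
theorem dbar_coord (i l : Fin n) : dbar d P i (x l) = if l = i then 1 else 0 := by
  rw [dbar_apply, ← Matrix.one_apply, ← mul_eq_one_comm.mp hP]
  exact Finset.sum_congr rfl fun k _ => mul_comm _ _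

include hP in
theorem delta_coord (e : Derivation ℝ R R) (l : Fin n) : delta d P x e (x l) = 0 := by
  simp [delta_apply, dbar_coord hP]

include hP hd in
theorem dbar_comm (i j : Fin n) (f : R) :
    dbar d P i (dbar d P j f) = dbar d P j (dbar d P i f) := by
  refine comm_of_comm_on_coords hP hd (d₁ := 0) (d₂ := 0) (a := fun k => P k i)
    (b := fun k => P k j) (by simp) (by simp) (by simp) (by simp [dbar_apply])
    (by simp [dbar_apply]) (fun l => ?_) f
  rw [dbar_coord hP, dbar_coord hP]
  split_ifs <;> simp

theorem delta_eq_span (e : Derivation ℝ R R) (f : R) :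
    delta d P x e f = e f + ∑ k, (-∑ i, e (x i) * P k i) * d k f := by
  rw [delta_apply, sub_eq_add_neg]
  congr 1
  simp only [dbar_apply, Finset.mul_sum, neg_mul, Finset.sum_mul, Finset.sum_neg_distrib]
  rw [Finset.sum_comm]
  simp only [mul_assoc]

include hP hd in
theorem delta_dbar_comm {e : Derivation ℝ R R} (he : ∀ k f, e (d k f) = d k (e f)) (i : Fin n)
    (f : R) : delta d P x e (dbar d P i f) = dbar d P i (delta d P x e f) := by
  refine comm_of_comm_on_coords hP hd (d₁ := e) (d₂ := 0)
    (b := fun k => P k i) he (by simp) (by simp) (delta_eq_span e)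
    (by simp [dbar_apply]) (fun l => ?_) f
  rw [dbar_coord hP, delta_coord hP]
  split_ifs <;> simp

include hP hd in
theorem delta_delta_comm {e e' : Derivation ℝ R R} (he : ∀ k f, e (d k f) = d k (e f))
    (he' : ∀ k f, e' (d k f) = d k (e' f)) (hee : ∀ f, e (e' f) = e' (e f)) (f : R) :
    delta d P x e (delta d P x e' f) = delta d P x e' (delta d P x e f) := by
  refine comm_of_comm_on_coords hP hd he he' hee (delta_eq_span e) (delta_eq_span e')
    (fun l => ?_) f
  rw [delta_coord hP, delta_coord hP, map_zero, map_zero]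

/-! ### Derivative of the Jacobian and the Piola identity -/

theorem derivation_prod {ι : Type*} [DecidableEq ι] (e : Derivation ℝ R R) (t : Finset ι)
    (f : ι → R) : e (∏ i ∈ t, f i) = ∑ i ∈ t, e (f i) * ∏ j ∈ t.erase i, f j := by
  induction t using Finset.induction_on with
  | empty => simp
  | insert a t ha ih =>
    rw [Finset.prod_insert ha, Derivation.leibniz, ih, Finset.sum_insert ha,
      Finset.erase_insert ha, smul_eq_mul, smul_eq_mul, Finset.mul_sum, add_comm,
      mul_comm (e (f a))]
    rw [mul_comm (∏ i ∈ t, f i)]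
    congr 1
    refine Finset.sum_congr rfl fun i hi => ?_
    have hia : i ≠ a := fun h => ha (h ▸ hi)
    rw [Finset.erase_insert_of_ne hia.symm, Finset.prod_insert (by simp [ha])]
    ring

/-- Jacobi's formula for derivations. -/
theorem derivation_det (e : Derivation ℝ R R) (A : Matrix (Fin n) (Fin n) R) :
    e A.det = ∑ i, ∑ j, A.adjugate j i * e (A i j) := by
  have h1 : e A.det = ∑ i, (A.updateRow i (fun j => e (A i j))).det := by
    simp only [← Matrix.det_transpose A, ← Matrix.det_transpose (A.updateRow _ _)]
    simp only [Matrix.det_apply, map_sum, Units.smul_def, map_zsmul]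
    rw [Finset.sum_comm]
    refine Finset.sum_congr rfl fun σ _ => ?_
    rw [← Finset.smul_sum]
    congr 1
    rw [derivation_prod]
    refine Finset.sum_congr rfl fun i _ => ?_
    rw [← Finset.mul_prod_erase Finset.univ _ (Finset.mem_univ i)]
    congr 1
    · simp
    · refine Finset.prod_congr rfl fun j hj => ?_
      simp [Matrix.updateRow_ne (Finset.ne_of_mem_erase hj)]
  rw [h1]
  refine Finset.sum_congr rfl fun i _ => ?_
  rw [← Matrix.cramer_transpose_apply, Matrix.cramer_eq_adjugate_mulVec,
    ← Matrix.adjugate_transpose]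
  rfl

include hP in
theorem derivation_jacobian (e : Derivation ℝ R R) :
    e (Matrix.of (fun l p => d p (x l))).det
      = (Matrix.of (fun l p => d p (x l))).det * ∑ l, ∑ p, P p l * e (d p (x l)) := by
  set Q := Matrix.of (fun l p => d p (x l)) with hQ
  have hadj : Q.adjugate = Q.det • P := by
    calc Q.adjugate = Q.adjugate * (Q * P) := by rw [mul_eq_one_comm.mp hP, mul_one]
      _ = Q.det • P := by rw [← mul_assoc, Matrix.adjugate_mul, smul_mul_assoc, one_mul]
  rw [derivation_det, hadj, Finset.mul_sum]
  refine Finset.sum_congr rfl fun l _ => ?_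
  rw [Finset.mul_sum]
  exact Finset.sum_congr rfl fun p _ => by simp [hQ, mul_assoc]

include hP hd in
-- Differentiating d̄_i x^l = δ^l_i and using d_p d_k x^l = d_k d_p x^l expresses the divergence of
-- a column of P by derivatives of the Jacobian matrix. The result is minus the logarithmic
-- derivative of the determinant along d̄_i, which is the cancellation behind the Piola identity.
theorem sum_deriv_frame (i : Fin n) :
    ∑ k, d k (P k i) = - ∑ l, ∑ p, P p l * dbar d P i (d p (x l)) := by
  have h : ∀ p l, ∑ k, d p (P k i) * d k (x l) = - dbar d P i (d p (x l)) := by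
    intro p l
    have h1 : d p (dbar d P i (x l)) = 0 := by
      rw [dbar_coord hP]; split_ifs <;> simp
    rw [dbar_apply, map_sum] at h1
    simp only [Derivation.leibniz, smul_eq_mul, Finset.sum_add_distrib] at h1
    rw [dbar_apply, Finset.sum_congr rfl fun k _ => mul_comm (d p (P k i)) (d k (x l)),
      eq_neg_iff_add_eq_zero, add_comm, ← h1]
    congr 1
    exact Finset.sum_congr rfl fun k _ => by rw [hd]
  have hQP : ∀ k p, ∑ l, P p l * d k (x l) = if p = k then 1 else 0 := by
    intro k p
    rw [← Matrix.one_apply, ← hP]; rfl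
  rw [Finset.sum_comm]
  simp only [← Finset.sum_neg_distrib, ← mul_neg, ← h]
  refine Finset.sum_congr rfl fun p _ => ?_
  simp only [Finset.mul_sum]
  rw [Finset.sum_comm]
  have : ∀ k, ∑ l, P p l * (d p (P k i) * d k (x l)) = d p (P k i) * if p = k then 1 else 0 := by
    intro k
    rw [← hQP, Finset.mul_sum]
    exact Finset.sum_congr rfl fun l _ => by ring
  simp [this]

include hP hd in
/-- The Piola identity. -/
theorem jacobian_mul_dbar (i : Fin n) (w : R) :
    (Matrix.of (fun l p => d p (x l))).det * dbar d P i w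
      = ∑ k, d k ((Matrix.of (fun l p => d p (x l))).det * P k i * w) := by
  set J := (Matrix.of (fun l p => d p (x l))).det
  have h1 : ∀ k, d k (J * P k i * w)
      = J * (P k i * d k w) + w * (J * d k (P k i)) + w * (P k i * d k J) := by
    intro k; simp only [Derivation.leibniz, smul_eq_mul]; ring
  simp only [h1, Finset.sum_add_distrib, ← Finset.mul_sum]
  rw [sum_deriv_frame hP hd, ← dbar_apply, ← dbar_apply, derivation_jacobian hP]
  ring

include hP in
-- The logarithmic derivative of the Jacobian along e is ∑ d̄_i(e(x^i)), and e = δ + e(x^i) d̄_i on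
-- g; the two extra contributions combine into d̄_i(e(x^i) g). A variation that also moves the
-- coordinates x thus differs from the one at fixed x by a divergence.
theorem derivation_jacobian_mul {e : Derivation ℝ R R} (he : ∀ k f, e (d k f) = d k (e f)) (g : R) :
    e ((Matrix.of (fun l p => d p (x l))).det * g)
      = (Matrix.of (fun l p => d p (x l))).det * delta d P x e g
        + ∑ i, (Matrix.of (fun l p => d p (x l))).det * dbar d P i (e (x i) * g) := by
  rw [Derivation.leibniz, derivation_jacobian hP, delta_apply]
  simp only [smul_eq_mul, Derivation.leibniz, mul_add, he, ← dbar_apply, Finset.sum_add_distrib,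
    Finset.mul_sum, mul_sub]
  have : ∀ l, g * ((Matrix.of fun l p => d p (x l)).det * dbar d P l (e (x l))) = (Matrix.of fun l p => d p (x l)).det * (g * dbar d P l (e (x l))) := by
    intro l; ring
  simp only [this]
  ring

end Frame
end Algebra

/-! ## Sums over tuples of indices -/

section TupleSum

variable {n : ℕ} {M : Type*} [AddCommMonoid M]

/-- The sum of `g` over all tuples of length `k`. -/
def tupleSum : ℕ → (List (Fin n) → M) → M
  | 0, g => g []
  | k + 1, g => ∑ i, tupleSum k (fun l => g (i :: l))

theorem sum_ofFn (k : ℕ) (g : List (Fin n) → M) :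
    ∑ K : Fin k → Fin n, g (List.ofFn K) = tupleSum k g := by
  induction k generalizing g with
  | zero => simp [tupleSum]
  | succ k ih =>
    rw [tupleSum, ← (Fin.consEquiv (fun _ : Fin (k + 1) => Fin n)).sum_comp,
      Fintype.sum_prod_type]
    refine Finset.sum_congr rfl fun i _ => ?_
    rw [← ih]
    refine Finset.sum_congr rfl fun K _ => ?_
    simp [List.ofFn_succ, Fin.consEquiv]

theorem tupleSum_congr {k : ℕ} {g h : List (Fin n) → M} (H : ∀ l, l.length = k → g l = h l) :
    tupleSum k g = tupleSum k h := by
  induction k generalizing g h with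
  | zero => exact H [] rfl
  | succ k ih =>
    exact Finset.sum_congr rfl fun i _ => ih fun l hl => H _ (by simp [hl])

theorem tupleSum_add (k : ℕ) (g h : List (Fin n) → M) :
    tupleSum k (fun l => g l + h l) = tupleSum k g + tupleSum k h := by
  simp only [← sum_ofFn, Finset.sum_add_distrib]

theorem tupleSum_sum {ι : Type*} (s : Finset ι) (k : ℕ) (g : ι → List (Fin n) → M) :
    tupleSum k (fun l => ∑ i ∈ s, g i l) = ∑ i ∈ s, tupleSum k (g i) := by
  simp only [← sum_ofFn]; exact Finset.sum_comm

theorem tupleSum_zero (k : ℕ) : tupleSum k (fun _ : List (Fin n) => (0 : M)) = 0 := by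
  simp only [← sum_ofFn, Finset.sum_const_zero]

theorem mul_tupleSum {R : Type*} [NonUnitalNonAssocSemiring R] (k : ℕ) (c : R)
    (g : List (Fin n) → R) : c * tupleSum k g = tupleSum k (fun l => c * g l) := by
  simp only [← sum_ofFn, Finset.mul_sum]

theorem tupleSum_mul {R : Type*} [NonUnitalNonAssocSemiring R] (k : ℕ) (c : R)
    (g : List (Fin n) → R) : tupleSum k g * c = tupleSum k (fun l => g l * c) := by
  simp only [← sum_ofFn, Finset.sum_mul]

theorem map_tupleSum {M' F : Type*} [AddCommMonoid M'] [FunLike F M M'] [AddMonoidHomClass F M M']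
    (f : F) (k : ℕ) (g : List (Fin n) → M) :
    f (tupleSum k g) = tupleSum k (fun l => f (g l)) := by
  simp only [← sum_ofFn, map_sum]

theorem nsmul_tupleSum (k c : ℕ) (g : List (Fin n) → M) :
    c • tupleSum k g = tupleSum k (fun l => c • g l) := by
  simp only [← sum_ofFn, Finset.smul_sum]

/-- The weight `r₁! ⋯ r_n! / k!` of a tuple. -/
def weight (l : List (Fin n)) : ℝ := (∏ i, ((l.count i).factorial : ℝ)) / (l.length.factorial : ℝ)

theorem weight_eq_of_perm {l l' : List (Fin n)} (h : l.Perm l') : weight l = weight l' := by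
  simp [weight, h.count_eq, h.length_eq]

/-- The multinomial count of the orderings of a multiset, by induction on its size: the orderings
that begin with i are the orderings of I with one i removed, and summing the multiplicities of all i
gives |I|. -/
theorem tupleSum_ite_mul_factorial (k : ℕ) (I : Multiset (Fin n)) (hI : I.card = k) :
    tupleSum k (fun l : List (Fin n) => if (l : Multiset (Fin n)) = I then 1 else 0)
      * ∏ i, (I.count i).factorial = k.factorial := by
  induction k generalizing I with
  | zero =>
    rw [Multiset.card_eq_zero] at hI
    simp [tupleSum, hI]
  | succ k ih =>
    rw [tupleSum, Finset.sum_mul, Nat.factorial_succ]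
    have h : ∀ i, tupleSum k (fun l => if ((i :: l : List (Fin n)) : Multiset (Fin n)) = I
        then 1 else 0) * ∏ j, (I.count j).factorial = I.count i * k.factorial := by
      intro i
      by_cases hi : i ∈ I
      · have e : ∀ l : List (Fin n), ((i :: l : List (Fin n)) : Multiset (Fin n)) = I
            ↔ (l : Multiset (Fin n)) = I.erase i := by
          intro l
          rw [← Multiset.cons_coe]
          constructor
          · rintro rfl; simp
          · intro h; rw [h, Multiset.cons_erase hi]
        simp only [e]
        have hc : (I.erase i).card = k := by rw [Multiset.card_erase_of_mem hi, hI]; rfl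
        rw [← ih _ hc, mul_left_comm]
        congr 1
        rw [← Finset.mul_prod_erase _ _ (Finset.mem_univ i),
          ← Finset.mul_prod_erase (a := i) _ (fun j => ((I.erase i).count j).factorial)
            (Finset.mem_univ i), ← mul_assoc, Multiset.count_erase_self,
          Nat.mul_factorial_pred (Multiset.count_pos.mpr hi).ne']
        congr 1
        refine Finset.prod_congr rfl fun j hj => ?_
        rw [Multiset.count_erase_of_ne (Finset.ne_of_mem_erase hj)]
      · have e : ∀ l : List (Fin n), ((i :: l : List (Fin n)) : Multiset (Fin n)) ≠ I := by
          intro l h; apply hi; rw [← h]; simp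
        simp [e, tupleSum_zero, hi]
    rw [Finset.sum_congr rfl fun i _ => h i, ← Finset.sum_mul]
    congr 1
    rw [← hI, Multiset.sum_count_eq_card (by simp)]

theorem tupleSum_weight (k : ℕ) (I : Multiset (Fin n)) (hI : I.card = k) :
    tupleSum k (fun l : List (Fin n) => if (l : Multiset (Fin n)) = I then weight l else 0) = 1 := by
  have h := tupleSum_ite_mul_factorial k I hI
  have h' : ((tupleSum k (fun l : List (Fin n) => if (l : Multiset (Fin n)) = I then (1 : ℕ) else 0) : ℕ) : ℝ)
      * ∏ i, ((I.count i).factorial : ℝ) = k.factorial := by exact_mod_cast h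
  have e : ∀ l : List (Fin n), (if (l : Multiset (Fin n)) = I then weight l else 0)
      = ((if (l : Multiset (Fin n)) = I then (1 : ℕ) else 0 : ℕ) : ℝ)
        * ((∏ i, ((I.count i).factorial : ℝ)) / k.factorial) := by
    intro l
    split_ifs with hl
    · subst hl; subst hI; simp [weight]
    · simp
  simp only [e, ← tupleSum_mul]
  rw [← Nat.coe_castAddMonoidHom (α := ℝ), map_tupleSum] at h'
  simp only [Nat.coe_castAddMonoidHom] at h'
  rw [← mul_div_assoc, h', div_self (by positivity)]

/-- A sum over multi-indices as a weighted sum over tuples. -/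
theorem sum_midx_eq_tupleSum {r : ℕ} (g : Multiset (Fin n) → ℝ) :
    ∑ I : MIdx n r, g I.1 = ∑ j ∈ Finset.range (r + 1), tupleSum j
      (fun l : List (Fin n) => weight l * g (l : Multiset (Fin n))) := by
  have h1 : ∀ I : MIdx n r, g I.1 = ∑ j ∈ Finset.range (r + 1), tupleSum j
      (fun l : List (Fin n) => if (l : Multiset (Fin n)) = I.1 then weight l * g l else 0) := by
    intro I
    rw [Finset.sum_eq_single I.1.card]
    · have : ∀ l : List (Fin n), (if (l : Multiset (Fin n)) = I.1 then weight l * g l else 0)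
          = (if (l : Multiset (Fin n)) = I.1 then weight l else 0) * g I.1 := by
        intro l; split_ifs with h
        · rw [h]
        · simp
      simp only [this, ← tupleSum_mul]
      rw [tupleSum_weight _ _ rfl, one_mul]
    · intro j _ hj
      rw [tupleSum_congr (h := fun _ => (0 : ℝ)), tupleSum_zero]
      intro l hl
      refine if_neg fun h => hj ?_
      rw [← h, ← hl]; simp
    · intro h; exact absurd (Finset.mem_range.mpr (Nat.lt_succ_of_le I.2)) h
  rw [Finset.sum_congr rfl fun I _ => h1 I, Finset.sum_comm]
  refine Finset.sum_congr rfl fun j hj => ?_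
  rw [← tupleSum_sum]
  refine tupleSum_congr fun l hl => ?_
  rw [Finset.sum_eq_single (⟨l, by simp [hl]; exact Nat.le_of_lt_succ (Finset.mem_range.mp hj)⟩ :
    MIdx n r)]
  · simp
  · intro I _ hI
    exact if_neg fun h => hI (Subtype.ext h.symm)
  · intro h; exact absurd (Finset.mem_univ _) h

end TupleSum

/-! ## Iterated derivations, adjoints -/

section Iterated

variable {R : Type*} [CommRing R] [Algebra ℝ R] {n : ℕ}

/-- `d_{j₁} ⋯ d_{j_k} f`. -/
def ders (d : Fin n → Derivation ℝ R R) : List (Fin n) → R → R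
  | [], f => f
  | j :: l, f => d j (ders d l f)

variable (d : Fin n → Derivation ℝ R R)

theorem ders_add (l : List (Fin n)) (f g : R) : ders d l (f + g) = ders d l f + ders d l g := by
  induction l with
  | nil => rfl
  | cons j l ih => simp [ders, ih]

variable {d} (hd : ∀ i j f, d i (d j f) = d j (d i f))

theorem ders_comm {e : Derivation ℝ R R} (he : ∀ i f, e (d i f) = d i (e f)) (l : List (Fin n))
    (f : R) : ders d l (e f) = e (ders d l f) := by
  induction l with
  | nil => rfl
  | cons j l ih => rw [ders, ders, ih, he]

include hd in
theorem ders_perm {l l' : List (Fin n)} (h : l.Perm l') (f : R) : ders d l f = ders d l' f := by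
  induction h with
  | nil => rfl
  | cons x _ ih => rw [ders, ders, ih]
  | swap x y l => exact hd _ _ _
  | trans _ _ ih₁ ih₂ => rw [ih₁, ih₂]

include hd in
/-- Integration by parts modulo `N`, for elements `w` of the ideal `C`. -/
theorem mul_ders_sub_mem {C : Ideal R} {N : AddSubgroup R} {J : R}
    (hC : ∀ i, ∀ w ∈ C, d i w ∈ C) (hN : ∀ i, ∀ w ∈ C, J * d i w ∈ N) (l : List (Fin n))
    (f w : R) (hw : w ∈ C) :
    J * (f * ders d l w) - J * ((-1) ^ l.length * ders d l f * w) ∈ N := by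
  have hCl : ∀ l : List (Fin n), ders d l w ∈ C := by
    intro l
    induction l with
    | nil => exact hw
    | cons j l ih => exact hC j _ ih
  induction l generalizing f with
  | nil => simp [ders, N.zero_mem]
  | cons j l ih =>
    have h1 : J * d j (f * ders d l w) ∈ N := hN j _ (C.mul_mem_left _ (hCl l))
    have h2 := ih (d j f)
    rw [ders_comm (hd j)] at h2
    rw [Derivation.leibniz, smul_eq_mul, smul_eq_mul] at h1
    convert N.sub_mem h1 h2 using 1
    simp only [ders, List.length_cons]
    ring

include hd in
/-- The Leibniz rule for a sum over tuples with symmetric coefficients. -/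
theorem tupleSum_ders_mul (k : ℕ) (B : List (Fin n) → R) (hB : ∀ l l', l.Perm l' → B l = B l')
    (f : R) :
    tupleSum k (fun l => ders d l (B l * f)) = ∑ ab ∈ Finset.HasAntidiagonal.antidiagonal k, k.choose ab.1 •
      tupleSum ab.1 (fun I => tupleSum ab.2 (fun J => ders d J (B (I ++ J)) * ders d I f)) := by
  induction k generalizing B f with
  | zero => simp [tupleSum, ders]
  | succ k ih =>
    -- Pascal's rule: the outermost derivative falls either on the coefficient, which lengthens J,
    -- or on f, which lengthens I. Both cases are again instances with k derivatives and a symmetric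
    -- family.
    rw [Finset.sum_antidiagonal_choose_succ_nsmul (fun a b => tupleSum a (fun I => tupleSum b
      (fun J => ders d J (B (I ++ J)) * ders d I f)))]
    rw [tupleSum]
    have h1 : ∀ i, tupleSum k (fun l => ders d (i :: l) (B (i :: l) * f))
        = tupleSum k (fun l => ders d l (d i (B (i :: l)) * f))
          + tupleSum k (fun l => ders d l (B (i :: l) * d i f)) := by
      intro i
      rw [← tupleSum_add]
      refine tupleSum_congr fun l _ => ?_
      rw [ders, ← ders_comm (hd i), Derivation.leibniz, smul_eq_mul, smul_eq_mul, ders_add,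
        add_comm, mul_comm f]
    rw [Finset.sum_congr rfl fun i _ => h1 i, Finset.sum_add_distrib]
    congr 1
    · rw [Finset.sum_congr rfl fun i _ => ih (fun l => d i (B (i :: l)))
        (fun l l' h => by rw [hB _ _ (h.cons i)]) f, Finset.sum_comm]
      refine Finset.sum_congr rfl fun ab _ => ?_
      rw [← Finset.smul_sum, ← tupleSum_sum]
      congr 1
      refine tupleSum_congr fun I _ => ?_
      rw [tupleSum]
      refine Finset.sum_congr rfl fun i _ => tupleSum_congr fun J _ => ?_
      rw [ders_comm (hd i), hB (I ++ i :: J) (i :: (I ++ J)) List.perm_middle, ders]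
    · rw [Finset.sum_congr rfl fun i _ => ih (fun l => B (i :: l))
        (fun l l' h => hB _ _ (h.cons i)) (d i f), Finset.sum_comm]
      refine Finset.sum_congr rfl fun ab hab => ?_
      rw [← Finset.smul_sum, tupleSum, ← Finset.HasAntidiagonal.mem_antidiagonal.mp hab, Nat.choose_symm_add]
      congr 1
      refine Finset.sum_congr rfl fun i _ => tupleSum_congr fun I _ => tupleSum_congr fun J _ => ?_
      rw [ders_comm (hd i)]
      rfl

include hd in
-- This is the expansion of a formal adjoint in normal form. The Leibniz rule distributes each tuple
-- l over the two factors as I and J, the sign splits as (-1)^{|I|} (-1)^{|J|}, and the number of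
-- ways to choose I inside l is the binomial coefficient of the Lie-Euler operators.
theorem sum_neg_one_pow_tupleSum_ders (s : ℕ) (B : List (Fin n) → R)
    (hB : ∀ l l', l.Perm l' → B l = B l') (f : R) :
    ∑ k ∈ Finset.range (s + 1), tupleSum k (fun l => (-1) ^ l.length * ders d l (B l * f))
      = ∑ a ∈ Finset.range (s + 1), tupleSum a (fun I => (-1) ^ I.length *
          (∑ b ∈ Finset.range (s + 1 - I.length), tupleSum b (fun J =>
            (-1) ^ b * ((I.length + b).choose I.length : R) * ders d J (B (I ++ J))))
          * ders d I f) := by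
  have h1 : ∀ k, tupleSum k (fun l => (-1) ^ l.length * ders d l (B l * f))
      = ∑ ab ∈ Finset.HasAntidiagonal.antidiagonal k, tupleSum ab.1 (fun I => (-1) ^ I.length *
          tupleSum ab.2 (fun J => (-1) ^ ab.2 * ((I.length + ab.2).choose I.length : R)
            * ders d J (B (I ++ J))) * ders d I f) := by
    intro k
    have : tupleSum k (fun l => (-1) ^ l.length * ders d l (B l * f))
        = (-1) ^ k * tupleSum k (fun l => ders d l (B l * f)) := by
      rw [mul_tupleSum]
      exact tupleSum_congr fun l hl => by rw [hl]
    rw [this, tupleSum_ders_mul hd k B hB, Finset.mul_sum]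
    refine Finset.sum_congr rfl fun ab hab => ?_
    rw [nsmul_tupleSum, mul_tupleSum]
    refine tupleSum_congr fun I hI => ?_
    rw [nsmul_tupleSum, mul_tupleSum, mul_tupleSum, tupleSum_mul]
    refine tupleSum_congr fun J hJ => ?_
    rw [← Finset.HasAntidiagonal.mem_antidiagonal.mp hab, hI, nsmul_eq_mul, pow_add]
    ring
  rw [Finset.sum_congr rfl fun k _ => h1 k, Finset.sum_sigma']
  have h2 : ∀ a ∈ Finset.range (s + 1), tupleSum a (fun I => (-1) ^ I.length *
          (∑ b ∈ Finset.range (s + 1 - I.length), tupleSum b (fun J =>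
            (-1) ^ b * ((I.length + b).choose I.length : R) * ders d J (B (I ++ J))))
          * ders d I f)
      = ∑ b ∈ Finset.range (s + 1 - a), tupleSum a (fun I => (-1) ^ I.length *
          tupleSum b (fun J => (-1) ^ b * ((I.length + b).choose I.length : R)
            * ders d J (B (I ++ J))) * ders d I f) := by
    intro a _
    rw [← tupleSum_sum]
    refine tupleSum_congr fun I hI => ?_
    rw [hI, Finset.mul_sum, Finset.sum_mul]
  rw [Finset.sum_congr rfl h2, Finset.sum_sigma']
  -- Pairs a + b = k with k ≤ s are the same as a ≤ s together with b ≤ s − a.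
  refine Finset.sum_bij' (fun x _ => ⟨x.2.1, x.2.2⟩) (fun y _ => ⟨y.1 + y.2, (y.1, y.2)⟩)
    ?_ ?_ ?_ ?_ ?_
  · rintro ⟨k, a, b⟩ h
    simp only [Finset.mem_sigma, Finset.mem_range, Finset.HasAntidiagonal.mem_antidiagonal] at h ⊢
    omega
  · rintro ⟨a, b⟩ h
    simp only [Finset.mem_sigma, Finset.mem_range, Finset.HasAntidiagonal.mem_antidiagonal] at h ⊢
    exact ⟨by omega, trivial⟩
  · rintro ⟨k, a, b⟩ h
    simp only [Finset.mem_sigma, Finset.mem_range, Finset.HasAntidiagonal.mem_antidiagonal] at h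
    obtain ⟨_, rfl⟩ := h
    rfl
  · rintro ⟨a, b⟩ _; rfl
  · rintro ⟨k, a, b⟩ _; rfl

end Iterated

/-! ## Smooth functions on an open set -/

section SmoothRing

variable {E : Type*} [NormedAddCommGroup E]

variable (V : TopologicalSpace.Opens E)

open Classical in
/-- Extension by zero. -/
def extendZero (f : V → ℝ) : E → ℝ := fun x => if h : x ∈ V then f ⟨x, h⟩ else 0

variable {V}

theorem extendZero_apply (f : V → ℝ) (x : V) : extendZero V f x = f x := by
  simp [extendZero, x.2]

theorem extendZero_of_mem (f : V → ℝ) {x : E} (hx : x ∈ V) : extendZero V f x = f ⟨x, hx⟩ := by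
  simp [extendZero, hx]

variable [NormedSpace ℝ E]

theorem contDiffAt_fderiv_apply {F : Type*} [NormedAddCommGroup F] [NormedSpace ℝ F] {f : E → F}
    {x : E} (hf : ContDiffAt ℝ ∞ f x) (v : E) : ContDiffAt ℝ ∞ (fun y => fderiv ℝ f y v) x :=
  (hf.fderiv_right (m := ∞) (by simp)).clm_apply contDiffAt_const

theorem contDiffOn_fderiv_apply {F : Type*} [NormedAddCommGroup F] [NormedSpace ℝ F] {f : E → F}
    {V : Set E} (hV : IsOpen V) (hf : ContDiffOn ℝ ∞ f V) {w : E → E} (hw : ContDiffOn ℝ ∞ w V) :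
    ContDiffOn ℝ ∞ (fun y => fderiv ℝ f y (w y)) V :=
  (hf.fderiv_of_isOpen hV (by simp)).clm_apply hw

theorem fderiv_fderiv_comm {F : Type*} [NormedAddCommGroup F] [NormedSpace ℝ F] {f : E → F}
    {x : E} (hf : ContDiffAt ℝ ∞ f x) (v w : E) :
    fderiv ℝ (fun y => fderiv ℝ f y v) x w = fderiv ℝ (fun y => fderiv ℝ f y w) x v := by
  have hd : DifferentiableAt ℝ (fderiv ℝ f) x :=
    (hf.fderiv_right (m := ∞) (by simp)).differentiableAt (by simp)
  have h1 : ∀ v, fderiv ℝ (fun y => fderiv ℝ f y v) x = (fderiv ℝ (fderiv ℝ f) x).flip v := by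
    intro v
    rw [fderiv_clm_apply hd (differentiableAt_const v)]
    simp
  rw [h1, h1]
  exact (hf.isSymmSndFDerivAt (by
    rw [minSmoothness_of_isRCLikeNormedField]; exact ENat.LEInfty.out)) w v

variable (V)

/-- The ring of smooth functions on an open set. -/
def SmoothRing : Subalgebra ℝ (V → ℝ) where
  carrier := {f | ContDiffOn ℝ ∞ (extendZero V f) V}
  mul_mem' := fun {f g} hf hg => (ContDiffOn.mul hf hg).congr fun x hx => by
    simp [extendZero_of_mem _ hx]
  add_mem' := fun {f g} hf hg => (ContDiffOn.add hf hg).congr fun x hx => by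
    simp [extendZero_of_mem _ hx]
  algebraMap_mem' := fun r => (contDiffOn_const (c := r)).congr fun x hx => by
    simp [extendZero_of_mem _ hx]

namespace SmoothRing

variable {V}

theorem smooth (f : SmoothRing V) : ContDiffOn ℝ ∞ (extendZero V f.1) V := f.2

/-- The restriction of a function to `V`. -/
def of (f : E → ℝ) (hf : ContDiffOn ℝ ∞ f V) : SmoothRing V :=
  ⟨fun x => f x, hf.congr fun x hx => by simp [extendZero_of_mem _ hx]⟩

@[simp] theorem of_apply (f : E → ℝ) (hf : ContDiffOn ℝ ∞ f V) (x : V) : (of f hf).1 x = f x := rfl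

theorem ext' {f g : SmoothRing V} (h : ∀ x, f.1 x = g.1 x) : f = g := Subtype.ext (funext h)

theorem extendZero_eventuallyEq (f : SmoothRing V) {g : E → ℝ} (h : ∀ x : V, f.1 x = g x) (x : V) :
    extendZero V f.1 =ᶠ[𝓝 (x : E)] g := by
  filter_upwards [V.isOpen.mem_nhds x.2] with y hy
  rw [extendZero_of_mem _ hy, h]

theorem contDiffAt (f : SmoothRing V) (x : V) : ContDiffAt ℝ ∞ (extendZero V f.1) x :=
  (smooth f).contDiffAt (V.isOpen.mem_nhds x.2)

theorem differentiableAt (f : SmoothRing V) (x : V) :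
    DifferentiableAt ℝ (extendZero V f.1) x := (contDiffAt f x).differentiableAt (by simp)

/-- The directional derivative, as a derivation of the ring of smooth functions. -/
def deriv (v : E) : Derivation ℝ (SmoothRing V) (SmoothRing V) :=
  Derivation.mk'
    { toFun := fun f => of (fun x => fderiv ℝ (extendZero V f.1) x v)
        (contDiffOn_fderiv_apply V.isOpen (smooth f) contDiffOn_const)
      map_add' := by
        intro f g
        refine ext' fun x => ?_
        have h : extendZero V (f.1 + g.1) =ᶠ[𝓝 (x : E)] _ := extendZero_eventuallyEq (f + g) (g := extendZero V f.1 + extendZero V g.1)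
          (fun x => by simp [extendZero_apply]) x
        simp [h.fderiv_eq, fderiv_add (differentiableAt f x) (differentiableAt g x)]
      map_smul' := by
        intro c f
        refine ext' fun x => ?_
        have h : extendZero V (c • f.1) =ᶠ[𝓝 (x : E)] _ := extendZero_eventuallyEq (c • f) (g := c • extendZero V f.1)
          (fun x => by simp [extendZero_apply]) x
        simp [h.fderiv_eq, fderiv_const_smul (differentiableAt f x)] }
    (by
      intro f g
      refine ext' fun x => ?_
      have h : extendZero V (f.1 * g.1) =ᶠ[𝓝 (x : E)] _ := extendZero_eventuallyEq (f * g) (g := extendZero V f.1 * extendZero V g.1)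
        (fun x => by simp [extendZero_apply]) x
      simp [h.fderiv_eq, fderiv_mul (differentiableAt f x) (differentiableAt g x),
        extendZero_apply])

theorem deriv_apply' (v : E) (f : SmoothRing V) (x : V) :
    (deriv v f).1 x = fderiv ℝ (extendZero V f.1) x v := rfl

theorem deriv_apply (v : E) (f : SmoothRing V) {g : E → ℝ} (h : ∀ x : V, f.1 x = g x) (x : V) :
    (deriv v f).1 x = fderiv ℝ g x v := by
  rw [deriv_apply', (extendZero_eventuallyEq f h x).fderiv_eq]

theorem deriv_comm (v w : E) (f : SmoothRing V) : deriv v (deriv w f) = deriv w (deriv v f) := by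
  refine ext' fun x => ?_
  rw [deriv_apply v (deriv w f) (g := fun x => fderiv ℝ (extendZero V f.1) x w) (deriv_apply' w f),
    deriv_apply w (deriv v f) (g := fun x => fderiv ℝ (extendZero V f.1) x v) (deriv_apply' v f)]
  exact fderiv_fderiv_comm (contDiffAt f x) w v

/-- Evaluation at a point. -/
def eval (x : V) : SmoothRing V →+* ℝ := (Pi.evalRingHom _ x).comp (SmoothRing V).val.toRingHom

theorem eval_apply (x : V) (f : SmoothRing V) : eval x f = f.1 x := rfl

theorem isUnit_of_ne_zero (f : SmoothRing V) (h : ∀ x, f.1 x ≠ 0) : IsUnit f := by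
  refine IsUnit.of_mul_eq_one (of (fun x => (extendZero V f.1 x)⁻¹)
    ((smooth f).inv fun x hx => by rw [extendZero_of_mem _ hx]; exact h _)) ?_
  refine ext' fun x => ?_
  simp [extendZero_apply, h x]

theorem map_matrix_inv_apply {ι : Type*} [Fintype ι] [DecidableEq ι]
    (A : Matrix ι ι (SmoothRing V)) (hA : ∀ x, (A.map (eval x)).det ≠ 0) :
    IsUnit A.det ∧ ∀ x : V, A⁻¹.map (eval x) = (A.map (eval x))⁻¹ := by
  have hu : IsUnit A.det := isUnit_of_ne_zero _ fun x => by
    have := hA x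
    rwa [← RingHom.mapMatrix_apply, ← RingHom.map_det, eval_apply] at this
  refine ⟨hu, fun x => ?_⟩
  symm
  apply Matrix.inv_eq_right_inv
  rw [← Matrix.map_mul, Matrix.mul_nonsing_inv _ hu, Matrix.map_one _ (map_zero _) (map_one _)]

end SmoothRing
end SmoothRing

/-! ## Agreement of Taylor polynomials -/

section Agree

variable {E F G : Type*} [NormedAddCommGroup E] [NormedSpace ℝ E] [NormedAddCommGroup F]
  [NormedSpace ℝ F] [NormedAddCommGroup G] [NormedSpace ℝ G]

/-- The Taylor polynomials of `f` and `g` at `0` agree up to order `r`. -/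
def Agree (r : ℕ) (f g : E → F) : Prop :=
  ∀ k ≤ r, iteratedFDeriv ℝ k f 0 = iteratedFDeriv ℝ k g 0

theorem Agree.mono {r r' : ℕ} (hr : r' ≤ r) {f g : E → F} (h : Agree r f g) : Agree r' f g :=
  fun k hk => h k (hk.trans hr)

theorem Agree.congr {r : ℕ} {f g f' g' : E → F} (h : Agree r f g) (hf : f =ᶠ[𝓝 0] f')
    (hg : g =ᶠ[𝓝 0] g') : Agree r f' g' := fun k hk => by
  rw [← (hf.iteratedFDeriv ℝ k).eq_of_nhds, ← (hg.iteratedFDeriv ℝ k).eq_of_nhds, h k hk]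

theorem Agree.apply_zero {r : ℕ} {f g : E → F} (h : Agree r f g) : f 0 = g 0 := by
  have := congrArg (fun q => q ![]) (h 0 (Nat.zero_le r))
  simpa using this

theorem Agree.fderiv {r : ℕ} {f g : E → F} (h : Agree (r + 1) f g) :
    Agree r (fderiv ℝ f) (fderiv ℝ g) := fun k hk => by
  have := h (k + 1) (by omega)
  rw [iteratedFDeriv_succ_eq_comp_right, iteratedFDeriv_succ_eq_comp_right] at this
  exact (continuousMultilinearCurryRightEquiv' ℝ k E F).symm.injective this

/-- By the Faà di Bruno formula the k-th derivative of φ ∘ f involves f only through its value and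
its derivatives of order equal to a block size of a partition of k, hence at most k. -/
theorem Agree.comp {r : ℕ} {f g : E → F} (hf : ContDiffAt ℝ ∞ f 0) (hg : ContDiffAt ℝ ∞ g 0)
    (h : Agree r f g) {φ : F → G} (hφ : ContDiffAt ℝ ∞ φ (f 0)) :
    Agree r (φ ∘ f) (φ ∘ g) := fun k hk => by
  have h0 := h.apply_zero
  have hk' : (k : ℕ∞ω) ≤ ∞ := by exact_mod_cast le_top
  rw [iteratedFDeriv_comp hφ hf hk', iteratedFDeriv_comp (h0 ▸ hφ) hg hk', ← h0]
  unfold FormalMultilinearSeries.taylorComp FormalMultilinearSeries.compAlongOrderedFinpartition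
  refine Finset.sum_congr rfl fun c _ => ?_
  congr 1
  funext m
  exact h _ ((c.partSize_le m).trans hk)

theorem Agree.prodMk {r : ℕ} {f g : E → F} {f' g' : E → G} (hf : ContDiffAt ℝ ∞ f 0)
    (hg : ContDiffAt ℝ ∞ g 0) (hf' : ContDiffAt ℝ ∞ f' 0) (hg' : ContDiffAt ℝ ∞ g' 0)
    (h : Agree r f g) (h' : Agree r f' g') :
    Agree r (fun x => (f x, f' x)) (fun x => (g x, g' x)) := fun k hk => by
  have hk' : (k : ℕ∞ω) ≤ ∞ := by exact_mod_cast le_top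
  rw [iteratedFDeriv_prodMk hf hf' hk', iteratedFDeriv_prodMk hg hg' hk', h k hk, h' k hk]

end Agree

/-! ### Iterated partial derivatives and Taylor polynomials -/

section Pderiv

variable {n : ℕ}

theorem contDiffAt_pderiv {f : (Fin n → ℝ) → ℝ} {t : Fin n → ℝ} (hf : ContDiffAt ℝ ∞ f t)
    (j : Fin n) : ContDiffAt ℝ ∞ (pderiv j f) t := contDiffAt_fderiv_apply hf _

theorem contDiffAt_pderivs {f : (Fin n → ℝ) → ℝ} {t : Fin n → ℝ} (hf : ContDiffAt ℝ ∞ f t)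
    (l : List (Fin n)) : ContDiffAt ℝ ∞ (pderivs l f) t := by
  induction l with
  | nil => exact hf
  | cons j l ih => exact contDiffAt_pderiv ih j

theorem pderiv_eventuallyEq {f g : (Fin n → ℝ) → ℝ} {t : Fin n → ℝ} (h : f =ᶠ[𝓝 t] g)
    (j : Fin n) : pderiv j f =ᶠ[𝓝 t] pderiv j g := by
  filter_upwards [h.fderiv (𝕜 := ℝ)] with s hs
  simp [pderiv, hs]

theorem pderivs_eventuallyEq {f g : (Fin n → ℝ) → ℝ} {t : Fin n → ℝ} (h : f =ᶠ[𝓝 t] g)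
    (l : List (Fin n)) : pderivs l f =ᶠ[𝓝 t] pderivs l g := by
  induction l with
  | nil => exact h
  | cons j l ih => exact pderiv_eventuallyEq ih j

theorem contDiffAt_eventually_infty {E F : Type*} [NormedAddCommGroup E] [NormedSpace ℝ E]
    [NormedAddCommGroup F] [NormedSpace ℝ F] {f : E → F} {x : E} {U : Set E} (hU : U ∈ 𝓝 x)
    (hf : ContDiffOn ℝ ∞ f U) : ∀ᶠ y in 𝓝 x, ContDiffAt ℝ ∞ f y := by
  filter_upwards [eventually_mem_nhds_iff.mpr hU] with y hy
  exact hf.contDiffAt hy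

theorem pderivs_perm {f : (Fin n → ℝ) → ℝ} {V : Set (Fin n → ℝ)} (hV : IsOpen V)
    (hf : ContDiffOn ℝ ∞ f V) {l l' : List (Fin n)} (h : l.Perm l') :
    Set.EqOn (pderivs l f) (pderivs l' f) V := by
  induction h with
  | nil => exact fun _ _ => rfl
  | @cons x l l' _ ih =>
    intro t ht
    exact ((pderiv_eventuallyEq (ih.eventuallyEq_of_mem (hV.mem_nhds ht)) x).eq_of_nhds)
  | swap x y l =>
    intro t ht
    exact (fderiv_fderiv_comm (contDiffAt_pderivs (hf.contDiffAt (hV.mem_nhds ht)) l) _ _)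
  | trans _ _ ih₁ ih₂ => exact ih₁.trans ih₂

theorem iteratedFDeriv_apply_eq_pderivs {f : (Fin n → ℝ) → ℝ} {V : Set (Fin n → ℝ)}
    (hV : IsOpen V) (hf : ContDiffOn ℝ ∞ f V) (k : ℕ) (J : Fin k → Fin n) {t : Fin n → ℝ}
    (ht : t ∈ V) : iteratedFDeriv ℝ k f t (fun i => Pi.single (J i) 1)
      = pderivs (List.ofFn J) f t := by
  induction k generalizing t with
  | zero => simp [pderivs]
  | succ k ih =>
    rw [iteratedFDeriv_succ_apply_left, List.ofFn_succ, pderivs, pderiv]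
    have he : pderivs (List.ofFn fun i => J i.succ) f =ᶠ[𝓝 t]
        fun t => iteratedFDeriv ℝ k f t (fun i => Pi.single (J i.succ) 1) := by
      filter_upwards [hV.mem_nhds ht] with s hs
      rw [ih _ hs]
    rw [he.fderiv_eq]
    have hd : DifferentiableAt ℝ (iteratedFDeriv ℝ k f) t :=
      (hf.contDiffAt (hV.mem_nhds ht)).differentiableAt_iteratedFDeriv
        (by exact_mod_cast WithTop.coe_lt_top k)
    rw [fderiv_continuousMultilinear_apply_const_apply hd]
    rfl

theorem agree_iff_pderivs {f g : (Fin n → ℝ) → ℝ} {V : Set (Fin n → ℝ)} (hV : IsOpen V)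
    (h0 : 0 ∈ V) (hf : ContDiffOn ℝ ∞ f V) (hg : ContDiffOn ℝ ∞ g V) (r : ℕ) :
    Agree r f g ↔ ∀ l : List (Fin n), l.length ≤ r → pderivs l f 0 = pderivs l g 0 := by
  constructor
  · intro h l hl
    have e : l = List.ofFn l.get := (List.ofFn_get l).symm
    rw [e, ← iteratedFDeriv_apply_eq_pderivs hV hf _ _ h0,
      ← iteratedFDeriv_apply_eq_pderivs hV hg _ _ h0, h _ hl]
  · intro h k hk
    apply ContinuousMultilinearMap.toMultilinearMap_injective
    refine Module.Basis.ext_multilinear (fun _ => Pi.basisFun ℝ (Fin n)) fun J => ?_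
    simp only [Pi.basisFun_apply, ContinuousMultilinearMap.coe_coe]
    rw [iteratedFDeriv_apply_eq_pderivs hV hf _ _ h0, iteratedFDeriv_apply_eq_pderivs hV hg _ _ h0]
    exact h _ (by simpa using hk)

/-! ### Monomials -/

/-- The monomial `t^I / I!`. -/
def mono (I : Multiset (Fin n)) (t : Fin n → ℝ) : ℝ :=
  ∏ i, t i ^ I.count i / ((I.count i).factorial : ℝ)

theorem contDiff_mono (I : Multiset (Fin n)) : ContDiff ℝ ∞ (mono I) := by
  unfold mono
  refine contDiff_prod fun i _ => ?_
  exact ((contDiff_apply ℝ ℝ i).pow _).div_const _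

theorem pderiv_mono (j : Fin n) (I : Multiset (Fin n)) :
    pderiv j (mono I) = if j ∈ I then mono (I.erase j) else 0 := by
  classical
  funext t
  have hd : ∀ i, HasFDerivAt (fun t : Fin n → ℝ => t i ^ I.count i / ((I.count i).factorial : ℝ))
      (((I.count i : ℝ) * t i ^ (I.count i - 1) / ((I.count i).factorial : ℝ)) •
        (ContinuousLinearMap.proj i : (Fin n → ℝ) →L[ℝ] ℝ)) t := by
    intro i
    have h1 : HasFDerivAt (fun t : Fin n → ℝ => t i)
      (ContinuousLinearMap.proj i : (Fin n → ℝ) →L[ℝ] ℝ) t := (ContinuousLinearMap.proj (R := ℝ)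
        (φ := fun _ : Fin n => ℝ) i).hasFDerivAt
    have h2 : HasDerivAt (fun y : ℝ => y ^ I.count i / ((I.count i).factorial : ℝ))
        ((I.count i : ℝ) * t i ^ (I.count i - 1) / ((I.count i).factorial : ℝ)) (t i) := by
      exact (hasDerivAt_pow _ _).div_const _
    exact h2.comp_hasFDerivAt t h1
  have h := HasFDerivAt.finsetProd (u := Finset.univ) (x := t) (fun i _ => hd i)
  have h' : fderiv ℝ (mono I) t = _ := h.fderiv
  rw [pderiv, h']
  simp only [sum_apply, smul_apply,
    ContinuousLinearMap.proj_apply, smul_eq_mul]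
  rw [Finset.sum_eq_single j]
  · simp only [Pi.single_eq_same, mul_one]
    split_ifs with hj
    · rw [mono, ← Finset.mul_prod_erase Finset.univ _ (Finset.mem_univ j), mul_comm]
      congr 1
      · rw [Multiset.count_erase_self]
        have hc := Multiset.count_pos.mpr hj
        obtain ⟨k, hk⟩ := Nat.exists_eq_succ_of_ne_zero hc.ne'
        rw [hk, Nat.succ_sub_one, Nat.factorial_succ]
        push_cast
        field_simp
      · refine Finset.prod_congr rfl fun i hi => ?_
        rw [Multiset.count_erase_of_ne (Finset.ne_of_mem_erase hi)]
    · rw [Multiset.count_eq_zero_of_notMem hj]; simp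
  · intro i _ hi
    simp [Pi.single_eq_of_ne hi]
  · simp

theorem mono_zero (I : Multiset (Fin n)) : mono I 0 = if I = 0 then 1 else 0 := by
  split_ifs with h
  · subst h; simp [mono]
  · obtain ⟨i, hi⟩ := Multiset.exists_mem_of_ne_zero h
    rw [mono, Finset.prod_eq_zero (Finset.mem_univ i)]
    simp [(Multiset.count_pos.mpr hi).ne']

theorem pderivs_mono (l : List (Fin n)) (I : Multiset (Fin n)) :
    pderivs l (mono I) = if (l : Multiset (Fin n)) ≤ I then mono (I - (l : Multiset (Fin n))) else 0 := by
  have hz : ∀ j : Fin n, pderiv j (0 : (Fin n → ℝ) → ℝ) = 0 := by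
    intro j; funext t; simp [pderiv]
  induction l with
  | nil => simp [pderivs]
  | cons j l ih =>
    rw [pderivs, ih, ← Multiset.cons_coe]
    by_cases h : (l : Multiset (Fin n)) ≤ I
    · rw [if_pos h, pderiv_mono]
      have e : (j ::ₘ (l : Multiset (Fin n)) ≤ I) ↔ j ∈ I - l := by
        rw [← Multiset.singleton_le, ← Multiset.singleton_add, le_tsub_iff_right h]
      simp only [e]
      congr 2
      rw [← Multiset.sub_singleton, tsub_tsub, add_comm, Multiset.singleton_add]
    · rw [if_neg h, if_neg fun h' => h ((Multiset.le_cons_self _ _).trans h'), hz]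

theorem pderivs_mono_zero (l : List (Fin n)) (I : Multiset (Fin n)) :
    pderivs l (mono I) 0 = if (l : Multiset (Fin n)) = I then 1 else 0 := by
  rw [pderivs_mono]
  by_cases h : (l : Multiset (Fin n)) ≤ I
  · rw [if_pos h, mono_zero]
    congr 1
    simp only [tsub_eq_zero_iff_le, eq_iff_iff]
    exact ⟨fun h' => le_antisymm h h', fun h' => h'.ge⟩
  · rw [if_neg h, if_neg fun h' => h h'.le]; rfl

theorem pderivs_sum {ι : Type*} (s : Finset ι) (c : ι → ℝ) {f : ι → (Fin n → ℝ) → ℝ}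
    (hf : ∀ i, ContDiff ℝ ∞ (f i)) (l : List (Fin n)) :
    pderivs l (fun t => ∑ i ∈ s, c i * f i t) = fun t => ∑ i ∈ s, c i * pderivs l (f i) t := by
  induction l with
  | nil => rfl
  | cons j l ih =>
    rw [pderivs, ih]
    funext t
    have hd : ∀ i, DifferentiableAt ℝ (pderivs l (f i)) t := fun i =>
      (contDiffAt_pderivs (hf i).contDiffAt l).differentiableAt (by simp)
    rw [pderiv, fderiv_fun_sum fun i _ => (hd i).const_mul (c i)]
    simp only [sum_apply]
    refine Finset.sum_congr rfl fun i _ => ?_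
    rw [fderiv_const_mul (hd i)]
    rfl

end Pderiv

/-! ## Coordinates along an immersion -/

section Along

variable {n m : ℕ} {X : Type*} [TopologicalSpace X] [ChartedSpace (Fin (n + m) → ℝ) X]

theorem IsChart.contMDiffAt {ψ : OpenPartialHomeomorph X (Fin (n + m) → ℝ)}
    (h : IsChart n m X ψ) {p : X} (hp : p ∈ ψ.source) :
    ContMDiffAt 𝓘(ℝ, Fin (n + m) → ℝ) 𝓘(ℝ, Fin (n + m) → ℝ) ∞ ψ p :=
  (contMDiffOn_of_mem_maximalAtlas h).contMDiffAt (ψ.open_source.mem_nhds hp)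

theorem IsChart.contMDiffAt_symm {ψ : OpenPartialHomeomorph X (Fin (n + m) → ℝ)}
    (h : IsChart n m X ψ) {z : Fin (n + m) → ℝ} (hz : z ∈ ψ.target) :
    ContMDiffAt 𝓘(ℝ, Fin (n + m) → ℝ) 𝓘(ℝ, Fin (n + m) → ℝ) ∞ ψ.symm z :=
  (contMDiffOn_symm_of_mem_maximalAtlas h).contMDiffAt (ψ.open_target.mem_nhds hz)

theorem IsChart.contDiffAt_transition {ψ ψ' : OpenPartialHomeomorph X (Fin (n + m) → ℝ)}
    (h : IsChart n m X ψ) (h' : IsChart n m X ψ') {z : Fin (n + m) → ℝ} (hz : z ∈ ψ.target)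
    (hz' : ψ.symm z ∈ ψ'.source) : ContDiffAt ℝ ∞ (fun z => ψ' (ψ.symm z)) z :=
  ((h'.contMDiffAt hz').comp z (h.contMDiffAt_symm hz)).contDiffAt

theorem ImmGerm.contMDiffAt (γ : ImmGerm n m X) :
    ContMDiffAt 𝓘(ℝ, Fin n → ℝ) 𝓘(ℝ, Fin (n + m) → ℝ) ∞ γ.toFun 0 := by
  obtain ⟨U, hU, h⟩ := γ.smooth
  exact h.contMDiffAt hU

/-- An immersion germ from its expression in a chart. -/
def ImmGerm.ofChart (f : (Fin n → ℝ) → X) {ψ : OpenPartialHomeomorph X (Fin (n + m) → ℝ)}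
    (hψ : IsChart n m X ψ) {U : Set (Fin n → ℝ)} (hU : U ∈ 𝓝 0)
    (hf : ContMDiffOn 𝓘(ℝ, Fin n → ℝ) 𝓘(ℝ, Fin (n + m) → ℝ) ∞ f U) (h0 : f 0 ∈ ψ.source)
    (hi : Function.Injective (fderiv ℝ (fun t => ψ (f t)) 0)) : ImmGerm n m X where
  toFun := f
  smooth := ⟨U, hU, hf⟩
  immersion := by
    have h1 := mfderiv_comp (0 : Fin n → ℝ) ((hψ.contMDiffAt h0).mdifferentiableAt (by simp))
      ((hf.contMDiffAt hU).mdifferentiableAt (by simp))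
    have h2 : Function.Injective (mfderiv 𝓘(ℝ, Fin n → ℝ) 𝓘(ℝ, Fin (n + m) → ℝ) (ψ ∘ f) 0) := by
      rw [mfderiv_eq_fderiv]; exact hi
    rw [h1] at h2
    exact Function.Injective.of_comp (f := mfderiv 𝓘(ℝ, Fin (n + m) → ℝ)
      𝓘(ℝ, Fin (n + m) → ℝ) ψ (f 0)) h2

namespace AChart

variable (c : AChart n m X)

/-- The expression of `γ` in the chart. -/
def loc (γ : ImmGerm n m X) (t : Fin n → ℝ) : Fin (n + m) → ℝ := c.ψ (γ.toFun t)

/-- `γ` is smooth on `V`, maps `V` into the chart, and `det(𝐱)` does not vanish. -/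
structure Good (γ : ImmGerm n m X) (V : TopologicalSpace.Opens (Fin n → ℝ)) : Prop where
  smooth : ContDiffOn ℝ ∞ (c.loc γ) V
  mem_source : ∀ t ∈ V, γ.toFun t ∈ c.ψ.source
  det_ne_zero : ∀ t ∈ V, (c.xMat γ t).det ≠ 0

variable {c}

theorem exists_smooth_nhds {γ : ImmGerm n m X} (h : γ.toFun 0 ∈ c.ψ.source) :
    ∃ V : Set (Fin n → ℝ), IsOpen V ∧ 0 ∈ V ∧ ContDiffOn ℝ ∞ (c.loc γ) V ∧
      ContinuousOn γ.toFun V ∧ ∀ t ∈ V, γ.toFun t ∈ c.ψ.source := by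
  obtain ⟨U, hU, hγ⟩ := γ.smooth
  obtain ⟨W, hWU, hW, h0⟩ := mem_nhds_iff.mp hU
  have hc : ContinuousOn γ.toFun W := hγ.continuousOn.mono hWU
  refine ⟨W ∩ γ.toFun ⁻¹' c.ψ.source, hc.isOpen_inter_preimage hW c.ψ.open_source, ⟨h0, h⟩, ?_,
    hc.mono Set.inter_subset_left, fun t ht => ht.2⟩
  intro t ht
  refine ContDiffAt.contDiffWithinAt ?_
  exact ((c.isChart.contMDiffAt ht.2).comp t
    (hγ.contMDiffAt (Filter.mem_of_superset (hW.mem_nhds ht.1) hWU))).contDiffAt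

theorem contDiffAt_loc {γ : ImmGerm n m X} (h : γ.toFun 0 ∈ c.ψ.source) :
    ContDiffAt ℝ ∞ (c.loc γ) 0 := by
  obtain ⟨V, hV, h0, hs, -⟩ := exists_smooth_nhds h
  exact hs.contDiffAt (hV.mem_nhds h0)

theorem contDiffOn_xFun {γ : ImmGerm n m X} {V : Set (Fin n → ℝ)}
    (h : ContDiffOn ℝ ∞ (c.loc γ) V) (i : Fin n) : ContDiffOn ℝ ∞ (c.xFun γ i) V :=
  contDiffOn_pi.mp h _

theorem contDiffOn_det_xMat {γ : ImmGerm n m X} {V : Set (Fin n → ℝ)} (hV : IsOpen V)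
    (h : ContDiffOn ℝ ∞ (c.loc γ) V) : ContDiffOn ℝ ∞ (fun t => (c.xMat γ t).det) V := by
  simp only [Matrix.det_apply]
  refine ContDiffOn.sum fun σ _ => ContDiffOn.const_smul _ (contDiffOn_prod fun i _ => ?_)
  exact contDiffOn_fderiv_apply hV (contDiffOn_xFun h _) contDiffOn_const

theorem InDom.exists_good {γ : ImmGerm n m X} (h : c.InDom γ) :
    ∃ V : TopologicalSpace.Opens (Fin n → ℝ), 0 ∈ V ∧ c.Good γ V := by
  obtain ⟨V, hV, h0, hs, -, hm⟩ := exists_smooth_nhds h.1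
  have hd := (contDiffOn_det_xMat hV hs).continuousOn
  refine ⟨⟨V ∩ (fun t => (c.xMat γ t).det) ⁻¹' {0}ᶜ,
    hd.isOpen_inter_preimage hV isOpen_compl_singleton⟩, ⟨h0, h.2⟩, ?_, ?_, ?_⟩
  · exact hs.mono Set.inter_subset_left
  · exact fun t ht => hm t ht.1
  · exact fun t ht => ht.2

namespace Good

variable {γ : ImmGerm n m X} {V : TopologicalSpace.Opens (Fin n → ℝ)} (h : c.Good γ V)

/-- The functions `xⁱ ∘ γ` in the ring of smooth functions. -/
def x (i : Fin n) : SmoothRing V := SmoothRing.of (c.xFun γ i) (contDiffOn_xFun h.smooth i)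

/-- The derivations `∂_j`. -/
def _root_.HelmholtzSonin.partials (V : TopologicalSpace.Opens (Fin n → ℝ)) (j : Fin n) :
    Derivation ℝ (SmoothRing V) (SmoothRing V) := SmoothRing.deriv (Pi.single j 1)

theorem _root_.HelmholtzSonin.partials_comm (V : TopologicalSpace.Opens (Fin n → ℝ))
    (i j : Fin n) (f : SmoothRing V) :
    partials V i (partials V j f) = partials V j (partials V i f) := SmoothRing.deriv_comm _ _ _

/-- The matrix `𝐱` over the ring of smooth functions. -/
def jac : Matrix (Fin n) (Fin n) (SmoothRing V) := Matrix.of fun l p => partials V p (h.x l)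

theorem jac_map (t : V) : h.jac.map (SmoothRing.eval t) = c.xMat γ t := by
  ext i j
  exact SmoothRing.deriv_apply _ _ (fun t => rfl) t

theorem inv_mul : h.jac⁻¹ * h.jac = 1 :=
  Matrix.nonsing_inv_mul _ (SmoothRing.map_matrix_inv_apply h.jac fun t => by
    rw [h.jac_map]; exact h.det_ne_zero t t.2).1

theorem jac_inv_apply (t : V) (i j : Fin n) : (h.jac⁻¹ i j).1 t = (c.xMat γ t)⁻¹ i j := by
  have := (SmoothRing.map_matrix_inv_apply h.jac fun t => by
    rw [h.jac_map]; exact h.det_ne_zero t t.2).2 t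
  rw [← h.jac_map, ← this]
  rfl

/-- The functions `y^σ_I` in the ring of smooth functions. -/
def y (σ : Fin m) (l : List (Fin n)) : SmoothRing V :=
  ders (dbar (partials V) h.jac⁻¹) l (SmoothRing.of (fun t => c.loc γ t (c.e (Sum.inr σ)))
    (contDiffOn_pi.mp h.smooth _))

theorem y_apply (σ : Fin m) (l : List (Fin n)) (t : V) : (h.y σ l).1 t = c.yFun γ σ l t := by
  induction l generalizing t with
  | nil => rfl
  | cons i l ih =>
    rw [y, ders, dbar_apply]
    rw [← SmoothRing.eval_apply, map_sum]
    refine Finset.sum_congr rfl fun j _ => ?_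
    rw [map_mul, SmoothRing.eval_apply, SmoothRing.eval_apply, h.jac_inv_apply]
    congr 1
    exact SmoothRing.deriv_apply _ _ ih t

include h in
theorem contDiffOn_yFun (σ : Fin m) (l : List (Fin n)) : ContDiffOn ℝ ∞ (c.yFun γ σ l) V :=
  (SmoothRing.smooth (h.y σ l)).congr fun t ht => by
    rw [extendZero_of_mem _ ht]; exact (h.y_apply σ l ⟨t, ht⟩).symm

include h in
-- The y^σ_I are iterated derivatives along ∂̄_i = zʲ_i ∂_j, and these derivations commute because
-- ∂̄_i(x^l ∘ γ) = δ^l_i.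
theorem yFun_perm (σ : Fin m) {l l' : List (Fin n)} (hl : l.Perm l') {t : Fin n → ℝ}
    (ht : t ∈ V) : c.yFun γ σ l t = c.yFun γ σ l' t := by
  rw [← h.y_apply σ l ⟨t, ht⟩, ← h.y_apply σ l' ⟨t, ht⟩, y, y,
    ders_perm (dbar_comm h.inv_mul (partials_comm V)) hl]

include h in
theorem pderiv_yFun (σ : Fin m) (l : List (Fin n)) (j : Fin n) {t : Fin n → ℝ} (ht : t ∈ V) :
    pderiv j (c.yFun γ σ l) t = ∑ i, c.xMat γ t i j * c.yFun γ σ (i :: l) t := by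
  have hdet := h.det_ne_zero t ht
  simp only [yFun, Finset.mul_sum]
  rw [Finset.sum_comm]
  have : ∀ k, ∑ i, c.xMat γ t i j * ((c.xMat γ t)⁻¹ k i * pderiv k (c.yFun γ σ l) t)
      = (if k = j then 1 else 0) * pderiv k (c.yFun γ σ l) t := by
    intro k
    rw [← Matrix.one_apply, ← Matrix.nonsing_inv_mul (c.xMat γ t) (isUnit_iff_ne_zero.mpr hdet),
      Matrix.mul_apply, Finset.sum_mul]
    exact Finset.sum_congr rfl fun i _ => by ring
  simp [this]

include h in
theorem mono {V' : TopologicalSpace.Opens (Fin n → ℝ)} (hV : V' ≤ V) : c.Good γ V' :=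
  ⟨h.smooth.mono hV, fun t ht => h.mem_source t (hV ht), fun t ht => h.det_ne_zero t (hV ht)⟩

end Good

/-! ### Dependence on the germ, the jet, and the parametrization -/

theorem xMat_eq_fderiv {γ : ImmGerm n m X} {t : Fin n → ℝ} (h : DifferentiableAt ℝ (c.loc γ) t)
    (i j : Fin n) :
    c.xMat γ t i j = fderiv ℝ (c.loc γ) t (Pi.single j 1) (c.e (Sum.inl i)) := by
  have := fderiv_pi (𝕜 := ℝ) (φ := fun k t => c.loc γ t k) (x := t)
    (fun k => differentiableAt_pi.mp h k)
  rw [show c.loc γ = fun t k => c.loc γ t k from rfl, this]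
  rfl

/-- Germs with a common jet have agreeing coordinates along them. -/
theorem agree_yFun {r : ℕ} {γ δ : ImmGerm n m X} (hγ : c.InDom γ) (hδ : c.InDom δ)
    (h : Agree r (c.loc γ) (c.loc δ)) (σ : Fin m) (l : List (Fin n)) (hl : l.length ≤ r) :
    Agree (r - l.length) (c.yFun γ σ l) (c.yFun δ σ l) := by
  obtain ⟨V, h0, hV⟩ := hγ.exists_good
  obtain ⟨V', h0', hV'⟩ := hδ.exists_good
  have sγ := hV.smooth.contDiffAt (V.isOpen.mem_nhds h0)
  have sδ := hV'.smooth.contDiffAt (V'.isOpen.mem_nhds h0')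
  induction l with
  | nil =>
    exact Agree.comp sγ sδ h (φ := fun z => z (c.e (Sum.inr σ))) (contDiff_apply ℝ ℝ _).contDiffAt
  | cons i l ih =>
    rw [List.length_cons] at hl
    have ih := ih (by omega)
    rw [show r - l.length = (r - (l.length + 1)) + 1 by omega] at ih
    have h1 := ih.fderiv
    have h2 : Agree (r - (l.length + 1)) (fderiv ℝ (c.loc γ)) (fderiv ℝ (c.loc δ)) :=
      (h.mono (show r - (l.length + 1) + 1 ≤ r by omega)).fderiv
    have syγ := (hV.contDiffOn_yFun σ l).contDiffAt (V.isOpen.mem_nhds h0)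
    have syδ := (hV'.contDiffOn_yFun σ l).contDiffAt (V'.isOpen.mem_nhds h0')
    have dγ := sγ.fderiv_right (m := ∞) (by simp)
    have dδ := sδ.fderiv_right (m := ∞) (by simp)
    have dyγ := syγ.fderiv_right (m := ∞) (by simp)
    have dyδ := syδ.fderiv_right (m := ∞) (by simp)
    let mat : ((Fin n → ℝ) →L[ℝ] (Fin (n + m) → ℝ)) → Matrix (Fin n) (Fin n) ℝ :=
      fun A => Matrix.of fun i j => A (Pi.single j 1) (c.e (Sum.inl i))
    -- One step of the recurrence as a map φ, smooth where det 𝐱 ≠ 0, of the first derivatives of γ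
    -- and of y_I. Passing to first derivatives is what costs one order of agreement per index.
    let φ : ((Fin n → ℝ) →L[ℝ] (Fin (n + m) → ℝ)) × ((Fin n → ℝ) →L[ℝ] ℝ) → ℝ :=
      fun A => (mat A.1).det⁻¹ * ∑ j, (mat A.1).adjugate j i * A.2 (Pi.single j 1)
    have hmat : ∀ i j, ContDiff ℝ ∞ (fun A => mat A i j) := by
      intro i j
      have h1 : ContDiff ℝ ∞ (fun A : (Fin n → ℝ) →L[ℝ] (Fin (n + m) → ℝ) =>
          A (Pi.single j 1)) := contDiff_id.clm_apply contDiff_const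
      exact contDiff_pi.mp h1 _
    have hdet : ∀ B : ((Fin n → ℝ) →L[ℝ] (Fin (n + m) → ℝ)) → Matrix (Fin n) (Fin n) ℝ,
        (∀ i j, ContDiff ℝ ∞ (fun A => B A i j)) → ContDiff ℝ ∞ (fun A => (B A).det) := by
      intro B hB
      simp only [Matrix.det_apply]
      exact ContDiff.sum fun σ _ => ContDiff.const_smul _ (contDiff_prod fun i _ => hB _ _)
    have hadj : ∀ i j, ContDiff ℝ ∞ (fun A => (mat A).adjugate i j) := by
      intro i j
      simp only [Matrix.adjugate_apply]
      refine hdet _ fun k l => ?_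
      by_cases hk : k = j
      · subst hk; simp only [Matrix.updateRow_self]; exact contDiff_const
      · simp only [Matrix.updateRow_ne hk]; exact hmat k l
    have hφ : ∀ {γ : ImmGerm n m X} {V : TopologicalSpace.Opens (Fin n → ℝ)},
        c.Good γ V → ∀ t ∈ V, c.yFun γ σ (i :: l) t
          = φ (fderiv ℝ (c.loc γ) t, fderiv ℝ (c.yFun γ σ l) t) := by
      intro γ V hV t ht
      have hm : mat (fderiv ℝ (c.loc γ) t) = c.xMat γ t := by
        ext i j
        exact (xMat_eq_fderiv ((hV.smooth.contDiffAt (V.isOpen.mem_nhds ht)).differentiableAt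
          (by simp)) i j).symm
      simp only [φ, hm, yFun, Matrix.inv_def, Ring.inverse_eq_inv', Finset.mul_sum]
      refine Finset.sum_congr rfl fun j _ => ?_
      simp [pderiv, mul_assoc]
    have hd0 : (mat (fderiv ℝ (c.loc γ) 0)).det ≠ 0 := by
      have hm : mat (fderiv ℝ (c.loc γ) 0) = c.xMat γ 0 := by
        ext i j
        exact (xMat_eq_fderiv (sγ.differentiableAt (by simp)) i j).symm
      rw [hm]; exact hγ.2
    have hφs : ContDiffAt ℝ ∞ φ (fderiv ℝ (c.loc γ) 0, fderiv ℝ (c.yFun γ σ l) 0) := by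
      refine ContDiffAt.mul (ContDiffAt.inv ?_ hd0) ?_
      · exact ((hdet mat hmat).comp contDiff_fst).contDiffAt
      · refine ContDiffAt.sum fun j _ => ContDiffAt.mul ?_ ?_
        · exact ((hadj j i).comp contDiff_fst).contDiffAt
        · exact (contDiff_snd.clm_apply contDiff_const).contDiffAt
    have key := Agree.comp (dγ.prodMk dyγ) (dδ.prodMk dyδ)
      (Agree.prodMk dγ dδ dyγ dyδ h2 h1) hφs
    refine key.congr ?_ ?_
    · filter_upwards [V.isOpen.mem_nhds h0] with t ht
      exact (hφ hV t ht).symm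
    · filter_upwards [V'.isOpen.mem_nhds h0'] with t ht
      exact (hφ hV' t ht).symm

end AChart

end Along

/-! ## Reparametrizations, graphs, and the points of the Grassmann manifold -/

theorem pderiv_comp {n p : ℕ} {f : (Fin p → ℝ) → ℝ} {α : (Fin n → ℝ) → (Fin p → ℝ)} {t : Fin n → ℝ}
    (hf : DifferentiableAt ℝ f (α t)) (hα : DifferentiableAt ℝ α t) (j : Fin n) :
    pderiv j (fun t => f (α t)) t
      = ∑ k, pderiv k f (α t) * fderiv ℝ α t (Pi.single j 1) k := by
  rw [pderiv, fderiv_fun_comp t hf hα, ContinuousLinearMap.comp_apply]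
  conv_lhs => rw [pi_eq_sum_univ' (fderiv ℝ α t (Pi.single j 1))]
  rw [map_sum]
  refine Finset.sum_congr rfl fun k _ => ?_
  rw [map_smul, smul_eq_mul, mul_comm, pderiv]

theorem Agree.pi {E ι : Type*} [NormedAddCommGroup E] [NormedSpace ℝ E] [Fintype ι] {r : ℕ}
    {f g : E → ι → ℝ} (hf : ContDiffAt ℝ ∞ f 0) (hg : ContDiffAt ℝ ∞ g 0)
    (h : ∀ i, Agree r (fun t => f t i) (fun t => g t i)) : Agree r f g := fun k hk => by
  have hk' : (k : ℕ∞ω) ≤ ∞ := by exact_mod_cast le_top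
  ext v i
  have h1 := (ContinuousLinearMap.proj (R := ℝ) (φ := fun _ : ι => ℝ) i).iteratedFDeriv_comp_left
    hf hk'
  have h2 := (ContinuousLinearMap.proj (R := ℝ) (φ := fun _ : ι => ℝ) i).iteratedFDeriv_comp_left
    hg hk'
  have h3 := h i k hk
  have h4 : iteratedFDeriv ℝ k (fun t => f t i) 0 v = iteratedFDeriv ℝ k (fun t => g t i) 0 v := by
    rw [h3]
  change iteratedFDeriv ℝ k (fun t => f t i) 0 = _ at h1
  change iteratedFDeriv ℝ k (fun t => g t i) 0 = _ at h2
  rw [h1, h2] at h4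
  exact h4

theorem Reparam.contDiffAt {n : ℕ} (α : Reparam n) : ∀ᶠ t in 𝓝 0, ContDiffAt ℝ ∞ α.toFun t := by
  obtain ⟨U, hU, h⟩ := α.smooth
  exact contDiffAt_eventually_infty hU h

section Points

variable {n m : ℕ} {X : Type*} [TopologicalSpace X] [ChartedSpace (Fin (n + m) → ℝ) X]

namespace AChart

variable {c : AChart n m X}

theorem loc_comp {γ δ : ImmGerm n m X} {α : Reparam n} (h : IsComp γ α δ) :
    c.loc δ =ᶠ[𝓝 0] fun t => c.loc γ (α.toFun t) := by
  filter_upwards [h] with t ht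
  simp [loc, ht]

/-- The Jacobian matrix of a reparametrization. -/
def _root_.HelmholtzSonin.Reparam.mat {n : ℕ} (α : Reparam n) (t : Fin n → ℝ) :
    Matrix (Fin n) (Fin n) ℝ := Matrix.of fun i j => fderiv ℝ α.toFun t (Pi.single j 1) i

theorem _root_.HelmholtzSonin.Reparam.det_mat {n : ℕ} (α : Reparam n) :
    (α.mat 0).det = α.det := by
  rw [Reparam.det, ContinuousLinearMap.det, ← LinearMap.det_toMatrix']
  congr 1

theorem xMat_comp {γ δ : ImmGerm n m X} {α : Reparam n} (h : IsComp γ α δ)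
    (hγ : γ.toFun 0 ∈ c.ψ.source) :
    ∀ᶠ t in 𝓝 0, c.xMat δ t = c.xMat γ (α.toFun t) * α.mat t := by
  obtain ⟨V, hV, h0, hs, -⟩ := exists_smooth_nhds hγ
  have hα := α.contDiffAt
  have hα0 : ContinuousAt α.toFun 0 := hα.self_of_nhds.continuousAt
  have hαV : ∀ᶠ t in 𝓝 0, α.toFun t ∈ V :=
    hα0.eventually (by rw [α.map_zero]; exact hV.mem_nhds h0)
  filter_upwards [(loc_comp (c := c) h).eventuallyEq_nhds, hα, hαV] with t ht hαt htV
  ext i j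
  have e : c.xFun δ i =ᶠ[𝓝 t] fun t => c.xFun γ i (α.toFun t) := by
    filter_upwards [ht] with s hs
    exact congrFun hs _
  rw [xMat, Matrix.of_apply, (pderiv_eventuallyEq e j).eq_of_nhds,
    pderiv_comp (((contDiffOn_xFun hs i).contDiffAt (hV.mem_nhds htV)).differentiableAt (by simp))
      (hαt.differentiableAt (by simp))]
  rfl

/-- The recurrence is invariant under reparametrization: the chain rule multiplies the partial
derivatives by the Jacobian matrix of α, while 𝐱 is multiplied by the same matrix, and 𝐱⁻¹ cancels
it. The identity is needed near 0, and not only at 0, so that it can be differentiated again. -/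
theorem yFun_comp {γ δ : ImmGerm n m X} {α : Reparam n} (h : IsComp γ α δ) (hγ : c.InDom γ)
    (σ : Fin m) (l : List (Fin n)) :
    c.yFun δ σ l =ᶠ[𝓝 0] fun t => c.yFun γ σ l (α.toFun t) := by
  obtain ⟨V, h0, hV⟩ := hγ.exists_good
  have hα := α.contDiffAt
  have hα0 : ContinuousAt α.toFun 0 := hα.self_of_nhds.continuousAt
  have hαV : ∀ᶠ t in 𝓝 0, α.toFun t ∈ V :=
    hα0.eventually (by rw [α.map_zero]; exact V.isOpen.mem_nhds h0)
  have hdet : ∀ᶠ t in 𝓝 0, (α.mat t).det ≠ 0 := by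
    have hc : ContinuousAt (fun t => (α.mat t).det) 0 := by
      have : ContinuousAt (fun t => fderiv ℝ α.toFun t) 0 :=
        (hα.self_of_nhds.fderiv_right (m := ∞) (by simp)).continuousAt
      refine (continuous_id.matrix_det (R := ℝ) (n := Fin n)).continuousAt.comp
        (f := fun t => α.mat t) ?_
      refine continuousAt_pi.mpr fun i => continuousAt_pi.mpr fun j => ?_
      exact continuousAt_pi.mp (this.clm_apply continuousAt_const) i
    exact hc.eventually_ne (by rw [α.det_mat]; exact α.det_ne_zero)
  induction l with
  | nil =>
    filter_upwards [loc_comp (c := c) h] with t ht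
    exact congrFun ht _
  | cons i l ih =>
    filter_upwards [ih.eventuallyEq_nhds, hα, hαV, xMat_comp h hγ.1, hdet] with t ht hαt htV hx hd
    simp only [yFun]
    rw [hx, Matrix.mul_inv_rev]
    have e : ∀ j, pderiv j (c.yFun δ σ l) t
        = ∑ k, pderiv k (c.yFun γ σ l) (α.toFun t) * α.mat t k j := by
      intro j
      rw [(pderiv_eventuallyEq ht j).eq_of_nhds]
      exact pderiv_comp (((hV.contDiffOn_yFun σ l).contDiffAt
        (V.isOpen.mem_nhds htV)).differentiableAt (by simp)) (hαt.differentiableAt (by simp)) j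
    simp only [e, Matrix.mul_apply, Finset.sum_mul, Finset.mul_sum]
    have e2 : ∀ j k l', (α.mat t)⁻¹ j l' * (c.xMat γ (α.toFun t))⁻¹ l' i
          * (pderiv k (c.yFun γ σ l) (α.toFun t) * α.mat t k j)
        = (c.xMat γ (α.toFun t))⁻¹ l' i * pderiv k (c.yFun γ σ l) (α.toFun t)
          * (α.mat t k j * (α.mat t)⁻¹ j l') := by intros; ring
    simp only [e2]
    rw [Finset.sum_comm]
    conv_lhs =>
      enter [2, l']
      rw [Finset.sum_comm]
    simp only [← Finset.mul_sum]
    have e3 : ∀ k l', ∑ j, α.mat t k j * (α.mat t)⁻¹ j l' = if k = l' then 1 else 0 := by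
      intro k l'
      rw [← Matrix.mul_apply, Matrix.mul_nonsing_inv _ (isUnit_iff_ne_zero.mpr hd),
        Matrix.one_apply]
    simp [e3]

theorem detX_comp {γ δ : ImmGerm n m X} {α : Reparam n} (h : IsComp γ α δ)
    (hγ : γ.toFun 0 ∈ c.ψ.source) : c.detX δ = c.detX γ * α.det := by
  have := (xMat_comp h hγ).self_of_nhds
  rw [detX, this, Matrix.det_mul, α.map_zero, α.det_mat, detX]

theorem base_comp {γ δ : ImmGerm n m X} {α : Reparam n} (h : IsComp γ α δ) :
    δ.toFun 0 = γ.toFun 0 := by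
  have := h.eq_of_nhds
  simpa [α.map_zero] using this

theorem inDom_comp {γ δ : ImmGerm n m X} {α : Reparam n} (h : IsComp γ α δ) :
    c.InDom δ ↔ c.InDom γ := by
  unfold InDom
  rw [base_comp h]
  refine and_congr_right fun hγ => ?_
  rw [detX_comp h hγ]
  exact ⟨left_ne_zero_of_mul, fun h => mul_ne_zero h α.det_ne_zero⟩

theorem coordGerm_comp {γ δ : ImmGerm n m X} {α : Reparam n} (h : IsComp γ α δ) (hγ : c.InDom γ)
    (r : ℕ) : c.coordGerm r δ = c.coordGerm r γ := by
  refine Prod.ext (funext fun i => ?_) (funext fun σ => funext fun I => ?_)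
  · have := (loc_comp (c := c) h).eq_of_nhds
    rw [α.map_zero] at this
    exact congrFun this _
  · have := (yFun_comp h hγ σ (sorted I.1)).eq_of_nhds
    rw [α.map_zero] at this
    exact this

theorem detX_of_agree {γ δ : ImmGerm n m X} (hγ : γ.toFun 0 ∈ c.ψ.source)
    (hδ : δ.toFun 0 ∈ c.ψ.source) (h : Agree 1 (c.loc γ) (c.loc δ)) : c.detX γ = c.detX δ := by
  have h1 : Agree 0 _ _ := h.fderiv
  have h2 := h1.apply_zero
  unfold detX
  congr 1
  ext i j
  rw [xMat_eq_fderiv ((contDiffAt_loc hγ).differentiableAt (by simp)),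
    xMat_eq_fderiv ((contDiffAt_loc hδ).differentiableAt (by simp)), h2]

theorem agree_of_jetEq {r : ℕ} {γ δ : ImmGerm n m X} (h : JetEq n m X r γ δ)
    (hγ : γ.toFun 0 ∈ c.ψ.source) : Agree r (c.loc γ) (c.loc δ) := h.2 c.ψ c.isChart hγ

theorem jetEq_of_agree {r : ℕ} {γ δ : ImmGerm n m X} (hγ : γ.toFun 0 ∈ c.ψ.source)
    (h0 : γ.toFun 0 = δ.toFun 0) (h : Agree r (c.loc γ) (c.loc δ)) : JetEq n m X r γ δ := by
  refine ⟨h0, fun ψ hψ hs => ?_⟩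
  have hδ : δ.toFun 0 ∈ c.ψ.source := h0 ▸ hγ
  have key := Agree.comp (contDiffAt_loc hγ) (contDiffAt_loc hδ) h
    (φ := fun z => ψ (c.ψ.symm z)) (c.isChart.contDiffAt_transition hψ (c.ψ.map_source hγ)
      (by
        rw [show c.ψ.symm (c.loc γ 0) = γ.toFun 0 from c.ψ.left_inv hγ]; exact hs))
  have e : ∀ γ : ImmGerm n m X, γ.toFun 0 ∈ c.ψ.source →
      (fun z => ψ (c.ψ.symm z)) ∘ c.loc γ =ᶠ[𝓝 0] fun t => ψ (γ.toFun t) := by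
    intro γ hγ
    obtain ⟨V, hV, h0, -, -, hm⟩ := exists_smooth_nhds hγ
    filter_upwards [hV.mem_nhds h0] with t ht
    simp [loc, c.ψ.left_inv (hm t ht)]
  exact key.congr (e γ hγ) (e δ hδ)

theorem inDom_of_jetEq {r : ℕ} (hr : 1 ≤ r) {γ δ : ImmGerm n m X} (h : JetEq n m X r γ δ)
    (hγ : c.InDom γ) : c.InDom δ := by
  have hδ : δ.toFun 0 ∈ c.ψ.source := h.1 ▸ hγ.1
  refine ⟨hδ, ?_⟩
  rw [← detX_of_agree hγ.1 hδ ((agree_of_jetEq h hγ.1).mono hr)]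
  exact hγ.2

theorem coordGerm_of_jetEq {r : ℕ} (hr : 1 ≤ r) {γ δ : ImmGerm n m X} (h : JetEq n m X r γ δ)
    (hγ : c.InDom γ) : c.coordGerm r γ = c.coordGerm r δ := by
  have ha := agree_of_jetEq h hγ.1
  refine Prod.ext (funext fun i => ?_) (funext fun σ => funext fun I => ?_)
  · exact congrFun ha.apply_zero _
  · exact (agree_yFun hγ (inDom_of_jetEq hr h hγ) ha σ (sorted I.1)
      (by simpa [sorted] using I.2)).apply_zero

open Classical in
/-- The coordinates of a germ, if it lies in the domain of the chart. -/
def coordGerm? (c : AChart n m X) (r : ℕ) (γ : ImmGerm n m X) : Option (Coord n m r) :=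
  if c.InDom γ then some (c.coordGerm r γ) else none

/-- A contact element is a class under two successive quotients, by jets and by reparametrizations.
Recording membership in the domain in an `Option` makes a total function on germs that descends
through both, so the domain and the coordinates are seen to be well defined together. -/
theorem coordGerm?_eq_of_rho_eq {r : ℕ} (hr : 1 ≤ r) {γ δ : ImmGerm n m X}
    (h : rho (jet r γ) = rho (jet r δ)) : c.coordGerm? r γ = c.coordGerm? r δ := by
  have hj : ∀ γ δ : ImmGerm n m X, JetEq n m X r γ δ → c.coordGerm? r γ = c.coordGerm? r δ := by
    intro γ δ h
    unfold coordGerm?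
    by_cases hγ : c.InDom γ
    · rw [if_pos hγ, if_pos (inDom_of_jetEq hr h hγ), coordGerm_of_jetEq hr h hγ]
    · rw [if_neg hγ, if_neg fun hδ => hγ (inDom_of_jetEq hr ((jetSetoid n m X r).symm h) hδ)]
  let F : Velocity n m X r → Option (Coord n m r) :=
    Quotient.lift (s := jetSetoid n m X r) (c.coordGerm? r) hj
  have hF : ∀ v w : Velocity n m X r, (∃ (γ δ : ImmGerm n m X) (α : Reparam n), IsComp γ α δ ∧
      jet r γ = v ∧ jet r δ = w) → F v = F w := by
    rintro _ _ ⟨γ, δ, α, h, rfl, rfl⟩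
    change c.coordGerm? r γ = c.coordGerm? r δ
    unfold coordGerm?
    by_cases hγ : c.InDom γ
    · rw [if_pos hγ, if_pos ((inDom_comp h).mpr hγ), coordGerm_comp h hγ]
    · rw [if_neg hγ, if_neg fun hδ => hγ ((inDom_comp h).mp hδ)]
  exact congrArg (Quot.lift F hF) h

theorem inDom_of_rho_eq {r : ℕ} (hr : 1 ≤ r) {γ δ : ImmGerm n m X}
    (h : rho (jet r γ) = rho (jet r δ)) (hγ : c.InDom γ) : c.InDom δ := by
  by_contra hδ
  have := coordGerm?_eq_of_rho_eq (c := c) hr h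
  simp [coordGerm?, hγ, hδ] at this

theorem coordGerm_eq_of_rho_eq {r : ℕ} (hr : 1 ≤ r) {γ δ : ImmGerm n m X}
    (h : rho (jet r γ) = rho (jet r δ)) (hγ : c.InDom γ) :
    c.coordGerm r γ = c.coordGerm r δ := by
  have := coordGerm?_eq_of_rho_eq (c := c) hr h
  simpa [coordGerm?, hγ, inDom_of_rho_eq hr h hγ] using this

theorem _root_.HelmholtzSonin.Grassmann.rho_jet_rep {r : ℕ} (p : Grassmann n m X r) :
    rho (jet r p.rep) = p := by
  have h : jet r p.rep = Quot.out p := Quotient.out_eq (s := jetSetoid n m X r) _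
  rw [h]
  exact Quot.out_eq p

theorem inDom_rep {r : ℕ} (hr : 1 ≤ r) {p : Grassmann n m X r} (hp : p ∈ c.dom r) :
    c.InDom p.rep := by
  obtain ⟨γ, hγ, rfl⟩ := hp
  exact inDom_of_rho_eq hr (Grassmann.rho_jet_rep _).symm hγ

theorem mem_dom_iff {r : ℕ} (hr : 1 ≤ r) {γ : ImmGerm n m X} :
    rho (jet r γ) ∈ c.dom r ↔ c.InDom γ :=
  ⟨fun ⟨_, hδ, h⟩ => inDom_of_rho_eq hr h hδ, fun h => ⟨γ, h, rfl⟩⟩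

theorem coord_rho_jet {r : ℕ} (hr : 1 ≤ r) {γ : ImmGerm n m X} (hγ : c.InDom γ) :
    c.coord r (rho (jet r γ)) = c.coordGerm r γ :=
  (coordGerm_eq_of_rho_eq hr (Grassmann.rho_jet_rep _).symm hγ).symm

theorem mem_image_iff {r : ℕ} (hr : 1 ≤ r) {k : Coord n m r} :
    k ∈ c.image r ↔ ∃ γ, c.InDom γ ∧ c.coordGerm r γ = k := by
  constructor
  · rintro ⟨p, hp, rfl⟩
    exact ⟨p.rep, inDom_rep hr hp, rfl⟩
  · rintro ⟨γ, hγ, rfl⟩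
    exact ⟨_, (mem_dom_iff hr).mpr hγ, coord_rho_jet hr hγ⟩

/-! ### Graphs -/

/-- The point of `ℝ^N` with coordinates `(x, y)`. -/
def assemble (c : AChart n m X) (x : Fin n → ℝ) (y : Fin m → ℝ) : Fin (n + m) → ℝ :=
  fun A => Sum.elim x y (c.e.symm A)

@[simp] theorem assemble_inl (x : Fin n → ℝ) (y : Fin m → ℝ) (i : Fin n) :
    c.assemble x y (c.e (Sum.inl i)) = x i := by simp [assemble]

@[simp] theorem assemble_inr (x : Fin n → ℝ) (y : Fin m → ℝ) (σ : Fin m) :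
    c.assemble x y (c.e (Sum.inr σ)) = y σ := by simp [assemble]

theorem assemble_eta (z : Fin (n + m) → ℝ) :
    c.assemble (fun i => z (c.e (Sum.inl i))) (fun σ => z (c.e (Sum.inr σ))) = z := by
  funext A
  obtain ⟨a, rfl⟩ := c.e.surjective A
  cases a <;> simp

theorem ContDiffAt_assemble {E : Type*} [NormedAddCommGroup E] [NormedSpace ℝ E] {k : ℕ∞ω}
    {f : E → Fin n → ℝ} {g : E → Fin m → ℝ} {t : E} (hf : ContDiffAt ℝ k f t)
    (hg : ContDiffAt ℝ k g t) : ContDiffAt ℝ k (fun t => c.assemble (f t) (g t)) t := by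
  refine contDiffAt_pi.mpr fun A => ?_
  obtain ⟨a, rfl⟩ := c.e.surjective A
  cases a with
  | inl i => simpa using contDiffAt_pi.mp hf i
  | inr σ => simpa using contDiffAt_pi.mp hg σ

theorem pderiv_const_add_apply {n : ℕ} (x : ℝ) (i j : Fin n) (t : Fin n → ℝ) :
    pderiv j (fun t => x + t i) t = (1 : Matrix (Fin n) (Fin n) ℝ) i j := by
  have h1 : HasFDerivAt (fun t : Fin n → ℝ => t i)
      (ContinuousLinearMap.proj i : (Fin n → ℝ) →L[ℝ] ℝ) t := (ContinuousLinearMap.proj (R := ℝ)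
        (φ := fun _ : Fin n => ℝ) i).hasFDerivAt
  rw [pderiv, (h1.const_add x).fderiv]
  simp [Matrix.one_apply, Pi.single_apply]

/-- `γ` is the graph of `u` over a neighbourhood of `x₀`, parametrized by translation. -/
def IsGraph (c : AChart n m X) (x₀ : Fin n → ℝ) (u : Fin m → (Fin n → ℝ) → ℝ)
    (γ : ImmGerm n m X) : Prop :=
  c.loc γ =ᶠ[𝓝 0] fun t => c.assemble (x₀ + t) (fun σ => u σ t)

theorem IsGraph.xMat {x₀ : Fin n → ℝ} {u : Fin m → (Fin n → ℝ) → ℝ} {γ : ImmGerm n m X}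
    (h : c.IsGraph x₀ u γ) : ∀ᶠ t in 𝓝 0, c.xMat γ t = 1 := by
  filter_upwards [h.eventuallyEq_nhds] with t ht
  ext i j
  have e : c.xFun γ i =ᶠ[𝓝 t] fun t => x₀ i + t i := by
    filter_upwards [ht] with s hs
    have := congrFun hs (c.e (Sum.inl i))
    rw [assemble_inl] at this
    exact this
  rw [AChart.xMat, Matrix.of_apply, (pderiv_eventuallyEq e j).eq_of_nhds]
  exact pderiv_const_add_apply _ _ _ _

theorem IsGraph.detX {x₀ : Fin n → ℝ} {u : Fin m → (Fin n → ℝ) → ℝ} {γ : ImmGerm n m X}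
    (h : c.IsGraph x₀ u γ) : c.detX γ = 1 := by
  rw [AChart.detX, h.xMat.self_of_nhds, Matrix.det_one]

/-- Along a graph 𝐱 is the identity matrix, so the recurrence reduces to partial differentiation. -/
theorem IsGraph.yFun {x₀ : Fin n → ℝ} {u : Fin m → (Fin n → ℝ) → ℝ} {γ : ImmGerm n m X}
    (h : c.IsGraph x₀ u γ) (σ : Fin m) (l : List (Fin n)) :
    c.yFun γ σ l =ᶠ[𝓝 0] pderivs l (u σ) := by
  induction l with
  | nil =>
    filter_upwards [h] with t ht
    have := congrFun ht (c.e (Sum.inr σ))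
    rw [assemble_inr] at this
    exact this
  | cons i l ih =>
    filter_upwards [h.xMat, ih.eventuallyEq_nhds] with t hx ht
    have e : ∀ j, pderiv j (c.yFun γ σ l) t = pderiv j (pderivs l (u σ)) t :=
      fun j => (pderiv_eventuallyEq ht j).eq_of_nhds
    simp [AChart.yFun, hx, e, pderivs, Matrix.one_apply]

/-- The graph of `u` as an immersion germ. -/
theorem exists_isGraph (x₀ : Fin n → ℝ) {u : Fin m → (Fin n → ℝ) → ℝ}
    (hu : ∀ᶠ t in 𝓝 0, ∀ σ, ContDiffAt ℝ ∞ (u σ) t)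
    (h0 : c.assemble x₀ (fun σ => u σ 0) ∈ c.ψ.target) :
    ∃ γ : ImmGerm n m X, c.IsGraph x₀ u γ ∧
      ∀ t, γ.toFun t = c.ψ.symm (c.assemble (x₀ + t) (fun σ => u σ t)) := by
  let g : (Fin n → ℝ) → (Fin (n + m) → ℝ) := fun t => c.assemble (x₀ + t) (fun σ => u σ t)
  have hg : ∀ᶠ t in 𝓝 0, ContDiffAt ℝ ∞ g t := by
    filter_upwards [hu] with t ht
    exact ContDiffAt_assemble (contDiffAt_const.add contDiffAt_id) (contDiffAt_pi.mpr ht)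
  have h0' : g 0 ∈ c.ψ.target := by simpa [g] using h0
  have hm : ∀ᶠ t in 𝓝 0, g t ∈ c.ψ.target :=
    hg.self_of_nhds.continuousAt.eventually (c.ψ.open_target.mem_nhds h0')
  have hgr : (fun t => c.ψ (c.ψ.symm (g t))) =ᶠ[𝓝 0] g := by
    filter_upwards [hm] with t ht
    exact c.ψ.right_inv ht
  have hi : Function.Injective (fderiv ℝ (fun t => c.ψ (c.ψ.symm (g t))) 0) := by
    rw [hgr.fderiv_eq]
    intro v w hvw
    funext i
    have hd : DifferentiableAt ℝ g 0 := hg.self_of_nhds.differentiableAt (by simp)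
    have e : ∀ v, fderiv ℝ g 0 v (c.e (Sum.inl i)) = v i := by
      intro v
      have h1 := fderiv_pi (𝕜 := ℝ) (φ := fun k t => g t k) (x := 0)
        (fun k => differentiableAt_pi.mp hd k)
      rw [show g = fun t k => g t k from rfl, h1]
      have h2 : (fun t => g t (c.e (Sum.inl i))) = fun t => x₀ i + t i := by
        funext t; simp [g]
      have h3 : HasFDerivAt (fun t : Fin n → ℝ => t i)
        (ContinuousLinearMap.proj i : (Fin n → ℝ) →L[ℝ] ℝ) 0 := (ContinuousLinearMap.proj (R := ℝ)
          (φ := fun _ : Fin n => ℝ) i).hasFDerivAt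
      simp only [ContinuousLinearMap.coe_pi', h2, (h3.const_add (x₀ i)).fderiv]
      rfl
    rw [← e v, ← e w, hvw]
  let γ := ImmGerm.ofChart (fun t => c.ψ.symm (g t)) c.isChart (U := {t | ContDiffAt ℝ ∞ g t ∧
    g t ∈ c.ψ.target}) (hg.and hm) (fun t ht =>
      ((c.isChart.contMDiffAt_symm ht.2).comp t ht.1.contMDiffAt).contMDiffWithinAt)
    (c.ψ.map_target h0') hi
  exact ⟨γ, hgr, fun t => rfl⟩

/-- The polynomials with prescribed derivatives at `0`. -/
def poly {r : ℕ} (k : Coord n m r) (σ : Fin m) (t : Fin n → ℝ) : ℝ :=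
  ∑ I : MIdx n r, k.2 σ I * mono I.1 t

theorem contDiff_poly {r : ℕ} (k : Coord n m r) (σ : Fin m) : ContDiff ℝ ∞ (poly k σ) :=
  ContDiff.sum fun I _ => contDiff_const.mul (contDiff_mono I.1)

theorem pderivs_poly_zero {r : ℕ} (k : Coord n m r) (σ : Fin m) (l : List (Fin n))
    (hl : l.length ≤ r) :
    pderivs l (poly k σ) 0 = k.2 σ ⟨(l : Multiset (Fin n)), by simpa using hl⟩ := by
  have := congrFun (pderivs_sum Finset.univ (fun I : MIdx n r => k.2 σ I)
    (fun I => contDiff_mono I.1) l) 0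
  unfold poly
  rw [this]
  simp only [pderivs_mono_zero]
  rw [Finset.sum_eq_single ⟨(l : Multiset (Fin n)), by simpa using hl⟩]
  · simp
  · intro I _ hI
    rw [if_neg fun h => hI (Subtype.ext h.symm), mul_zero]
  · simp

/-- The point of `ℝ^N` below a point of the coordinate space. -/
def pt (c : AChart n m X) {r : ℕ} (k : Coord n m r) : Fin (n + m) → ℝ :=
  c.assemble k.1 (fun σ => k.2 σ ⟨0, Nat.zero_le r⟩)

theorem IsGraph.coordGerm {x₀ : Fin n → ℝ} {u : Fin m → (Fin n → ℝ) → ℝ} {γ : ImmGerm n m X}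
    (h : c.IsGraph x₀ u γ) (r : ℕ) :
    c.coordGerm r γ = (x₀, fun σ I => pderivs (sorted I.1) (u σ) 0) := by
  refine Prod.ext (funext fun i => ?_) (funext fun σ => funext fun I => ?_)
  · have := congrFun h.eq_of_nhds (c.e (Sum.inl i))
    rw [assemble_inl, Pi.add_apply, Pi.zero_apply, add_zero] at this
    exact this
  · exact (h.yFun σ _).eq_of_nhds

theorem IsGraph.coordGerm_poly {r : ℕ} {k : Coord n m r} {γ : ImmGerm n m X}
    (h : c.IsGraph k.1 (poly k) γ) : c.coordGerm r γ = k := by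
  rw [h.coordGerm]
  refine Prod.ext rfl (funext fun σ => funext fun I => ?_)
  dsimp only
  rw [pderivs_poly_zero k σ _ (by simpa [sorted] using I.2)]
  exact congrArg (k.2 σ) (Subtype.ext (Multiset.sort_eq I.1 _))

/-- The polynomial whose Taylor coefficients are the coordinates of k is a section through k, and
its graph is an immersion with det 𝐱 = 1. The only condition on k is therefore that its base point
lies in the range of the chart of X. -/
theorem IsGraph.pt_mem {r : ℕ} {k : Coord n m r} (hk : c.pt k ∈ c.ψ.target) :
    ∃ γ : ImmGerm n m X, c.IsGraph k.1 (poly k) γ ∧ c.InDom γ ∧ c.coordGerm r γ = k ∧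
      ∀ t, γ.toFun t = c.ψ.symm (c.assemble (k.1 + t) (fun σ => poly k σ t)) := by
  have h0 : c.assemble k.1 (fun σ => poly k σ 0) = c.pt k := by
    unfold pt
    congr 1
    funext σ
    exact pderivs_poly_zero k σ [] (Nat.zero_le r)
  obtain ⟨γ, hγ, hγ'⟩ := exists_isGraph (c := c) k.1 (u := poly k)
    (Filter.Eventually.of_forall fun t σ => (contDiff_poly k σ).contDiffAt) (h0 ▸ hk)
  refine ⟨γ, hγ, ⟨?_, ?_⟩, hγ.coordGerm_poly, hγ'⟩
  · rw [hγ', add_zero, h0]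
    exact c.ψ.map_target hk
  · rw [hγ.detX]; exact one_ne_zero

theorem pt_coordGerm (r : ℕ) (γ : ImmGerm n m X) : c.pt (c.coordGerm r γ) = c.loc γ 0 := by
  rw [← c.assemble_eta (c.loc γ 0)]
  unfold pt
  congr 1
  funext σ
  simp [AChart.coordGerm, sorted, AChart.yFun, loc]

theorem mem_image_iff_pt {r : ℕ} (hr : 1 ≤ r) {k : Coord n m r} :
    k ∈ c.image r ↔ c.pt k ∈ c.ψ.target := by
  rw [mem_image_iff hr]
  constructor
  · rintro ⟨γ, hγ, rfl⟩
    rw [pt_coordGerm]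
    exact c.ψ.map_source hγ.1
  · intro hk
    obtain ⟨γ, -, h1, h2, -⟩ := IsGraph.pt_mem hk
    exact ⟨γ, h1, h2⟩

end AChart
end Points

/-! ### Reduction of immersions to graphs; injectivity of the adapted charts -/

section Points

variable {n m : ℕ} {X : Type*} [TopologicalSpace X] [ChartedSpace (Fin (n + m) → ℝ) X]

namespace AChart

variable {c : AChart n m X}

/-- Every immersion in the domain of the chart can be reparametrized as a graph. -/
theorem exists_comp_isGraph {γ : ImmGerm n m X} (h : c.InDom γ) :
    ∃ (α : Reparam n) (δ : ImmGerm n m X) (u : Fin m → (Fin n → ℝ) → ℝ), IsComp γ α δ ∧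
      (∀ᶠ t in 𝓝 0, ∀ σ, ContDiffAt ℝ ∞ (u σ) t) ∧ c.IsGraph (fun i => c.xFun γ i 0) u δ := by
  obtain ⟨V, h0, hV⟩ := h.exists_good
  set x₀ : Fin n → ℝ := fun i => c.xFun γ i 0
  let f : (Fin n → ℝ) → (Fin n → ℝ) := fun t i => c.xFun γ i t - x₀ i
  have hf : ∀ t ∈ V, ContDiffAt ℝ ∞ f t := fun t ht => contDiffAt_pi.mpr fun i =>
    ((contDiffOn_xFun hV.smooth i).contDiffAt (V.isOpen.mem_nhds ht)).sub contDiffAt_const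
  have hdet : ∀ t ∈ V, (fderiv ℝ f t).det ≠ 0 := by
    intro t ht
    have hm : (fderiv ℝ f t).det = (c.xMat γ t).det := by
      rw [ContinuousLinearMap.det, ← LinearMap.det_toMatrix']
      congr 1
      ext i j
      have hd := (hf t ht).differentiableAt (by simp)
      have h1 := fderiv_pi (𝕜 := ℝ) (φ := fun k t => f t k) (x := t)
        (fun k => differentiableAt_pi.mp hd k)
      rw [LinearMap.toMatrix'_apply]
      change fderiv ℝ (fun t k => f t k) t _ i = _
      rw [h1]
      simp only [f, ContinuousLinearMap.coe_pi', fderiv_sub_const]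
      rfl
    rw [hm]; exact hV.det_ne_zero t ht
  let A : ∀ t ∈ V, (Fin n → ℝ) ≃L[ℝ] (Fin n → ℝ) := fun t ht =>
    (fderiv ℝ f t).toContinuousLinearEquivOfDetNeZero (hdet t ht)
  have hA : ∀ t (ht : t ∈ V), HasFDerivAt f (A t ht : (Fin n → ℝ) →L[ℝ] (Fin n → ℝ)) t := by
    intro t ht
    have := ((hf t ht).differentiableAt (by simp)).hasFDerivAt
    rwa [← ContinuousLinearMap.coe_toContinuousLinearEquivOfDetNeZero _ (hdet t ht)] at this
  -- The inverse function theorem for t ↦ x(γ(t)) − x₀. Its local inverse is the reparametrization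
  -- that makes x₀ + t the x-coordinates.
  let e := (hf 0 h0).toOpenPartialHomeomorph f (hA 0 h0) (by simp)
  have he : (e : (Fin n → ℝ) → (Fin n → ℝ)) = f := rfl
  have h0s : (0 : Fin n → ℝ) ∈ e.source :=
    (hf 0 h0).mem_toOpenPartialHomeomorph_source (hA 0 h0) (by simp)
  have hf0 : f 0 = 0 := by funext i; simp [f, x₀]
  have h0t : (0 : Fin n → ℝ) ∈ e.target := by
    have := e.map_source h0s
    rwa [he, hf0] at this
  have hs0 : e.symm 0 = 0 := by
    have := e.left_inv h0s
    rwa [he, hf0] at this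
  have hW : {t | t ∈ e.target ∧ e.symm t ∈ V} ∈ 𝓝 (0 : Fin n → ℝ) := by
    refine Filter.inter_mem (e.open_target.mem_nhds h0t) ?_
    exact (e.continuousAt_symm h0t).preimage_mem_nhds (by rw [hs0]; exact V.isOpen.mem_nhds h0)
  have hα : ∀ t, t ∈ e.target ∧ e.symm t ∈ V → ContDiffAt ℝ ∞ e.symm t := fun t ht =>
    e.contDiffAt_symm ht.1 (hA _ ht.2) (hf _ ht.2)
  have hinv : ∀ t ∈ e.target, f (e.symm t) = t := fun t ht => e.right_inv ht
  let α : Reparam n :=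
    { toFun := e.symm
      smooth := ⟨_, hW, fun t ht => (hα t ht).contDiffWithinAt⟩
      map_zero := hs0
      det_ne_zero := by
        intro hz
        have h1 : fderiv ℝ (fun t => f (e.symm t)) 0 = ContinuousLinearMap.id ℝ _ := by
          have : (fun t => f (e.symm t)) =ᶠ[𝓝 0] id := by
            filter_upwards [e.open_target.mem_nhds h0t] with t ht
            exact hinv t ht
          rw [this.fderiv_eq, fderiv_id]
        rw [fderiv_fun_comp 0 (by rw [hs0]; exact (hf 0 h0).differentiableAt (by simp))
          ((hα 0 ⟨h0t, by rw [hs0]; exact h0⟩).differentiableAt (by simp))] at h1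
        have h2 := congrArg (fun L : (Fin n → ℝ) →L[ℝ] (Fin n → ℝ) => LinearMap.det L.toLinearMap) h1
        simp only [ContinuousLinearMap.toLinearMap_comp, LinearMap.det_comp,
          show (ContinuousLinearMap.id ℝ (Fin n → ℝ)).toLinearMap = LinearMap.id from rfl,
          LinearMap.det_id] at h2
        have hz' : LinearMap.det (fderiv ℝ e.symm 0).toLinearMap = 0 := hz
        rw [hz', mul_zero] at h2
        exact zero_ne_one h2 }
  let u : Fin m → (Fin n → ℝ) → ℝ := fun σ t => c.loc γ (e.symm t) (c.e (Sum.inr σ))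
  have hu : ∀ᶠ t in 𝓝 0, ∀ σ, ContDiffAt ℝ ∞ (u σ) t := by
    filter_upwards [hW] with t ht σ
    exact contDiffAt_pi.mp ((hV.smooth.contDiffAt (V.isOpen.mem_nhds ht.2)).comp t (hα t ht)) _
  have hloc : ∀ t ∈ e.target, c.assemble (x₀ + t) (fun σ => u σ t) = c.loc γ (e.symm t) := by
    intro t ht
    rw [← c.assemble_eta (c.loc γ (e.symm t))]
    congr 1
    have := hinv t ht
    funext i
    have hi := congrFun this i
    simp only [f] at hi
    rw [Pi.add_apply, ← hi]
    change x₀ i + (c.xFun γ i (e.symm t) - x₀ i) = c.xFun γ i (e.symm t)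
    ring
  have hbase : c.assemble x₀ (fun σ => u σ 0) ∈ c.ψ.target := by
    have := hloc 0 h0t
    rw [add_zero, hs0] at this
    rw [this]
    exact c.ψ.map_source h.1
  obtain ⟨δ, hδ, hδ'⟩ := exists_isGraph (c := c) x₀ hu hbase
  refine ⟨α, δ, u, ?_, hu, hδ⟩
  filter_upwards [hW] with t ht
  rw [hδ', hloc t ht.1]
  exact c.ψ.left_inv (hV.mem_source _ ht.2)

/-- A reparametrization of an immersion has the jet of the polynomial graph with its coordinates. -/
theorem exists_comp_jet_eq {γ δ₀ : ImmGerm n m X} (h : c.InDom γ) (r : ℕ)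
    (hδ₀ : c.IsGraph (c.coordGerm r γ).1 (poly (c.coordGerm r γ)) δ₀) (hδ₀s : c.InDom δ₀) :
    ∃ (α : Reparam n) (δ : ImmGerm n m X), IsComp γ α δ ∧ c.detX δ = 1 ∧
      jet r δ = jet r δ₀ := by
  obtain ⟨α, δ, u, hc, hu, hδ⟩ := exists_comp_isGraph h
  refine ⟨α, δ, hc, hδ.detX, Quotient.sound (s := jetSetoid n m X r) ?_⟩
  have hdδ : c.InDom δ := (inDom_comp hc).mpr h
  obtain ⟨V, h0, hV⟩ := hdδ.exists_good
  have hco : c.coordGerm r δ = c.coordGerm r γ := coordGerm_comp hc h r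
  have h1 : ∀ σ, Agree r (u σ) (poly (c.coordGerm r γ) σ) := by
    intro σ
    obtain ⟨W, hW, hWo, hW0⟩ := mem_nhds_iff.mp hu
    rw [agree_iff_pderivs hWo hW0 (fun t ht => (hW ht σ).contDiffWithinAt)
      (contDiff_poly _ σ).contDiffOn]
    intro l hl
    rw [← (hδ.yFun σ l).eq_of_nhds, pderivs_poly_zero _ _ _ hl, ← hco]
    refine hV.yFun_perm σ ?_ h0
    rw [← Multiset.coe_eq_coe, sorted, Multiset.sort_eq]
  have h2 : Agree r (c.loc δ) (c.loc δ₀) := by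
    refine Agree.pi (contDiffAt_loc hdδ.1) (contDiffAt_loc hδ₀s.1) fun A => ?_
    have ha : ∀ᶠ t in 𝓝 0, c.loc δ t A = c.assemble ((c.coordGerm r γ).1 + t) (fun σ => u σ t) A := by
      filter_upwards [hδ] with t ht; rw [ht]; rfl
    have hb : ∀ᶠ t in 𝓝 0, c.loc δ₀ t A = c.assemble ((c.coordGerm r γ).1 + t)
        (fun σ => poly (c.coordGerm r γ) σ t) A := by
      filter_upwards [hδ₀] with t ht; rw [ht]
    obtain ⟨a, rfl⟩ := c.e.surjective A
    cases a with
    | inl i =>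
      simp only [assemble_inl] at ha hb
      exact Agree.congr (f := fun t => ((c.coordGerm r γ).1 + t) i)
        (g := fun t => ((c.coordGerm r γ).1 + t) i) (fun _ _ => rfl) (ha.mono fun _ h => h.symm)
        (hb.mono fun _ h => h.symm)
    | inr σ =>
      simp only [assemble_inr] at ha hb
      exact (h1 σ).congr (ha.mono fun _ h => h.symm) (hb.mono fun _ h => h.symm)
  refine jetEq_of_agree hdδ.1 ?_ h2
  have := h2.apply_zero
  rw [← c.ψ.left_inv hdδ.1, ← c.ψ.left_inv hδ₀s.1]
  exact congrArg c.ψ.symm this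

/-- Both contact elements are represented by the r-jet of one and the same polynomial graph, the one
determined by the common coordinates. -/
theorem rho_jet_eq_of_coordGerm_eq {r : ℕ} {γ δ : ImmGerm n m X} (hγ : c.InDom γ)
    (hδ : c.InDom δ) (h : c.coordGerm r γ = c.coordGerm r δ) :
    rho (jet r γ) = rho (jet r δ) := by
  have hk : c.pt (c.coordGerm r γ) ∈ c.ψ.target := by
    rw [pt_coordGerm]; exact c.ψ.map_source hγ.1
  obtain ⟨δ₀, hg, hd, -, -⟩ := IsGraph.pt_mem hk
  obtain ⟨α, γ', hc, -, hj⟩ := exists_comp_jet_eq hγ r hg hd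
  obtain ⟨α', δ', hc', -, hj'⟩ := exists_comp_jet_eq hδ r (h ▸ hg) hd
  have h1 : rho (jet r γ) = rho (jet r γ') := Quot.sound ⟨γ, γ', α, hc, rfl, rfl⟩
  have h2 : rho (jet r δ) = rho (jet r δ') := Quot.sound ⟨δ, δ', α', hc', rfl, rfl⟩
  rw [h1, h2, hj, hj']

theorem coord_injOn {r : ℕ} (hr : 1 ≤ r) : Set.InjOn (c.coord r) (c.dom r) := by
  intro p hp q hq h
  rw [← p.rho_jet_rep, ← q.rho_jet_rep]
  exact rho_jet_eq_of_coordGerm_eq (inDom_rep hr hp) (inDom_rep hr hq) h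

theorem change_coord {c' : AChart n m X} {r : ℕ} (hr : 1 ≤ r) {p : Grassmann n m X r}
    (hp : p ∈ c.dom r) : c.change c' r (c.coord r p) = c'.coord r p := by
  have h : ∃ q ∈ c.dom r, c.coord r q = c.coord r p := ⟨p, hp, rfl⟩
  rw [change, dif_pos h]
  congr 1
  exact coord_injOn hr h.choose_spec.1 hp h.choose_spec.2

theorem change_coordGerm {c' : AChart n m X} {r : ℕ} (hr : 1 ≤ r) {γ : ImmGerm n m X}
    (hγ : c.InDom γ) (hγ' : c'.InDom γ) :
    c.change c' r (c.coordGerm r γ) = c'.coordGerm r γ := by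
  rw [← coord_rho_jet hr hγ, change_coord hr ((mem_dom_iff hr).mpr hγ), coord_rho_jet hr hγ']

theorem mem_overlap_iff {c' : AChart n m X} {r : ℕ} (hr : 1 ≤ r) {k : Coord n m r} :
    k ∈ c.overlap c' r ↔ ∃ γ, c.InDom γ ∧ c'.InDom γ ∧ c.coordGerm r γ = k := by
  constructor
  · rintro ⟨p, ⟨hp, hp'⟩, rfl⟩
    exact ⟨p.rep, inDom_rep hr hp, inDom_rep hr hp', rfl⟩
  · rintro ⟨γ, hγ, hγ', rfl⟩
    exact ⟨_, ⟨(mem_dom_iff hr).mpr hγ, (mem_dom_iff hr).mpr hγ'⟩, coord_rho_jet hr hγ⟩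

end AChart
end Points

/-! ## Calculus on the coordinate space -/

theorem contDiffAt_matrix_det {E ι : Type*} [NormedAddCommGroup E] [NormedSpace ℝ E] [Fintype ι]
    [DecidableEq ι] {A : E → Matrix ι ι ℝ} {x : E}
    (hA : ∀ i j, ContDiffAt ℝ ∞ (fun y => A y i j) x) :
    ContDiffAt ℝ ∞ (fun y => (A y).det) x := by
  simp only [Matrix.det_apply]
  exact ContDiffAt.sum fun σ _ => ContDiffAt.const_smul _ (contDiffAt_prod fun i _ => hA _ _)

theorem contDiffAt_matrix_inv {E ι : Type*} [NormedAddCommGroup E] [NormedSpace ℝ E] [Fintype ι]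
    [DecidableEq ι] {A : E → Matrix ι ι ℝ} {x : E}
    (hA : ∀ i j, ContDiffAt ℝ ∞ (fun y => A y i j) x) (h0 : (A x).det ≠ 0) (i j : ι) :
    ContDiffAt ℝ ∞ (fun y => (A y)⁻¹ i j) x := by
  have e : (fun y => (A y)⁻¹ i j) = fun y => (A y).det⁻¹ * (A y).adjugate i j := by
    funext y
    simp [Matrix.inv_def, Ring.inverse_eq_inv']
  rw [e]
  refine ((contDiffAt_matrix_det hA).inv h0).mul ?_
  simp only [Matrix.adjugate_apply]
  refine contDiffAt_matrix_det fun k l => ?_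
  by_cases hk : k = j
  · subst hk; simp only [Matrix.updateRow_self]; exact contDiffAt_const
  · simp only [Matrix.updateRow_ne hk]; exact hA k l

section CoordCalculus

variable {n m r : ℕ}

theorem dy_apply (σ : Fin m) {I : Multiset (Fin n)} (h : I.card ≤ r) (k : Coord n m r) :
    dy σ I k = k.2 σ ⟨I, h⟩ := by simp [dy, h]

theorem dy_of_lt (σ : Fin m) {I : Multiset (Fin n)} (h : r < I.card) :
    (dy σ I : Coord n m r →ₗ[ℝ] ℝ) = 0 := by simp [dy, h.not_ge]

theorem dx_apply (i : Fin n) (k : Coord n m r) : dx i k = k.1 i := rfl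

theorem ey_fst (σ : Fin m) (I : Multiset (Fin n)) : (ey σ I : Coord n m r).1 = 0 := by
  unfold ey; split_ifs <;> rfl

theorem ey_snd (σ τ : Fin m) {I : Multiset (Fin n)} (J : MIdx n r) (hI : I.card ≤ r) :
    (ey σ I : Coord n m r).2 τ J = if τ = σ ∧ J.1 = I then 1 else 0 := by
  simp only [ey, dif_pos hI]
  by_cases h : τ = σ
  · subst h
    simp [Pi.single_apply, Subtype.ext_iff]
  · simp [h]

theorem dy_ey (σ τ : Fin m) {I J : Multiset (Fin n)} (hI : I.card ≤ r) :
    dy τ J (ey σ I : Coord n m r) = if τ = σ ∧ J = I then 1 else 0 := by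
  by_cases hJ : J.card ≤ r
  · rw [dy_apply _ hJ, ey_snd _ _ _ hI]
  · rw [dy_of_lt _ (not_le.mp hJ), if_neg]
    · rfl
    · rintro ⟨-, rfl⟩; exact hJ hI

theorem eq_sum_ey (w : Fin m → MIdx n r → ℝ) :
    ((0, w) : Coord n m r) = ∑ σ, ∑ I : MIdx n r, w σ I • (ey σ I.1 : Coord n m r) := by
  refine Prod.ext ?_ (funext fun τ => funext fun J => ?_)
  · simp [Prod.fst_sum, ey_fst]
  · simp only [Prod.snd_sum, Prod.smul_snd, Finset.sum_apply, Pi.smul_apply, smul_eq_mul]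
    simp only [fun (σ : Fin m) (I : MIdx n r) => ey_snd σ τ J I.2]
    rw [Finset.sum_eq_single τ, Finset.sum_eq_single J]
    · simp
    · intro I _ hI
      rw [if_neg fun h => hI (Subtype.ext h.2.symm), mul_zero]
    · simp
    · intro σ _ hσ
      exact Finset.sum_eq_zero fun I _ => by rw [if_neg fun h => hσ h.1.symm, mul_zero]
    · simp

theorem eq_sum_totalVec (k v : Coord n m r) :
    v = ∑ i, v.1 i • totalVec i k + ∑ σ, ∑ I : MIdx n r,
      (v.2 σ I - ∑ i, v.1 i * (if I.1.card < r then dy σ (i ::ₘ I.1) k else 0)) •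
        (ey σ I.1 : Coord n m r) := by
  rw [← eq_sum_ey]
  refine Prod.ext ?_ (funext fun τ => funext fun J => ?_)
  · funext j
    simp [Prod.fst_sum, totalVec, Pi.single_apply]
  · simp [Prod.snd_sum, totalVec]

variable {F : Type*} [NormedAddCommGroup F] [NormedSpace ℝ F]

/-- `f` is of order at most `q` on `U`. -/
def OrderLE (q : ℕ) (U : Set (Coord n m r)) (f : Coord n m r → F) : Prop :=
  ∀ k ∈ U, ∀ (σ : Fin m) (I : Multiset (Fin n)), q < I.card → fderiv ℝ f k (ey σ I) = 0

theorem OrderLE.mono {q q' : ℕ} (h : q ≤ q') {U : Set (Coord n m r)} {f : Coord n m r → F}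
    (hf : OrderLE q U f) : OrderLE q' U f := fun k hk σ I hI => hf k hk σ I (h.trans_lt hI)

theorem OrderLE.congr {q : ℕ} {U : Set (Coord n m r)} (hU : IsOpen U) {f g : Coord n m r → F}
    (hf : OrderLE q U f) (h : Set.EqOn f g U) : OrderLE q U g := fun k hk σ I hI => by
  rw [← (h.eventuallyEq_of_mem (hU.mem_nhds hk)).fderiv_eq, hf k hk σ I hI]

theorem OrderLE.comp {G : Type*} [NormedAddCommGroup G] [NormedSpace ℝ G] {q : ℕ}
    {U : Set (Coord n m r)} {f : Coord n m r → F} (hf : OrderLE q U f)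
    (hd : ∀ k ∈ U, DifferentiableAt ℝ f k) {φ : F → G}
    (hφ : ∀ k ∈ U, DifferentiableAt ℝ φ (f k)) : OrderLE q U (fun k => φ (f k)) :=
  fun k hk σ I hI => by
    rw [fderiv_fun_comp k (hφ k hk) (hd k hk), ContinuousLinearMap.comp_apply, hf k hk σ I hI,
      map_zero]

theorem OrderLE.pi {ι : Type*} [Fintype ι] {q : ℕ} {U : Set (Coord n m r)}
    {f : ι → Coord n m r → F} (hf : ∀ i, OrderLE q U (f i))
    (hd : ∀ i, ∀ k ∈ U, DifferentiableAt ℝ (f i) k) :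
    OrderLE q U (fun k i => f i k) := fun k hk σ I hI => by
  rw [fderiv_pi fun i => hd i k hk]
  funext i
  exact hf i k hk σ I hI

theorem OrderLE.mul {q : ℕ} {U : Set (Coord n m r)} {f g : Coord n m r → ℝ}
    (hf : OrderLE q U f) (hg : OrderLE q U g) (hfd : ∀ k ∈ U, DifferentiableAt ℝ f k)
    (hgd : ∀ k ∈ U, DifferentiableAt ℝ g k) : OrderLE q U (fun k => f k * g k) :=
  fun k hk σ I hI => by
    rw [fderiv_fun_mul (hfd k hk) (hgd k hk)]
    simp [hf k hk σ I hI, hg k hk σ I hI]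

theorem OrderLE.sum {ι : Type*} {s : Finset ι} {q : ℕ} {U : Set (Coord n m r)}
    {f : ι → Coord n m r → ℝ} (hf : ∀ i, OrderLE q U (f i))
    (hd : ∀ i, ∀ k ∈ U, DifferentiableAt ℝ (f i) k) :
    OrderLE q U (fun k => ∑ i ∈ s, f i k) := fun k hk σ I hI => by
  rw [fderiv_fun_sum fun i _ => hd i k hk, sum_apply]
  exact Finset.sum_eq_zero fun i _ => hf i k hk σ I hI

/-- The linear part of `totalVec`. -/
def totalLin (i : Fin n) : Coord n m r →L[ℝ] Coord n m r :=
  LinearMap.toContinuousLinearMap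
    { toFun := fun k => (0, fun σ J => if J.1.card < r then dy σ (i ::ₘ J.1) k else 0)
      map_add' := fun k k' => by
        refine Prod.ext (by simp) (funext fun σ => funext fun J => ?_)
        by_cases h : J.1.card < r <;> simp [h]
      map_smul' := fun a k => by
        refine Prod.ext (by simp) (funext fun σ => funext fun J => ?_)
        by_cases h : J.1.card < r <;> simp [h] }

theorem totalVec_eq (i : Fin n) (k : Coord n m r) :
    totalVec i k = (Pi.single i 1, 0) + totalLin i k := by
  refine Prod.ext ?_ (funext fun σ => funext fun J => ?_)
  · simp [totalVec, totalLin]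
  · simp [totalVec, totalLin]

theorem contDiff_totalVec (i : Fin n) :
    ContDiff ℝ ∞ (totalVec i : Coord n m r → Coord n m r) := by
  rw [show (totalVec i : Coord n m r → Coord n m r) = fun k => (Pi.single i 1, 0) + totalLin i k
    from funext (totalVec_eq i)]
  exact contDiff_const.add (totalLin i).contDiff

theorem fderiv_totalVec (i : Fin n) (k : Coord n m r) : fderiv ℝ (totalVec i) k = totalLin i := by
  rw [show (totalVec i : Coord n m r → Coord n m r) = fun k => (Pi.single i 1, 0) + totalLin i k
    from funext (totalVec_eq i)]
  rw [fderiv_const_add, ContinuousLinearMap.fderiv]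

/-- This is the commutator of ∂/∂y^σ_I with D_i: it is zero or ∂/∂y^σ of I with one i removed, which
explains why a total derivative raises the order by one. -/
theorem totalLin_ey (i : Fin n) (σ : Fin m) (I : Multiset (Fin n)) :
    totalLin i (ey σ I : Coord n m r) = 0 ∨
      (i ∈ I ∧ totalLin i (ey σ I : Coord n m r) = ey σ (I.erase i)) := by
  by_cases hI : I.card ≤ r
  · have e : ∀ τ (J : MIdx n r), (totalLin i (ey σ I : Coord n m r)).2 τ J
        = if J.1.card < r then (if τ = σ ∧ i ::ₘ J.1 = I then 1 else 0) else 0 := by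
      intro τ J
      rw [← dy_ey σ τ hI]; rfl
    by_cases hi : i ∈ I
    · right
      refine ⟨hi, Prod.ext ?_ (funext fun τ => funext fun J => ?_)⟩
      · rw [ey_fst]; rfl
      · have hc : (I.erase i).card + 1 = I.card := by
          rw [Multiset.card_erase_of_mem hi]
          show I.card.pred + 1 = _
          have := Multiset.card_pos_iff_exists_mem.mpr ⟨i, hi⟩
          exact Nat.succ_pred_eq_of_pos this
        rw [e, ey_snd _ _ _ (by omega)]
        have hJ : i ::ₘ J.1 = I ↔ J.1 = I.erase i := by
          constructor
          · intro h; rw [← h, Multiset.erase_cons_head]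
          · intro h; rw [h, Multiset.cons_erase hi]
        simp only [hJ]
        by_cases h : τ = σ ∧ J.1 = I.erase i
        · rw [if_pos h, if_pos (by rw [h.2]; omega)]
        · rw [if_neg h, ite_self]
    · left
      refine Prod.ext rfl (funext fun τ => funext fun J => ?_)
      have hn : ¬(τ = σ ∧ i ::ₘ J.1 = I) := fun h => hi (h.2 ▸ Multiset.mem_cons_self _ _)
      rw [e, if_neg hn, ite_self]
      rfl
  · left
    simp [ey, hI]

theorem contDiffOn_D {U : Set (Coord n m r)} (hU : IsOpen U) {f : Coord n m r → ℝ}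
    (hf : ContDiffOn ℝ ∞ f U) (i : Fin n) : ContDiffOn ℝ ∞ (D i f) U :=
  contDiffOn_fderiv_apply hU hf (contDiff_totalVec i).contDiffOn

theorem OrderLE.D {q : ℕ} {U : Set (Coord n m r)} (hU : IsOpen U) {f : Coord n m r → ℝ}
    (hf : ContDiffOn ℝ ∞ f U) (h : OrderLE q U f) (i : Fin n) :
    OrderLE (q + 1) U (D i f) := by
  intro k hk σ I hI
  have hfk := hf.contDiffAt (hU.mem_nhds hk)
  have hd : DifferentiableAt ℝ (fderiv ℝ f) k :=
    (hfk.fderiv_right (m := ∞) (by simp)).differentiableAt (by simp)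
  have hw : DifferentiableAt ℝ (totalVec i : Coord n m r → Coord n m r) k :=
    (contDiff_totalVec i).contDiffAt.differentiableAt (by simp)
  have hD : fderiv ℝ (HelmholtzSonin.D i f) k (ey σ I)
      = fderiv ℝ (fderiv ℝ f) k (ey σ I) (totalVec i k)
        + fderiv ℝ f k (totalLin i (ey σ I)) := by
    unfold HelmholtzSonin.D
    rw [fderiv_clm_apply hd hw, fderiv_totalVec]
    simp [add_comm]
  -- By symmetry of the second derivative, ∂/∂y^σ_I can act on f first, and there it gives zero on a
  -- whole neighbourhood of k.
  have h1 : fderiv ℝ (fderiv ℝ f) k (ey σ I) (totalVec i k) = 0 := by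
    have hs := fderiv_fderiv_comm hfk (totalVec i k) (ey σ I)
    have e : ∀ v w : Coord n m r, fderiv ℝ (fun y => fderiv ℝ f y v) k w
        = fderiv ℝ (fderiv ℝ f) k w v := by
      intro v w
      rw [fderiv_clm_apply hd (differentiableAt_const v)]
      simp
    rw [← e, hs]
    have hz : (fun y => fderiv ℝ f y (ey σ I)) =ᶠ[𝓝 k] fun _ => 0 := by
      filter_upwards [hU.mem_nhds hk] with y hy
      exact h y hy σ I (by omega)
    rw [hz.fderiv_eq]
    simp
  rw [hD, h1, zero_add]
  rcases totalLin_ey (r := r) i σ I with h0 | ⟨hi, h0⟩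
  · rw [h0, map_zero]
  · rw [h0]
    refine h k hk σ _ ?_
    rw [Multiset.card_erase_of_mem hi]
    exact Nat.lt_pred_iff.mpr hI

/-- The derivative of a function of order `q < r` along a vector tangent to a holonomic section. -/
theorem fderiv_eq_sum_D {q : ℕ} (hq : q < r) {f : Coord n m r → ℝ} {k v : Coord n m r}
    (hf : ∀ (σ : Fin m) (I : Multiset (Fin n)), q < I.card → fderiv ℝ f k (ey σ I) = 0)
    (hv : ∀ (σ : Fin m) (I : MIdx n r), I.1.card ≤ q →
      v.2 σ I = ∑ i, v.1 i * dy σ (i ::ₘ I.1) k) :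
    fderiv ℝ f k v = ∑ i, v.1 i * D i f k := by
  conv_lhs => rw [eq_sum_totalVec k v]
  simp only [map_add, map_sum, map_smul, smul_eq_mul]
  refine add_eq_left.mpr ?_
  · refine Finset.sum_eq_zero fun σ _ => Finset.sum_eq_zero fun I _ => ?_
    by_cases hI : I.1.card ≤ q
    · rw [hv σ I hI]; simp [hI.trans_lt hq]
    · rw [hf σ _ (not_le.mp hI), mul_zero]

end CoordCalculus

/-! ## The chart change in coordinates -/

section Change

variable {n m : ℕ} {X : Type*} [TopologicalSpace X] [ChartedSpace (Fin (n + m) → ℝ) X]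

namespace AChart

variable (c c' : AChart n m X) {r : ℕ}

/-- The coordinates of the base point in the second chart. -/
def locChange (k : Coord n m r) : Fin (n + m) → ℝ := c'.ψ (c.ψ.symm (c.pt k))

/-- `x̄ʲ` by an explicit formula. -/
def xExp (j : Fin n) (k : Coord n m r) : ℝ := c.locChange c' k (c'.e (Sum.inl j))

/-- `D_p x̄ˡ` by an explicit formula. -/
def qExp (k : Coord n m r) : Matrix (Fin n) (Fin n) ℝ := Matrix.of fun l p => D p (c.xExp c' l) k

/-- `ȳ^ν_I` by the recurrence `ȳ^ν_{iI} = Pʲ_i D_j ȳ^ν_I`. -/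
def yExp (ν : Fin m) : List (Fin n) → Coord n m r → ℝ
  | [] => fun k => c.locChange c' k (c'.e (Sum.inr ν))
  | i :: l => fun k => ∑ j, (c.qExp c' k)⁻¹ j i * D j (yExp ν l) k

variable (r) in
/-- Points over the overlap of the charts of `X`. -/
def baseOverlap : Set (Coord n m r) := {k | c.pt k ∈ c.ψ.target ∧ c.ψ.symm (c.pt k) ∈ c'.ψ.source}

variable {c c'}

theorem contDiff_pt : ContDiff ℝ ∞ (c.pt : Coord n m r → _) := by
  refine contDiff_iff_contDiffAt.mpr fun k => ContDiffAt_assemble contDiffAt_fst ?_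
  refine contDiffAt_pi.mpr fun σ => ?_
  have h : ContDiff ℝ ∞ (fun k : Coord n m r => k.2 σ) := (contDiff_apply ℝ _ σ).comp contDiff_snd
  exact ((contDiff_apply ℝ ℝ _).comp h).contDiffAt

theorem isOpen_baseOverlap : IsOpen (c.baseOverlap c' r) := by
  have h1 : IsOpen (c.ψ.target ∩ c.ψ.symm ⁻¹' c'.ψ.source) :=
    c.ψ.symm.isOpen_inter_preimage c'.ψ.open_source
  exact h1.preimage contDiff_pt.continuous

theorem contDiffOn_locChange : ContDiffOn ℝ ∞ (c.locChange c' : Coord n m r → _)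
    (c.baseOverlap c' r) := fun k hk =>
  ((c.isChart.contDiffAt_transition c'.isChart hk.1 hk.2).comp k
    contDiff_pt.contDiffAt).contDiffWithinAt

theorem contDiffOn_xExp (j : Fin n) :
    ContDiffOn ℝ ∞ (c.xExp c' j : Coord n m r → ℝ) (c.baseOverlap c' r) :=
  contDiffOn_pi.mp contDiffOn_locChange _

theorem orderLE_locChange (A : Fin (n + m)) :
    OrderLE 0 (c.baseOverlap c' r) (fun k : Coord n m r => c.locChange c' k A) := by
  intro k hk σ I hI
  by_cases hIr : I.card ≤ r
  swap
  · rw [ey, dif_neg hIr, map_zero]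
  have hd : DifferentiableAt ℝ (fun k : Coord n m r => c.locChange c' k A) k :=
    ((contDiffOn_pi.mp contDiffOn_locChange A).contDiffAt
      (isOpen_baseOverlap.mem_nhds hk)).differentiableAt (by simp)
  rw [← hd.lineDeriv_eq_fderiv, lineDeriv]
  have hc : ∀ a : ℝ, c.pt (k + a • ey σ I) = c.pt k := by
    intro a
    unfold pt
    congr 1
    · simp [ey_fst]
    · funext τ
      simp only [Prod.snd_add, Prod.smul_snd, Pi.add_apply, Pi.smul_apply, smul_eq_mul]
      rw [ey_snd _ _ _ hIr, if_neg, mul_zero, add_zero]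
      rintro ⟨-, h⟩
      rw [← h] at hI
      simp at hI
  simp only [locChange, hc]
  simp

theorem contDiffOn_qExp (l p : Fin n) :
    ContDiffOn ℝ ∞ (fun k : Coord n m r => c.qExp c' k l p) (c.baseOverlap c' r) :=
  contDiffOn_D isOpen_baseOverlap (contDiffOn_xExp l) p

theorem orderLE_qExp (l p : Fin n) :
    OrderLE 1 (c.baseOverlap c' r) (fun k : Coord n m r => c.qExp c' k l p) :=
  OrderLE.D isOpen_baseOverlap (contDiffOn_xExp l) (orderLE_locChange _) p

variable (c c' r) in
/-- The overlap of the charts, by an explicit formula. -/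
def overlapExp : Set (Coord n m r) := {k ∈ c.baseOverlap c' r | (c.qExp c' k).det ≠ 0}

theorem contDiffOn_det_qExp :
    ContDiffOn ℝ ∞ (fun k : Coord n m r => (c.qExp c' k).det) (c.baseOverlap c' r) := fun _ hk =>
  (contDiffAt_matrix_det fun i j =>
    (contDiffOn_qExp i j).contDiffAt (isOpen_baseOverlap.mem_nhds hk)).contDiffWithinAt

theorem isOpen_overlapExp : IsOpen (c.overlapExp c' r) :=
  contDiffOn_det_qExp.continuousOn.isOpen_inter_preimage isOpen_baseOverlap isOpen_compl_singleton

theorem contDiffOn_qExp_inv (i j : Fin n) :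
    ContDiffOn ℝ ∞ (fun k : Coord n m r => (c.qExp c' k)⁻¹ i j) (c.overlapExp c' r) := fun _ hk =>
  (contDiffAt_matrix_inv (fun i j => (contDiffOn_qExp i j).contDiffAt
    (isOpen_baseOverlap.mem_nhds hk.1)) hk.2 i j).contDiffWithinAt

theorem orderLE_qExp_inv (i j : Fin n) :
    OrderLE 1 (c.overlapExp c' r) (fun k : Coord n m r => (c.qExp c' k)⁻¹ i j) := by
  have hd : ∀ l p, ∀ k ∈ c.overlapExp c' r,
      DifferentiableAt ℝ (fun k : Coord n m r => c.qExp c' k l p) k := fun l p k hk =>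
    ((contDiffOn_qExp l p).contDiffAt (isOpen_baseOverlap.mem_nhds hk.1)).differentiableAt (by simp)
  have h1 : OrderLE 1 (c.overlapExp c' r) (fun (k : Coord n m r) l p => c.qExp c' k l p) :=
    OrderLE.pi (f := fun l k p => c.qExp c' k l p)
      (fun l => OrderLE.pi (f := fun p k => c.qExp c' k l p)
        (fun p k hk => orderLE_qExp l p k hk.1) (hd l))
      (fun l k hk => differentiableAt_pi.mpr fun p => hd l p k hk)
  refine h1.comp (φ := fun A : Fin n → Fin n → ℝ => (Matrix.of A)⁻¹ i j)
    (fun k hk => differentiableAt_pi.mpr fun l => differentiableAt_pi.mpr fun p => hd l p k hk) ?_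
  intro k hk
  refine (contDiffAt_matrix_inv (A := fun A : Fin n → Fin n → ℝ => Matrix.of A) (fun l p => ?_)
    hk.2 i j).differentiableAt (by simp)
  exact ((contDiff_apply ℝ ℝ p).comp (contDiff_apply ℝ (Fin n → ℝ) l)).contDiffAt

theorem yExp_smooth_order (ν : Fin m) (l : List (Fin n)) :
    ContDiffOn ℝ ∞ (c.yExp c' ν l : Coord n m r → ℝ) (c.overlapExp c' r) ∧
      OrderLE l.length (c.overlapExp c' r) (c.yExp c' ν l : Coord n m r → ℝ) := by
  induction l with
  | nil =>
    exact ⟨(contDiffOn_pi.mp contDiffOn_locChange _).mono fun _ hk => hk.1,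
      fun k hk => orderLE_locChange _ k hk.1⟩
  | cons i l ih =>
    have hs : ∀ j, ContDiffOn ℝ ∞ (D j (c.yExp c' ν l : Coord n m r → ℝ)) (c.overlapExp c' r) :=
      fun j => contDiffOn_D isOpen_overlapExp ih.1 j
    have hd : ∀ {f : Coord n m r → ℝ}, ContDiffOn ℝ ∞ f (c.overlapExp c' r) →
        ∀ k ∈ c.overlapExp c' r, DifferentiableAt ℝ f k := fun hf k hk =>
      (hf.contDiffAt (isOpen_overlapExp.mem_nhds hk)).differentiableAt (by simp)
    constructor
    · exact ContDiffOn.sum fun j _ => (contDiffOn_qExp_inv j i).mul (hs j)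
    · refine OrderLE.sum (fun j => OrderLE.mul ?_ ?_ (hd (contDiffOn_qExp_inv j i)) (hd (hs j)))
        (fun j => hd ((contDiffOn_qExp_inv j i).mul (hs j)))
      · exact (orderLE_qExp_inv j i).mono (by simp)
      · exact OrderLE.D isOpen_overlapExp ih.1 ih.2 j

/-! ### Coordinates along an immersion -/

/-- The coordinates of the prolongation of `γ`. -/
def along (c : AChart n m X) (r : ℕ) (γ : ImmGerm n m X) (t : Fin n → ℝ) : Coord n m r :=
  (fun i => c.xFun γ i t, fun σ I => c.yFun γ σ (sorted I.1) t)

theorem pt_along (γ : ImmGerm n m X) (t : Fin n → ℝ) : c.pt (c.along r γ t) = c.loc γ t := by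
  rw [← c.assemble_eta (c.loc γ t)]
  unfold pt
  congr 1
  funext σ
  simp [along, sorted, AChart.yFun, loc]

variable {γ : ImmGerm n m X} {V : TopologicalSpace.Opens (Fin n → ℝ)}

theorem Good.contDiffAt_along (h : c.Good γ V) {t : Fin n → ℝ} (ht : t ∈ V) :
    ContDiffAt ℝ ∞ (c.along r γ) t := by
  refine ContDiffAt.prodMk (contDiffAt_pi.mpr fun i =>
    (contDiffOn_xFun h.smooth i).contDiffAt (V.isOpen.mem_nhds ht)) (contDiffAt_pi.mpr fun σ =>
      contDiffAt_pi.mpr fun I => (h.contDiffOn_yFun σ _).contDiffAt (V.isOpen.mem_nhds ht))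

/-- The formal derivatives along an immersion. -/
theorem Good.pderiv_along (h : c.Good γ V) {t : Fin n → ℝ} (ht : t ∈ V) {q : ℕ} (hq : q < r)
    {U : Set (Coord n m r)} (hU : IsOpen U) {f : Coord n m r → ℝ} (hf : ContDiffOn ℝ ∞ f U)
    (ho : OrderLE q U f) (hk : c.along r γ t ∈ U) (j : Fin n) :
    pderiv j (fun t => f (c.along r γ t)) t = ∑ i, c.xMat γ t i j * D i f (c.along r γ t) := by
  have hs := h.contDiffAt_along (r := r) ht
  have hd : DifferentiableAt ℝ (c.along r γ) t := hs.differentiableAt (by simp)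
  rw [pderiv, fderiv_fun_comp t ((hf.contDiffAt (hU.mem_nhds hk)).differentiableAt (by simp)) hd,
    ContinuousLinearMap.comp_apply]
  have h1 : ∀ i, (fderiv ℝ (c.along r γ) t (Pi.single j 1)).1 i = c.xMat γ t i j := by
    intro i
    have := fderiv_fun_comp t (g := fun k : Coord n m r => k.1 i)
      ((contDiff_apply ℝ ℝ i).comp contDiff_fst |>.contDiffAt (n := ∞) |>.differentiableAt (by simp)) hd
    have hl : fderiv ℝ (fun k : Coord n m r => k.1 i) (c.along r γ t)
        = (ContinuousLinearMap.proj (R := ℝ) (φ := fun _ : Fin n => ℝ) i).comp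
          (ContinuousLinearMap.fst ℝ _ _) :=
      ((ContinuousLinearMap.proj (R := ℝ) (φ := fun _ : Fin n => ℝ) i).comp
          (ContinuousLinearMap.fst ℝ (Fin n → ℝ) (Fin m → MIdx n r → ℝ))).fderiv
    rw [hl] at this
    exact (congrArg (fun L : (Fin n → ℝ) →L[ℝ] ℝ => L (Pi.single j 1)) this).symm
  have h2 : ∀ σ (I : MIdx n r), (fderiv ℝ (c.along r γ) t (Pi.single j 1)).2 σ I
      = pderiv j (c.yFun γ σ (sorted I.1)) t := by
    intro σ I
    let L : Coord n m r →L[ℝ] ℝ := ((ContinuousLinearMap.proj (R := ℝ) (φ := fun _ : MIdx n r => ℝ)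
      I).comp (ContinuousLinearMap.proj (R := ℝ) (φ := fun _ : Fin m => MIdx n r → ℝ) σ)).comp
        (ContinuousLinearMap.snd ℝ (Fin n → ℝ) (Fin m → MIdx n r → ℝ))
    have := fderiv_fun_comp t (g := L) L.differentiableAt hd
    rw [L.fderiv] at this
    exact (congrArg (fun L : (Fin n → ℝ) →L[ℝ] ℝ => L (Pi.single j 1)) this).symm
  rw [fderiv_eq_sum_D hq (ho _ hk)]
  · simp only [h1]
  · intro σ I hI
    have hI' : (j ::ₘ I.1).card ≤ r := by rw [Multiset.card_cons]; omega
    rw [h2, h.pderiv_yFun σ _ j ht]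
    refine Finset.sum_congr rfl fun i _ => ?_
    rw [h1, dy_apply σ (show (i ::ₘ I.1).card ≤ r by rw [Multiset.card_cons]; omega)]
    congr 1
    refine h.yFun_perm σ ?_ ht
    rw [← Multiset.coe_eq_coe, sorted, sorted, Multiset.sort_eq, ← Multiset.cons_coe,
      Multiset.sort_eq]

theorem Good.along_mem (h : c.Good γ V) {t : Fin n → ℝ} (ht : t ∈ V)
    (ht' : γ.toFun t ∈ c'.ψ.source) : c.along r γ t ∈ c.baseOverlap c' r := by
  have h1 := h.mem_source t ht
  refine ⟨by rw [pt_along]; exact c.ψ.map_source h1, ?_⟩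
  rw [pt_along, loc, c.ψ.left_inv h1]
  exact ht'

theorem Good.locChange_along (h : c.Good γ V) {t : Fin n → ℝ} (ht : t ∈ V) :
    c.locChange c' (c.along r γ t) = c'.loc γ t := by
  rw [locChange, pt_along, loc, c.ψ.left_inv (h.mem_source t ht)]
  rfl

theorem Good.xMat_change (hr : 1 ≤ r) (h : c.Good γ V) {t : Fin n → ℝ} (ht : t ∈ V)
    (ht' : γ.toFun t ∈ c'.ψ.source) :
    c'.xMat γ t = c.qExp c' (c.along r γ t) * c.xMat γ t := by
  ext i j
  have e : c'.xFun γ i =ᶠ[𝓝 t] fun t => c.xExp c' i (c.along r γ t) := by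
    filter_upwards [V.isOpen.mem_nhds ht] with s hs
    rw [xExp, h.locChange_along hs]; rfl
  rw [xMat, Matrix.of_apply, (pderiv_eventuallyEq e j).eq_of_nhds,
    h.pderiv_along ht (q := 0) (by omega) isOpen_baseOverlap (contDiffOn_xExp i)
      (orderLE_locChange _) (h.along_mem ht ht') j, Matrix.mul_apply]
  exact Finset.sum_congr rfl fun k _ => by rw [mul_comm]; rfl

/-- Along an immersion the formal derivatives are 𝐱 times the total derivatives and 𝐱̄ = Q 𝐱, so 𝐱
cancels from the recurrence for ȳ and leaves ȳ_{iI} = Pʲ_i D_j ȳ_I. Each step needs y_I of order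
less than r, which is why |l| ≤ r is required. -/
theorem Good.yFun_change (hr : 1 ≤ r) (h : c.Good γ V) (h' : c'.Good γ V) (ν : Fin m)
    (l : List (Fin n)) (hl : l.length ≤ r) {t : Fin n → ℝ} (ht : t ∈ V) :
    c'.yFun γ ν l t = c.yExp c' ν l (c.along r γ t) := by
  have hm : ∀ t ∈ V, c.along r γ t ∈ c.overlapExp c' r := by
    intro t ht
    refine ⟨h.along_mem ht (h'.mem_source t ht), fun h0 => h'.det_ne_zero t ht ?_⟩
    rw [h.xMat_change hr ht (h'.mem_source t ht), Matrix.det_mul, h0, zero_mul]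
  induction l generalizing t with
  | nil => exact congrFun (h.locChange_along (c' := c') ht).symm _
  | cons i l ih =>
    rw [List.length_cons] at hl
    have e : c'.yFun γ ν l =ᶠ[𝓝 t] fun t => c.yExp c' ν l (c.along r γ t) := by
      filter_upwards [V.isOpen.mem_nhds ht] with s hs
      exact ih (by omega) hs
    have hp : ∀ j, pderiv j (c'.yFun γ ν l) t
        = ∑ k, c.xMat γ t k j * D k (c.yExp c' ν l) (c.along r γ t) := by
      intro j
      rw [(pderiv_eventuallyEq e j).eq_of_nhds]
      exact h.pderiv_along ht (by omega) isOpen_overlapExp (yExp_smooth_order ν l).1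
        (yExp_smooth_order ν l).2 (hm t ht) j
    simp only [yFun, yExp, hp]
    rw [h.xMat_change hr ht (h'.mem_source t ht), Matrix.mul_inv_rev]
    simp only [Matrix.mul_apply, Finset.sum_mul, Finset.mul_sum]
    have hu := isUnit_iff_ne_zero.mpr (h.det_ne_zero t ht)
    have e2 : ∀ j k p, (c.xMat γ t)⁻¹ j p * (c.qExp c' (c.along r γ t))⁻¹ p i
          * (c.xMat γ t k j * D k (c.yExp c' ν l) (c.along r γ t))
        = (c.qExp c' (c.along r γ t))⁻¹ p i * D k (c.yExp c' ν l) (c.along r γ t)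
          * (c.xMat γ t k j * (c.xMat γ t)⁻¹ j p) := by intros; ring
    simp only [e2]
    rw [Finset.sum_comm]
    conv_lhs =>
      enter [2, p]
      rw [Finset.sum_comm]
    simp only [← Finset.mul_sum]
    have e3 : ∀ k p, ∑ j, c.xMat γ t k j * (c.xMat γ t)⁻¹ j p = if k = p then 1 else 0 := by
      intro k p
      rw [← Matrix.mul_apply, Matrix.mul_nonsing_inv _ hu, Matrix.one_apply]
    simp [e3]

end AChart
end Change

/-! ### Smoothness, order and recurrence of the chart change -/

section Change

variable {n m : ℕ} {X : Type*} [TopologicalSpace X] [ChartedSpace (Fin (n + m) → ℝ) X]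

namespace AChart

variable {c c' : AChart n m X} {r : ℕ}

theorem exists_good₂ {γ : ImmGerm n m X} (h : c.InDom γ) (h' : c'.InDom γ) :
    ∃ V : TopologicalSpace.Opens (Fin n → ℝ), 0 ∈ V ∧ c.Good γ V ∧ c'.Good γ V := by
  obtain ⟨V, h0, hV⟩ := h.exists_good
  obtain ⟨V', h0', hV'⟩ := h'.exists_good
  exact ⟨V ⊓ V', ⟨h0, h0'⟩, hV.mono inf_le_left, hV'.mono inf_le_right⟩

theorem detX_change (hr : 1 ≤ r) {γ : ImmGerm n m X} (h : c.InDom γ)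
    (h' : γ.toFun 0 ∈ c'.ψ.source) :
    c'.detX γ = (c.qExp c' (c.coordGerm r γ)).det * c.detX γ := by
  obtain ⟨V, h0, hV⟩ := h.exists_good
  rw [detX, hV.xMat_change hr h0 h', Matrix.det_mul]
  rfl

theorem inDom_iff_overlapExp (hr : 1 ≤ r) {γ : ImmGerm n m X} (h : c.InDom γ) :
    c'.InDom γ ↔ c.coordGerm r γ ∈ c.overlapExp c' r := by
  have hb : c.coordGerm r γ ∈ c.baseOverlap c' r ↔ γ.toFun 0 ∈ c'.ψ.source := by
    unfold baseOverlap
    rw [Set.mem_ofPred_eq, pt_coordGerm, loc, c.ψ.left_inv h.1]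
    exact and_iff_right (c.ψ.map_source h.1)
  constructor
  · intro h'
    refine ⟨hb.mpr h'.1, fun h0 => h'.2 ?_⟩
    rw [detX_change hr h h'.1, h0, zero_mul]
  · intro hk
    have hs := hb.mp hk.1
    refine ⟨hs, ?_⟩
    rw [detX_change hr h hs]
    exact mul_ne_zero hk.2 h.2

/-- Since det 𝐱̄ = det Q · det 𝐱 along every immersion, the overlap is cut out by the condition on
base points and det Q ≠ 0. This description is open and makes no choice of representatives. -/
theorem overlap_eq (hr : 1 ≤ r) : c.overlap c' r = c.overlapExp c' r := by
  ext k
  rw [mem_overlap_iff hr]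
  constructor
  · rintro ⟨γ, h, h', rfl⟩
    exact (inDom_iff_overlapExp hr h).mp h'
  · intro hk
    obtain ⟨γ, -, h1, h2, -⟩ := IsGraph.pt_mem hk.1.1
    exact ⟨γ, h1, (inDom_iff_overlapExp hr h1).mpr (h2 ▸ hk), h2⟩

theorem isOpen_overlap (hr : 1 ≤ r) : IsOpen (c.overlap c' r) := by
  rw [overlap_eq hr]; exact isOpen_overlapExp

theorem isOpen_image (hr : 1 ≤ r) : IsOpen (c.image r) := by
  have : c.image r = c.pt ⁻¹' c.ψ.target := Set.ext fun k => mem_image_iff_pt hr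
  rw [this]
  exact c.ψ.open_target.preimage contDiff_pt.continuous

theorem overlap_subset_image : c.overlap c' r ⊆ c.image r :=
  Set.image_mono Set.inter_subset_left

theorem change_eq (hr : 1 ≤ r) {k : Coord n m r} (hk : k ∈ c.overlap c' r) :
    c.change c' r k = (fun i => c.xExp c' i k, fun ν I => c.yExp c' ν (sorted I.1) k) := by
  obtain ⟨γ, h, h', rfl⟩ := (mem_overlap_iff hr).mp hk
  obtain ⟨V, h0, hV, hV'⟩ := exists_good₂ h h'
  rw [change_coordGerm hr h h']
  refine Prod.ext (funext fun i => ?_) (funext fun ν => funext fun I => ?_)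
  · exact congrFun (hV.locChange_along (c' := c') h0).symm _
  · exact hV.yFun_change hr hV' ν _ (by simpa [sorted] using I.2) h0

theorem xBar_eqOn (hr : 1 ≤ r) (j : Fin n) :
    Set.EqOn (c.xBar c' r j) (c.xExp c' j) (c.overlap c' r) := fun k hk => by
  rw [xBar, change_eq hr hk]

theorem yBar_eqOn (hr : 1 ≤ r) (ν : Fin m) (l : List (Fin n)) (hl : l.length ≤ r) :
    Set.EqOn (c.yBar c' r ν l) (c.yExp c' ν l) (c.overlap c' r) := fun k hk => by
  obtain ⟨γ, h, h', rfl⟩ := (mem_overlap_iff hr).mp hk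
  obtain ⟨V, h0, hV, hV'⟩ := exists_good₂ h h'
  rw [yBar, change_coordGerm hr h h', dy_apply _ (by simpa using hl)]
  refine Eq.trans ?_ (hV.yFun_change hr hV' ν l hl h0)
  refine hV'.yFun_perm ν ?_ h0
  rw [← Multiset.coe_eq_coe, sorted, Multiset.sort_eq]

theorem contDiffOn_change (hr : 1 ≤ r) :
    ContDiffOn ℝ ∞ (c.change c' r) (c.overlap c' r) := by
  refine ContDiffOn.congr ?_ fun k hk => change_eq hr hk
  rw [overlap_eq hr]
  refine ContDiffOn.prodMk (contDiffOn_pi.mpr fun i => (contDiffOn_xExp i).mono fun _ h => h.1) ?_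
  exact contDiffOn_pi.mpr fun ν => contDiffOn_pi.mpr fun I => (yExp_smooth_order ν _).1

theorem contDiffOn_xBar (hr : 1 ≤ r) (j : Fin n) :
    ContDiffOn ℝ ∞ (c.xBar c' r j) (c.overlap c' r) :=
  contDiffOn_pi.mp ((contDiffOn_change hr).fst) j

theorem contDiffOn_yBar (hr : 1 ≤ r) (ν : Fin m) (l : List (Fin n)) :
    ContDiffOn ℝ ∞ (c.yBar c' r ν l) (c.overlap c' r) := by
  by_cases hl : (l : Multiset (Fin n)).card ≤ r
  · have : c.yBar c' r ν l = fun k => (c.change c' r k).2 ν ⟨l, hl⟩ :=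
      funext fun k => dy_apply ν hl _
    rw [this]
    exact contDiffOn_pi.mp (contDiffOn_pi.mp ((contDiffOn_change hr).snd) ν) _
  · have : c.yBar c' r ν l = fun k => 0 := by
      funext k
      rw [yBar, dy_of_lt _ (not_le.mp hl)]; rfl
    rw [this]
    exact contDiffOn_const

theorem orderLE_xBar (hr : 1 ≤ r) (j : Fin n) : OrderLE 0 (c.overlap c' r) (c.xBar c' r j) := by
  refine OrderLE.congr (isOpen_overlap hr) ?_ (xBar_eqOn hr j).symm
  rw [overlap_eq hr]
  exact fun k hk => orderLE_locChange _ k hk.1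

theorem orderLE_yBar (hr : 1 ≤ r) (ν : Fin m) (l : List (Fin n)) (hl : l.length ≤ r) :
    OrderLE l.length (c.overlap c' r) (c.yBar c' r ν l) := by
  refine OrderLE.congr (isOpen_overlap hr) ?_ (yBar_eqOn hr ν l hl).symm
  rw [overlap_eq hr]
  exact (yExp_smooth_order ν l).2

theorem D_congr {U : Set (Coord n m r)} (hU : IsOpen U) {f g : Coord n m r → ℝ}
    (h : Set.EqOn f g U) (i : Fin n) : Set.EqOn (D i f) (D i g) U := fun k hk => by
  rw [D, D, (h.eventuallyEq_of_mem (hU.mem_nhds hk)).fderiv_eq]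

theorem Q_eq (hr : 1 ≤ r) {k : Coord n m r} (hk : k ∈ c.overlap c' r) :
    c.Q c' r k = c.qExp c' k := by
  ext l p
  exact D_congr (isOpen_overlap hr) (xBar_eqOn hr l) p hk

theorem det_Q_ne_zero (hr : 1 ≤ r) {k : Coord n m r} (hk : k ∈ c.overlap c' r) :
    (c.Q c' r k).det ≠ 0 := by
  rw [Q_eq hr hk]
  rw [overlap_eq hr] at hk
  exact hk.2

theorem contDiffOn_Q (hr : 1 ≤ r) (l p : Fin n) :
    ContDiffOn ℝ ∞ (fun k => c.Q c' r k l p) (c.overlap c' r) :=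
  contDiffOn_D (isOpen_overlap hr) (contDiffOn_xBar hr l) p

theorem contDiffOn_Pmat (hr : 1 ≤ r) (l p : Fin n) :
    ContDiffOn ℝ ∞ (fun k => c.Pmat c' r k l p) (c.overlap c' r) := fun _ hk =>
  (contDiffAt_matrix_inv (fun i j => (contDiffOn_Q hr i j).contDiffAt
    ((isOpen_overlap hr).mem_nhds hk)) (det_Q_ne_zero hr hk) l p).contDiffWithinAt

/-- The recurrence `ȳ^ν_{iI} = Pʲ_i D_j ȳ^ν_I`. -/
theorem yBar_cons (hr : 1 ≤ r) (ν : Fin m) (i : Fin n) (l : List (Fin n)) (hl : l.length + 1 ≤ r)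
    {k : Coord n m r} (hk : k ∈ c.overlap c' r) :
    c.yBar c' r ν (i :: l) k = ∑ j, c.Pmat c' r k j i * D j (c.yBar c' r ν l) k := by
  rw [yBar_eqOn hr ν (i :: l) (by simpa using hl) hk, yExp]
  refine Finset.sum_congr rfl fun j _ => ?_
  rw [Pmat, Q_eq hr hk, D_congr (isOpen_overlap hr) (yBar_eqOn hr ν l (by omega)) j hk]

theorem change_mem_overlap (hr : 1 ≤ r) {k : Coord n m r} (hk : k ∈ c.overlap c' r) :
    c.change c' r k ∈ c'.overlap c r := by
  obtain ⟨γ, h, h', rfl⟩ := (mem_overlap_iff hr).mp hk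
  rw [change_coordGerm hr h h']
  exact (mem_overlap_iff hr).mpr ⟨γ, h', h, rfl⟩

/-! ### Truncation -/

theorem truncate_coordGerm {s t : ℕ} (h : s ≤ t) (γ : ImmGerm n m X) :
    truncate h (c.coordGerm t γ) = c.coordGerm s γ := rfl

theorem truncate_mem_image {s t : ℕ} (hs : 1 ≤ s) (h : s ≤ t) {k : Coord n m t}
    (hk : k ∈ c.image t) : truncate h k ∈ c.image s := by
  obtain ⟨γ, h1, rfl⟩ := (mem_image_iff (hs.trans h)).mp hk
  exact (mem_image_iff hs).mpr ⟨γ, h1, rfl⟩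

end AChart

/-- `truncate` as a continuous linear map. -/
def truncateL {n m s t : ℕ} (h : s ≤ t) : Coord n m t →L[ℝ] Coord n m s :=
  LinearMap.toContinuousLinearMap
    { toFun := truncate h, map_add' := fun _ _ => rfl, map_smul' := fun _ _ => rfl }

theorem truncateL_apply {n m s t : ℕ} (h : s ≤ t) (k : Coord n m t) :
    truncateL h k = truncate h k := rfl

theorem truncate_ey {n m s t : ℕ} (h : s ≤ t) (σ : Fin m) {I : Multiset (Fin n)} (hI : I.card ≤ t) :
    truncate h (ey σ I : Coord n m t) = ey σ I := by
  refine Prod.ext ?_ (funext fun τ => funext fun J => ?_)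
  · rw [ey_fst]; exact ey_fst (r := t) σ I
  · have h1 : (truncate h (ey σ I : Coord n m t)).2 τ J
        = if τ = σ ∧ J.1 = I then 1 else 0 := ey_snd σ τ ⟨J.1, J.2.trans h⟩ hI
    rw [h1]
    by_cases hs : I.card ≤ s
    · rw [ey_snd _ _ _ hs]
    · rw [if_neg]
      · simp [ey, hs]
      · rintro ⟨-, hJ⟩; exact hs (hJ ▸ J.2)

theorem orderLE_comp_truncate {n m s t : ℕ} (h : s ≤ t) {U : Set (Coord n m s)}
    {U' : Set (Coord n m t)} (hU : IsOpen U) (hUU : ∀ k ∈ U', truncate h k ∈ U)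
    {f : Coord n m s → ℝ} (hf : ContDiffOn ℝ ∞ f U) :
    OrderLE s U' (fun k => f (truncate h k)) := fun k hk σ I hI => by
  have hd : DifferentiableAt ℝ f (truncateL h k) :=
    (hf.contDiffAt (hU.mem_nhds (hUU k hk))).differentiableAt (by simp)
  have := fderiv_fun_comp k hd (truncateL h).differentiableAt
  rw [ContinuousLinearMap.fderiv] at this
  change fderiv ℝ (fun k => f (truncateL h k)) k _ = 0
  have hz : truncateL h (ey σ I : Coord n m t) = 0 := by
    rw [truncateL_apply]
    by_cases hIt : I.card ≤ t
    · rw [truncate_ey h σ hIt, ey, dif_neg (by omega)]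
    · rw [ey, dif_neg hIt]; rfl
  rw [this, ContinuousLinearMap.comp_apply, hz, map_zero]

theorem contDiffOn_comp_truncate {n m s t : ℕ} (h : s ≤ t) {U : Set (Coord n m s)}
    {U' : Set (Coord n m t)} (hUU : ∀ k ∈ U', truncate h k ∈ U)
    {f : Coord n m s → ℝ} (hf : ContDiffOn ℝ ∞ f U) :
    ContDiffOn ℝ ∞ (fun k => f (truncate h k)) U' :=
  hf.comp (truncateL h).contDiff.contDiffOn hUU

end Change

section Frame

variable {n m : ℕ} {X : Type*} [TopologicalSpace X] [ChartedSpace (Fin (n + m) → ℝ) X]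

/-! ## The functions `T_σ` -/

/-- The coordinate vector `∂/∂x^A` at `p`. -/
def coordVec (ψ : OpenPartialHomeomorph X (Fin (n + m) → ℝ)) (A : Fin (n + m)) (p : X) :
    Fin (n + m) → ℝ :=
  ContinuousLinearMap.inverse (mfderiv 𝓘(ℝ, Fin (n + m) → ℝ) 𝓘(ℝ, Fin (n + m) → ℝ) ψ p)
    (Pi.single A (1 : ℝ))

/-- The differential of a chart, as a map between model spaces. -/
def chartDeriv (ψ : OpenPartialHomeomorph X (Fin (n + m) → ℝ)) (p : X) :
    (Fin (n + m) → ℝ) →L[ℝ] (Fin (n + m) → ℝ) :=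
  mfderiv 𝓘(ℝ, Fin (n + m) → ℝ) 𝓘(ℝ, Fin (n + m) → ℝ) ψ p

theorem IsChart.mdifferentiable {ψ : OpenPartialHomeomorph X (Fin (n + m) → ℝ)}
    (h : IsChart n m X ψ) :
    ψ.MDifferentiable 𝓘(ℝ, Fin (n + m) → ℝ) 𝓘(ℝ, Fin (n + m) → ℝ) :=
  ⟨(contMDiffOn_of_mem_maximalAtlas h).mdifferentiableOn (by simp),
    (contMDiffOn_symm_of_mem_maximalAtlas h).mdifferentiableOn (by simp)⟩

theorem IsChart.exists_equiv {ψ : OpenPartialHomeomorph X (Fin (n + m) → ℝ)}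
    (h : IsChart n m X ψ) {p : X} (hp : p ∈ ψ.source) :
    ∃ e : (Fin (n + m) → ℝ) ≃L[ℝ] (Fin (n + m) → ℝ), (e : _ →L[ℝ] _) = chartDeriv ψ p ∧
      ∀ A, coordVec ψ A p = e.symm (Pi.single A 1) := by
  let e : (Fin (n + m) → ℝ) ≃L[ℝ] (Fin (n + m) → ℝ) := h.mdifferentiable.mfderiv hp
  have he : (e : _ →L[ℝ] _) = chartDeriv ψ p := rfl
  refine ⟨e, he, fun A => ?_⟩
  change ContinuousLinearMap.inverse (chartDeriv ψ p) (Pi.single A (1 : ℝ)) = _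
  rw [← he, ContinuousLinearMap.inverse_equiv]
  rfl

theorem chartDeriv_coordVec {ψ : OpenPartialHomeomorph X (Fin (n + m) → ℝ)}
    (h : IsChart n m X ψ) {p : X} (hp : p ∈ ψ.source) (A : Fin (n + m)) :
    chartDeriv ψ p (coordVec ψ A p) = Pi.single A 1 := by
  obtain ⟨e, he, hA⟩ := h.exists_equiv hp
  rw [hA, ← he]
  exact e.apply_symm_apply _

theorem eq_sum_coordVec {ψ : OpenPartialHomeomorph X (Fin (n + m) → ℝ)}
    (h : IsChart n m X ψ) {p : X} (hp : p ∈ ψ.source) (u : Fin (n + m) → ℝ) :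
    u = ∑ B, chartDeriv ψ p u B • coordVec ψ B p := by
  obtain ⟨e, he, hA⟩ := h.exists_equiv hp
  apply e.injective
  rw [map_sum]
  simp only [map_smul, hA, e.apply_symm_apply]
  rw [← he]
  funext A
  rw [Finset.sum_apply, Finset.sum_eq_single A]
  · simp
  · intro B _ hB
    simp [hB.symm]
  · simp

theorem fderiv_transition {ψ ψ' : OpenPartialHomeomorph X (Fin (n + m) → ℝ)}
    (h : IsChart n m X ψ) (h' : IsChart n m X ψ') {p : X} (hp : p ∈ ψ.source)
    (hp' : p ∈ ψ'.source) (u : Fin (n + m) → ℝ) :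
    fderiv ℝ (fun z => ψ' (ψ.symm z)) (ψ p) (chartDeriv ψ p u) = chartDeriv ψ' p u := by
  have h1 := h.contDiffAt_transition h' (ψ.map_source hp) ((ψ.left_inv hp).symm ▸ hp')
  have h2 := mfderiv_comp p (I := 𝓘(ℝ, Fin (n + m) → ℝ)) (I' := 𝓘(ℝ, Fin (n + m) → ℝ))
    (I'' := 𝓘(ℝ, Fin (n + m) → ℝ)) (g := fun z => ψ' (ψ.symm z)) (f := ψ)
    ((h1.differentiableAt (by simp)).mdifferentiableAt)
    ((h.contMDiffAt hp).mdifferentiableAt (by simp))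
  have h3 : (fun z => ψ' (ψ.symm z)) ∘ ψ =ᶠ[𝓝 p] ψ' := by
    filter_upwards [ψ.open_source.mem_nhds hp] with q hq
    exact congrArg ψ' (ψ.left_inv hq)
  rw [h3.mfderiv_eq] at h2
  rw [mfderiv_eq_fderiv] at h2
  exact (congrArg (fun L : (Fin (n + m) → ℝ) →L[ℝ] (Fin (n + m) → ℝ) => L u) h2).symm

theorem ImmGerm.chartDeriv_mfderiv (γ : ImmGerm n m X)
    {ψ : OpenPartialHomeomorph X (Fin (n + m) → ℝ)} (h : IsChart n m X ψ)
    (hp : γ.toFun 0 ∈ ψ.source) (w : Fin n → ℝ) :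
    chartDeriv ψ (γ.toFun 0)
        (mfderiv 𝓘(ℝ, Fin n → ℝ) 𝓘(ℝ, Fin (n + m) → ℝ) γ.toFun 0 w)
      = fderiv ℝ (fun t => ψ (γ.toFun t)) 0 w := by
  have h2 := mfderiv_comp (0 : Fin n → ℝ) ((h.contMDiffAt hp).mdifferentiableAt (by simp))
    (γ.contMDiffAt.mdifferentiableAt (by simp))
  rw [mfderiv_eq_fderiv] at h2
  exact (congrArg (fun L : (Fin n → ℝ) →L[ℝ] (Fin (n + m) → ℝ) => L w) h2).symm

end Frame

namespace DiffEq

variable {n m : ℕ} {X : Type*} [TopologicalSpace X] [ChartedSpace (Fin (n + m) → ℝ) X]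
variable {s : ℕ} {T : DiffEq n m X s}

/-- The covector of a velocity, as a functional on the model space. -/
def covec (T : DiffEq n m X s) (γ : ImmGerm n m X) : (Fin (n + m) → ℝ) →L[ℝ] ℝ := T.form (jet s γ)

theorem component_eq (ψ : OpenPartialHomeomorph X (Fin (n + m) → ℝ)) (A : Fin (n + m))
    (γ : ImmGerm n m X) :
    component T.form ψ A (jet s γ) = T.covec γ (coordVec ψ A (γ.toFun 0)) := rfl

theorem IsHomogeneous.component_comp (hT : T.IsHomogeneous) {γ δ : ImmGerm n m X} {α : Reparam n}
    (h : IsComp γ α δ) (ψ : OpenPartialHomeomorph X (Fin (n + m) → ℝ)) (A : Fin (n + m)) :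
    component T.form ψ A (jet s δ) = α.det * component T.form ψ A (jet s γ) := by
  rw [component_eq, component_eq, ← AChart.base_comp h]
  exact hT.equivariant γ δ α h _

variable {c c' : AChart n m X}

/-- The immersion γ is reparametrized by α into a graph with the s-jet of δ₀. Equivariance
multiplies 𝒯 by det α, and det 𝐱 · det α = 1 because a graph has det 𝐱 = 1. In particular 𝒯_A / det
𝐱 depends only on the coordinates of the contact element. -/
theorem IsHomogeneous.component_eq_detX_mul (hT : T.IsHomogeneous) {γ δ₀ : ImmGerm n m X}
    (h : c.InDom γ) (hδ₀ : c.IsGraph (c.coordGerm s γ).1 (AChart.poly (c.coordGerm s γ)) δ₀)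
    (hδ₀s : c.InDom δ₀) (A : Fin (n + m)) :
    component T.form c.ψ A (jet s γ) = c.detX γ * component T.form c.ψ A (jet s δ₀) := by
  obtain ⟨α, δ, hc, hd, hj⟩ := AChart.exists_comp_jet_eq h s hδ₀ hδ₀s
  rw [← hj, hT.component_comp hc, ← mul_assoc, ← AChart.detX_comp hc h.1, hd, one_mul]

theorem IsHomogeneous.nonhom_eq_graph (hT : T.IsHomogeneous) (σ : Fin m)
    {k : Coord n m s} {δ₀ : ImmGerm n m X}
    (hδ₀ : c.IsGraph k.1 (AChart.poly k) δ₀) (hδ₀s : c.InDom δ₀) :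
    T.nonhom c σ k = component T.form c.ψ (c.e (Sum.inr σ)) (jet s δ₀) := by
  have hex : ∃ γ, c.InDom γ ∧ c.coordGerm s γ = k := ⟨δ₀, hδ₀s, hδ₀.coordGerm_poly⟩
  rw [nonhom, dif_pos hex]
  obtain ⟨h1, h2⟩ := hex.choose_spec
  rw [hT.component_eq_detX_mul h1 (by rwa [h2]) hδ₀s, mul_div_cancel_left₀ _ h1.2]

theorem IsHomogeneous.component_eq_nonhom (hs : 1 ≤ s) (hT : T.IsHomogeneous) {γ : ImmGerm n m X}
    (h : c.InDom γ) (σ : Fin m) :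
    component T.form c.ψ (c.e (Sum.inr σ)) (jet s γ)
      = c.detX γ * T.nonhom c σ (c.coordGerm s γ) := by
  obtain ⟨δ₀, h1, h2, -, -⟩ := AChart.IsGraph.pt_mem (c := c) (k := c.coordGerm s γ)
    ((AChart.mem_image_iff_pt hs).mp ((AChart.mem_image_iff hs).mpr ⟨γ, h, rfl⟩))
  rw [hT.component_eq_detX_mul h h1 h2, hT.nonhom_eq_graph σ h1 h2]

theorem _root_.HelmholtzSonin.pderivs_const_add (a : ℝ) (f : (Fin n → ℝ) → ℝ) (l : List (Fin n)) :
    pderivs l (fun t => a + f t) = fun t => (if l = [] then a else 0) + pderivs l f t := by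
  induction l with
  | nil => rfl
  | cons j l ih =>
    funext t
    rw [pderivs, ih, pderiv, fderiv_const_add]
    simp [pderivs, pderiv]

/-- The jet coordinates of the polynomial section through `k`. -/
def graphJet (c : AChart n m X) (k : Coord n m s) : Fin (n + m) → MIdx n s → ℝ := fun A J =>
  Sum.elim (fun i => (if sorted J.1 = [] then k.1 i else 0) + pderivs (sorted J.1) (fun t => t i) 0)
    (fun τ => k.2 τ J) (c.e.symm A)

theorem contDiff_graphJet (c : AChart n m X) :
    ContDiff ℝ ∞ (graphJet c : Coord n m s → _) := by
  refine contDiff_pi.mpr fun A => contDiff_pi.mpr fun J => ?_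
  unfold graphJet
  rcases c.e.symm A with i | τ
  · simp only [Sum.elim_inl]
    refine ContDiff.add ?_ contDiff_const
    split_ifs
    · exact (contDiff_apply ℝ ℝ i).comp contDiff_fst
    · exact contDiff_const
  · simp only [Sum.elim_inr]
    exact ((contDiff_apply ℝ ℝ J).comp (contDiff_apply ℝ (MIdx n s → ℝ) τ)).comp contDiff_snd

theorem jetCoord_graph {k : Coord n m s} {δ : ImmGerm n m X} (h : c.IsGraph k.1 (AChart.poly k) δ) :
    jetCoord c.ψ s δ = graphJet c k := by
  funext A J
  have e : (fun t => c.ψ (δ.toFun t) A) =ᶠ[𝓝 0]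
      fun t => c.assemble (k.1 + t) (fun σ => AChart.poly k σ t) A := by
    filter_upwards [h] with t ht
    exact congrFun ht A
  rw [jetCoord, (pderivs_eventuallyEq e _).eq_of_nhds, graphJet]
  unfold AChart.assemble
  rcases c.e.symm A with i | τ
  · simp only [Sum.elim_inl, Pi.add_apply]
    rw [pderivs_const_add]
  · simp only [Sum.elim_inr]
    rw [AChart.pderivs_poly_zero k τ _ (by simpa [sorted] using J.2)]
    exact congrArg (k.2 τ) (Subtype.ext (Multiset.sort_eq J.1 (· ≤ ·)))

/-- On the image of the chart T_σ is the component of 𝒯 at the polynomial graph through k, and the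
jet coordinates of that graph are affine functions of k; so the smoothness of 𝒯 passes to T_σ. -/
theorem IsHomogeneous.contDiffOn_nonhom (hs : 1 ≤ s) (hT : T.IsHomogeneous) (c : AChart n m X)
    (σ : Fin m) : ContDiffOn ℝ ∞ (T.nonhom c σ) (c.image s) := by
  obtain ⟨F, hF, hTF⟩ := T.smooth c.ψ c.isChart (c.e (Sum.inr σ))
  have key : ∀ k ∈ c.image s, graphJet c k ∈ jetCoord c.ψ s '' {γ | γ.toFun 0 ∈ c.ψ.source} ∧
      T.nonhom c σ k = F (graphJet c k) := by
    intro k hk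
    obtain ⟨δ, h1, h2, -, -⟩ := AChart.IsGraph.pt_mem ((AChart.mem_image_iff_pt hs).mp hk)
    refine ⟨⟨δ, h2.1, jetCoord_graph h1⟩, ?_⟩
    rw [hT.nonhom_eq_graph σ h1 h2, hTF δ h2.1, jetCoord_graph h1]
  exact (hF.comp (contDiff_graphJet c).contDiffOn fun k hk => (key k hk).1).congr
    fun k hk => (key k hk).2

/-- The functional `𝒯` kills the tangent vectors of the immersion, so that
`𝒯_{xⁱ} = - y^α_i 𝒯_α`. -/
theorem IsHomogeneous.component_inl (hT : T.IsHomogeneous) {γ : ImmGerm n m X} (h : c.InDom γ)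
    (i : Fin n) :
    T.covec γ (coordVec c.ψ (c.e (Sum.inl i)) (γ.toFun 0))
      = - ∑ α, c.yFun γ α [i] 0 * T.covec γ (coordVec c.ψ (c.e (Sum.inr α)) (γ.toFun 0)) := by
  have hu : IsUnit (c.xMat γ 0).det := isUnit_iff_ne_zero.mpr h.2
  have hd := (AChart.contDiffAt_loc h.1).differentiableAt (by simp)
  have key : ∀ j, ∑ i, c.xMat γ 0 i j * T.covec γ (coordVec c.ψ (c.e (Sum.inl i)) (γ.toFun 0))
      + ∑ α, pderiv j (c.yFun γ α []) 0
        * T.covec γ (coordVec c.ψ (c.e (Sum.inr α)) (γ.toFun 0)) = 0 := by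
    intro j
    have h1 := hT.pullback_eq_zero γ (Pi.single j 1)
    have h2 := eq_sum_coordVec c.isChart h.1
      (mfderiv 𝓘(ℝ, Fin n → ℝ) 𝓘(ℝ, Fin (n + m) → ℝ) γ.toFun 0 (Pi.single j 1))
    change T.covec γ _ = 0 at h1
    rw [h2, map_sum] at h1
    simp only [map_smul, smul_eq_mul, γ.chartDeriv_mfderiv c.isChart h.1] at h1
    rw [← c.e.sum_comp, Fintype.sum_sum_type] at h1
    rw [← h1]
    congr 1
    · refine Finset.sum_congr rfl fun i _ => ?_
      rw [AChart.xMat_eq_fderiv hd]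
      rfl
    · refine Finset.sum_congr rfl fun α _ => ?_
      congr 1
      exact congrArg (fun L : (Fin n → ℝ) →L[ℝ] ℝ => L (Pi.single j 1))
        (fderiv_apply hd (c.e (Sum.inr α)))
  have hy : ∀ α, c.yFun γ α [i] 0 = ∑ j, (c.xMat γ 0)⁻¹ j i * pderiv j (c.yFun γ α []) 0 :=
    fun α => rfl
  have hsum : ∑ j, (c.xMat γ 0)⁻¹ j i
      * ∑ i', c.xMat γ 0 i' j * T.covec γ (coordVec c.ψ (c.e (Sum.inl i')) (γ.toFun 0))
      = T.covec γ (coordVec c.ψ (c.e (Sum.inl i)) (γ.toFun 0)) := by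
    simp only [Finset.mul_sum]
    rw [Finset.sum_comm]
    have hm := Matrix.mul_nonsing_inv _ hu
    rw [Finset.sum_eq_single i]
    · have := congrFun (congrFun hm i) i
      rw [Matrix.mul_apply, Matrix.one_apply_eq] at this
      simp only [← mul_assoc, ← Finset.sum_mul]
      rw [Finset.sum_congr rfl fun j _ => mul_comm _ _, this, one_mul]
    · intro i' _ hi'
      have := congrFun (congrFun hm i') i
      rw [Matrix.mul_apply, Matrix.one_apply_ne hi'] at this
      simp only [← mul_assoc, ← Finset.sum_mul]
      rw [Finset.sum_congr rfl fun j _ => mul_comm _ _, this, zero_mul]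
    · simp
  rw [← hsum, eq_neg_iff_add_eq_zero]
  simp only [hy, Finset.sum_mul]
  rw [Finset.sum_comm (s := Finset.univ (α := Fin m)), ← Finset.sum_add_distrib]
  refine Finset.sum_eq_zero fun j _ => ?_
  rw [← mul_zero ((c.xMat γ 0)⁻¹ j i), ← key j, mul_add, Finset.mul_sum (s := Finset.univ (α := Fin m))]
  simp only [mul_assoc]

theorem _root_.HelmholtzSonin.AChart.fderiv_locChange_ey {r : ℕ} {k : Coord n m r}
    (hk : k ∈ c.baseOverlap c' r) (σ : Fin m) (A : Fin (n + m)) :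
    fderiv ℝ (fun k : Coord n m r => c.locChange c' k A) k (ey σ 0)
      = fderiv ℝ (fun z => c'.ψ (c.ψ.symm z)) (c.pt k) (Pi.single (c.e (Sum.inr σ)) 1) A := by
  have h1 : DifferentiableAt ℝ (fun z => c'.ψ (c.ψ.symm z)) (c.pt k) :=
    (c.isChart.contDiffAt_transition c'.isChart hk.1 hk.2).differentiableAt (by simp)
  let L : Coord n m r →L[ℝ] (Fin (n + m) → ℝ) := LinearMap.toContinuousLinearMap
    { toFun := c.pt
      map_add' := fun a b => by
        funext A
        obtain ⟨a', rfl⟩ := c.e.surjective A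
        cases a' <;> simp [AChart.pt]
      map_smul' := fun a b => by
        funext A
        obtain ⟨a', rfl⟩ := c.e.surjective A
        cases a' <;> simp [AChart.pt] }
  have h2 := fderiv_comp k (f := L) h1 L.differentiableAt
  have h3 : L (ey σ 0) = Pi.single (c.e (Sum.inr σ)) 1 := by
    change c.pt (ey σ 0 : Coord n m r) = _
    funext A
    obtain ⟨a', rfl⟩ := c.e.surjective A
    rcases a' with i | τ
    · simp [AChart.pt, ey_fst]
    · rw [AChart.pt, AChart.assemble_inr, ey_snd _ _ _ (by simp), Pi.single_apply]
      simp
  rw [ContinuousLinearMap.fderiv] at h2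
  have h4 : DifferentiableAt ℝ (fun k : Coord n m r => c.locChange c' k) k :=
    h1.comp k L.differentiableAt
  rw [fderiv_apply h4 A]
  change fderiv ℝ ((fun z => c'.ψ (c.ψ.symm z)) ∘ L) k (ey σ 0) A = _
  rw [h2, ContinuousLinearMap.comp_apply, h3]
  rfl

theorem _root_.HelmholtzSonin.Del_nil {r : ℕ} (σ : Fin m) (f : Coord n m r → ℝ) (k : Coord n m r) :
    Del σ [] f k = fderiv ℝ f k (ey σ 0) := by
  simp [Del]

/-- The transformation law `T_σ = 𝒥 P^α_σ T̄_α`. -/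
theorem IsHomogeneous.nonhom_change (hs : 1 ≤ s) (hT : T.IsHomogeneous) {t : ℕ} (hst : s ≤ t)
    {k : Coord n m t} (hk : k ∈ c.overlap c' t) (σ : Fin m) :
    T.nonhom c σ (truncate hst k)
      = c.J c' t k * ∑ α, c.P c' t α σ k * T.nonhom c' α (truncate hst (c.change c' t k)) := by
  have ht := hs.trans hst
  obtain ⟨γ, h, h', rfl⟩ := (AChart.mem_overlap_iff ht).mp hk
  have hb : c.coordGerm t γ ∈ c.baseOverlap c' t := by
    rw [AChart.overlap_eq ht] at hk; exact hk.1
  have e1 := hT.component_eq_nonhom hs h σ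
  -- The coordinate vector ∂/∂y^σ of the first chart is expanded in the coordinate vectors of the
  -- second; its components are the derivatives of x̄ⁱ and ȳ^α along ∂/∂y^σ.
  rw [component_eq, eq_sum_coordVec c'.isChart h'.1 (coordVec c.ψ _ _), map_sum] at e1
  simp only [map_smul, smul_eq_mul] at e1
  have hcomp : ∀ A, chartDeriv c'.ψ (γ.toFun 0) (coordVec c.ψ (c.e (Sum.inr σ)) (γ.toFun 0)) A
      = fderiv ℝ (fun k : Coord n m t => c.locChange c' k A) (c.coordGerm t γ) (ey σ 0) := by
    intro A
    rw [AChart.fderiv_locChange_ey hb, AChart.pt_coordGerm,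
      ← fderiv_transition c.isChart c'.isChart h.1 h'.1, chartDeriv_coordVec c.isChart h.1]
    rfl
  have hx : ∀ i, Del σ [] (c.xBar c' t i) (c.coordGerm t γ)
      = fderiv ℝ (fun k : Coord n m t => c.locChange c' k (c'.e (Sum.inl i))) (c.coordGerm t γ)
          (ey σ 0) := fun i => by
    rw [Del_nil, ((AChart.xBar_eqOn ht i).eventuallyEq_of_mem
      ((AChart.isOpen_overlap ht).mem_nhds hk)).fderiv_eq]
    rfl
  have hy : ∀ α, Del σ [] (c.yBar c' t α []) (c.coordGerm t γ)
      = fderiv ℝ (fun k : Coord n m t => c.locChange c' k (c'.e (Sum.inr α))) (c.coordGerm t γ)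
          (ey σ 0) := fun α => by
    rw [Del_nil, ((AChart.yBar_eqOn ht α [] (by simp)).eventuallyEq_of_mem
      ((AChart.isOpen_overlap ht).mem_nhds hk)).fderiv_eq]
    rfl
  have hyi : ∀ α i, c.yBar c' t α [i] (c.coordGerm t γ) = c'.yFun γ α [i] 0 := fun α i => by
    rw [AChart.yBar, AChart.change_coordGerm ht h h', dy_apply _ (by simpa using ht)]
    change c'.yFun γ α (sorted ({i} : Multiset (Fin n))) 0 = _
    rw [sorted, Multiset.sort_singleton]
  have hN : ∀ α, T.covec γ (coordVec c'.ψ (c'.e (Sum.inr α)) (γ.toFun 0))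
      = c'.detX γ * T.nonhom c' α (c'.coordGerm s γ) := fun α => by
    rw [← hT.component_eq_nonhom hs h' α, component_eq]
  simp only [hcomp] at e1
  rw [← c'.e.sum_comp, Fintype.sum_sum_type] at e1
  -- Replacing the x̄-components of 𝒯 by −ȳ^α_i 𝒯̄_α turns the coefficients of 𝒯̄_α into P^α_σ.
  simp only [hT.component_inl h', ← hx, ← hy, ← hyi, hN] at e1
  have hdet : c'.detX γ = c.J c' t (c.coordGerm t γ) * c.detX γ := by
    rw [AChart.detX_change ht h h'.1, AChart.J, AChart.Q_eq ht hk]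
  rw [AChart.change_coordGerm ht h h', AChart.truncate_coordGerm, AChart.truncate_coordGerm]
  apply mul_left_cancel₀ h.2
  rw [← e1, hdet]
  simp only [AChart.P, sub_mul, Finset.sum_sub_distrib, mul_neg, Finset.sum_neg_distrib,
    Finset.mul_sum, Finset.sum_mul, mul_sub]
  rw [Finset.sum_comm (s := Finset.univ (α := Fin n)), neg_add_eq_sub]
  congr 1
  · exact Finset.sum_congr rfl fun α _ => by ring
  · exact Finset.sum_congr rfl fun α _ => Finset.sum_congr rfl fun i _ => by ring

end DiffEq

/-! ## The linearization minus its formal adjoint -/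

section Helmholtz

variable {R : Type*} [CommRing R] {n m : ℕ}

theorem tupleSum_mem (N : AddSubgroup R) (k : ℕ) {g : List (Fin n) → R}
    (h : ∀ l, l.length = k → g l ∈ N) : tupleSum k g ∈ N := by
  rw [← sum_ofFn]
  exact N.sum_mem fun K _ => h _ (by simp)

theorem tupleSum_sub (k : ℕ) (g h : List (Fin n) → R) :
    tupleSum k (fun l => g l - h l) = tupleSum k g - tupleSum k h := by
  rw [← sum_ofFn, ← sum_ofFn, ← sum_ofFn, Finset.sum_sub_distrib]

variable [Algebra ℝ R]

/-- The operator `∑_{|I| ≤ s} A^I_{σν} d_I φ^ν`. -/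
def linOp (d : Fin n → Derivation ℝ R R) (s : ℕ) (A : Fin m → Fin m → List (Fin n) → R)
    (φ : Fin m → R) (σ : Fin m) : R :=
  ∑ j ∈ Finset.range (s + 1), ∑ ν, tupleSum j (fun l => A σ ν l * ders d l (φ ν))

/-- The coefficients of the formal adjoint of `linOp`. -/
def adjCoeff (d : Fin n → Derivation ℝ R R) (s : ℕ) (A : Fin m → Fin m → List (Fin n) → R)
    (σ ν : Fin m) (l : List (Fin n)) : R :=
  ∑ b ∈ Finset.range (s + 1 - l.length), tupleSum b (fun J =>
    (-1) ^ b * ((l.length + b).choose l.length : R) * ders d J (A ν σ (l ++ J)))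

/-- The coefficients of `linOp` minus its formal adjoint. -/
def helmCoeff (d : Fin n → Derivation ℝ R R) (s : ℕ) (A : Fin m → Fin m → List (Fin n) → R)
    (σ ν : Fin m) (l : List (Fin n)) : R :=
  A σ ν l - (-1) ^ l.length * adjCoeff d s A σ ν l

variable {d : Fin n → Derivation ℝ R R} (hd : ∀ i j f, d i (d j f) = d j (d i f))
  {C : Ideal R} {N : AddSubgroup R}

include hd in
/-- Integration by parts. -/
theorem linOp_sub_helmOp_mem (s : ℕ) {J : R} (hC : ∀ i, ∀ w ∈ C, d i w ∈ C)
    (hN : ∀ i, ∀ w ∈ C, J * d i w ∈ N) (A : Fin m → Fin m → List (Fin n) → R)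
    (hA : ∀ σ ν l l', l.Perm l' → A σ ν l = A σ ν l') (φ ψ : Fin m → R) (hψ : ∀ σ, ψ σ ∈ C) :
    J * (∑ σ, (linOp d s A φ σ * ψ σ - linOp d s A ψ σ * φ σ))
      - J * ∑ σ, linOp d s (helmCoeff d s A) φ σ * ψ σ ∈ N := by
  -- The adjoint is put back in the form ∑ (-1)^{|l|} d_l(A^l_{νσ} φ^ν), which is what integration
  -- by parts produces.
  have e1 : ∀ σ, linOp d s (helmCoeff d s A) φ σ = linOp d s A φ σ
      - ∑ ν, ∑ j ∈ Finset.range (s + 1),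
        tupleSum j (fun l => (-1) ^ l.length * ders d l (A ν σ l * φ ν)) := by
    intro σ
    have h1 : ∀ ν, ∑ j ∈ Finset.range (s + 1),
        tupleSum j (fun l => (-1) ^ l.length * ders d l (A ν σ l * φ ν))
        = ∑ j ∈ Finset.range (s + 1), tupleSum j (fun l =>
          (-1) ^ l.length * adjCoeff d s A σ ν l * ders d l (φ ν)) := fun ν =>
      sum_neg_one_pow_tupleSum_ders hd s (A ν σ) (hA ν σ) (φ ν)
    simp only [h1]
    rw [Finset.sum_comm, linOp, linOp, ← Finset.sum_sub_distrib]
    refine Finset.sum_congr rfl fun j _ => ?_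
    rw [← Finset.sum_sub_distrib]
    refine Finset.sum_congr rfl fun ν _ => ?_
    rw [← tupleSum_sub]
    simp only [helmCoeff, sub_mul]
  -- The terms (Lφ)_σ ψ^σ cancel. What remains is, tuple by tuple, the integration by parts of
  -- A^l_{σν} φ^σ against d_l ψ^ν, where only ψ has to lie in C.
  have e2 : J * (∑ σ, (linOp d s A φ σ * ψ σ - linOp d s A ψ σ * φ σ))
      - J * ∑ σ, linOp d s (helmCoeff d s A) φ σ * ψ σ
      = -∑ σ, ∑ ν, ∑ j ∈ Finset.range (s + 1), tupleSum j (fun l =>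
          J * (A σ ν l * φ σ * ders d l (ψ ν))
            - J * ((-1) ^ l.length * ders d l (A σ ν l * φ σ) * ψ ν)) := by
    simp only [e1, tupleSum_sub, Finset.sum_sub_distrib, sub_mul]
    rw [Finset.sum_comm (f := fun σ ν => ∑ j ∈ Finset.range (s + 1), tupleSum j (fun l =>
      J * ((-1) ^ l.length * ders d l (A σ ν l * φ σ) * ψ ν)))]
    have h2 : ∀ σ, linOp d s A ψ σ * φ σ = ∑ ν, ∑ j ∈ Finset.range (s + 1),
        tupleSum j (fun l => A σ ν l * φ σ * ders d l (ψ ν)) := by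
      intro σ
      rw [linOp, Finset.sum_comm, Finset.sum_mul]
      refine Finset.sum_congr rfl fun ν _ => ?_
      rw [Finset.sum_mul]
      refine Finset.sum_congr rfl fun j _ => ?_
      rw [tupleSum_mul]
      exact tupleSum_congr fun l _ => by ring
    simp only [h2, Finset.mul_sum, Finset.sum_mul, mul_tupleSum, tupleSum_mul, mul_sub]
    ring
  rw [e2]
  refine N.neg_mem (N.sum_mem fun σ _ => N.sum_mem fun ν _ => N.sum_mem fun j _ =>
    tupleSum_mem N j fun l _ => ?_)
  exact mul_ders_sub_mem hd hC hN l _ _ (hψ ν)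

variable {x : Fin n → R} {P : Matrix (Fin n) (Fin n) R}
  (hP : P * Matrix.of (fun l p => d p (x l)) = 1)

theorem delta_mul_apply (e : Derivation ℝ R R) (f g : R) :
    delta d P x e (f * g) = f * delta d P x e g + g * delta d P x e f := by
  rw [Derivation.leibniz, smul_eq_mul, smul_eq_mul]

include hP hd in
/-- The operator `linOp` minus its formal adjoint transforms by `𝒥 P^α_σ`, up to null elements. -/
theorem helmOp_change_mem (s : ℕ) {ea eb : Derivation ℝ R R}
    (hea : ∀ k f, ea (d k f) = d k (ea f)) (heb : ∀ k f, eb (d k f) = d k (eb f))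
    (hab : ∀ f, ea (eb f) = eb (ea f))
    (hC : ∀ i, ∀ w ∈ C, d i w ∈ C) (hN : ∀ i, ∀ w ∈ C, d i w ∈ N)
    {A B : Fin m → Fin m → List (Fin n) → R}
    (hA : ∀ σ ν l l', l.Perm l' → A σ ν l = A σ ν l')
    (hB : ∀ σ ν l l', l.Perm l' → B σ ν l = B σ ν l')
    {T G Y φ ψ : Fin m → R} {p : Fin m → Fin m → R}
    (hψa : ∀ σ, ea (ψ σ) = 0) (hφb : ∀ σ, eb (φ σ) = 0)
    (hT : ∀ σ, T σ = (Matrix.of (fun l p => d p (x l))).det * ∑ α, p α σ * G α)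
    (hYa : ∀ α, ∑ σ, p α σ * φ σ = delta d P x ea (Y α))
    (hYb : ∀ α, ∑ σ, p α σ * ψ σ = delta d P x eb (Y α))
    (hTa : ∀ σ, ea (T σ) = linOp d s A φ σ) (hTb : ∀ σ, eb (T σ) = linOp d s A ψ σ)
    (hGa : ∀ α, delta d P x ea (G α)
      = linOp (dbar d P) s B (fun β => delta d P x ea (Y β)) α)
    (hGb : ∀ α, delta d P x eb (G α)
      = linOp (dbar d P) s B (fun β => delta d P x eb (Y β)) α)
    (hψC : ∀ σ, ψ σ ∈ C) (hxC : ∀ i, eb (x i) ∈ C) :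
    ∑ σ, (linOp d s (helmCoeff d s A) φ σ
      - (Matrix.of (fun l p => d p (x l))).det * ∑ α, p α σ *
          linOp (dbar d P) s (helmCoeff (dbar d P) s B) (fun β => delta d P x ea (Y β)) α)
        * ψ σ ∈ N := by
  set J := (Matrix.of (fun l p => d p (x l))).det with hJ
  set φ' : Fin m → R := fun β => delta d P x ea (Y β) with hφ'
  set ψ' : Fin m → R := fun β => delta d P x eb (Y β) with hψ'
  have hψ'C : ∀ α, ψ' α ∈ C := fun α => by
    rw [hψ']
    change delta d P x eb (Y α) ∈ C
    rw [← hYb]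
    exact C.sum_mem fun σ _ => C.mul_mem_left _ (hψC σ)
  have hCb : ∀ i, ∀ w ∈ C, dbar d P i w ∈ C := fun i w hw => by
    rw [dbar_apply]
    exact C.sum_mem fun k _ => C.mul_mem_left _ (hC k w hw)
  have hNb : ∀ i, ∀ w ∈ C, J * dbar d P i w ∈ N := fun i w hw => by
    rw [jacobian_mul_dbar hP hd]
    exact N.sum_mem fun k _ => hN k _ (C.mul_mem_left _ hw)
  have h1 := linOp_sub_helmOp_mem hd s (J := 1) hC (by simpa using hN) A hA φ ψ hψC
  have h2 := linOp_sub_helmOp_mem (dbar_comm hP hd) s hCb hNb B hB φ' ψ' hψ'C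
  -- the 1-form `∑ T_σ dy^σ` on the variations
  have eθ : ∀ u u' : Fin m → R, (∀ α, ∑ σ, p α σ * u σ = u' α) →
      ∑ σ, T σ * u σ = J * ∑ α, G α * u' α := by
    intro u u' hu
    simp only [hT, ← hu, Finset.mul_sum, Finset.sum_mul]
    rw [Finset.sum_comm]
    exact Finset.sum_congr rfl fun α _ => Finset.sum_congr rfl fun σ _ => by ring
  -- In the first chart ψ does not depend on the parameter of ea, nor φ on that of eb, so only T is
  -- differentiated.
  have e1 : ∑ σ, (linOp d s A φ σ * ψ σ - linOp d s A ψ σ * φ σ)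
      = ea (∑ σ, T σ * ψ σ) - eb (∑ σ, T σ * φ σ) := by
    rw [map_sum, map_sum, ← Finset.sum_sub_distrib]
    refine Finset.sum_congr rfl fun σ _ => ?_
    simp only [Derivation.leibniz, smul_eq_mul, hψa, hφb, hTa, hTb]
    ring
  -- In the second chart the variations δȳ depend on both parameters, but δ_a δ_b ȳ = δ_b δ_a ȳ, so
  -- the terms with undifferentiated G cancel in the antisymmetrization.
  have e2 : delta d P x ea (∑ α, G α * ψ' α) - delta d P x eb (∑ α, G α * φ' α)
      = ∑ α, (linOp (dbar d P) s B φ' α * ψ' α - linOp (dbar d P) s B ψ' α * φ' α) := by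
    rw [map_sum, map_sum, ← Finset.sum_sub_distrib]
    refine Finset.sum_congr rfl fun α _ => ?_
    rw [delta_mul_apply, delta_mul_apply, hGa, hGb,
      delta_delta_comm hP hd hea heb hab (Y α)]
    ring
  have e3 : ea (∑ σ, T σ * ψ σ) - eb (∑ σ, T σ * φ σ)
      = J * ∑ α, (linOp (dbar d P) s B φ' α * ψ' α - linOp (dbar d P) s B ψ' α * φ' α)
        + ∑ i, J * dbar d P i (ea (x i) * (∑ α, G α * ψ' α) - eb (x i) * ∑ α, G α * φ' α) := by
    rw [eθ ψ ψ' hYb, eθ φ φ' hYa, derivation_jacobian_mul hP hea, derivation_jacobian_mul hP heb,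
      ← e2]
    simp only [map_sub, mul_sub, Finset.sum_sub_distrib]
    ring
  -- The divergence correction is null: its first part contains δ_b ȳ and its second part eb(x̄ⁱ),
  -- both of which lie in C. Nothing is required of the supports of φ or δ_a ȳ.
  have h3 : ∑ i, J * dbar d P i (ea (x i) * (∑ α, G α * ψ' α) - eb (x i) * ∑ α, G α * φ' α)
      ∈ N := N.sum_mem fun i _ => hNb i _ (C.sub_mem
        (C.mul_mem_left _ (C.sum_mem fun α _ => C.mul_mem_left _ (hψ'C α)))
        (C.mul_mem_right _ (hxC i)))
  have e4 : ∑ σ, (J * ∑ α, p α σ * linOp (dbar d P) s (helmCoeff (dbar d P) s B) φ' α) * ψ σ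
      = J * ∑ α, linOp (dbar d P) s (helmCoeff (dbar d P) s B) φ' α * ψ' α := by
    simp only [hψ', ← hYb, Finset.mul_sum, Finset.sum_mul]
    rw [Finset.sum_comm]
    exact Finset.sum_congr rfl fun α _ => Finset.sum_congr rfl fun σ _ => by ring
  simp only [sub_mul, Finset.sum_sub_distrib]
  rw [e4]
  have := N.sub_mem (N.add_mem h2 h3) h1
  rw [one_mul, one_mul, e1, e3] at this
  convert this using 1
  ring

end Helmholtz

/-! ### The operators Δ and vertical derivatives -/

section Order

variable {n m r : ℕ}

theorem Del_eq (σ : Fin m) (l : List (Fin n)) (f : Coord n m r → ℝ) :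
    Del σ l f = fun k => weight l * fderiv ℝ f k (ey σ (l : Multiset (Fin n))) := rfl

theorem Del_perm (σ : Fin m) {l l' : List (Fin n)} (h : l.Perm l') (f : Coord n m r → ℝ) :
    Del σ l f = Del σ l' f := by
  rw [Del_eq, Del_eq, weight_eq_of_perm h, Multiset.coe_eq_coe.mpr h]

theorem contDiffOn_Del {U : Set (Coord n m r)} (hU : IsOpen U) {f : Coord n m r → ℝ}
    (hf : ContDiffOn ℝ ∞ f U) (σ : Fin m) (l : List (Fin n)) : ContDiffOn ℝ ∞ (Del σ l f) U :=
  contDiffOn_const.mul (contDiffOn_fderiv_apply hU hf contDiffOn_const)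

theorem OrderLE.Del {q : ℕ} {U : Set (Coord n m r)} (hU : IsOpen U) {f : Coord n m r → ℝ}
    (hf : ContDiffOn ℝ ∞ f U) (h : OrderLE q U f) (σ : Fin m) (l : List (Fin n)) :
    OrderLE q U (Del σ l f) := fun k hk τ J hJ => by
  have hk' := hU.mem_nhds hk
  have h1 : DifferentiableAt ℝ
      (fun k => fderiv ℝ f k (ey σ (l : Multiset (Fin n)))) k :=
    ((contDiffOn_fderiv_apply hU hf (contDiffOn_const (c := ey σ (l : Multiset (Fin n))))).contDiffAt
      hk').differentiableAt (by simp)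
  rw [Del_eq, fderiv_const_mul h1, smul_apply,
    fderiv_fderiv_comm (hf.contDiffAt hk')]
  have h2 : (fun y => fderiv ℝ f y (ey τ J)) =ᶠ[𝓝 k] fun _ => 0 := by
    filter_upwards [hk'] with y hy
    exact h y hy τ J hJ
  rw [h2.fderiv_eq]
  simp

/-- The weights in Δ^I_σ are the reciprocals of the numbers of orderings, so the sum over
multi-indices of ∂f/∂y^σ_I becomes a sum over tuples; tuples longer than the order of f contribute
nothing. -/
theorem fderiv_vertical {q : ℕ} (hq : q ≤ r) {f : Coord n m r → ℝ} {k : Coord n m r}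
    (hf : ∀ (σ : Fin m) (I : Multiset (Fin n)), q < I.card → fderiv ℝ f k (ey σ I) = 0)
    (w : Fin m → Multiset (Fin n) → ℝ) :
    fderiv ℝ f k (0, fun σ I => w σ I.1)
      = ∑ j ∈ Finset.range (q + 1), ∑ σ, tupleSum j (fun l => Del σ l f k * w σ l) := by
  rw [eq_sum_ey, map_sum]
  have h1 : ∀ σ, fderiv ℝ f k (∑ I : MIdx n r, w σ I.1 • (ey σ I.1 : Coord n m r))
      = ∑ j ∈ Finset.range (r + 1), tupleSum j (fun l => Del σ l f k * w σ l) := by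
    intro σ
    rw [map_sum]
    simp only [map_smul, smul_eq_mul]
    rw [sum_midx_eq_tupleSum (fun I => w σ I * fderiv ℝ f k (ey σ I))]
    refine Finset.sum_congr rfl fun j _ => tupleSum_congr fun l _ => ?_
    rw [Del_eq]
    ring
  simp only [h1]
  rw [Finset.sum_comm]
  symm
  refine Finset.sum_subset (Finset.range_mono (by omega)) fun j _ hj => ?_
  refine Finset.sum_eq_zero fun σ _ => ?_
  rw [← tupleSum_zero (n := n) j]
  refine tupleSum_congr fun l hl => ?_
  rw [Del_eq]
  simp only
  rw [hf σ _ (by simp at hj ⊢; omega)]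
  ring

end Order

/-! ### Jets of families of sections -/

section JetFrame

variable {E : Type*} [NormedAddCommGroup E] [NormedSpace ℝ E] {V : TopologicalSpace.Opens E}

/-- A derivation given by a vector field. -/
def IsDir (e : Derivation ℝ (SmoothRing V) (SmoothRing V)) : Prop :=
  ∃ w : V → E, ∀ f z, (e f).1 z = fderiv ℝ (extendZero V f.1) z (w z)

theorem isDir_deriv (v : E) : IsDir (SmoothRing.deriv v : Derivation ℝ (SmoothRing V) _) :=
  ⟨fun _ => v, fun f z => SmoothRing.deriv_apply' v f z⟩

theorem IsDir.sum {ι : Type*} (t : Finset ι) {e : ι → Derivation ℝ (SmoothRing V) (SmoothRing V)}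
    (he : ∀ i, IsDir (e i)) (a : ι → SmoothRing V) {e' : Derivation ℝ (SmoothRing V) (SmoothRing V)}
    (h : ∀ f, e' f = ∑ i ∈ t, a i * e i f) : IsDir e' := by
  choose w hw using he
  refine ⟨fun z => ∑ i ∈ t, (a i).1 z • w i z, fun f z => ?_⟩
  rw [h, ← SmoothRing.eval_apply, map_sum, map_sum]
  refine Finset.sum_congr rfl fun i _ => ?_
  rw [map_mul, map_smul, SmoothRing.eval_apply, SmoothRing.eval_apply, hw, smul_eq_mul]

theorem IsDir.dbar {n : ℕ} {d : Fin n → Derivation ℝ (SmoothRing V) (SmoothRing V)}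
    (hd : ∀ i, IsDir (d i)) (P : Matrix (Fin n) (Fin n) (SmoothRing V)) (i : Fin n) :
    IsDir (dbar d P i) :=
  IsDir.sum Finset.univ hd (fun k => P k i) fun f => dbar_apply d P i f

theorem IsDir.delta {n : ℕ} {d : Fin n → Derivation ℝ (SmoothRing V) (SmoothRing V)}
    (hd : ∀ i, IsDir (d i)) (P : Matrix (Fin n) (Fin n) (SmoothRing V)) (x : Fin n → SmoothRing V)
    {e : Derivation ℝ (SmoothRing V) (SmoothRing V)} (he : IsDir e) :
    IsDir (delta d P x e) := by
  obtain ⟨w, hw⟩ := he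
  choose u hu using fun i => IsDir.dbar hd P i
  refine ⟨fun z => w z - ∑ i, (e (x i)).1 z • u i z, fun f z => ?_⟩
  rw [delta_apply, ← SmoothRing.eval_apply, map_sub, map_sub, map_sum, map_sum,
    SmoothRing.eval_apply, hw]
  congr 1
  refine Finset.sum_congr rfl fun i _ => ?_
  rw [map_mul, map_smul, SmoothRing.eval_apply, SmoothRing.eval_apply, hu, smul_eq_mul]

variable {n m r : ℕ}

/-- A family of jets `κ` of sections, together with the derivations along the sections. -/
structure JetFrame (V : TopologicalSpace.Opens E) (U : Set (Coord n m r)) (κ : E → Coord n m r)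
    (d : Fin n → Derivation ℝ (SmoothRing V) (SmoothRing V)) (X : Fin n → SmoothRing V)
    (Y : Fin m → SmoothRing V) : Prop where
  isOpen : IsOpen U
  smooth : ContDiffOn ℝ ∞ κ V
  mem : ∀ z ∈ V, κ z ∈ U
  x_apply : ∀ i (z : V), (X i).1 z = (κ z).1 i
  y_apply : ∀ σ l, l.length ≤ r → ∀ z : V,
    (ders d l (Y σ)).1 z = dy σ (l : Multiset (Fin n)) (κ z)
  dir : ∀ i, IsDir (d i)
  d_x : ∀ i l, d i (X l) = if l = i then 1 else 0

namespace JetFrame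

variable {U : Set (Coord n m r)} {κ : E → Coord n m r}
  {d : Fin n → Derivation ℝ (SmoothRing V) (SmoothRing V)} {X : Fin n → SmoothRing V}
  {Y : Fin m → SmoothRing V} (h : JetFrame V U κ d X Y)

include h

/-- The pull-back of a function on jets to the parameters of the family. -/
def pull {f : Coord n m r → ℝ} (hf : ContDiffOn ℝ ∞ f U) : SmoothRing V :=
  SmoothRing.of (fun z => f (κ z)) (hf.comp h.smooth h.mem)

theorem pull_apply {f : Coord n m r → ℝ} (hf : ContDiffOn ℝ ∞ f U) (z : V) :
    (h.pull hf).1 z = f (κ z) := rfl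

theorem chain {f : Coord n m r → ℝ} (hf : ContDiffOn ℝ ∞ f U) {F : SmoothRing V}
    (hF : ∀ z : V, F.1 z = f (κ z)) {e : Derivation ℝ (SmoothRing V) (SmoothRing V)}
    (he : IsDir e) (z : V) :
    (e F).1 z = fderiv ℝ f (κ z)
      (fun i => (e (X i)).1 z, fun σ I => (e (ders d (sorted I.1) (Y σ))).1 z) := by
  obtain ⟨w, hw⟩ := he
  have hκ : DifferentiableAt ℝ κ z :=
    (h.smooth.contDiffAt (V.isOpen.mem_nhds z.2)).differentiableAt (by simp)
  have hfd : DifferentiableAt ℝ f (κ z) :=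
    (hf.contDiffAt (h.isOpen.mem_nhds (h.mem z z.2))).differentiableAt (by simp)
  have key : ∀ {F : SmoothRing V} {g : Coord n m r → ℝ} (_ : ∀ z : V, F.1 z = g (κ z))
      (_ : DifferentiableAt ℝ g (κ z)), (e F).1 z = fderiv ℝ g (κ z) (fderiv ℝ κ z (w z)) := by
    intro F g hF hg
    rw [hw, (SmoothRing.extendZero_eventuallyEq F (g := fun z => g (κ z)) hF z).fderiv_eq,
      fderiv_fun_comp (z : E) hg hκ]
    rfl
  rw [key hF hfd]
  congr 1
  refine Prod.ext (funext fun i => ?_) (funext fun σ => funext fun I => ?_)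
  · let L : Coord n m r →L[ℝ] ℝ := LinearMap.toContinuousLinearMap (dx i)
    refine Eq.symm ((key (g := L) (fun z => h.x_apply i z) L.differentiableAt).trans ?_)
    rw [L.fderiv]
    rfl
  · let L : Coord n m r →L[ℝ] ℝ := LinearMap.toContinuousLinearMap (dy σ I.1)
    have hl : (sorted I.1).length ≤ r := by simpa [sorted] using I.2
    have hI : ((sorted I.1 : List (Fin n)) : Multiset (Fin n)) = I.1 := Multiset.sort_eq _ _
    refine Eq.symm ((key (g := L) (fun z => (h.y_apply σ _ hl z).trans (by rw [hI]; rfl))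
      L.differentiableAt).trans ?_)
    rw [L.fderiv]
    exact dy_apply σ I.2 _

/-- The family is holonomic: d_i of the coordinate y_I is y_{iI}. This holds only for |I| < r, hence
the order of f must be below r for d_i to act as D_i. -/
theorem d_apply {q : ℕ} (hq : q < r) {f : Coord n m r → ℝ} (hf : ContDiffOn ℝ ∞ f U)
    (ho : OrderLE q U f) {F : SmoothRing V} (hF : ∀ z : V, F.1 z = f (κ z)) (i : Fin n) (z : V) :
    (d i F).1 z = D i f (κ z) := by
  have e1 : ∀ l, (d i (X l)).1 z = if l = i then 1 else 0 := fun l => by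
    rw [h.d_x]
    split_ifs <;> rfl
  rw [h.chain hf hF (h.dir i), fderiv_eq_sum_D hq (ho _ (h.mem z z.2))]
  · simp [e1]
  · intro σ I hI
    simp only [e1, ite_mul, one_mul, zero_mul, Finset.sum_ite_eq', Finset.mem_univ, if_true]
    have hl : (i :: sorted I.1).length ≤ r := by
      have : (sorted I.1).length = I.1.card := by simp [sorted]
      simp only [List.length_cons]; omega
    have := h.y_apply σ (i :: sorted I.1) hl z
    rw [ders] at this
    rw [this, ← Multiset.cons_coe]
    congr 2
    exact congrArg _ (Multiset.sort_eq _ _)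

theorem contDiffOn_Ds {f : Coord n m r → ℝ} (hf : ContDiffOn ℝ ∞ f U) (l : List (Fin n)) :
    ContDiffOn ℝ ∞ (Ds l f) U := by
  induction l with
  | nil => exact hf
  | cons j l ih => exact contDiffOn_D h.isOpen ih j

theorem orderLE_Ds {q : ℕ} {f : Coord n m r → ℝ} (hf : ContDiffOn ℝ ∞ f U)
    (ho : OrderLE q U f) (l : List (Fin n)) : OrderLE (q + l.length) U (Ds l f) := by
  induction l with
  | nil => exact ho
  | cons j l ih =>
    exact OrderLE.mono (by simp only [List.length_cons]; omega)
      (OrderLE.D h.isOpen (h.contDiffOn_Ds hf l) ih j)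

theorem ders_apply {q : ℕ} {f : Coord n m r → ℝ} (hf : ContDiffOn ℝ ∞ f U)
    (ho : OrderLE q U f) {F : SmoothRing V} (hF : ∀ z : V, F.1 z = f (κ z)) (l : List (Fin n))
    (hl : q + l.length ≤ r) (z : V) : (ders d l F).1 z = Ds l f (κ z) := by
  induction l generalizing z with
  | nil => exact hF z
  | cons j l ih =>
    have hl' : q + l.length < r := by simp only [List.length_cons] at hl; omega
    exact h.d_apply hl' (h.contDiffOn_Ds hf l) (h.orderLE_Ds hf ho l) (ih hl'.le) j z

theorem vert_apply {f : Coord n m r → ℝ} (hf : ContDiffOn ℝ ∞ f U) {F : SmoothRing V}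
    (hF : ∀ z : V, F.1 z = f (κ z)) {e : Derivation ℝ (SmoothRing V) (SmoothRing V)}
    (he : IsDir e) (hx : ∀ i, e (X i) = 0) (hc : ∀ i f, e (d i f) = d i (e f)) (z : V) :
    (e F).1 z = fderiv ℝ f (κ z) (0, fun σ I => (ders d (sorted I.1) (e (Y σ))).1 z) := by
  rw [h.chain hf hF he]
  congr 1
  refine Prod.ext (funext fun i => ?_) (funext fun σ => funext fun I => ?_)
  · simp only [hx]; rfl
  · simp only [ders_comm hc]

/-- A derivation e that fixes x and commutes with the d_i has d_I e(y^σ) as its effect on y^σ_I. Its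
effect on f is thus the linearization of f along the family, with coefficients Δ^I_σ f, applied to
e(y). -/
theorem vert_eq (hdc : ∀ i j f, d i (d j f) = d j (d i f)) {q : ℕ} (hq : q ≤ r)
    {f : Coord n m r → ℝ} (hf : ContDiffOn ℝ ∞ f U) (ho : OrderLE q U f) {F : SmoothRing V}
    (hF : ∀ z : V, F.1 z = f (κ z)) {e : Derivation ℝ (SmoothRing V) (SmoothRing V)}
    (he : IsDir e) (hx : ∀ i, e (X i) = 0) (hc : ∀ i f, e (d i f) = d i (e f)) :
    e F = ∑ j ∈ Finset.range (q + 1), ∑ σ, tupleSum j (fun l =>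
      h.pull (contDiffOn_Del h.isOpen hf σ l) * ders d l (e (Y σ))) := by
  refine SmoothRing.ext' fun z => ?_
  rw [h.vert_apply hf hF he hx hc,
    fderiv_vertical hq (ho _ (h.mem z z.2)) (fun σ I => (ders d (sorted I) (e (Y σ))).1 z),
    ← SmoothRing.eval_apply, map_sum]
  refine Finset.sum_congr rfl fun j _ => ?_
  rw [map_sum]
  refine Finset.sum_congr rfl fun σ _ => ?_
  rw [map_tupleSum]
  refine tupleSum_congr fun l _ => ?_
  rw [map_mul, SmoothRing.eval_apply, SmoothRing.eval_apply, h.pull_apply]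
  congr 1
  refine congrArg (fun F : SmoothRing V => F.1 z) (ders_perm hdc ?_ _)
  rw [← Multiset.coe_eq_coe]
  exact Multiset.sort_eq _ _

/-- The coefficients `H^I_{σν}`, along the family. -/
theorem helmCoeff_apply {s : ℕ} (hst : 2 * s ≤ r) {f : Fin m → Coord n m r → ℝ}
    (hf : ∀ σ, ContDiffOn ℝ ∞ (f σ) U) (ho : ∀ σ, OrderLE s U (f σ)) (σ ν : Fin m)
    (l : List (Fin n)) (z : V) :
    (helmCoeff d s (fun σ ν l => h.pull (contDiffOn_Del h.isOpen (hf σ) ν l)) σ ν l).1 z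
      = Del ν l (f σ) (κ z) - (-1 : ℝ) ^ l.length * lieEuler s σ l (f ν) (κ z) := by
  rw [helmCoeff, ← SmoothRing.eval_apply, map_sub, map_mul, map_pow, map_neg, map_one,
    SmoothRing.eval_apply, h.pull_apply]
  congr 2
  rw [adjCoeff, map_sum, lieEuler]
  refine Finset.sum_congr rfl fun b hb => ?_
  rw [map_tupleSum, sum_ofFn b (fun J => (-1 : ℝ) ^ b * ((l.length + b).choose l.length : ℝ)
      * Ds J (Del σ (l ++ J) (f ν)) (κ z))]
  refine tupleSum_congr fun J hJ => ?_
  rw [map_mul, map_mul, map_pow, map_neg, map_one, map_natCast, SmoothRing.eval_apply,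
    h.ders_apply (contDiffOn_Del h.isOpen (hf ν) σ (l ++ J)) (OrderLE.Del h.isOpen (hf ν) (ho ν) σ _)
      (fun z => h.pull_apply _ z) J]
  -- Here 2s ≤ r enters: Δ T_ν has order at most s and up to s total derivatives are applied to it.
  rw [Finset.mem_range] at hb
  omega

end JetFrame
end JetFrame

section Slice

variable {n : ℕ} {G : Type*} [NormedAddCommGroup G] [NormedSpace ℝ G]
  {V : TopologicalSpace.Opens ((Fin n → ℝ) × G)}

/-! ## Null elements: total divergences integrate to zero -/

/-- The restriction of a function of parameters to the slice `(x, 0)`. -/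
def slice (f : SmoothRing V) (x : Fin n → ℝ) : ℝ := extendZero V f.1 (x, 0)

theorem extendZero_of_notMem {E : Type*} [NormedAddCommGroup E] (V : TopologicalSpace.Opens E)
    (f : V → ℝ) {x : E} (hx : x ∉ V) : extendZero V f x = 0 := by
  rw [extendZero, dif_neg hx]

theorem slice_of_mem (f : SmoothRing V) {x : Fin n → ℝ} (hx : (x, (0 : G)) ∈ V) :
    slice f x = f.1 ⟨(x, 0), hx⟩ := extendZero_of_mem f.1 hx

theorem slice_of_notMem (f : SmoothRing V) {x : Fin n → ℝ} (hx : (x, (0 : G)) ∉ V) :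
    slice f x = 0 := extendZero_of_notMem V f.1 hx

theorem slice_add (f g : SmoothRing V) (x : Fin n → ℝ) : slice (f + g) x = slice f x + slice g x := by
  by_cases hx : (x, (0 : G)) ∈ V
  · simp only [slice_of_mem _ hx]; rfl
  · simp only [slice_of_notMem _ hx, add_zero]

theorem slice_mul (f g : SmoothRing V) (x : Fin n → ℝ) : slice (f * g) x = slice f x * slice g x := by
  by_cases hx : (x, (0 : G)) ∈ V
  · simp only [slice_of_mem _ hx]; rfl
  · simp only [slice_of_notMem _ hx, mul_zero]

theorem slice_neg (f : SmoothRing V) (x : Fin n → ℝ) : slice (-f) x = -slice f x := by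
  by_cases hx : (x, (0 : G)) ∈ V
  · simp only [slice_of_mem _ hx]; rfl
  · simp only [slice_of_notMem _ hx, neg_zero]

theorem slice_zero (x : Fin n → ℝ) : slice (0 : SmoothRing V) x = 0 := by
  by_cases hx : (x, (0 : G)) ∈ V
  · rw [slice_of_mem _ hx]; rfl
  · rw [slice_of_notMem _ hx]

variable (V) in
/-- Functions whose slice has compact support. -/
def sliceIdeal : Ideal (SmoothRing V) where
  carrier := {f | ∃ Z : Set (Fin n → ℝ), IsCompact Z ∧ (∀ x ∈ Z, (x, (0 : G)) ∈ V) ∧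
    ∀ x ∉ Z, slice f x = 0}
  add_mem' := by
    rintro f g ⟨Z, h1, h2, h3⟩ ⟨Z', h1', h2', h3'⟩
    refine ⟨Z ∪ Z', h1.union h1', ?_, fun x hx => ?_⟩
    · rintro x (hx | hx)
      exacts [h2 x hx, h2' x hx]
    · rw [slice_add, h3 x fun h => hx (.inl h), h3' x fun h => hx (.inr h), add_zero]
  zero_mem' := ⟨∅, isCompact_empty, fun x hx => hx.elim, fun x _ => slice_zero x⟩
  smul_mem' := by
    rintro f g ⟨Z, h1, h2, h3⟩
    exact ⟨Z, h1, h2, fun x hx => by rw [smul_eq_mul, slice_mul, h3 x hx, mul_zero]⟩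

theorem contDiffAt_slice (f : SmoothRing V) {x : Fin n → ℝ} (hx : (x, (0 : G)) ∈ V) :
    ContDiffAt ℝ ∞ (slice f) x :=
  (SmoothRing.contDiffAt f ⟨(x, 0), hx⟩).comp x (contDiffAt_id.prodMk contDiffAt_const)

/-- The compact set is required to lie inside the slice of V: there the function is smooth, and on
its open complement the extension is zero. -/
theorem slice_smooth_of_mem {f : SmoothRing V} (hf : f ∈ sliceIdeal V) :
    ContDiff ℝ ∞ (slice f) ∧ HasCompactSupport (slice f) := by
  obtain ⟨Z, h1, h2, h3⟩ := hf
  refine ⟨contDiff_iff_contDiffAt.mpr fun x => ?_, HasCompactSupport.intro h1 h3⟩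
  by_cases hx : x ∈ Z
  · exact contDiffAt_slice f (h2 x hx)
  · refine (contDiffAt_const (c := (0 : ℝ))).congr_of_eventuallyEq ?_
    filter_upwards [h1.isClosed.isOpen_compl.mem_nhds hx] with y hy
    exact h3 y hy

open MeasureTheory in
theorem integrable_slice {f : SmoothRing V} (hf : f ∈ sliceIdeal V) : Integrable (slice f) :=
  (slice_smooth_of_mem hf).1.continuous.integrable_of_hasCompactSupport (slice_smooth_of_mem hf).2

open MeasureTheory in
variable (V) in
/-- Functions whose slice has compact support and integral zero. -/
def sliceNull : AddSubgroup (SmoothRing V) where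
  carrier := {f | f ∈ sliceIdeal V ∧ ∫ x, slice f x = 0}
  add_mem' := by
    rintro f g ⟨h1, h2⟩ ⟨h1', h2'⟩
    refine ⟨add_mem h1 h1', ?_⟩
    simp only [slice_add]
    rw [integral_add (integrable_slice h1) (integrable_slice h1'), h2, h2', add_zero]
  zero_mem' := ⟨zero_mem _, by simp only [slice_zero, integral_zero]⟩
  neg_mem' := by
    rintro f ⟨h1, h2⟩
    refine ⟨neg_mem h1, ?_⟩
    simp only [slice_neg]
    rw [integral_neg, h2, neg_zero]

/-- The derivation `∂_i` on functions of the parameters. -/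
def paramDeriv (V : TopologicalSpace.Opens ((Fin n → ℝ) × G)) (i : Fin n) :
    Derivation ℝ (SmoothRing V) (SmoothRing V) := SmoothRing.deriv (Pi.single i 1, 0)

theorem slice_paramDeriv_of_mem (f : SmoothRing V) (i : Fin n) {x : Fin n → ℝ}
    (hx : (x, (0 : G)) ∈ V) : slice (paramDeriv V i f) x = pderiv i (slice f) x := by
  have h1 := (SmoothRing.differentiableAt f ⟨(x, 0), hx⟩)
  have h2 := HasFDerivAt.comp x (f := fun y : Fin n → ℝ => (y, (0 : G))) h1.hasFDerivAt
    (hasFDerivAt_prodMk_left x (0 : G))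
  rw [slice_of_mem _ hx, paramDeriv, SmoothRing.deriv_apply']
  change _ = fderiv ℝ (extendZero V f.1 ∘ fun x => (x, (0 : G))) x (Pi.single i 1)
  rw [h2.fderiv]
  rfl

theorem slice_paramDeriv {f : SmoothRing V} (hf : f ∈ sliceIdeal V) (i : Fin n) :
    slice (paramDeriv V i f) = pderiv i (slice f) := by
  funext x
  by_cases hx : (x, (0 : G)) ∈ V
  · exact slice_paramDeriv_of_mem f i hx
  · obtain ⟨Z, h1, h2, h3⟩ := hf
    have hxZ : x ∉ Z := fun h => hx (h2 x h)
    have : slice f =ᶠ[𝓝 x] fun _ => 0 := by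
      filter_upwards [h1.isClosed.isOpen_compl.mem_nhds hxZ] with y hy
      exact h3 y hy
    rw [slice_of_notMem _ hx, pderiv, this.fderiv_eq]
    simp

theorem paramDeriv_mem {f : SmoothRing V} (hf : f ∈ sliceIdeal V) (i : Fin n) :
    paramDeriv V i f ∈ sliceIdeal V := by
  have hf' := hf
  obtain ⟨Z, h1, h2, h3⟩ := hf'
  refine ⟨Z, h1, h2, fun x hx => ?_⟩
  have : slice f =ᶠ[𝓝 x] fun _ => 0 := by
    filter_upwards [h1.isClosed.isOpen_compl.mem_nhds hx] with y hy
    exact h3 y hy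
  rw [slice_paramDeriv hf, pderiv, this.fderiv_eq]
  simp

open MeasureTheory in
theorem paramDeriv_mem_null {f : SmoothRing V} (hf : f ∈ sliceIdeal V) (i : Fin n) :
    paramDeriv V i f ∈ sliceNull V := by
  refine ⟨paramDeriv_mem hf i, ?_⟩
  have h1 := integrable_slice hf
  have h2 := integrable_slice (paramDeriv_mem hf i)
  rw [slice_paramDeriv hf] at h2 ⊢
  change Integrable (fun x => fderiv ℝ (slice f) x (Pi.single i 1)) at h2
  change ∫ x, fderiv ℝ (slice f) x (Pi.single i 1) = 0
  -- Integration by parts against the constant function 1 shows that a derivative of a compactly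
  -- supported function has integral zero.
  have h3 := integral_mul_fderiv_eq_neg_fderiv_mul_of_integrable (μ := volume)
    (f := fun _ : Fin n → ℝ => (1 : ℝ)) (g := slice f) (v := Pi.single i 1)
    (by simp) (by simpa using h2) (by simpa using h1) (fun _ _ => differentiableAt_const _)
    (fun x _ => (slice_smooth_of_mem hf).1.differentiable (by simp) x)
  simpa using h3

end Slice

section Variation

variable {n m r : ℕ}

/-! ## Two-parameter variations of a section -/

/-- The jets of the sections `u + aφ + bψ`. -/
def variation (r : ℕ) (u φ ψ : Fin m → (Fin n → ℝ) → ℝ) (z : (Fin n → ℝ) × ℝ × ℝ) : Coord n m r :=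
  (z.1, fun σ I => pderivs (sorted I.1) (u σ) z.1 + z.2.1 * pderivs (sorted I.1) (φ σ) z.1
    + z.2.2 * pderivs (sorted I.1) (ψ σ) z.1)

theorem contDiff_pderivs {f : (Fin n → ℝ) → ℝ} (hf : ContDiff ℝ ∞ f) (l : List (Fin n)) :
    ContDiff ℝ ∞ (pderivs l f) :=
  contDiff_iff_contDiffAt.mpr fun _ => contDiffAt_pderivs hf.contDiffAt l

theorem pderivs_perm_of_contDiff {f : (Fin n → ℝ) → ℝ} (hf : ContDiff ℝ ∞ f)
    {l l' : List (Fin n)} (h : l.Perm l') : pderivs l f = pderivs l' f :=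
  funext fun _ => pderivs_perm isOpen_univ hf.contDiffOn h (Set.mem_univ _)

theorem contDiff_affine {A B C : (Fin n → ℝ) → ℝ} (hA : ContDiff ℝ ∞ A) (hB : ContDiff ℝ ∞ B)
    (hC : ContDiff ℝ ∞ C) :
    ContDiff ℝ ∞ (fun z : (Fin n → ℝ) × ℝ × ℝ => A z.1 + z.2.1 * B z.1 + z.2.2 * C z.1) := by
  fun_prop

theorem fderiv_affine {A B C : (Fin n → ℝ) → ℝ} (hA : Differentiable ℝ A) (hB : Differentiable ℝ B)
    (hC : Differentiable ℝ C) (z v : (Fin n → ℝ) × ℝ × ℝ) :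
    fderiv ℝ (fun z : (Fin n → ℝ) × ℝ × ℝ => A z.1 + z.2.1 * B z.1 + z.2.2 * C z.1) z v
      = fderiv ℝ A z.1 v.1 + (z.2.1 * fderiv ℝ B z.1 v.1 + v.2.1 * B z.1)
        + (z.2.2 * fderiv ℝ C z.1 v.1 + v.2.2 * C z.1) := by
  have h1 : HasFDerivAt (fun z : (Fin n → ℝ) × ℝ × ℝ => z.1) (ContinuousLinearMap.fst ℝ _ _) z :=
    hasFDerivAt_fst
  have h2 : HasFDerivAt (fun z : (Fin n → ℝ) × ℝ × ℝ => z.2.1)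
      ((ContinuousLinearMap.fst ℝ ℝ ℝ).comp (ContinuousLinearMap.snd ℝ _ _)) z :=
    (hasFDerivAt_fst (𝕜 := ℝ) (p := z.2)).comp z hasFDerivAt_snd
  have h3 : HasFDerivAt (fun z : (Fin n → ℝ) × ℝ × ℝ => z.2.2)
      ((ContinuousLinearMap.snd ℝ ℝ ℝ).comp (ContinuousLinearMap.snd ℝ _ _)) z :=
    (hasFDerivAt_snd (𝕜 := ℝ) (p := z.2)).comp z hasFDerivAt_snd
  have hA' := (hA z.1).hasFDerivAt.comp z h1
  have hB' := (hB z.1).hasFDerivAt.comp z h1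
  have hC' := (hC z.1).hasFDerivAt.comp z h1
  have := (hA'.add (h2.mul hB')).add (h3.mul hC')
  rw [HasFDerivAt.fderiv (f := fun z : (Fin n → ℝ) × ℝ × ℝ =>
    A z.1 + z.2.1 * B z.1 + z.2.2 * C z.1) this]
  simp [mul_comm]

variable {u φ ψ : Fin m → (Fin n → ℝ) → ℝ}

theorem contDiff_variation (hu : ∀ σ, ContDiff ℝ ∞ (u σ)) (hφ : ∀ σ, ContDiff ℝ ∞ (φ σ))
    (hψ : ∀ σ, ContDiff ℝ ∞ (ψ σ)) : ContDiff ℝ ∞ (variation r u φ ψ) :=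
  contDiff_fst.prodMk (contDiff_pi.mpr fun σ => contDiff_pi.mpr fun _ =>
    contDiff_affine (contDiff_pderivs (hu σ) _) (contDiff_pderivs (hφ σ) _)
      (contDiff_pderivs (hψ σ) _))

/-- The coordinates `xⁱ` of a variation. -/
def baseCoord (V : TopologicalSpace.Opens ((Fin n → ℝ) × ℝ × ℝ)) (i : Fin n) : SmoothRing V :=
  SmoothRing.of (fun z => z.1 i) ((contDiff_apply ℝ ℝ i).comp contDiff_fst).contDiffOn

/-- The functions of the parameters `A + aB + bC`. -/
def affine (V : TopologicalSpace.Opens ((Fin n → ℝ) × ℝ × ℝ)) {A B C : (Fin n → ℝ) → ℝ}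
    (hA : ContDiff ℝ ∞ A) (hB : ContDiff ℝ ∞ B) (hC : ContDiff ℝ ∞ C) : SmoothRing V :=
  SmoothRing.of _ (contDiff_affine hA hB hC).contDiffOn

theorem affine_apply (V : TopologicalSpace.Opens ((Fin n → ℝ) × ℝ × ℝ)) {A B C : (Fin n → ℝ) → ℝ}
    (hA : ContDiff ℝ ∞ A) (hB : ContDiff ℝ ∞ B) (hC : ContDiff ℝ ∞ C) (z : V) :
    (affine V hA hB hC).1 z = A z.1.1 + z.1.2.1 * B z.1.1 + z.1.2.2 * C z.1.1 := rfl

variable (V : TopologicalSpace.Opens ((Fin n → ℝ) × ℝ × ℝ))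

theorem deriv_affine (v : (Fin n → ℝ) × ℝ × ℝ) {A B C : (Fin n → ℝ) → ℝ}
    (hA : ContDiff ℝ ∞ A) (hB : ContDiff ℝ ∞ B) (hC : ContDiff ℝ ∞ C) (z : V) :
    (SmoothRing.deriv v (affine V hA hB hC)).1 z
      = fderiv ℝ A z.1.1 v.1 + (z.1.2.1 * fderiv ℝ B z.1.1 v.1 + v.2.1 * B z.1.1)
        + (z.1.2.2 * fderiv ℝ C z.1.1 v.1 + v.2.2 * C z.1.1) := by
  rw [SmoothRing.deriv_apply _ _ (g := fun z => A z.1 + z.2.1 * B z.1 + z.2.2 * C z.1)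
      (fun z => affine_apply V hA hB hC z),
    fderiv_affine (hA.differentiable (by simp)) (hB.differentiable (by simp))
      (hC.differentiable (by simp))]

theorem ders_affine {A B C : (Fin n → ℝ) → ℝ}
    (hA : ContDiff ℝ ∞ A) (hB : ContDiff ℝ ∞ B) (hC : ContDiff ℝ ∞ C) (l : List (Fin n)) :
    ders (paramDeriv V) l (affine V hA hB hC)
      = affine V (contDiff_pderivs hA l) (contDiff_pderivs hB l) (contDiff_pderivs hC l) := by
  induction l with
  | nil => rfl
  | cons i l ih =>
    rw [ders, ih]
    refine SmoothRing.ext' fun z => ?_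
    rw [paramDeriv, deriv_affine, affine_apply]
    simp [pderivs, pderiv]

theorem deriv_baseCoord (v : (Fin n → ℝ) × ℝ × ℝ) (l : Fin n) (z : V) :
    (SmoothRing.deriv v (baseCoord V l)).1 z = v.1 l := by
  rw [SmoothRing.deriv_apply _ (baseCoord V l) (g := fun z => z.1 l) fun z => rfl]
  have : HasFDerivAt (fun z : (Fin n → ℝ) × ℝ × ℝ => z.1 l)
      ((ContinuousLinearMap.proj l).comp (ContinuousLinearMap.fst ℝ (Fin n → ℝ) (ℝ × ℝ))) z.1 :=
    ((ContinuousLinearMap.proj l).comp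
      (ContinuousLinearMap.fst ℝ (Fin n → ℝ) (ℝ × ℝ))).hasFDerivAt
  rw [this.fderiv]
  rfl

theorem jetFrame_variation (hu : ∀ σ, ContDiff ℝ ∞ (u σ)) (hφ : ∀ σ, ContDiff ℝ ∞ (φ σ))
    (hψ : ∀ σ, ContDiff ℝ ∞ (ψ σ)) {U : Set (Coord n m r)} (hU : IsOpen U)
    (hV : ∀ z ∈ V, variation r u φ ψ z ∈ U) :
    JetFrame V U (variation r u φ ψ) (paramDeriv V) (baseCoord V)
      (fun σ => affine V (hu σ) (hφ σ) (hψ σ)) where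
  isOpen := hU
  smooth := (contDiff_variation hu hφ hψ).contDiffOn
  mem := hV
  x_apply := fun i z => rfl
  y_apply := by
    intro σ l hl z
    rw [ders_affine, affine_apply, dy_apply σ (by simpa using hl)]
    have hp : l.Perm (sorted (l : Multiset (Fin n))) := by
      rw [← Multiset.coe_eq_coe]
      exact (Multiset.sort_eq _ _).symm
    rw [pderivs_perm_of_contDiff (hu σ) hp, pderivs_perm_of_contDiff (hφ σ) hp,
      pderivs_perm_of_contDiff (hψ σ) hp]
    rfl
  dir := fun i => isDir_deriv _
  d_x := by
    intro i l
    refine SmoothRing.ext' fun z => ?_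
    rw [paramDeriv, deriv_baseCoord]
    change (Pi.single i 1 : Fin n → ℝ) l = _
    rw [Pi.single_apply]
    split_ifs <;> rfl

end Variation

/-! ### The second chart along a family of sections -/

section FrameChange

variable {n m : ℕ} {X : Type*} [TopologicalSpace X] [ChartedSpace (Fin (n + m) → ℝ) X]
  {E : Type*} [NormedAddCommGroup E] [NormedSpace ℝ E] {V : TopologicalSpace.Opens E} {r : ℕ}
  {c c' : AChart n m X}

namespace AChart

theorem contDiffOn_P (hr : 1 ≤ r) (α σ : Fin m) :
    ContDiffOn ℝ ∞ (c.P c' r α σ) (c.overlap c' r) :=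
  (contDiffOn_Del (isOpen_overlap hr) (contDiffOn_yBar hr α []) σ []).sub
    (ContDiffOn.sum fun i _ => (contDiffOn_yBar hr α [i]).mul
      (contDiffOn_Del (isOpen_overlap hr) (contDiffOn_xBar hr i) σ []))

end AChart

namespace JetFrame

variable {κ : E → Coord n m r} {d : Fin n → Derivation ℝ (SmoothRing V) (SmoothRing V)}
  {x : Fin n → SmoothRing V} {Y : Fin m → SmoothRing V}
  (h : JetFrame V (c.overlap c' r) κ d x Y) (hr : 1 ≤ r)

/-- The functions `x̄ⁱ` of the parameters. -/
def xNew (i : Fin n) : SmoothRing V := h.pull (AChart.contDiffOn_xBar hr i)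

/-- The functions `ȳ^ν` of the parameters. -/
def yNew (ν : Fin m) : SmoothRing V := h.pull (AChart.contDiffOn_yBar hr ν [])

/-- The matrix `Pʲ_i` as a function of the parameters. -/
def pMat : Matrix (Fin n) (Fin n) (SmoothRing V) :=
  Matrix.of fun i j => h.pull (AChart.contDiffOn_Pmat hr i j)

theorem d_xNew_apply (i p : Fin n) (z : V) :
    (d p (h.xNew hr i)).1 z = c.Q c' r (κ z) i p :=
  h.d_apply (q := 0) (by omega) (AChart.contDiffOn_xBar hr i) (AChart.orderLE_xBar hr i)
    (fun _ => rfl) p z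

theorem map_jac_xNew (z : V) :
    (Matrix.of fun l p => d p (h.xNew hr l)).map (SmoothRing.eval z) = c.Q c' r (κ z) := by
  ext l p
  exact h.d_xNew_apply hr l p z

theorem det_xNew_apply (z : V) :
    (Matrix.of fun l p => d p (h.xNew hr l)).det.1 z = c.J c' r (κ z) := by
  rw [← SmoothRing.eval_apply, RingHom.map_det, RingHom.mapMatrix_apply, h.map_jac_xNew]
  rfl

theorem pMat_mul : h.pMat hr * (Matrix.of fun l p => d p (h.xNew hr l)) = 1 := by
  ext i j : 1
  refine SmoothRing.ext' fun z => ?_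
  have h1 : (h.pMat hr).map (SmoothRing.eval z) = c.Pmat c' r (κ z) := by
    ext i j
    rfl
  have h2 : (h.pMat hr * (Matrix.of fun l p => d p (h.xNew hr l))).map (SmoothRing.eval z) = 1 := by
    rw [Matrix.map_mul, h.map_jac_xNew, h1, AChart.Pmat,
      Matrix.nonsing_inv_mul _ (isUnit_iff_ne_zero.mpr (AChart.det_Q_ne_zero hr (h.mem z z.2)))]
  refine (congrFun (congrFun h2 i) j).trans ?_
  rw [Matrix.one_apply, Matrix.one_apply]
  split_ifs <;> rfl

theorem dbar_pMat_apply (i : Fin n) (F : SmoothRing V) (z : V) :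
    (dbar d (h.pMat hr) i F).1 z = ∑ k, c.Pmat c' r (κ z) k i * (d k F).1 z := by
  rw [dbar_apply, ← SmoothRing.eval_apply, map_sum]
  refine Finset.sum_congr rfl fun k _ => ?_
  rw [map_mul]
  rfl

theorem ders_yNew_apply (ν : Fin m) (l : List (Fin n)) (hl : l.length ≤ r) (z : V) :
    (ders (dbar d (h.pMat hr)) l (h.yNew hr ν)).1 z = c.yBar c' r ν l (κ z) := by
  induction l generalizing z with
  | nil => rfl
  | cons i l ih =>
    have hl' : l.length < r := hl
    rw [ders, dbar_pMat_apply, AChart.yBar_cons hr ν i l hl (h.mem z z.2)]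
    refine Finset.sum_congr rfl fun k _ => ?_
    rw [h.d_apply hl' (AChart.contDiffOn_yBar hr ν l) (AChart.orderLE_yBar hr ν l hl'.le)
      (ih hl'.le)]

/-- The same family of contact elements, read in the second chart, is holonomic for the derivations
d̄_i. All results about families then apply to the barred objects without a reparametrization by x̄.
-/
theorem change : JetFrame V (c'.overlap c r) (fun z => c.change c' r (κ z))
    (dbar d (h.pMat hr)) (h.xNew hr) (h.yNew hr) where
  isOpen := AChart.isOpen_overlap hr
  smooth := (AChart.contDiffOn_change hr).comp h.smooth h.mem
  mem := fun z hz => AChart.change_mem_overlap hr (h.mem z hz)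
  x_apply := fun _ _ => rfl
  y_apply := fun ν l hl z => h.ders_yNew_apply hr ν l hl z
  dir := IsDir.dbar h.dir _
  d_x := dbar_coord (h.pMat_mul hr)

section Vertical

variable (hdc : ∀ i j f, d i (d j f) = d j (d i f))
  {e : Derivation ℝ (SmoothRing V) (SmoothRing V)} (he : IsDir e) (hx : ∀ i, e (x i) = 0)
  (hc : ∀ i f, e (d i f) = d i (e f))

include hdc he hx hc

theorem vert_zero {f : Coord n m r → ℝ} (hf : ContDiffOn ℝ ∞ f (c.overlap c' r))
    (ho : OrderLE 0 (c.overlap c' r) f) :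
    e (h.pull hf) = ∑ σ, h.pull (contDiffOn_Del h.isOpen hf σ []) * e (Y σ) := by
  rw [h.vert_eq hdc (Nat.zero_le r) hf ho (fun _ => rfl) he hx hc]
  simp [tupleSum, ders]

/-- As x̄ and ȳ have order 0, e acts on them by e(y^σ) Δ_σ, while d̄_i ȳ^α = ȳ^α_i. Inserting this
into δ = e − e(x̄ⁱ) d̄_i reproduces the definition of P^α_σ. -/
theorem sum_P_mul (α : Fin m) :
    ∑ σ, h.pull (AChart.contDiffOn_P hr α σ) * e (Y σ)
      = delta d (h.pMat hr) (h.xNew hr) e (h.yNew hr α) := by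
  rw [delta_apply, yNew, h.vert_zero hdc he hx hc _ (AChart.orderLE_yBar hr α [] (by simp))]
  have h1 : ∀ i, e (h.xNew hr i) = _ := fun i =>
    h.vert_zero hdc he hx hc (AChart.contDiffOn_xBar hr i) (AChart.orderLE_xBar hr i)
  have h2 : ∀ i, dbar d (h.pMat hr) i (h.yNew hr α) = h.pull (AChart.contDiffOn_yBar hr α [i]) :=
    fun i => SmoothRing.ext' fun z => h.ders_yNew_apply hr α [i] (by simpa using hr) z
  have h3 : ∀ σ, h.pull (AChart.contDiffOn_P hr α σ)
      = h.pull (contDiffOn_Del h.isOpen (AChart.contDiffOn_yBar hr α []) σ [])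
        - ∑ i, h.pull (AChart.contDiffOn_yBar hr α [i])
          * h.pull (contDiffOn_Del h.isOpen (AChart.contDiffOn_xBar hr i) σ []) := by
    intro σ
    refine SmoothRing.ext' fun z => ?_
    rw [← SmoothRing.eval_apply, ← SmoothRing.eval_apply, map_sub, map_sum]
    simp only [map_mul]
    rfl
  change _ = _ - ∑ i, e (h.xNew hr i) * dbar d (h.pMat hr) i (h.yNew hr α)
  simp only [h1, h2, h3, sub_mul, Finset.sum_sub_distrib, Finset.sum_mul]
  congr 1
  rw [Finset.sum_comm]
  exact Finset.sum_congr rfl fun i _ => Finset.sum_congr rfl fun σ _ => by ring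

/-- The variation `dbar_J δȳ^β` as a function of the jets. -/
theorem ders_delta_apply (β : Fin m) (l : List (Fin n)) (hl : l.length < r) (z : V) :
    (ders (dbar d (h.pMat hr)) l (delta d (h.pMat hr) (h.xNew hr) e (h.yNew hr β))).1 z
      = fderiv ℝ (c.yBar c' r β l) (κ z)
          (0, fun σ I => (ders d (sorted I.1) (e (Y σ))).1 z)
        - ∑ i, fderiv ℝ (c.xBar c' r i) (κ z)
          (0, fun σ I => (ders d (sorted I.1) (e (Y σ))).1 z)
          * ∑ j, c.Pmat c' r (κ z) j i * D j (c.yBar c' r β l) (κ z) := by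
  -- Because δ commutes with the d̄_i, the derivatives of δȳ^β are δ applied to ȳ^β_l, whose
  -- derivatives are known from the chart change.
  rw [ders_comm (fun i f => delta_dbar_comm (h.pMat_mul hr) hdc hc i f), delta_apply]
  have h1 := h.vert_apply (AChart.contDiffOn_yBar hr β l) (h.ders_yNew_apply hr β l hl.le) he hx hc z
  have h2 : ∀ i, (e (h.xNew hr i)).1 z = _ := fun i =>
    h.vert_apply (AChart.contDiffOn_xBar hr i) (fun _ => rfl) he hx hc z
  rw [← SmoothRing.eval_apply, map_sub, map_sum, SmoothRing.eval_apply, h1]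
  congr 1
  refine Finset.sum_congr rfl fun i _ => ?_
  rw [map_mul, SmoothRing.eval_apply, SmoothRing.eval_apply, h2, dbar_pMat_apply]
  congr 1
  refine Finset.sum_congr rfl fun k _ => ?_
  rw [h.d_apply hl (AChart.contDiffOn_yBar hr β l) (AChart.orderLE_yBar hr β l hl.le)
    (h.ders_yNew_apply hr β l hl.le)]

end Vertical

end JetFrame
end FrameChange

/-! ### The transformation law modulo divergences -/

section ChartChange

variable {n m : ℕ} {X : Type*} [TopologicalSpace X] [ChartedSpace (Fin (n + m) → ℝ) X]
  {s t : ℕ} {T : DiffEq n m X s}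

theorem linOp_apply {E : Type*} [NormedAddCommGroup E] [NormedSpace ℝ E]
    {V : TopologicalSpace.Opens E} (d : Fin n → Derivation ℝ (SmoothRing V) (SmoothRing V))
    (A : Fin m → Fin m → List (Fin n) → SmoothRing V) (φ : Fin m → SmoothRing V) (σ : Fin m)
    (z : V) : (linOp d s A φ σ).1 z = ∑ j ∈ Finset.range (s + 1), ∑ ν, tupleSum j (fun l =>
      (A σ ν l).1 z * (ders d l (φ ν)).1 z) := by
  rw [linOp, ← SmoothRing.eval_apply, map_sum]
  refine Finset.sum_congr rfl fun j _ => ?_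
  rw [map_sum]
  refine Finset.sum_congr rfl fun ν _ => ?_
  rw [map_tupleSum]
  exact tupleSum_congr fun l _ => map_mul _ _ _

namespace AChart

/-- `δȳ^β_I = v(ȳ^β_I) - v(x̄ⁱ) Pʲ_i D_j ȳ^β_I` for a vertical vector `v` at `k`. -/
def yVar (c c' : AChart n m X) (β : Fin m) (l : List (Fin n)) (k v : Coord n m t) : ℝ :=
  fderiv ℝ (c.yBar c' t β l) k v - ∑ i, fderiv ℝ (c.xBar c' t i) k v
    * ∑ j, c.Pmat c' t k j i * D j (c.yBar c' t β l) k

end AChart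

/-- The difference of the two sides of the transformation law of the Helmholtz operator, applied
to the jet `v` of a variation. -/
def helmDefect (hst : s ≤ t) (T : DiffEq n m X s) (c c' : AChart n m X) (σ : Fin m)
    (k v : Coord n m t) : ℝ :=
  (∑ j ∈ Finset.range (s + 1), ∑ ν, tupleSum j (fun l =>
    HS hst (T.nonhom c) σ ν l k * dy ν (l : Multiset (Fin n)) v))
  - c.J c' t k * ∑ α, c.P c' t α σ k * ∑ j ∈ Finset.range (s + 1), ∑ β, tupleSum j (fun l =>
      HS hst (T.nonhom c') α β l (c.change c' t k) * c.yVar c' β l k v)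

/-- The vertical jet of a variation. -/
def vertJet (t : ℕ) (φ : Fin m → (Fin n → ℝ) → ℝ) (x : Fin n → ℝ) : Coord n m t :=
  (0, fun σ I => pderivs (sorted I.1) (φ σ) x)

section Family

variable (hs : 1 ≤ s) (ht : 2 * s ≤ t) (hT : T.IsHomogeneous) (c c' : AChart n m X)

include hs hT in
theorem nonhom_smooth_order (hst : s ≤ t) (σ : Fin m) :
    ContDiffOn ℝ ∞ (fun k => T.nonhom c σ (truncate hst k)) (c.overlap c' t) ∧
    OrderLE s (c.overlap c' t) (fun k => T.nonhom c σ (truncate hst k)) := by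
  have hm : ∀ k ∈ c.overlap c' t, truncate hst k ∈ c.image s := fun k hk =>
    AChart.truncate_mem_image hs hst (AChart.overlap_subset_image hk)
  exact ⟨contDiffOn_comp_truncate hst hm (hT.contDiffOn_nonhom hs c σ),
    orderLE_comp_truncate hst (AChart.isOpen_image hs) hm (hT.contDiffOn_nonhom hs c σ)⟩

variable {u φ ψ : Fin m → (Fin n → ℝ) → ℝ} (hu : ∀ σ, ContDiff ℝ ∞ (u σ))
  (hφ : ∀ σ, ContDiff ℝ ∞ (φ σ)) (hψ : ∀ σ, ContDiff ℝ ∞ (ψ σ))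

/-- A function of `x`, as a function of the parameters. -/
def ofBase (V : TopologicalSpace.Opens ((Fin n → ℝ) × ℝ × ℝ)) {A : (Fin n → ℝ) → ℝ}
    (hA : ContDiff ℝ ∞ A) : SmoothRing V :=
  affine V hA (contDiff_const (c := (0 : ℝ))) (contDiff_const (c := (0 : ℝ)))

theorem ofBase_apply (V : TopologicalSpace.Opens ((Fin n → ℝ) × ℝ × ℝ)) {A : (Fin n → ℝ) → ℝ}
    (hA : ContDiff ℝ ∞ A) (z : V) : (ofBase V hA).1 z = A z.1.1 := by
  rw [ofBase, affine_apply]; simp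

theorem deriv_comm_paramDeriv {V : TopologicalSpace.Opens ((Fin n → ℝ) × ℝ × ℝ)}
    (v : (Fin n → ℝ) × ℝ × ℝ) (i : Fin n) (f : SmoothRing V) :
    SmoothRing.deriv v (paramDeriv V i f) = paramDeriv V i (SmoothRing.deriv v f) :=
  SmoothRing.deriv_comm _ _ _

set_option maxHeartbeats 800000 in
include hs ht hT hu hφ hψ in
-- This carries the algebraic law over to jets. In the ring of functions of (x, a, b) the defect of
-- the law along u + aφ + bψ is an element g_σ whose values depend only on jets, and ∑ g_σ ψ^σ
-- restricts at a = b = 0 to a function of integral zero.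
theorem exists_helmDefect_mem (hst : s ≤ t) (V : TopologicalSpace.Opens ((Fin n → ℝ) × ℝ × ℝ))
    (hV : ∀ z ∈ V, variation t u φ ψ z ∈ c.overlap c' t) :
    ∃ g : Fin m → SmoothRing V,
      (∀ σ (z : V), (g σ).1 z = helmDefect hst T c c' σ (variation t u φ ψ z) (vertJet t φ z.1.1)) ∧
      ((∀ σ, ofBase V (hψ σ) ∈ sliceIdeal V) →
        ∑ σ, g σ * ofBase V (hψ σ) ∈ sliceNull V) := by
  have ht1 : 1 ≤ t := hs.trans hst
  let Y : Fin m → SmoothRing V := fun σ => affine V (hu σ) (hφ σ) (hψ σ)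
  have h : JetFrame V (c.overlap c' t) (variation t u φ ψ) (paramDeriv V) (baseCoord V) Y :=
    jetFrame_variation V hu hφ hψ (AChart.isOpen_overlap ht1) hV
  have h' := h.change ht1
  have hdc : ∀ i j (f : SmoothRing V), paramDeriv V i (paramDeriv V j f)
      = paramDeriv V j (paramDeriv V i f) := fun i j f => SmoothRing.deriv_comm _ _ _
  have hP := h.pMat_mul ht1
  have hdc' := dbar_comm hP hdc
  set ea : Derivation ℝ (SmoothRing V) (SmoothRing V) := SmoothRing.deriv (0, 1, 0) with hea
  set eb : Derivation ℝ (SmoothRing V) (SmoothRing V) := SmoothRing.deriv (0, 0, 1) with heb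
  have hac : ∀ i f, ea (paramDeriv V i f) = paramDeriv V i (ea f) := deriv_comm_paramDeriv _
  have hbc : ∀ i f, eb (paramDeriv V i f) = paramDeriv V i (eb f) := deriv_comm_paramDeriv _
  have hax : ∀ i, ea (baseCoord V i) = 0 := fun i =>
    SmoothRing.ext' fun z => deriv_baseCoord V _ i z
  have hbx : ∀ i, eb (baseCoord V i) = 0 := fun i =>
    SmoothRing.ext' fun z => deriv_baseCoord V _ i z
  have haY : ∀ σ, ea (Y σ) = ofBase V (hφ σ) := fun σ =>
    SmoothRing.ext' fun z => by
      rw [hea, deriv_affine, ofBase_apply]; simp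
  have hbY : ∀ σ, eb (Y σ) = ofBase V (hψ σ) := fun σ =>
    SmoothRing.ext' fun z => by
      rw [heb, deriv_affine, ofBase_apply]; simp
  have hf := fun σ => (nonhom_smooth_order hs hT c c' hst σ).1
  have ho := fun σ => (nonhom_smooth_order hs hT c c' hst σ).2
  have hf' := fun σ => (nonhom_smooth_order hs hT c' c hst σ).1
  have ho' := fun σ => (nonhom_smooth_order hs hT c' c hst σ).2
  set A : Fin m → Fin m → List (Fin n) → SmoothRing V := fun σ ν l =>
    h.pull (contDiffOn_Del h.isOpen (hf σ) ν l) with hA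
  set B : Fin m → Fin m → List (Fin n) → SmoothRing V := fun σ ν l =>
    h'.pull (contDiffOn_Del h'.isOpen (hf' σ) ν l) with hB
  set ζ : Fin m → SmoothRing V := fun β =>
    delta (paramDeriv V) (h.pMat ht1) (h.xNew ht1) ea (h.yNew ht1 β) with hζ
  set p : Fin m → Fin m → SmoothRing V := fun α σ => h.pull (AChart.contDiffOn_P ht1 α σ) with hp
  refine ⟨fun σ => linOp (paramDeriv V) s (helmCoeff (paramDeriv V) s A) (fun σ => ea (Y σ)) σ
      - (Matrix.of (fun l p => paramDeriv V p (h.xNew ht1 l))).det * ∑ α, p α σ *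
          linOp (dbar (paramDeriv V) (h.pMat ht1)) s
            (helmCoeff (dbar (paramDeriv V) (h.pMat ht1)) s B) ζ α, ?_, ?_⟩
  · intro σ z
    have hw : ∀ σ l, (ders (paramDeriv V) l (ea (Y σ))).1 z = pderivs l (φ σ) z.1.1 := by
      intro σ l
      rw [haY, ofBase, ders_affine, affine_apply]
      have : ∀ l : List (Fin n), pderivs l (fun _ : Fin n → ℝ => (0 : ℝ)) = fun _ => 0 := by
        intro l
        induction l with
        | nil => rfl
        | cons j l ih => rw [pderivs, ih]; funext x; simp [pderiv]
      rw [this]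
      simp
    have hperm : ∀ (σ : Fin m) (l : List (Fin n)), l.length ≤ s →
        pderivs l (φ σ) z.1.1 = dy σ (l : Multiset (Fin n)) (vertJet t φ z.1.1) := by
      intro σ l hl
      rw [dy_apply σ (by simp only [Multiset.coe_card]; omega)]
      have hp : l.Perm (sorted (l : Multiset (Fin n))) := by
        rw [← Multiset.coe_eq_coe]
        exact (Multiset.sort_eq _ _).symm
      rw [pderivs_perm_of_contDiff (hφ σ) hp]
      rfl
    rw [← SmoothRing.eval_apply, map_sub, map_mul, map_sum, SmoothRing.eval_apply,
      SmoothRing.eval_apply, h.det_xNew_apply, linOp_apply, helmDefect]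
    congr 1
    · refine Finset.sum_congr rfl fun j hj => Finset.sum_congr rfl fun ν _ =>
        tupleSum_congr fun l hl => ?_
      rw [Finset.mem_range] at hj
      rw [hw, hperm ν l (by omega)]
      exact congrArg (· * _) (h.helmCoeff_apply ht hf ho σ ν l z)
    · refine congrArg (_ * ·) (Finset.sum_congr rfl fun α _ => ?_)
      rw [map_mul, SmoothRing.eval_apply, SmoothRing.eval_apply, linOp_apply]
      refine congrArg (_ * ·) (Finset.sum_congr rfl fun j hj => Finset.sum_congr rfl fun β _ =>
        tupleSum_congr fun l hl => ?_)
      rw [Finset.mem_range] at hj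
      refine congrArg₂ (· * ·) (h'.helmCoeff_apply ht hf' ho' α β l z) ?_
      have e : ((0, fun σ I => (ders (paramDeriv V) (sorted I.1) (ea (Y σ))).1 z) : Coord n m t)
          = vertJet t φ z.1.1 := Prod.ext rfl (funext fun σ => funext fun I => hw σ _)
      rw [← e]
      exact h.ders_delta_apply ht1 hdc (isDir_deriv _) hax hac β l (by omega) z
  · intro hC
    simp only [← hbY] at hC ⊢
    refine helmOp_change_mem hdc hP s (C := sliceIdeal V) (N := sliceNull V) (ea := ea) (eb := eb)
      hac hbc (fun f => SmoothRing.deriv_comm _ _ _) (fun i w hw => paramDeriv_mem hw i)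
      (fun i w hw => paramDeriv_mem_null hw i) (A := A) (B := B) ?_ ?_
      (T := fun σ => h.pull (hf σ)) (G := fun α => h'.pull (hf' α)) (Y := h.yNew ht1)
      (φ := fun σ => ea (Y σ)) (ψ := fun σ => eb (Y σ)) (p := p)
      ?_ ?_ ?_ ?_ ?_ ?_ ?_ ?_ ?_ hC ?_
    · intro σ ν l l' hl
      refine SmoothRing.ext' fun z => ?_
      change Del ν l _ _ = Del ν l' _ _
      rw [Del_perm ν hl]
    · intro σ ν l l' hl
      refine SmoothRing.ext' fun z => ?_
      change Del ν l _ _ = Del ν l' _ _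
      rw [Del_perm ν hl]
    · intro σ
      rw [hbY, ofBase]
      refine SmoothRing.ext' fun z => ?_
      rw [hea, deriv_affine]
      simp
    · intro σ
      rw [haY, ofBase]
      refine SmoothRing.ext' fun z => ?_
      rw [heb, deriv_affine]
      simp
    · intro σ
      refine SmoothRing.ext' fun z => ?_
      rw [← SmoothRing.eval_apply, ← SmoothRing.eval_apply, map_mul, map_sum,
        SmoothRing.eval_apply z (Matrix.det _), h.det_xNew_apply]
      simp only [map_mul]
      exact hT.nonhom_change hs hst (hV z z.2) σ
    · exact h.sum_P_mul ht1 hdc (isDir_deriv _) hax hac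
    · exact h.sum_P_mul ht1 hdc (isDir_deriv _) hbx hbc
    · exact fun σ => h.vert_eq hdc hst (hf σ) (ho σ) (fun _ => rfl) (isDir_deriv _) hax hac
    · exact fun σ => h.vert_eq hdc hst (hf σ) (ho σ) (fun _ => rfl) (isDir_deriv _) hbx hbc
    · exact fun α => h'.vert_eq hdc' hst (hf' α) (ho' α) (fun _ => rfl)
        (IsDir.delta h.dir _ _ (isDir_deriv _)) (delta_coord hP ea)
        (fun i f => delta_dbar_comm hP hdc hac i f)
    · exact fun α => h'.vert_eq hdc' hst (hf' α) (ho' α) (fun _ => rfl)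
        (IsDir.delta h.dir _ _ (isDir_deriv _)) (delta_coord hP eb)
        (fun i f => delta_dbar_comm hP hdc hbc i f)
    · intro i
      -- As x̄ⁱ has order 0, its variation along ψ is a combination of the ψ^σ themselves.
      rw [JetFrame.xNew, h.vert_zero hdc (isDir_deriv _) hbx hbc _ (AChart.orderLE_xBar ht1 i)]
      exact Ideal.sum_mem _ fun σ _ => Ideal.mul_mem_left _ _ (hC σ)

end Family

end ChartChange

/-! ### From null integrals to the coefficients -/

section Extraction

variable {n m : ℕ} {X : Type*} [TopologicalSpace X] [ChartedSpace (Fin (n + m) → ℝ) X]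
  {s t : ℕ} {T : DiffEq n m X s}

/-- The jet of a section. -/
def jetSec (t : ℕ) (u : Fin m → (Fin n → ℝ) → ℝ) (x : Fin n → ℝ) : Coord n m t :=
  (x, fun σ I => pderivs (sorted I.1) (u σ) x)

theorem variation_zero (u φ ψ : Fin m → (Fin n → ℝ) → ℝ) (x : Fin n → ℝ) :
    variation t u φ ψ (x, 0) = jetSec t u x := by
  simp [variation, jetSec]

theorem contDiff_jetSec {u : Fin m → (Fin n → ℝ) → ℝ} (hu : ∀ σ, ContDiff ℝ ∞ (u σ)) :
    ContDiff ℝ ∞ (jetSec t u) :=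
  contDiff_id.prodMk (contDiff_pi.mpr fun σ => contDiff_pi.mpr fun _ => contDiff_pderivs (hu σ) _)

open MeasureTheory in
-- The fundamental lemma of the calculus of variations: the defect along the section u does not
-- involve ψ, it integrates to zero against every test function supported in the domain, and it is
-- continuous there.
theorem helmDefect_jetSec_eq_zero (hs : 1 ≤ s) (ht : 2 * s ≤ t) (hst : s ≤ t)
    (hT : T.IsHomogeneous) (c c' : AChart n m X) {u φ : Fin m → (Fin n → ℝ) → ℝ}
    (hu : ∀ σ, ContDiff ℝ ∞ (u σ)) (hφ : ∀ σ, ContDiff ℝ ∞ (φ σ)) (σ₀ : Fin m) {x₀ : Fin n → ℝ}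
    (hx₀ : jetSec t u x₀ ∈ c.overlap c' t) :
    helmDefect hst T c c' σ₀ (jetSec t u x₀) (vertJet t φ x₀) = 0 := by
  have hU : IsOpen (c.overlap c' t) := AChart.isOpen_overlap (hs.trans hst)
  set V₀ : Set (Fin n → ℝ) := jetSec t u ⁻¹' c.overlap c' t with hV₀
  have hV₀o : IsOpen V₀ := hU.preimage (contDiff_jetSec hu).continuous
  set f : (Fin n → ℝ) → ℝ := fun x => helmDefect hst T c c' σ₀ (jetSec t u x) (vertJet t φ x) with hf
  have key : ∀ ψ : Fin m → (Fin n → ℝ) → ℝ, (∀ σ, ContDiff ℝ ∞ (ψ σ)) →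
      ∃ V : TopologicalSpace.Opens ((Fin n → ℝ) × ℝ × ℝ), (∀ x, (x, (0 : ℝ × ℝ)) ∈ V ↔ x ∈ V₀) ∧
        ∀ z ∈ V, variation t u φ ψ z ∈ c.overlap c' t := by
    intro ψ hψ
    refine ⟨⟨variation t u φ ψ ⁻¹' c.overlap c' t,
      hU.preimage (contDiff_variation hu hφ hψ).continuous⟩, fun x => ?_, fun z hz => hz⟩
    change variation t u φ ψ (x, 0) ∈ c.overlap c' t ↔ _
    rw [variation_zero]
    rfl
  have hcont : ContinuousOn f V₀ := by
    -- Continuity is read off from the smooth function g; the choice ψ = 0 serves only to have such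
    -- a g.
    have h0 : ∀ _ : Fin m, ContDiff ℝ ∞ (fun _ : Fin n → ℝ => (0 : ℝ)) := fun _ => contDiff_const
    obtain ⟨V, hVx, hV⟩ := key (fun _ _ => 0) h0
    obtain ⟨g, hg, -⟩ := exists_helmDefect_mem hs ht hT c c' hu hφ h0 hst V hV
    intro x hx
    have h1 := (contDiffAt_slice (g σ₀) ((hVx x).mpr hx)).continuousAt
    refine (h1.congr ?_).continuousWithinAt
    filter_upwards [hV₀o.mem_nhds hx] with y hy
    rw [slice_of_mem _ ((hVx y).mpr hy), hg, variation_zero]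
  have hint : ∀ χ : (Fin n → ℝ) → ℝ, ContDiff ℝ ∞ χ → HasCompactSupport χ → tsupport χ ⊆ V₀ →
      ∫ x, χ x • f x = 0 := by
    intro χ hχ hχc hχs
    -- A variation in the single component σ₀ isolates the defect with that index.
    set ψ : Fin m → (Fin n → ℝ) → ℝ := fun σ => if σ = σ₀ then χ else fun _ => 0 with hψ_def
    have hψ : ∀ σ, ContDiff ℝ ∞ (ψ σ) := fun σ => by
      rw [hψ_def]
      dsimp only
      split_ifs
      exacts [hχ, contDiff_const]
    have hψ0 : ∀ σ, ∀ x ∉ tsupport χ, ψ σ x = 0 := fun σ x hx => by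
      rw [hψ_def]
      dsimp only
      split_ifs
      exacts [image_eq_zero_of_notMem_tsupport hx, rfl]
    obtain ⟨V, hVx, hV⟩ := key ψ hψ
    obtain ⟨g, hg, hN⟩ := exists_helmDefect_mem hs ht hT c c' hu hφ hψ hst V hV
    have h2 := (hN fun σ => ⟨tsupport χ, hχc, fun x hx => (hVx x).mpr (hχs hx), fun x hx => by
      by_cases hxV : (x, (0 : ℝ × ℝ)) ∈ V
      · rw [slice_of_mem _ hxV, ofBase_apply, hψ0 σ x hx]
      · rw [slice_of_notMem _ hxV]⟩).2
    rw [← h2]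
    refine integral_congr_ae (Filter.Eventually.of_forall fun x => ?_)
    dsimp only
    by_cases hx : x ∈ V₀
    · have hxV := (hVx x).mpr hx
      rw [slice_of_mem _ hxV, ← SmoothRing.eval_apply, map_sum, Finset.sum_eq_single σ₀]
      · rw [map_mul, SmoothRing.eval_apply, SmoothRing.eval_apply, ofBase_apply, hg, variation_zero,
          hψ_def]
        simp only [if_true, smul_eq_mul]
        ring
      · intro σ _ hσ
        rw [map_mul, SmoothRing.eval_apply _ (ofBase V (hψ σ)), ofBase_apply, hψ_def]
        simp [hσ]
      · simp
    · rw [slice_of_notMem _ fun h => hx ((hVx x).mp h),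
        image_eq_zero_of_notMem_tsupport fun h => hx (hχs h), zero_smul]
  have hae := hV₀o.ae_eq_zero_of_integral_contDiff_smul_eq_zero (μ := volume)
    (hcont.locallyIntegrableOn hV₀o.measurableSet) hint
  exact MeasureTheory.Measure.eqOn_open_of_ae_eq (μ := volume) (f := f) (g := fun _ => 0)
    ((ae_restrict_iff' hV₀o.measurableSet).mpr hae) hV₀o hcont continuousOn_const hx₀

theorem pderivs_comp_sub (f : (Fin n → ℝ) → ℝ) (a : Fin n → ℝ) (l : List (Fin n)) :
    pderivs l (fun x => f (x - a)) = fun x => pderivs l f (x - a) := by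
  induction l with
  | nil => rfl
  | cons i l ih =>
    funext x
    rw [pderivs, ih, pderiv, fderiv_comp_sub]
    rfl

/-- The polynomial section through k and the variation φ = (x − x₀)^I / I! in the component ν, whose
jet at x₀ is the unit vector ∂/∂y^ν_I, turn the identity along sections into one for a single
coefficient. -/
theorem helmDefect_ey_eq_zero (hs : 1 ≤ s) (ht : 2 * s ≤ t) (hst : s ≤ t) (hT : T.IsHomogeneous)
    (c c' : AChart n m X) {k : Coord n m t} (hk : k ∈ c.overlap c' t) (σ ν : Fin m)
    {I : Multiset (Fin n)} (hI : I.card ≤ t) : helmDefect hst T c c' σ k (ey ν I) = 0 := by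
  set u : Fin m → (Fin n → ℝ) → ℝ := fun τ x => AChart.poly k τ (x - k.1) with hu_def
  set φ : Fin m → (Fin n → ℝ) → ℝ := fun τ x => (if τ = ν then 1 else 0) * mono I (x - k.1)
    with hφ_def
  have hu : ∀ τ, ContDiff ℝ ∞ (u τ) := fun τ =>
    (AChart.contDiff_poly k τ).comp (contDiff_id.sub contDiff_const)
  have hφ : ∀ τ, ContDiff ℝ ∞ (φ τ) := fun τ =>
    contDiff_const.mul ((contDiff_mono I).comp (contDiff_id.sub contDiff_const))
  have hsort : ∀ J : MIdx n t, ((sorted J.1 : List (Fin n)) : Multiset (Fin n)) = J.1 :=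
    fun J => Multiset.sort_eq _ _
  have h1 : jetSec t u k.1 = k := by
    refine Prod.ext rfl (funext fun τ => funext fun J => ?_)
    change pderivs (sorted J.1) (fun x => AChart.poly k τ (x - k.1)) k.1 = _
    rw [pderivs_comp_sub]
    simp only [sub_self]
    rw [AChart.pderivs_poly_zero k τ _ (by simpa [sorted] using J.2)]
    exact congrArg (k.2 τ) (Subtype.ext (hsort J))
  have h2 : vertJet t φ k.1 = ey ν I := by
    refine Prod.ext (ey_fst ν I).symm (funext fun τ => funext fun J => ?_)
    change pderivs (sorted J.1) (fun x => (if τ = ν then 1 else 0) * mono I (x - k.1)) k.1 = _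
    rw [pderivs_comp_sub (fun x => (if τ = ν then 1 else 0) * mono I x)]
    have h3 := pderivs_sum (n := n) {()} (fun _ => if τ = ν then (1 : ℝ) else 0)
      (f := fun _ => mono I) (fun _ => contDiff_mono I) (sorted J.1)
    simp only [Finset.sum_singleton] at h3
    rw [h3]
    simp only [sub_self]
    rw [pderivs_mono_zero, hsort, ey_snd _ _ _ hI]
    split_ifs <;> simp_all
  have := helmDefect_jetSec_eq_zero hs ht hst hT c c' hu hφ σ (x₀ := k.1) (by rwa [h1])
  rwa [h1, h2] at this

theorem HS_perm (h : s ≤ t) (F : Fin m → Coord n m s → ℝ) (σ ν : Fin m) {l l' : List (Fin n)}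
    (hl : l.Perm l') : HS h F σ ν l = HS h F σ ν l' := by
  funext k
  have h1 : ∀ J : List (Fin n), Del σ (l ++ J) (fun k' => F ν (truncate h k'))
      = Del σ (l' ++ J) (fun k' => F ν (truncate h k')) := fun J => Del_perm σ (hl.append_right J) _
  simp only [HS, lieEuler, h1, Del_perm ν hl, hl.length_eq]

/-- Recovers a coefficient of a symmetric family from a sum over tuples: the orderings of l₀ all
contribute g(l₀), and their common weight is the reciprocal of their number. -/
theorem weight_mul_sum_ite (s : ℕ) {l₀ : List (Fin n)} (hl₀ : l₀.length ≤ s)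
    (g : List (Fin n) → ℝ) (hg : ∀ l l', l.Perm l' → g l = g l') :
    weight l₀ * ∑ j ∈ Finset.range (s + 1), tupleSum j (fun l =>
      g l * if (l : Multiset (Fin n)) = (l₀ : Multiset (Fin n)) then 1 else 0) = g l₀ := by
  rw [Finset.sum_eq_single l₀.length]
  · rw [mul_tupleSum]
    have : ∀ l : List (Fin n), weight l₀ * (g l *
        if (l : Multiset (Fin n)) = (l₀ : Multiset (Fin n)) then 1 else 0)
        = g l₀ * if (l : Multiset (Fin n)) = (l₀ : Multiset (Fin n)) then weight l else 0 := by
      intro l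
      split_ifs with h
      · rw [hg l l₀ (Multiset.coe_eq_coe.mp h), weight_eq_of_perm (Multiset.coe_eq_coe.mp h)]
        ring
      · simp
    simp only [this]
    rw [← mul_tupleSum, tupleSum_weight _ _ (by simp), mul_one]
  · intro j _ hj
    refine (tupleSum_congr fun l hl => ?_).trans (tupleSum_zero j)
    rw [if_neg, mul_zero]
    intro h
    exact hj (hl ▸ (Multiset.coe_eq_coe.mp h).length_eq)
  · intro h
    exact absurd (Finset.mem_range.mpr (by omega)) h

/-- The transformation law of the Helmholtz-Sonin expressions. -/
theorem HS_change (hs : 1 ≤ s) (ht : 2 * s ≤ t) (hst : s ≤ t) (hT : T.IsHomogeneous)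
    (c c' : AChart n m X) {k : Coord n m t} (hk : k ∈ c.overlap c' t) (σ ν : Fin m)
    {I : List (Fin n)} (hI : I.length ≤ s) :
    HS hst (T.nonhom c) σ ν I k
      = c.J c' t k * ∑ α, c.P c' t α σ k *
          ∑ j ∈ Finset.range (s + 1), ∑ J : Fin j → Fin n, ∑ β,
            (Del ν I (c.yBar c' t β (List.ofFn J)) k
              - ∑ i, ∑ l, c.Pmat c' t k i l * D i (c.yBar c' t β (List.ofFn J)) k
                  * Del ν I (c.xBar c' t l) k)
            * HS hst (T.nonhom c') α β (List.ofFn J) (c.change c' t k) := by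
  have hIt : (I : Multiset (Fin n)).card ≤ t := by simpa using hI.trans hst
  -- The defect vanishes at the unit vector ∂/∂y^ν_I. Multiplying by the weight of I extracts
  -- H^I_{σν} on one side and turns ∂/∂y^ν_I into Δ^I_ν on the other.
  have h0 := helmDefect_ey_eq_zero hs ht hst hT c c' hk σ ν hIt
  rw [helmDefect, sub_eq_zero] at h0
  have h1 : weight I * ∑ j ∈ Finset.range (s + 1), ∑ ν', tupleSum j (fun l =>
      HS hst (T.nonhom c) σ ν' l k * dy ν' (l : Multiset (Fin n)) (ey ν (I : Multiset (Fin n)) :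
        Coord n m t)) = HS hst (T.nonhom c) σ ν I k := by
    rw [← weight_mul_sum_ite s hI (fun l => HS hst (T.nonhom c) σ ν l k) fun l l' hl => by
      rw [HS_perm hst _ σ ν hl]]
    congr 1
    refine Finset.sum_congr rfl fun j _ => ?_
    rw [Finset.sum_eq_single ν]
    · refine tupleSum_congr fun l _ => ?_
      rw [dy_ey _ _ hIt]
      simp
    · intro ν' _ hν'
      rw [← tupleSum_zero (n := n) j]
      refine tupleSum_congr fun l _ => ?_
      rw [dy_ey _ _ hIt]
      simp [hν']
    · simp
  rw [← h1, h0]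
  have h2 : ∀ β l, weight I * c.yVar c' β l k (ey ν (I : Multiset (Fin n)))
      = Del ν I (c.yBar c' t β l) k - ∑ i, ∑ l', c.Pmat c' t k i l' * D i (c.yBar c' t β l) k
          * Del ν I (c.xBar c' t l') k := by
    intro β l
    rw [AChart.yVar, mul_sub]
    congr 1
    rw [Finset.sum_comm, Finset.mul_sum]
    refine Finset.sum_congr rfl fun i _ => ?_
    rw [Finset.mul_sum, Finset.mul_sum]
    refine Finset.sum_congr rfl fun j _ => ?_
    rw [Del_eq]
    ring
  simp only [← h2]
  rw [mul_left_comm, Finset.mul_sum (s := Finset.univ (α := Fin m))]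
  congr 1
  refine Finset.sum_congr rfl fun α _ => ?_
  rw [mul_left_comm, Finset.mul_sum]
  congr 1
  refine Finset.sum_congr rfl fun j _ => ?_
  rw [sum_ofFn j (fun J => ∑ β, weight I * c.yVar c' β J k (ey ν (I : Multiset (Fin n)))
    * HS hst (T.nonhom c') α β J (c.change c' t k)), Finset.mul_sum, tupleSum_sum]
  refine Finset.sum_congr rfl fun β _ => ?_
  rw [mul_tupleSum]
  exact tupleSum_congr fun l _ => by ring

theorem Del_xBar_eq_zero {t : ℕ} {c c' : AChart n m X} (ht : 1 ≤ t) {k : Coord n m t}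
    (hk : k ∈ c.overlap c' t) (ν : Fin m) {I : List (Fin n)} (hI : I ≠ []) (l : Fin n) :
    Del ν I (c.xBar c' t l) k = 0 := by
  rw [Del_eq]
  dsimp only
  rw [AChart.orderLE_xBar ht l k hk ν I (by simpa using List.length_pos_iff.mpr hI), mul_zero]

theorem Del_yBar_eq_zero {t : ℕ} {c c' : AChart n m X} (ht : 1 ≤ t) {k : Coord n m t}
    (hk : k ∈ c.overlap c' t) (ν β : Fin m) {I J : List (Fin n)} (hIJ : J.length < I.length)
    (hJ : J.length ≤ t) : Del ν I (c.yBar c' t β J) k = 0 := by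
  rw [Del_eq]
  dsimp only
  rw [AChart.orderLE_yBar ht β J hJ k hk ν I (by simpa using hIJ), mul_zero]

/-- For |I| ≥ 1 the functions x̄ do not depend on y_I, and ȳ_J does not depend on y_I when |J| <
|I|. The general law then loses the correction term and the short tuples J. -/
theorem HS_change_of_ne_nil (hs : 1 ≤ s) (ht : 2 * s ≤ t) (hst : s ≤ t) (hT : T.IsHomogeneous)
    (c c' : AChart n m X) {k : Coord n m t} (hk : k ∈ c.overlap c' t) (σ ν : Fin m)
    {I : List (Fin n)} (hI0 : I ≠ []) (hI : I.length ≤ s) :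
    HS hst (T.nonhom c) σ ν I k
      = c.J c' t k * ∑ α, c.P c' t α σ k *
          ∑ j ∈ Finset.Icc I.length s, ∑ J : Fin j → Fin n, ∑ β,
            Del ν I (c.yBar c' t β (List.ofFn J)) k
            * HS hst (T.nonhom c') α β (List.ofFn J) (c.change c' t k) := by
  rw [HS_change hs ht hst hT c c' hk σ ν hI]
  have ht1 := hs.trans hst
  simp only [Del_xBar_eq_zero ht1 hk ν hI0, mul_zero, Finset.sum_const_zero, sub_zero]
  congr 1
  refine Finset.sum_congr rfl fun α _ => ?_
  congr 1
  symm
  refine Finset.sum_subset (fun j hj => ?_) fun j hj hj' => ?_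
  · rw [Finset.mem_Icc] at hj
    exact Finset.mem_range.mpr (by omega)
  · rw [Finset.mem_range] at hj
    rw [Finset.mem_Icc, not_and] at hj'
    refine Finset.sum_eq_zero fun J _ => Finset.sum_eq_zero fun β _ => ?_
    rw [Del_yBar_eq_zero ht1 hk ν β (by simp; omega) (by simp; omega), zero_mul]

end Extraction

/-! ## Exterior products with 1-forms -/

section Wedge

variable {V : Type*} [AddCommGroup V] [Module ℝ V]

theorem sum_form_apply {ι : Type*} {q : ℕ} (t : Finset ι) (β : ι → V [⋀^Fin q]→ₗ[ℝ] ℝ)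
    (v : Fin q → V) : (∑ i ∈ t, β i) v = ∑ i ∈ t, β i v := by
  classical
  induction t using Finset.induction_on with
  | empty => rfl
  | insert i t hi ih => rw [Finset.sum_insert hi, Finset.sum_insert hi, AlternatingMap.add_apply, ih]

/-- The shuffle that puts the index `i` in front. -/
def frontShuffle {a : ℕ} (f : Fin 1 ⊕ Fin a ≃ Fin (a + 1)) (i : Fin (a + 1)) :
    Equiv.Perm (Fin 1 ⊕ Fin a) := f.symm.permCongr i.cycleRange.symm

/-- A coset of the permutations that preserve the blocks of sizes 1 and a is determined by where the
single element of the first block goes. The shuffles of type (1, a) are thus indexed by a + 1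
positions. -/
theorem bijective_frontShuffle {a : ℕ} {f : Fin 1 ⊕ Fin a ≃ Fin (a + 1)} (hf : f (Sum.inl 0) = 0) :
    Function.Bijective (fun i => (Quotient.mk'' (frontShuffle f i) :
      Equiv.Perm.ModSumCongr (Fin 1) (Fin a))) := by
  have h0 : ∀ i, frontShuffle f i (Sum.inl 0) = f.symm i := fun i => by
    simp [frontShuffle, Equiv.permCongr_apply, hf]
  constructor
  · intro i j hij
    have h1 := QuotientGroup.leftRel_apply.mp (Quotient.exact' hij)
    obtain ⟨⟨p, q⟩, hpq⟩ := h1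
    have h2 := Equiv.congr_fun hpq (Sum.inl 0)
    rw [Equiv.Perm.sumCongrHom_apply, Equiv.Perm.sumCongr_apply, Sum.map_inl,
      Subsingleton.elim (p 0) 0, Equiv.Perm.mul_apply, Equiv.Perm.eq_inv_iff_eq, h0, h0] at h2
    exact f.symm.injective h2
  · intro q
    induction q using Quotient.inductionOn' with
    | h σ =>
      refine ⟨f (σ (Sum.inl 0)), Quotient.sound' ?_⟩
      rw [QuotientGroup.leftRel_apply]
      refine Equiv.Perm.mem_sumCongrHom_range_of_perm_mapsTo_inl ?_
      rintro _ ⟨j, rfl⟩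
      rw [Subsingleton.elim j 0]
      refine ⟨0, ?_⟩
      rw [Equiv.Perm.mul_apply, Equiv.Perm.eq_inv_iff_eq, h0, f.symm_apply_apply]

/-- The shuffle that brings the position i to the front is a cycle of sign (-1)^i, so the exterior
product with a 1-form is an alternating sum of the type of a cofactor expansion. -/
theorem wedge_oneForm_apply {a : ℕ} (h : 1 + a = a + 1) (w : V →ₗ[ℝ] ℝ) (β : V [⋀^Fin a]→ₗ[ℝ] ℝ)
    (v : Fin (a + 1) → V) : wedge h (oneForm w) β v
      = ∑ i : Fin (a + 1), (-1 : ℝ) ^ (i : ℕ) * (w (v i) * β (i.removeNth v)) := by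
  set f : Fin 1 ⊕ Fin a ≃ Fin (a + 1) := finSumFinEquiv.trans (finCongr h) with hf
  have hl : f (Sum.inl 0) = 0 := by
    ext; simp [hf]
  have hr : ∀ j, f (Sum.inr j) = j.succ := fun j => by
    ext; simp [hf]
  rw [wedge, AlternatingMap.domDomCongr_apply, LinearMap.compAlternatingMap_apply,
    AlternatingMap.domCoprod_apply, _root_.sum_apply, map_sum]
  refine (Fintype.sum_bijective _ (bijective_frontShuffle hl) _ _ fun i => ?_).symm
  rw [AlternatingMap.domCoprod.summand_mk'', _root_.smul_apply,
    MultilinearMap.domDomCongr_apply, MultilinearMap.domCoprod_apply]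
  have h1 : Equiv.Perm.sign (frontShuffle f i) = (-1) ^ (i : ℕ) := by
    rw [frontShuffle, Equiv.Perm.sign_permCongr, Equiv.Perm.sign_symm, Fin.sign_cycleRange]
  have h2 : ∀ x, f (frontShuffle f i x) = i.cycleRange.symm (f x) := fun x => by
    simp [frontShuffle, Equiv.permCongr_apply]
  have h3 : ∀ x, (v ∘ f) (frontShuffle f i x) = v (i.cycleRange.symm (f x)) := fun x => by
    rw [Function.comp_apply, h2]
  simp only [AlternatingMap.coe_multilinearMap]
  have e1 : (fun j => (v ∘ f) (frontShuffle f i (Sum.inr j))) = i.removeNth v := by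
    funext j
    rw [h3, hr, Fin.cycleRange_symm_succ]
    rfl
  have e2 : oneForm w (fun j => (v ∘ f) (frontShuffle f i (Sum.inl j))) = w (v i) := by
    rw [oneForm, AlternatingMap.ofSubsingleton_apply_apply, h3, hl, Fin.cycleRange_symm_zero]
  change _ = (TensorProduct.lid ℝ ℝ) (_ • (oneForm w (fun j => (v ∘ f) (frontShuffle f i (Sum.inl j)))
    ⊗ₜ[ℝ] β (fun j => (v ∘ f) (frontShuffle f i (Sum.inr j)))))
  rw [e1, e2, h1]
  rcases Nat.even_or_odd (i : ℕ) with he | ho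
  · simp [he.neg_one_pow]
  · simp [ho.neg_one_pow]

variable {a q : ℕ} (h : 1 + a = q)

/-- `(w, β) ↦ w ∧ β` as a bilinear map. -/
def wedgeL : (V →ₗ[ℝ] ℝ) →ₗ[ℝ] (V [⋀^Fin a]→ₗ[ℝ] ℝ) →ₗ[ℝ] (V [⋀^Fin q]→ₗ[ℝ] ℝ) :=
  LinearMap.mk₂ ℝ (fun w β => wedge h (oneForm w) β)
    (by
      obtain rfl : q = a + 1 := by omega
      intro w w' β
      ext v
      rw [AlternatingMap.add_apply]
      simp only [wedge_oneForm_apply, LinearMap.add_apply, ← Finset.sum_add_distrib]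
      exact Finset.sum_congr rfl fun i _ => by ring)
    (by
      obtain rfl : q = a + 1 := by omega
      intro r w β
      ext v
      rw [AlternatingMap.smul_apply]
      simp only [wedge_oneForm_apply, LinearMap.smul_apply, smul_eq_mul, Finset.mul_sum]
      exact Finset.sum_congr rfl fun i _ => by ring)
    (by
      obtain rfl : q = a + 1 := by omega
      intro w β β'
      ext v
      rw [AlternatingMap.add_apply]
      simp only [wedge_oneForm_apply, AlternatingMap.add_apply, ← Finset.sum_add_distrib]
      exact Finset.sum_congr rfl fun i _ => by ring)
    (by
      obtain rfl : q = a + 1 := by omega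
      intro r w β
      ext v
      rw [AlternatingMap.smul_apply]
      simp only [wedge_oneForm_apply, AlternatingMap.smul_apply, smul_eq_mul, Finset.mul_sum]
      exact Finset.sum_congr rfl fun i _ => by ring)

theorem wedgeL_apply (w : V →ₗ[ℝ] ℝ) (β : V [⋀^Fin a]→ₗ[ℝ] ℝ) :
    wedgeL h w β = wedge h (oneForm w) β := rfl

theorem wedgeL_compLinearMap {W : Type*} [AddCommGroup W] [Module ℝ W] (w : V →ₗ[ℝ] ℝ)
    (β : V [⋀^Fin a]→ₗ[ℝ] ℝ) (L : W →ₗ[ℝ] V) :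
    (wedgeL h w β).compLinearMap L = wedgeL h (w ∘ₗ L) (β.compLinearMap L) := by
  obtain rfl : q = a + 1 := by omega
  ext v
  rw [AlternatingMap.compLinearMap_apply, wedgeL_apply, wedgeL_apply, wedge_oneForm_apply,
    wedge_oneForm_apply]
  rfl

/-- Interior product with a vector. -/
def contract (e : V) (α : V [⋀^Fin q]→ₗ[ℝ] ℝ) : V [⋀^Fin a]→ₗ[ℝ] ℝ :=
  (α.domDomCongr (finCongr (by omega : q = a + 1))).curryLeft e

/-- Of the multilinear expansion only the terms with at most one entry e survive, by alternation. -/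
theorem map_sub_smul_eq {ι : Type*} [DecidableEq ι] (α : V [⋀^ι]→ₗ[ℝ] ℝ) (e : V) (c : ι → ℝ)
    (S : Finset ι) (v : ι → V) : α (fun i => if i ∈ S then v i - c i • e else v i)
      = α v - ∑ i ∈ S, c i * α (Function.update v i e) := by
  induction S using Finset.induction_on generalizing v with
  | empty => simp
  | insert j S hj ih =>
    have h1 : (fun i => if i ∈ insert j S then v i - c i • e else v i)
        = Function.update (fun i => if i ∈ S then v i - c i • e else v i) j (v j - c j • e) := by
      funext i
      by_cases hij : i = j
      · subst hij; simp
      · simp [hij]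
    have h2 : Function.update (fun i => if i ∈ S then v i - c i • e else v i) j (v j)
        = fun i => if i ∈ S then v i - c i • e else v i := by
      funext i
      by_cases hij : i = j
      · subst hij; simp [hj]
      · simp [hij]
    have h3 : Function.update (fun i => if i ∈ S then v i - c i • e else v i) j e
        = fun i => if i ∈ S then Function.update v j e i - c i • e else Function.update v j e i := by
      funext i
      by_cases hij : i = j
      · subst hij; simp [hj]
      · simp [hij]
    have h4 : ∀ i ∈ S, α (Function.update (Function.update v j e) i e) = 0 := by
      intro i hi
      have hij : i ≠ j := fun h => hj (h ▸ hi)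
      exact α.map_eq_zero_of_eq _ (i := i) (j := j) (by simp [hij.symm]) hij
    have h5 : ∑ i ∈ S, c i * α (Function.update (Function.update v j e) i e) = 0 :=
      Finset.sum_eq_zero fun i hi => by rw [h4 i hi, mul_zero]
    rw [h1, α.map_update_sub, α.map_update_smul, h2, h3, ih v, ih (Function.update v j e),
      Finset.sum_insert hj, h5, sub_zero, smul_eq_mul]
    ring

/-- Projection along `e` changes a form by a multiple of the 1-form. -/
theorem compLinearMap_sub_eq (w : V →ₗ[ℝ] ℝ) (e : V) (α : V [⋀^Fin q]→ₗ[ℝ] ℝ) :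
    α.compLinearMap (LinearMap.id - w.smulRight e) = α - wedgeL h w (contract h e α) := by
  obtain rfl : q = a + 1 := by omega
  ext v
  rw [AlternatingMap.sub_apply, AlternatingMap.compLinearMap_apply, wedgeL_apply,
    wedge_oneForm_apply]
  have h1 := map_sub_smul_eq α e (fun i => w (v i)) Finset.univ v
  simp only [Finset.mem_univ, if_true] at h1
  refine h1.trans ?_
  congr 1
  refine Finset.sum_congr rfl fun i _ => ?_
  have h2 : Function.update v i e = i.insertNth e (i.removeNth v) := by
    rw [Fin.insertNth_removeNth]
  have h3 : contract h e α (i.removeNth v) = α (Matrix.vecCons e (i.removeNth v)) := rfl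
  rw [h2, h3, AlternatingMap.map_insertNth, zsmul_eq_mul]
  push_cast
  ring

end Wedge

/-! ### Division of smooth forms by 1-forms -/

section SmoothForms

variable {n m r a q : ℕ} {U : Set (Coord n m r)}

theorem SmoothFormOn.wedgeL (h : 1 + a = q) {w : Coord n m r → Coord n m r →ₗ[ℝ] ℝ}
    (hw : ∀ v, ContDiffOn ℝ ∞ (fun k => w k v) U) {β : CForm n m r a} (hβ : SmoothFormOn U β) :
    SmoothFormOn U (fun k => wedgeL h (w k) (β k)) := by
  obtain rfl : q = a + 1 := by omega
  intro v
  simp only [wedgeL_apply, wedge_oneForm_apply]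
  exact ContDiffOn.sum fun i _ => contDiffOn_const.mul ((hw _).mul (hβ _))

theorem SmoothFormOn.sub {α β : CForm n m r q} (hα : SmoothFormOn U α) (hβ : SmoothFormOn U β) :
    SmoothFormOn U (fun k => α k - β k) := fun v => (hα v).sub (hβ v)

theorem SmoothFormOn.smul {f : Coord n m r → ℝ} (hf : ContDiffOn ℝ ∞ f U) {β : CForm n m r q}
    (hβ : SmoothFormOn U β) : SmoothFormOn U (fun k => f k • β k) := fun v => hf.mul (hβ v)

theorem SmoothFormOn.sum {ι : Type*} {t : Finset ι} {β : ι → CForm n m r q}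
    (hβ : ∀ i, SmoothFormOn U (β i)) : SmoothFormOn U (fun k => ∑ i ∈ t, β i k) := fun v => by
  have : (fun k => (∑ i ∈ t, β i k) v) = fun k => ∑ i ∈ t, β i k v := by
    funext k
    rw [sum_form_apply]
  rw [this]
  exact ContDiffOn.sum fun i _ => hβ i v

theorem SmoothFormOn.contract (h : 1 + a = q) (e : Coord n m r) {β : CForm n m r q}
    (hβ : SmoothFormOn U β) : SmoothFormOn U (fun k => contract h e (β k)) := fun _ => hβ _

/-- A smooth form that vanishes on the common kernel of 1-forms is a sum of multiples of them. -/
theorem exists_eq_sum_wedgeL {ι : Type*} [DecidableEq ι] (h : 1 + a = q)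
    {w : ι → Coord n m r → Coord n m r →ₗ[ℝ] ℝ} {e : ι → Coord n m r}
    (hw : ∀ i v, ContDiffOn ℝ ∞ (fun k => w i k v) U)
    (hwe : ∀ i j k, w i k (e j) = if i = j then 1 else 0) (S : Finset ι) (α : CForm n m r q)
    (hα : SmoothFormOn U α) :
    ∃ Φ : ι → CForm n m r a, (∀ i, SmoothFormOn U (Φ i)) ∧
      ∀ k, α k = (α k).compLinearMap (LinearMap.id - ∑ i ∈ S, (w i k).smulRight (e i))
        + ∑ i ∈ S, wedgeL h (w i k) (Φ i k) := by
  induction S using Finset.induction_on generalizing α with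
  | empty =>
    refine ⟨fun _ _ => 0, fun _ _ => contDiffOn_const, fun k => ?_⟩
    simp only [Finset.sum_empty, sub_zero, add_zero]
    rfl
  | insert j S hj ih =>
    -- The 1-forms are split off one at a time: projecting along e_j subtracts the multiple of w_j
    -- by the contraction with e_j, which is again smooth.
    have h1 : ∀ k, (α k).compLinearMap (LinearMap.id - (w j k).smulRight (e j))
        = α k - HelmholtzSonin.wedgeL h (w j k) (HelmholtzSonin.contract h (e j) (α k)) :=
      fun k => compLinearMap_sub_eq h (w j k) (e j) (α k)
    have h2 : SmoothFormOn U (fun k =>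
        (α k).compLinearMap (LinearMap.id - (w j k).smulRight (e j))) := by
      simp only [h1]
      exact hα.sub (SmoothFormOn.wedgeL h (hw j) (hα.contract h (e j)))
    obtain ⟨Φ, hΦ, hk⟩ := ih _ h2
    refine ⟨Function.update Φ j fun k => HelmholtzSonin.contract h (e j) (α k), fun i => ?_,
      fun k => ?_⟩
    · by_cases hij : i = j
      · subst hij
        rw [Function.update_self]
        exact hα.contract h (e i)
      · rw [Function.update_of_ne hij]
        exact hΦ i
    · have h3 := hk k
      rw [h1] at h3
      -- The successive projections compose to the simultaneous one because w_j vanishes on e_i for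
      -- i ≠ j.
      have h4 : (α k - HelmholtzSonin.wedgeL h (w j k) (HelmholtzSonin.contract h (e j) (α k))).compLinearMap
          (LinearMap.id - ∑ i ∈ S, (w i k).smulRight (e i))
          = (α k).compLinearMap (LinearMap.id - ∑ i ∈ insert j S, (w i k).smulRight (e i)) := by
        rw [← h1]
        ext v
        simp only [AlternatingMap.compLinearMap_apply]
        congr 1
        funext p
        rw [Finset.sum_insert hj]
        have h5 : w j k (∑ i ∈ S, (w i k (v p)) • e i) = 0 := by
          rw [map_sum]
          refine Finset.sum_eq_zero fun i hi => ?_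
          rw [map_smul, hwe, if_neg fun h : j = i => hj (h ▸ hi), smul_zero]
        simp only [LinearMap.sub_apply, LinearMap.id_apply, LinearMap.smulRight_apply,
          LinearMap.add_apply, LinearMap.sum_apply, map_sub, h5]
        module
      rw [h4] at h3
      have h6 : ∑ i ∈ S, HelmholtzSonin.wedgeL h (w i k) (Function.update Φ j
          (fun k => HelmholtzSonin.contract h (e j) (α k)) i k)
          = ∑ i ∈ S, HelmholtzSonin.wedgeL h (w i k) (Φ i k) :=
        Finset.sum_congr rfl fun i hi => by
          rw [Function.update_of_ne fun h : i = j => hj (h ▸ hi)]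
      rw [Finset.sum_insert (f := fun i => HelmholtzSonin.wedgeL h (w i k) (Function.update Φ j
          (fun k => HelmholtzSonin.contract h (e j) (α k)) i k)) hj, h6, Function.update_self]
      rw [sub_eq_iff_eq_add] at h3
      refine h3.trans ?_
      abel

end SmoothForms

/-! ## Contact forms under chart changes -/

section Vertical

/-- Pairs of an index `ν` and a tuple of length at most `q`. -/
abbrev VIdx (m n q : ℕ) : Type := Fin m × (Σ j : Fin (q + 1), Fin j → Fin n)

/-- The tuple of a pair. -/
def VIdx.tuple {m n q : ℕ} (a : VIdx m n q) : List (Fin n) := List.ofFn a.2.2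

theorem VIdx.length_tuple_le {m n q : ℕ} (a : VIdx m n q) : a.tuple.length ≤ q := by
  rw [VIdx.tuple, List.length_ofFn]
  exact Nat.lt_succ_iff.mp a.2.1.2

theorem sum_vIdx {m n q : ℕ} {M : Type*} [AddCommMonoid M] (g : Fin m → List (Fin n) → M) :
    ∑ a : VIdx m n q, g a.1 a.tuple
      = ∑ j ∈ Finset.range (q + 1), ∑ I : Fin j → Fin n, ∑ ν, g ν (List.ofFn I) := by
  rw [Fintype.sum_prod_type_right, Fintype.sum_sigma, Finset.sum_range]
  rfl

theorem sum_range_tupleSum {m n q : ℕ} {M : Type*} [AddCommMonoid M]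
    (g : Fin m → List (Fin n) → M) :
    ∑ j ∈ Finset.range (q + 1), ∑ ν, tupleSum j (g ν) = ∑ a : VIdx m n q, g a.1 a.tuple := by
  rw [sum_vIdx]
  refine Finset.sum_congr rfl fun j _ => ?_
  rw [Finset.sum_comm]
  exact Finset.sum_congr rfl fun ν _ => (sum_ofFn j (g ν)).symm

/-- Linear algebra of ω̄ = dȳ − ȳ_p dx̄^p: both differentials are split into a horizontal part and a
contact part. The horizontal parts cancel since PQ = 1, and the coefficients of the contact part are
collected. -/
theorem sum_sub_sum_mul_inv {ι κ : Type*} [Fintype ι] [DecidableEq ι] [Fintype κ]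
    {P Q : Matrix ι ι ℝ} (h : P * Q = 1) (v y : ι → ℝ) (A w : κ → ℝ) (B : ι → κ → ℝ) :
    ∑ p, v p * y p + ∑ a, A a * w a
        - ∑ x, (∑ i, P i x * y i) * (∑ p, v p * Q x p + ∑ a, B x a * w a)
      = ∑ a, (A a - ∑ i, ∑ x, P i x * y i * B x a) * w a := by
  have h1 : ∑ x, (∑ i, P i x * y i) * ∑ p, v p * Q x p = ∑ p, v p * y p := by
    calc ∑ x, (∑ i, P i x * y i) * ∑ p, v p * Q x p
        = ∑ x, ∑ p, ∑ i, v p * (P i x * Q x p * y i) := by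
          refine Finset.sum_congr rfl fun x _ => ?_
          rw [Finset.mul_sum]
          refine Finset.sum_congr rfl fun p _ => ?_
          rw [Finset.sum_mul]
          exact Finset.sum_congr rfl fun i _ => by ring
      _ = ∑ p, ∑ i, v p * ((P * Q) i p * y i) := by
          rw [Finset.sum_comm]
          refine Finset.sum_congr rfl fun p _ => ?_
          rw [Finset.sum_comm]
          refine Finset.sum_congr rfl fun i _ => ?_
          rw [Matrix.mul_apply, Finset.sum_mul, Finset.mul_sum]
      _ = ∑ p, v p * y p := by simp [h, Matrix.one_apply]
  have h2 : ∑ x, (∑ i, P i x * y i) * ∑ a, B x a * w a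
      = ∑ a, (∑ i, ∑ x, P i x * y i * B x a) * w a := by
    simp_rw [Finset.mul_sum]
    rw [Finset.sum_comm]
    refine Finset.sum_congr rfl fun a _ => ?_
    rw [Finset.sum_comm, Finset.sum_mul]
    refine Finset.sum_congr rfl fun x _ => ?_
    rw [Finset.sum_mul, Finset.sum_mul]
    exact Finset.sum_congr rfl fun i _ => by ring
  simp only [mul_add, Finset.sum_add_distrib, h1, h2, sub_mul, Finset.sum_sub_distrib]
  ring

variable {n m r : ℕ}

theorem omega_apply (σ : Fin m) (I : Multiset (Fin n)) (k v : Coord n m r) :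
    omega σ I k v = dy σ I v - ∑ i, dy σ (i ::ₘ I) k * v.1 i := by
  simp [omega, dx_apply]

/-- The vertical remainder after removing the total derivatives is measured by the contact forms.
Only the terms with |I| < r involve genuine contact forms. -/
theorem eq_sum_totalVec_add_omega (k v : Coord n m r) :
    v = ∑ i, v.1 i • totalVec i k + (0, fun σ I => omega σ I.1 k v) := by
  conv_lhs => rw [eq_sum_totalVec k v]
  rw [eq_sum_ey]
  congr 1
  refine Finset.sum_congr rfl fun σ _ => Finset.sum_congr rfl fun I _ => ?_
  rw [omega_apply, dy_apply σ I.2]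
  congr 2
  refine Finset.sum_congr rfl fun i _ => ?_
  split_ifs with h
  · ring
  -- In top order |I| = r the coordinate y_{iI} is zero by convention, so `omega` is just dy^σ_I, as
  -- it should be for the truncated total derivative.
  · rw [dy_of_lt σ (by rw [Multiset.card_cons]; omega)]
    simp

theorem fderiv_eq_sum_omega {q : ℕ} (hq : q ≤ r) {f : Coord n m r → ℝ} {k : Coord n m r}
    (hf : ∀ (σ : Fin m) (I : Multiset (Fin n)), q < I.card → fderiv ℝ f k (ey σ I) = 0)
    (v : Coord n m r) : fderiv ℝ f k v = ∑ i, v.1 i * D i f k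
      + ∑ a : VIdx m n q, Del a.1 a.tuple f k * omega a.1 a.tuple k v := by
  conv_lhs => rw [eq_sum_totalVec_add_omega k v]
  rw [map_add, map_sum, fderiv_vertical hq hf (fun σ I => omega σ I k v),
    sum_range_tupleSum fun σ l => Del σ l f k * omega σ l k v]
  congr 1
  exact Finset.sum_congr rfl fun i _ => by rw [map_smul]; rfl

end Vertical

/-! ### Pull-back of contact forms under chart changes -/

section Change

variable {n m : ℕ} {X : Type*} [TopologicalSpace X] [ChartedSpace (Fin (n + m) → ℝ) X]

namespace AChart

variable {c c' : AChart n m X} {t : ℕ} (ht : 1 ≤ t) {k : Coord n m t} (hk : k ∈ c.overlap c' t)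
include ht hk

theorem differentiableAt_change : DifferentiableAt ℝ (c.change c' t) k :=
  ((contDiffOn_change ht).contDiffAt ((isOpen_overlap ht).mem_nhds hk)).differentiableAt (by simp)

theorem fderiv_change_fst (v : Coord n m t) (i : Fin n) :
    (fderiv ℝ (c.change c' t) k v).1 i = fderiv ℝ (c.xBar c' t i) k v := by
  have h := ((ContinuousLinearMap.proj (R := ℝ) i).comp (ContinuousLinearMap.fst ℝ (Fin n → ℝ)
    (Fin m → MIdx n t → ℝ))).hasFDerivAt.comp k (differentiableAt_change ht hk).hasFDerivAt
  exact (congrArg (fun L => L v) h.fderiv).symm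

theorem dy_fderiv_change (v : Coord n m t) (ν : Fin m) (l : List (Fin n)) :
    dy ν (l : Multiset (Fin n)) (fderiv ℝ (c.change c' t) k v)
      = fderiv ℝ (c.yBar c' t ν l) k v := by
  have h := (LinearMap.toContinuousLinearMap
    (dy ν (l : Multiset (Fin n)) : Coord n m t →ₗ[ℝ] ℝ)).hasFDerivAt.comp k
    (differentiableAt_change ht hk).hasFDerivAt
  exact (congrArg (fun L => L v) h.fderiv).symm

theorem fderiv_xBar_eq (v : Coord n m t) (i : Fin n) {q : ℕ} (hq : q ≤ t) :
    fderiv ℝ (c.xBar c' t i) k v = ∑ p, v.1 p * c.Q c' t k i p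
      + ∑ a : VIdx m n q, Del a.1 a.tuple (c.xBar c' t i) k * omega a.1 a.tuple k v :=
  fderiv_eq_sum_omega hq (fun σ I hI => orderLE_xBar ht i k hk σ I (by omega)) v

/-- The recurrence gives ȳ_{pJ} = Pⁱ_p D_i ȳ_J, which makes the dx-part of the pulled-back form
vanish. The remaining coefficients are those of the transformation law of H^I_{σν}, with the roles
of the two charts exchanged. -/
theorem omega_change (β : Fin m) (J : List (Fin n)) {q : ℕ} (hJ : J.length ≤ q) (hq : q < t)
    (v : Coord n m t) :
    omega β J (c.change c' t k) (fderiv ℝ (c.change c' t) k v)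
      = ∑ a : VIdx m n q, (Del a.1 a.tuple (c.yBar c' t β J) k - ∑ i, ∑ p, c.Pmat c' t k i p
          * D i (c.yBar c' t β J) k * Del a.1 a.tuple (c.xBar c' t p) k)
            * omega a.1 a.tuple k v := by
  have hQ : c.Pmat c' t k * c.Q c' t k = 1 :=
    Matrix.nonsing_inv_mul _ (det_Q_ne_zero ht hk).isUnit
  have hy : ∀ p, dy β (p ::ₘ (J : Multiset (Fin n))) (c.change c' t k)
      = ∑ i, c.Pmat c' t k i p * D i (c.yBar c' t β J) k := fun p =>
    yBar_cons ht β p J (by omega) hk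
  rw [omega_apply, dy_fderiv_change ht hk, fderiv_eq_sum_omega hq.le
    (fun σ I hI => orderLE_yBar ht β J (by omega) k hk σ I (by omega)) v]
  simp only [hy, fderiv_change_fst ht hk, fderiv_xBar_eq ht hk v _ hq.le]
  exact sum_sub_sum_mul_inv hQ _ _ _ _ _

theorem omega_zero_change (α : Fin m) (v : Coord n m t) :
    omega α 0 (c.change c' t k) (fderiv ℝ (c.change c' t) k v)
      = ∑ σ, c.P c' t α σ k * omega σ 0 k v := by
  -- With order bound 0 only the empty tuple remains.
  have h := omega_change ht hk α [] (Nat.zero_le 0) ht v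
  rw [sum_vIdx fun ν l => (Del ν l (c.yBar c' t α []) k - ∑ i, ∑ p, c.Pmat c' t k i p
    * D i (c.yBar c' t α []) k * Del ν l (c.xBar c' t p) k) * omega ν l k v] at h
  rw [Finset.sum_range_one, Fintype.sum_unique] at h
  simp only [List.ofFn_zero] at h
  refine h.trans (Finset.sum_congr rfl fun σ _ => ?_)
  congr 1
  rw [P]
  congr 1
  rw [Finset.sum_comm]
  refine Finset.sum_congr rfl fun p _ => ?_
  rw [yBar_cons ht α p [] (by simpa using ht) hk, Finset.sum_mul]

end AChart

end Change

/-! ### Transformation of the Helmholtz form -/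

section HelmholtzForm

variable {V : Type*} [AddCommGroup V] [Module ℝ V]

theorem compLinearMap_sum {W ι : Type*} [AddCommGroup W] [Module ℝ W] {q : ℕ} (S : Finset ι)
    (β : ι → V [⋀^Fin q]→ₗ[ℝ] ℝ) (L : W →ₗ[ℝ] V) :
    (∑ i ∈ S, β i).compLinearMap L = ∑ i ∈ S, (β i).compLinearMap L := by
  ext v
  rw [sum_form_apply, AlternatingMap.compLinearMap_apply, sum_form_apply]
  rfl

theorem sum_comm₃ {M ι κ μ : Type*} [AddCommMonoid M] [Fintype ι] [Fintype κ] [Fintype μ]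
    (f : ι → κ → μ → M) : ∑ i, ∑ j, ∑ k, f i j k = ∑ j, ∑ k, ∑ i, f i j k := by
  rw [Finset.sum_comm]
  exact Finset.sum_congr rfl fun j _ => Finset.sum_comm

/-- The coefficients H and the vectors w, u transform contragrediently, with the same matrices A and
P. Substituting the transformed vectors therefore reassembles H, and only the factor J is left over.
-/
theorem sum_smul_bilin_change {M κ ι : Type*} [AddCommGroup M] [Module ℝ M] [Fintype κ] [Fintype ι]
    (B : V →ₗ[ℝ] V →ₗ[ℝ] M) {A : κ → κ → ℝ} {P : ι → ι → ℝ} {J : ℝ} (hJ : J ≠ 0)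
    {H H' : ι → κ → ℝ} (hH : ∀ σ q, H σ q = J * ∑ α, P α σ * ∑ p, A p q * H' α p)
    (w : κ → V) (u : ι → V) :
    ∑ p, ∑ α, H' α p • B (∑ q, A p q • w q) (∑ σ, P α σ • u σ)
      = ∑ q, ∑ σ, H σ q • J⁻¹ • B (w q) (u σ) := by
  calc _ = ∑ p, ∑ α, ∑ q, ∑ σ, (P α σ * (A p q * H' α p)) • B (w q) (u σ) := by
        refine Finset.sum_congr rfl fun p _ => Finset.sum_congr rfl fun α _ => ?_
        rw [show B (∑ q, A p q • w q) = ∑ q, B (A p q • w q) from map_sum _ _ _,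
          LinearMap.sum_apply, Finset.smul_sum]
        refine Finset.sum_congr rfl fun q _ => ?_
        rw [map_sum, Finset.smul_sum]
        refine Finset.sum_congr rfl fun σ _ => ?_
        rw [(B _).map_smul, B.map_smul, LinearMap.smul_apply, smul_smul, smul_smul]
        congr 1
        ring
    _ = ∑ q, ∑ σ, ∑ α, ∑ p, (P α σ * (A p q * H' α p)) • B (w q) (u σ) := by
        rw [Finset.sum_comm]
        exact (Finset.sum_congr rfl fun α _ => sum_comm₃ _).trans (sum_comm₃ _)
    _ = _ := by
        refine Finset.sum_congr rfl fun q _ => Finset.sum_congr rfl fun σ _ => ?_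
        rw [hH, smul_smul, mul_comm J, mul_assoc, mul_inv_cancel₀ hJ, mul_one, Finset.sum_smul]
        refine Finset.sum_congr rfl fun α _ => ?_
        rw [Finset.mul_sum, Finset.sum_smul]

variable {n m s t : ℕ}

/-- The form `∑ H^I_{σν} ω^ν_I ∧ ω^σ ∧ Λ` at the point `k`, as a function of `Λ`. -/
def helmForm (h : s ≤ t) (F : Fin m → Coord n m s → ℝ) (k : Coord n m t) :
    ((Coord n m t) [⋀^Fin n]→ₗ[ℝ] ℝ) →ₗ[ℝ] ((Coord n m t) [⋀^Fin (n + 2)]→ₗ[ℝ] ℝ) :=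
  ∑ a : VIdx m n s, ∑ σ, HS h F σ a.1 a.tuple k •
    (wedgeL (by omega : 1 + (1 + n) = n + 2) (omega a.1 a.tuple k) ∘ₗ
      wedgeL (rfl : 1 + n = 1 + n) (omega σ 0 k))

theorem helmForm_apply (h : s ≤ t) (F : Fin m → Coord n m s → ℝ) (k : Coord n m t)
    (L : (Coord n m t) [⋀^Fin n]→ₗ[ℝ] ℝ) :
    helmForm h F k L = ∑ a : VIdx m n s, ∑ σ, HS h F σ a.1 a.tuple k •
      wedgeL (by omega : 1 + (1 + n) = n + 2) (omega a.1 a.tuple k)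
        (wedgeL (rfl : 1 + n = 1 + n) (omega σ 0 k) L) := by
  simp [helmForm]

theorem HSForm_eq (h : s ≤ t) (F : Fin m → Coord n m s → ℝ) (k : Coord n m t) :
    HSForm h F k = helmForm h F k theta0 := by
  rw [helmForm_apply, HSForm]
  rw [sum_vIdx fun ν l => ∑ σ, HS h F σ ν l k •
      wedgeL (by omega : 1 + (1 + n) = n + 2) (omega ν l k)
        (wedgeL (rfl : 1 + n = 1 + n) (omega σ 0 k) theta0)]
  refine Finset.sum_congr rfl fun j _ => Finset.sum_congr rfl fun I _ => ?_
  rw [Finset.sum_comm]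
  rfl

variable {X : Type*} [TopologicalSpace X] [ChartedSpace (Fin (n + m) → ℝ) X] {T : DiffEq n m X s}

/-- The matrices of the law for H^I_{σν} are those of the contact forms, so they cancel and 𝓙⁻¹
remains. It is attached to the n-form so that the invariance of the whole expression becomes a
condition on that n-form alone. -/
theorem helmForm_change (hs : 1 ≤ s) (ht : 2 * s ≤ t) (hst : s ≤ t) (hT : T.IsHomogeneous)
    (c c' : AChart n m X) {k : Coord n m t} (hk : k ∈ c.overlap c' t)
    (L : (Coord n m t) [⋀^Fin n]→ₗ[ℝ] ℝ) :
    (helmForm hst (T.nonhom c') (c.change c' t k) L).compLinearMap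
        (fderiv ℝ (c.change c' t) k : Coord n m t →ₗ[ℝ] Coord n m t)
      = helmForm hst (T.nonhom c) k ((c.J c' t k)⁻¹ • L.compLinearMap
        (fderiv ℝ (c.change c' t) k : Coord n m t →ₗ[ℝ] Coord n m t)) := by
  have ht1 : 1 ≤ t := hs.trans hst
  set G : Coord n m t →ₗ[ℝ] Coord n m t := 
    (fderiv ℝ (c.change c' t) k : Coord n m t →ₗ[ℝ] Coord n m t) with hG
  have hw : ∀ p : VIdx m n s, omega p.1 p.tuple (c.change c' t k) ∘ₗ G
      = ∑ q : VIdx m n s, (Del q.1 q.tuple (c.yBar c' t p.1 p.tuple) k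
        - ∑ i, ∑ l, c.Pmat c' t k i l * D i (c.yBar c' t p.1 p.tuple) k
            * Del q.1 q.tuple (c.xBar c' t l) k) • omega q.1 q.tuple k := fun p => by
    refine LinearMap.ext fun v => ?_
    rw [LinearMap.sum_apply]
    exact AChart.omega_change ht1 hk p.1 p.tuple p.length_tuple_le (by omega) v
  have hu : ∀ α, omega α 0 (c.change c' t k) ∘ₗ G
      = ∑ σ, c.P c' t α σ k • omega σ 0 k := fun α => by
    refine LinearMap.ext fun v => ?_
    rw [LinearMap.sum_apply]
    exact AChart.omega_zero_change ht1 hk α v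
  have hH : ∀ (σ : Fin m) (q : VIdx m n s), HS hst (T.nonhom c) σ q.1 q.tuple k
      = c.J c' t k * ∑ α, c.P c' t α σ k * ∑ p : VIdx m n s,
        (Del q.1 q.tuple (c.yBar c' t p.1 p.tuple) k
        - ∑ i, ∑ l, c.Pmat c' t k i l * D i (c.yBar c' t p.1 p.tuple) k
            * Del q.1 q.tuple (c.xBar c' t l) k)
          * HS hst (T.nonhom c') α p.1 p.tuple (c.change c' t k) := fun σ q => by
    rw [HS_change hs ht hst hT c c' hk σ q.1 q.length_tuple_le]
    refine congrArg _ (Finset.sum_congr rfl fun α _ => congrArg _ ?_)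
    exact (sum_vIdx fun β l => (Del q.1 q.tuple (c.yBar c' t β l) k
        - ∑ i, ∑ p, c.Pmat c' t k i p * D i (c.yBar c' t β l) k
            * Del q.1 q.tuple (c.xBar c' t p) k)
          * HS hst (T.nonhom c') α β l (c.change c' t k)).symm
  set B : (Coord n m t →ₗ[ℝ] ℝ) →ₗ[ℝ] (Coord n m t →ₗ[ℝ] ℝ) →ₗ[ℝ]
      ((Coord n m t) [⋀^Fin (n + 2)]→ₗ[ℝ] ℝ) :=
    LinearMap.mk₂ ℝ (fun w u => wedgeL (by omega : 1 + (1 + n) = n + 2) w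
      (wedgeL (rfl : 1 + n = 1 + n) u (L.compLinearMap G)))
      (fun _ _ _ => by simp) (fun _ _ _ => by simp) (fun _ _ _ => by simp) (fun _ _ _ => by simp)
    with hB
  have key := sum_smul_bilin_change B (AChart.det_Q_ne_zero ht1 hk) hH
    (fun q : VIdx m n s => omega q.1 q.tuple k) (fun σ => omega σ 0 k)
  rw [helmForm_apply, helmForm_apply, compLinearMap_sum]
  refine Eq.trans (Finset.sum_congr rfl fun p _ => ?_) (key.trans
    (Finset.sum_congr rfl fun q _ => Finset.sum_congr rfl fun σ _ => ?_))
  · rw [compLinearMap_sum]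
    refine Finset.sum_congr rfl fun α _ => ?_
    rw [← hw, ← hu]
    change HS hst (T.nonhom c') α p.1 p.tuple (c.change c' t k) • (wedgeL _ _ _).compLinearMap G = _
    rw [wedgeL_compLinearMap, wedgeL_compLinearMap]
    rfl
  · rw [map_smul, map_smul]
    rfl

end HelmholtzForm

/-! ## A Riemannian metric in charts -/

section Metric

variable {n m : ℕ} {X : Type*} [TopologicalSpace X] [ChartedSpace (Fin (n + m) → ℝ) X]

/-- The standard scalar product pulled back by a linear map, as a bilinear map. -/
def pullDot {N : ℕ} (L : (Fin N → ℝ) →L[ℝ] (Fin N → ℝ)) :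
    (Fin N → ℝ) →ₗ[ℝ] (Fin N → ℝ) →ₗ[ℝ] ℝ :=
  ∑ A, (LinearMap.mul ℝ ℝ).compl₁₂ (LinearMap.proj A ∘ₗ (L : (Fin N → ℝ) →ₗ[ℝ] (Fin N → ℝ)))
    (LinearMap.proj A ∘ₗ (L : (Fin N → ℝ) →ₗ[ℝ] (Fin N → ℝ)))

theorem pullDot_apply {N : ℕ} (L : (Fin N → ℝ) →L[ℝ] (Fin N → ℝ)) (u v : Fin N → ℝ) :
    pullDot L u v = ∑ A, L u A * L v A := by
  simp [pullDot]

variable (f : SmoothPartitionOfUnity X 𝓘(ℝ, Fin (n + m) → ℝ) X Set.univ)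

/-- The metric given by a partition of unity subordinate to the charts, in the chart `ψ`. -/
def metric (ψ : OpenPartialHomeomorph X (Fin (n + m) → ℝ)) (z : Fin (n + m) → ℝ) :
    (Fin (n + m) → ℝ) →ₗ[ℝ] (Fin (n + m) → ℝ) →ₗ[ℝ] ℝ :=
  ∑ a ∈ f.finsupport (ψ.symm z), f a (ψ.symm z) • pullDot (fderiv ℝ
    (fun z => chartAt (Fin (n + m) → ℝ) a (ψ.symm z)) z)

theorem metric_apply (ψ : OpenPartialHomeomorph X (Fin (n + m) → ℝ)) (z u v : Fin (n + m) → ℝ) :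
    metric f ψ z u v = ∑ a ∈ f.finsupport (ψ.symm z), f a (ψ.symm z) *
      pullDot (fderiv ℝ (fun z => chartAt (Fin (n + m) → ℝ) a (ψ.symm z)) z) u v := by
  simp [metric]

variable [IsManifold 𝓘(ℝ, Fin (n + m) → ℝ) ∞ X]

theorem isChart_chartAt (a : X) : IsChart n m X (chartAt (Fin (n + m) → ℝ) a) :=
  IsManifold.chart_mem_maximalAtlas a

variable {f} (hf : f.IsSubordinate (fun x => (chartAt (Fin (n + m) → ℝ) x).source))
  {ψ ψ' : OpenPartialHomeomorph X (Fin (n + m) → ℝ)} (hψ : IsChart n m X ψ)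
  (hψ' : IsChart n m X ψ')
include hf hψ

theorem contDiffOn_metric (u v : Fin (n + m) → ℝ) :
    ContDiffOn ℝ ∞ (fun z => metric f ψ z u v) ψ.target := by
  intro z hz
  refine ContDiffAt.contDiffWithinAt ?_
  set g : X → (Fin (n + m) → ℝ) → ℝ := fun a z =>
    pullDot (fderiv ℝ (fun z => chartAt (Fin (n + m) → ℝ) a (ψ.symm z)) z) u v with hg
  have h1 : ContMDiffAt 𝓘(ℝ, Fin (n + m) → ℝ) 𝓘(ℝ, ℝ) ∞
      (fun x => ∑ᶠ a, f a x • g a (ψ x)) (ψ.symm z) := by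
    refine f.contMDiffAt_finsum fun a ha => ?_
    have h2 := hψ.contDiffAt_transition (isChart_chartAt a) hz (hf a ha)
    have h3 : ContDiffAt ℝ ∞ (g a) z := by
      simp only [hg, pullDot_apply]
      have h4 : ContDiffAt ℝ ∞ (fderiv ℝ (fun z => chartAt (Fin (n + m) → ℝ) a (ψ.symm z))) z :=
        h2.fderiv_right le_rfl
      exact ContDiffAt.sum fun A _ => (contDiffAt_pi.mp (h4.clm_apply contDiffAt_const) A).mul
        (contDiffAt_pi.mp (h4.clm_apply contDiffAt_const) A)
    have h5 := hψ.contMDiffAt (ψ.map_target hz)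
    rw [← ψ.right_inv hz] at h3
    exact h3.contMDiffAt.comp _ h5
  have h6 := (h1.comp z (hψ.contMDiffAt_symm hz)).contDiffAt
  refine h6.congr_of_eventuallyEq ?_
  filter_upwards [ψ.open_target.mem_nhds hz] with z' hz'
  rw [metric_apply]
  refine Eq.trans ?_ (f.sum_finsupport_smul_eq_finsum (ψ.symm z') fun a x => g a (ψ x))
  simp only [ψ.right_inv hz', smul_eq_mul, hg]

/-- The right-hand side does not mention ψ: it is the scalar product at p as an intrinsic quantity,
and its comparison in two charts gives the transformation of the metric. -/
theorem metric_chartDeriv {p : X} (hp : p ∈ ψ.source) (u v : Fin (n + m) → ℝ) :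
    metric f ψ (ψ p) (chartDeriv ψ p u) (chartDeriv ψ p v)
      = ∑ a ∈ f.finsupport p, f a p *
        pullDot (chartDeriv (chartAt (Fin (n + m) → ℝ) a) p) u v := by
  rw [metric_apply, ψ.left_inv hp]
  refine Finset.sum_congr rfl fun a ha => ?_
  have hpa : p ∈ (chartAt (Fin (n + m) → ℝ) a).source := by
    refine hf a (subset_tsupport _ ?_)
    rwa [f.mem_finsupport] at ha
  simp only [pullDot_apply, fderiv_transition hψ (isChart_chartAt a) hp hpa]

include hψ' in
theorem metric_change {z : Fin (n + m) → ℝ} (hz : z ∈ ψ.target) (hz' : ψ.symm z ∈ ψ'.source)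
    (u v : Fin (n + m) → ℝ) :
    metric f ψ' (ψ' (ψ.symm z)) (fderiv ℝ (fun z => ψ' (ψ.symm z)) z u)
      (fderiv ℝ (fun z => ψ' (ψ.symm z)) z v) = metric f ψ z u v := by
  have hp := ψ.map_target hz
  obtain ⟨e, he, -⟩ := hψ.exists_equiv hp
  have hu : ∀ u, u = chartDeriv ψ (ψ.symm z) (e.symm u) := fun u => by
    rw [← he]
    exact (e.apply_symm_apply u).symm
  have h1 := fderiv_transition hψ hψ' hp hz'
  have h2 := metric_chartDeriv hf hψ hp (e.symm u) (e.symm v)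
  rw [ψ.right_inv hz] at h1 h2
  rw [← hu, ← hu] at h2
  rw [h2, hu u, hu v, h1, h1, metric_chartDeriv hf hψ' hz', ← hu, ← hu]

theorem metric_pos {z u : Fin (n + m) → ℝ} (hz : z ∈ ψ.target) (hu : u ≠ 0) :
    0 < metric f ψ z u u := by
  have hp := ψ.map_target hz
  obtain ⟨e, he, -⟩ := hψ.exists_equiv hp
  have h2 := metric_chartDeriv hf hψ hp (e.symm u) (e.symm u)
  rw [ψ.right_inv hz, ← he] at h2
  rw [show u = (e : _ →L[ℝ] _) (e.symm u) from (e.apply_symm_apply u).symm, h2]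
  obtain ⟨a, ha⟩ := f.exists_pos_of_mem (Set.mem_univ (ψ.symm z))
  have hpa : ψ.symm z ∈ (chartAt (Fin (n + m) → ℝ) a).source :=
    hf a (subset_tsupport _ ha.ne')
  refine Finset.sum_pos' (fun b _ => mul_nonneg (f.nonneg b _) ?_)
    ⟨a, (f.mem_finsupport _).mpr ha.ne', mul_pos ha ?_⟩
  · rw [pullDot_apply]
    exact Finset.sum_nonneg fun A _ => mul_self_nonneg _
  · obtain ⟨e', he', -⟩ := (isChart_chartAt (n := n) (m := m) a).exists_equiv hpa
    rw [pullDot_apply, ← he']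
    have h0 : (e' : _ →L[ℝ] _) (e.symm u) ≠ (0 : Fin (n + m) → ℝ) := by
      simpa using hu
    obtain ⟨A, hA⟩ := Function.ne_iff.mp h0
    exact Finset.sum_pos' (fun B _ => mul_self_nonneg _)
      ⟨A, Finset.mem_univ A, mul_self_pos.mpr hA⟩

end Metric

/-! ## A horizontal volume form -/

section HorizontalVolume

variable {n m : ℕ} {X : Type*} [TopologicalSpace X] [ChartedSpace (Fin (n + m) → ℝ) X] {t : ℕ}

namespace AChart

/-- The differential of the projection to `X`, in coordinates. -/
def ptL (c : AChart n m X) : Coord n m t →ₗ[ℝ] (Fin (n + m) → ℝ) where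
  toFun := c.pt
  map_add' k l := by
    funext A
    obtain ⟨a, rfl⟩ := c.e.surjective A
    cases a <;> simp [pt]
  map_smul' a k := by
    funext A
    obtain ⟨b, rfl⟩ := c.e.surjective A
    cases b <;> simp [pt]

variable {c c' : AChart n m X}

theorem ptL_apply (k : Coord n m t) : c.ptL k = c.pt k := rfl

theorem pt_congr {v w : Coord n m t} (h1 : v.1 = w.1)
    (h2 : ∀ σ : Fin m, dy σ (0 : Multiset (Fin n)) v = dy σ (0 : Multiset (Fin n)) w) :
    c.pt v = c.pt w := by
  unfold pt
  rw [h1]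
  congr 1
  funext σ
  have := h2 σ
  rwa [dy_apply σ (by simp), dy_apply σ (by simp)] at this

theorem pt_change (ht : 1 ≤ t) {k : Coord n m t} (hk : k ∈ c.overlap c' t) :
    c'.pt (c.change c' t k) = c'.ψ (c.ψ.symm (c.pt k)) := by
  rw [change_eq ht hk, pt]
  refine Eq.trans ?_ (c'.assemble_eta (c.locChange c' k))
  congr 1
  funext σ
  simp [sorted, yExp]

theorem pt_mem_of_mem_overlap (ht : 1 ≤ t) {k : Coord n m t} (hk : k ∈ c.overlap c' t) :
    c.pt k ∈ c.ψ.target ∧ c.ψ.symm (c.pt k) ∈ c'.ψ.source := by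
  rw [overlap_eq ht] at hk
  exact hk.1

theorem pt_fderiv_change (ht : 1 ≤ t) {k : Coord n m t} (hk : k ∈ c.overlap c' t)
    (v : Coord n m t) : c'.pt (fderiv ℝ (c.change c' t) k v)
      = fderiv ℝ (fun z => c'.ψ (c.ψ.symm z)) (c.pt k) (c.pt v) := by
  obtain ⟨h1, h2⟩ := pt_mem_of_mem_overlap ht hk
  have hL : ∀ d : AChart n m X, HasFDerivAt (d.pt : Coord n m t → _)
      (LinearMap.toContinuousLinearMap d.ptL) k := fun d =>
    (LinearMap.toContinuousLinearMap (d.ptL (t := t))).hasFDerivAt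
  have hL' : HasFDerivAt (c'.pt : Coord n m t → _)
      (LinearMap.toContinuousLinearMap c'.ptL) (c.change c' t k) :=
    (LinearMap.toContinuousLinearMap (c'.ptL (t := t))).hasFDerivAt
  have e1 := hL'.comp k (differentiableAt_change ht hk).hasFDerivAt
  have e2 := ((c.isChart.contDiffAt_transition c'.isChart h1 h2).differentiableAt
    (by simp)).hasFDerivAt.comp k (hL c)
  have e3 : (c'.pt ∘ c.change c' t : Coord n m t → _)
      =ᶠ[𝓝 k] (fun z => c'.ψ (c.ψ.symm z)) ∘ c.pt := by
    filter_upwards [(isOpen_overlap ht).mem_nhds hk] with k' hk'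
    exact pt_change ht hk'
  exact congrArg (fun L => L v) (e1.unique (e2.congr_of_eventuallyEq e3))

/-- After projection to X the total derivatives span the contact n-plane, which is the same in all
charts; the two bases differ by P. The x̄-components agree because QP = 1, and the ȳ-components by
the recurrence for ȳ^σ_l. -/
theorem pt_totalVec_change (ht : 1 ≤ t) {k : Coord n m t} (hk : k ∈ c.overlap c' t) (l : Fin n) :
    c'.pt (totalVec l (c.change c' t k))
      = fderiv ℝ (fun z => c'.ψ (c.ψ.symm z)) (c.pt k)
          (∑ i, c.Pmat c' t k i l • c.pt (totalVec i k)) := by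
  have h1 : ∑ i, c.Pmat c' t k i l • c.pt (totalVec i k)
      = c.pt (∑ i, c.Pmat c' t k i l • totalVec i k) := by
    simp only [← ptL_apply, map_sum, map_smul]
  rw [h1, ← pt_fderiv_change ht hk]
  refine pt_congr (funext fun j => ?_) fun σ => ?_
  · have h2 := congrFun (congrFun (Matrix.mul_nonsing_inv _ (det_Q_ne_zero ht hk).isUnit) j) l
    rw [fderiv_change_fst ht hk, map_sum]
    refine Eq.trans ?_ (h2.symm.trans ?_)
    · simp [totalVec, Matrix.one_apply, Pi.single_apply]
    · rw [Matrix.mul_apply]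
      refine Finset.sum_congr rfl fun i _ => ?_
      rw [map_smul, smul_eq_mul, mul_comm]
      rfl
  · have h2 := yBar_cons ht σ l [] (by simpa using ht) hk
    have h3 := dy_fderiv_change ht hk (∑ i, c.Pmat c' t k i l • totalVec i k) σ []
    rw [Multiset.coe_nil] at h3
    rw [h3, map_sum, dy_apply σ (by simp)]
    refine Eq.trans ?_ (h2.trans (Finset.sum_congr rfl fun i _ => ?_))
    · exact if_pos (show 0 < t from ht)
    · rw [map_smul]
      rfl

variable (f : SmoothPartitionOfUnity X 𝓘(ℝ, Fin (n + m) → ℝ) X Set.univ) (c)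

/-- The scalar products of a vector with the total derivatives. -/
def pairing (k : Coord n m t) : Coord n m t →ₗ[ℝ] (Fin n → ℝ) :=
  LinearMap.pi fun i => metric f c.ψ (c.pt k) (c.pt (totalVec i k)) ∘ₗ c.ptL

theorem pairing_apply (k v : Coord n m t) (i : Fin n) :
    c.pairing f k v i = metric f c.ψ (c.pt k) (c.pt (totalVec i k)) (c.pt v) := rfl

/-- The Gram matrix of the total derivatives. -/
def gram (k : Coord n m t) : Matrix (Fin n) (Fin n) ℝ :=
  Matrix.of fun i j => c.pairing f k (totalVec i k) j

/-- The volume form on the contact element, extended by orthogonal projection. -/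
def horVol (k : Coord n m t) : (Coord n m t) [⋀^Fin n]→ₗ[ℝ] ℝ :=
  (c.gram f k).det⁻¹ • Matrix.detRowAlternating.compLinearMap (c.pairing f k)

theorem horVol_apply (k : Coord n m t) (v : Fin n → Coord n m t) :
    c.horVol f k v = (c.gram f k).det⁻¹ * (Matrix.of fun a => c.pairing f k (v a)).det := rfl

variable [IsManifold 𝓘(ℝ, Fin (n + m) → ℝ) ∞ X]
variable {f} (hf : f.IsSubordinate (fun x => (chartAt (Fin (n + m) → ℝ) x).source))
include hf

/-- The projections of the total derivatives to X are linearly independent, as their x-components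
are the standard basis; a vector in the kernel of the Gram matrix would have length zero. -/
theorem det_gram_ne_zero {k : Coord n m t} (hk : c.pt k ∈ c.ψ.target) : (c.gram f k).det ≠ 0 := by
  intro h0
  obtain ⟨x, hx, hx0⟩ := Matrix.exists_vecMul_eq_zero_iff.mpr h0
  set w : Coord n m t := ∑ i, x i • totalVec i k with hw
  have h1 : c.pairing f k w = 0 := by
    rw [← hx0, hw, map_sum]
    funext j
    simp [Matrix.vecMul, dotProduct, gram]
  have h2 : metric f c.ψ (c.pt k) (c.pt w) (c.pt w) = 0 := by
    have h3 : c.pt w = ∑ i, x i • c.pt (totalVec i k) := by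
      simp only [hw, ← ptL_apply, map_sum, map_smul]
    have h4 : ∀ i, metric f c.ψ (c.pt k) (c.pt (totalVec i k)) (c.pt w) = 0 := fun i => by
      rw [← pairing_apply, h1, Pi.zero_apply]
    have h5 : ∀ u, metric f c.ψ (c.pt k) (∑ i, x i • c.pt (totalVec i k)) u
        = ∑ i, x i * metric f c.ψ (c.pt k) (c.pt (totalVec i k)) u := fun u => by
      simp
    rw [← h3] at h5
    rw [h5]
    exact Finset.sum_eq_zero fun i _ => by rw [h4, mul_zero]
  refine (metric_pos hf c.isChart hk (fun h => hx ?_)).ne' h2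
  funext i
  have h3 : w.1 i = x i := by
    simp [hw, totalVec, Prod.fst_sum, Finset.sum_apply, Pi.single_apply]
  rw [← h3, show w.1 i = c.pt w (c.e (Sum.inl i)) by simp [pt], h]
  rfl

theorem contDiffOn_pairing {g : Coord n m t → Coord n m t} (hg : ContDiff ℝ ∞ g) (ht : 1 ≤ t)
    (i : Fin n) :
    ContDiffOn ℝ ∞ (fun k => c.pairing f k (g k) i) (c.image t) := by
  have h1 : ∀ z u v, metric f c.ψ z u v = ∑ A, ∑ B, u A * (v B *
      metric f c.ψ z (Pi.single A 1) (Pi.single B 1)) := fun z u v => by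
    conv_lhs => rw [pi_eq_sum_univ' u, pi_eq_sum_univ' v]
    simp only [map_sum, map_smul, LinearMap.sum_apply, LinearMap.smul_apply, smul_eq_mul,
      Finset.mul_sum]
    rw [Finset.sum_comm]
    exact Finset.sum_congr rfl fun A _ => Finset.sum_congr rfl fun B _ => by ring
  have h3 : (fun k => c.pairing f k (g k) i) = fun k => ∑ A, ∑ B,
      c.pt (totalVec i k) A * (c.pt (g k) B *
        metric f c.ψ (c.pt k) (Pi.single A 1) (Pi.single B 1)) := funext fun k => h1 _ _ _
  rw [h3]
  have h2 : ∀ (h : Coord n m t → Coord n m t), ContDiff ℝ ∞ h → ∀ A,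
      ContDiff ℝ ∞ (fun k => c.pt (h k) A) := fun h hh A =>
    contDiff_pi.mp (contDiff_pt.comp hh) A
  refine ContDiffOn.sum fun A _ => ContDiffOn.sum fun B _ =>
    (h2 _ (contDiff_totalVec i) A).contDiffOn.mul ((h2 g hg B).contDiffOn.mul ?_)
  exact (contDiffOn_metric hf c.isChart _ _).comp contDiff_pt.contDiffOn
    fun k hk => (mem_image_iff_pt ht).mp hk

theorem smoothFormOn_horVol (ht : 1 ≤ t) : SmoothFormOn (c.image t) (c.horVol f) := by
  intro v k hk
  refine ContDiffAt.contDiffWithinAt ?_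
  have h1 : ∀ g : Coord n m t → Coord n m t, ContDiff ℝ ∞ g → ∀ i,
      ContDiffAt ℝ ∞ (fun k => c.pairing f k (g k) i) k := fun g hg i =>
    (c.contDiffOn_pairing hf hg ht i).contDiffAt ((isOpen_image ht).mem_nhds hk)
  simp only [horVol_apply]
  exact ((contDiffAt_matrix_det fun i j => h1 _ (contDiff_totalVec i) j).inv
    (c.det_gram_ne_zero hf ((mem_image_iff_pt ht).mp hk))).mul
    (contDiffAt_matrix_det fun i j => h1 _ contDiff_const j)

/-- If all ω^σ vanish on v, its projection to X is already a combination of the total derivatives,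
with coefficients dxⁱ(v). The orthogonal projection then changes nothing and the Gram determinant
cancels. -/
theorem horVol_of_omega_eq_zero {k : Coord n m t} (hk : c.pt k ∈ c.ψ.target)
    {v : Fin n → Coord n m t} (hv : ∀ a (σ : Fin m), omega σ 0 k (v a) = 0) :
    c.horVol f k v = theta0 v := by
  have h1 : ∀ a, c.pt (v a) = c.ptL (∑ i, (v a).1 i • totalVec i k) := fun a => by
    conv_lhs => rw [eq_sum_totalVec_add_omega k (v a), ← ptL_apply, map_add]
    have h3 : c.pt ((0, fun σ I => omega σ I.1 k (v a)) : Coord n m t) = c.pt 0 :=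
      pt_congr rfl fun σ => by
        rw [dy_apply σ (by simp), map_zero]
        exact hv a σ
    exact add_eq_left.mpr (h3.trans c.ptL.map_zero)
  have h2 : (Matrix.of fun a => c.pairing f k (v a))
      = (Matrix.of fun a => (v a).1) * c.gram f k := by
    ext a j
    rw [Matrix.of_apply, pairing_apply, h1, map_sum, map_sum, Matrix.mul_apply]
    refine Finset.sum_congr rfl fun i _ => ?_
    rw [map_smul, map_smul]
    rfl
  rw [horVol_apply, h2, Matrix.det_mul, mul_comm, mul_assoc,
    mul_inv_cancel₀ (c.det_gram_ne_zero hf hk), mul_one]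
  rfl

variable {c}

theorem pairing_change (ht : 1 ≤ t) {k : Coord n m t} (hk : k ∈ c.overlap c' t)
    {u w : Coord n m t}
    (h : c'.pt w = fderiv ℝ (fun z => c'.ψ (c.ψ.symm z)) (c.pt k) (c.pt u)) (l : Fin n) :
    c'.pairing f (c.change c' t k) w l = ∑ i, c.pairing f k u i * c.Pmat c' t k i l := by
  obtain ⟨h1, h2⟩ := pt_mem_of_mem_overlap ht hk
  rw [pairing_apply, h, pt_totalVec_change ht hk, pt_change ht hk,
    metric_change hf c.isChart c'.isChart h1 h2, map_sum, LinearMap.sum_apply]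
  refine Finset.sum_congr rfl fun i _ => ?_
  rw [map_smul, LinearMap.smul_apply, smul_eq_mul, mul_comm]
  rfl

/-- Passing to the second chart multiplies the Gram determinant by (det P)² and the determinant of
the scalar products by det P, so the quotient is multiplied by (det P)⁻¹ = 𝓙, with no contact terms
left. -/
theorem horVol_change (ht : 1 ≤ t) {k : Coord n m t} (hk : k ∈ c.overlap c' t) :
    (c.J c' t k)⁻¹ • (c'.horVol f (c.change c' t k)).compLinearMap
        (fderiv ℝ (c.change c' t) k : Coord n m t →ₗ[ℝ] Coord n m t) = c.horVol f k := by
  ext v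
  have hP : (c.J c' t k)⁻¹ = (c.Pmat c' t k).det := by
    rw [Pmat, Matrix.det_nonsing_inv, Ring.inverse_eq_inv']
    rfl
  have hP0 : (c.Pmat c' t k).det ≠ 0 := hP ▸ inv_ne_zero (det_Q_ne_zero ht hk)
  have h1 : (Matrix.of fun a => c'.pairing f (c.change c' t k) (fderiv ℝ (c.change c' t) k (v a)))
      = (Matrix.of fun a => c.pairing f k (v a)) * c.Pmat c' t k := by
    ext a l
    exact pairing_change hf ht hk (pt_fderiv_change ht hk (v a)) l
  have h2 : c'.gram f (c.change c' t k)
      = (c.Pmat c' t k).transpose * c.gram f k * c.Pmat c' t k := by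
    ext l l'
    have h3 : c'.pt (totalVec l (c.change c' t k))
        = fderiv ℝ (fun z => c'.ψ (c.ψ.symm z)) (c.pt k)
          (c.pt (∑ i, c.Pmat c' t k i l • totalVec i k)) := by
      rw [pt_totalVec_change ht hk]
      simp only [← ptL_apply, map_sum, map_smul]
    rw [gram, Matrix.of_apply, pairing_change hf ht hk h3, Matrix.mul_apply]
    refine Finset.sum_congr rfl fun i _ => ?_
    congr 1
    rw [map_sum, Finset.sum_apply, Matrix.mul_apply]
    refine Finset.sum_congr rfl fun j _ => ?_
    rw [map_smul]
    rfl
  rw [AlternatingMap.smul_apply, AlternatingMap.compLinearMap_apply, horVol_apply, horVol_apply, hP]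
  change _ • (_ * (Matrix.of fun a => c'.pairing f (c.change c' t k)
    (fderiv ℝ (c.change c' t) k (v a))).det) = _
  rw [h1, h2, Matrix.det_mul, Matrix.det_mul, Matrix.det_mul, Matrix.det_transpose, smul_eq_mul]
  field_simp

end AChart

end HorizontalVolume

/-! ## The global class -/

section GlobalClass

variable {n m s t : ℕ}

theorem ContactOrder.sum {r q d : ℕ} {ι : Type*} {U : Set (Coord n m r)} (S : Finset ι)
    {β : ι → CForm n m r q} (hβ : ∀ i ∈ S, ContactOrder U d q (β i)) :
    ContactOrder U d q (fun k => ∑ i ∈ S, β i k) := by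
  classical
  induction S using Finset.induction_on with
  | empty => exact ContactOrder.zero d q
  | insert j S hj ih =>
    have h1 : (fun k => ∑ i ∈ insert j S, β i k) = β j + fun k => ∑ i ∈ S, β i k :=
      funext fun k => Finset.sum_insert hj
    rw [h1]
    exact ContactOrder.add _ _ (hβ j (Finset.mem_insert_self j S))
      (ih fun i hi => hβ i (Finset.mem_insert_of_mem hi))

theorem ContactOrder.sub {r q d : ℕ} {U : Set (Coord n m r)} {α β : CForm n m r q}
    (hα : ContactOrder U d q α) (hβ : ContactOrder U d q β) : ContactOrder U d q (α - β) := by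
  rw [sub_eq_add_neg]
  exact hα.add _ _ (hβ.neg _)

theorem contDiff_omega {r : ℕ} (σ : Fin m) (I : Multiset (Fin n)) (v : Coord n m r) :
    ContDiff ℝ ∞ (fun k : Coord n m r => omega σ I k v) := by
  have h : ∀ J : Multiset (Fin n), ContDiff ℝ ∞ (fun k : Coord n m r => dy σ J k) := fun J =>
    (LinearMap.toContinuousLinearMap (dy σ J : Coord n m r →ₗ[ℝ] ℝ)).contDiff
  simp only [omega_apply]
  exact contDiff_const.sub (ContDiff.sum fun i _ => (h _).mul contDiff_const)

theorem omega_zero_ey {r : ℕ} (σ τ : Fin m) (k : Coord n m r) :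
    omega σ 0 k (ey τ 0) = if σ = τ then 1 else 0 := by
  rw [omega_apply, dy_ey τ σ (by simp), ey_fst]
  simp

theorem contDiffOn_Ds {r : ℕ} {U : Set (Coord n m r)} (hU : IsOpen U) {f : Coord n m r → ℝ}
    (hf : ContDiffOn ℝ ∞ f U) (l : List (Fin n)) : ContDiffOn ℝ ∞ (Ds l f) U := by
  induction l with
  | nil => exact hf
  | cons j l ih => exact contDiffOn_D hU ih j

theorem contDiffOn_HS {U : Set (Coord n m t)} (hU : IsOpen U) (hst : s ≤ t)
    {F : Fin m → Coord n m s → ℝ} (hF : ∀ σ, ContDiffOn ℝ ∞ (fun k => F σ (truncate hst k)) U)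
    (σ ν : Fin m) (l : List (Fin n)) : ContDiffOn ℝ ∞ (HS hst F σ ν l) U := by
  refine (contDiffOn_Del hU (hF σ) ν l).sub (contDiffOn_const.mul ?_)
  exact ContDiffOn.sum fun j _ => ContDiffOn.sum fun J _ =>
    contDiffOn_const.mul (contDiffOn_Ds hU (contDiffOn_Del hU (hF ν) σ _) _)

theorem smoothFormOn_helmForm {U : Set (Coord n m t)} (hst : s ≤ t) {F : Fin m → Coord n m s → ℝ}
    (hF : ∀ σ ν l, ContDiffOn ℝ ∞ (HS hst F σ ν l) U) {α : CForm n m t n}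
    (hα : SmoothFormOn U α) : SmoothFormOn U (fun k => helmForm hst F k (α k)) := by
  simp only [helmForm_apply]
  exact SmoothFormOn.sum fun a => SmoothFormOn.sum fun σ => SmoothFormOn.smul (hF _ _ _)
    (SmoothFormOn.wedgeL _ (fun v => (contDiff_omega _ _ v).contDiffOn)
      (SmoothFormOn.wedgeL _ (fun v => (contDiff_omega _ _ v).contDiffOn) hα))

/-- An n-form that vanishes on the common kernel of the ω^σ is a sum of terms ω^τ ∧ Φ. Together with
ω^ν_I ∧ ω^σ this makes three contact factors, which is the number required in degree n + 2. The
forms ω^ν_I with |I| = s are admissible because s + 1 ≤ t. -/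
theorem stronglyContactOn_helmForm (hn : 1 ≤ n) {U : Set (Coord n m t)} (hst : s + 1 ≤ t)
    {F : Fin m → Coord n m s → ℝ}
    (hF : ∀ σ ν l, ContDiffOn ℝ ∞ (HS (Nat.le_of_succ_le hst) F σ ν l) U) {α : CForm n m t n}
    (hα : SmoothFormOn U α)
    (h0 : ∀ k ∈ U, ∀ v : Fin n → Coord n m t, (∀ a (σ : Fin m), omega σ 0 k (v a) = 0) →
      α k v = 0) :
    StronglyContactOn U (d := 2) (fun k => helmForm (Nat.le_of_succ_le hst) F k (α k)) := by
  -- The cofactor Φ has degree n − 1, so n ≥ 1 is needed here.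
  have hn1 : 1 + (n - 1) = n := by omega
  obtain ⟨Φ, hΦ, hk⟩ := exists_eq_sum_wedgeL hn1 (U := U) (w := fun σ : Fin m => omega σ 0)
    (e := fun σ => ey σ 0) (fun σ v => (contDiff_omega σ 0 v).contDiffOn)
    (fun σ τ k => omega_zero_ey σ τ k) Finset.univ α hα
  -- Subtracting ω^σ(v) ∂/∂y^σ from v lands in the common kernel of the ω^σ, where α vanishes.
  have h1 : ∀ k ∈ U, α k = ∑ τ, wedgeL hn1 (omega τ 0 k) (Φ τ k) := fun k hkU => by
    conv_lhs => rw [hk k]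
    refine add_eq_right.mpr (AlternatingMap.ext fun v => h0 k hkU _ fun a σ => ?_)
    simp [map_sum, omega_zero_ey]
  refine ContactOrder.congr _ _ (fun k hkU => ?_) (ContactOrder.sum
    (Finset.univ : Finset (VIdx m n s)) fun a _ => ContactOrder.sum (Finset.univ : Finset (Fin m))
    fun σ _ => ContactOrder.sum (Finset.univ : Finset (Fin m)) fun τ _ =>
    ContactOrder.omega_wedge (by omega : 1 + (1 + n) = n + 2) a.1 a.tuple
      (by have := a.length_tuple_le; rw [Multiset.coe_card]; omega) _
    (ContactOrder.omega_wedge (rfl : 1 + n = 1 + n) σ 0 (by simp; omega) _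
    (ContactOrder.omega_wedge hn1 τ 0 (by simp; omega) _
    (ContactOrder.base _ (SmoothFormOn.smul (hF σ a.1 a.tuple) (hΦ τ))))))
  rw [helmForm_apply, h1 k hkU]
  refine Finset.sum_congr rfl fun a _ => Finset.sum_congr rfl fun σ _ => ?_
  rw [map_sum, map_sum, Finset.smul_sum]
  refine Finset.sum_congr rfl fun τ _ => ?_
  simp only [← wedgeL_apply, map_smul]

variable {X : Type*} [TopologicalSpace X] [ChartedSpace (Fin (n + m) → ℝ) X]
  {T : DiffEq n m X s}

open Classical in
/-- The form `∑ H^I_{σν} ω^ν_I ∧ ω^σ ∧ Λ`, where `Λ` is the horizontal volume form. -/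
def globalForm (hst : s ≤ t) (T : DiffEq n m X s)
    (f : SmoothPartitionOfUnity X 𝓘(ℝ, Fin (n + m) → ℝ) X Set.univ) (c : AChart n m X) :
    CForm n m t (n + 2) :=
  fun k => if k ∈ c.image t then helmForm hst (T.nonhom c) k (c.horVol f k) else 0

variable (hs : 1 ≤ s) (ht : 2 * s ≤ t) (hT : T.IsHomogeneous)

include hs hT in
theorem contDiffOn_HS_nonhom (hst : s ≤ t) (c : AChart n m X) (σ ν : Fin m) (l : List (Fin n)) :
    ContDiffOn ℝ ∞ (HS hst (T.nonhom c) σ ν l) (c.image t) :=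
  contDiffOn_HS (AChart.isOpen_image (hs.trans hst)) hst (fun σ =>
    contDiffOn_comp_truncate hst (fun _ hk => AChart.truncate_mem_image hs hst hk)
      (hT.contDiffOn_nonhom hs c σ)) σ ν l

variable [IsManifold 𝓘(ℝ, Fin (n + m) → ℝ) ∞ X]
  {f : SmoothPartitionOfUnity X 𝓘(ℝ, Fin (n + m) → ℝ) X Set.univ}
  (hf : f.IsSubordinate (fun x => (chartAt (Fin (n + m) → ℝ) x).source))
include hs ht hT hf

/-- The factor 𝓙⁻¹ left by the coefficients and contact forms is exactly what the horizontal volume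
form absorbs, so the local expressions agree and not only their classes. -/
theorem globalForm_mem (hst : s ≤ t) : globalForm hst T f ∈ Form n m X t (n + 2) := by
  have ht1 : 1 ≤ t := hs.trans hst
  refine ⟨fun c v => ?_, fun c c' k hk => ?_, fun c k hk => if_neg hk⟩
  · refine ContDiffOn.congr (smoothFormOn_helmForm hst (contDiffOn_HS_nonhom hs hT hst c)
      (c.smoothFormOn_horVol hf ht1) v) fun k hk => ?_
    rw [globalForm, if_pos hk]
  · rw [globalForm, globalForm, if_pos (AChart.overlap_subset_image hk),
      if_pos (AChart.overlap_subset_image (AChart.change_mem_overlap ht1 hk)),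
      helmForm_change hs ht hst hT c c' hk, AChart.horVol_change hf ht1 hk]

theorem stronglyContactOn_globalForm_sub (hn : 1 ≤ n) (hst : s ≤ t) (c : AChart n m X) :
    StronglyContactOn (c.image t) (d := 2) (globalForm hst T f c - HSForm hst (T.nonhom c)) := by
  have ht1 : 1 ≤ t := hs.trans hst
  refine ContactOrder.congr _ _ (fun k hk => ?_) (stronglyContactOn_helmForm hn
    (U := c.image t) (show s + 1 ≤ t by omega) (F := T.nonhom c)
    (contDiffOn_HS_nonhom hs hT hst c)
    ((c.smoothFormOn_horVol hf ht1).sub (β := fun _ => theta0) fun _ => contDiffOn_const)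
    fun k hk v hv => ?_)
  · change _ = globalForm hst T f c k - HSForm hst (T.nonhom c) k
    rw [map_sub, HSForm_eq, globalForm, if_pos hk]
  · rw [AlternatingMap.sub_apply,
      c.horVol_of_omega_eq_zero hf ((AChart.mem_image_iff_pt ht1).mp hk) hv, sub_self]

end GlobalClass

/-! ### Uniqueness of the class -/

section Uniqueness

variable {n m t : ℕ} {X : Type*} [TopologicalSpace X] [ChartedSpace (Fin (n + m) → ℝ) X]

/-- Local forms that are represented by a global form modulo contact forms determine a class. -/
theorem existsUnique_class {d : ℕ} {H : AChart n m X → CForm n m t (n + d)}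
    (η₀ : Form n m X t (n + d)) (h₀ : ∀ c, StronglyContactOn (c.image t) (η₀.1 c - H c)) :
    ∃! h : Form n m X t (n + d) ⧸ ContactForm n m X t d,
      ∀ η : Form n m X t (n + d), QuotientAddGroup.mk η = h →
        ∀ c : AChart n m X, StronglyContactOn (c.image t) (η.1 c - H c) := by
  refine ⟨QuotientAddGroup.mk η₀, fun η hη c => ?_, fun h hh => ?_⟩
  · have h1 := QuotientAddGroup.eq.mp hη c
    have h2 : η.1 c - H c = (η₀.1 c - H c) - (-η + η₀).1 c := by
      change _ = (η₀.1 c - H c) - (-η.1 c + η₀.1 c)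
      abel
    rw [h2]
    exact ContactOrder.sub (h₀ c) h1
  · obtain ⟨η, rfl⟩ := QuotientAddGroup.mk_surjective h
    refine QuotientAddGroup.eq.mpr fun c => ?_
    have h2 : (-η + η₀).1 c = (η₀.1 c - H c) - (η.1 c - H c) := by
      change -η.1 c + η₀.1 c = _
      abel
    rw [h2]
    exact ContactOrder.sub (h₀ c) (hh η rfl c)

end Uniqueness

end HelmholtzSonin

end

theorem mainTheorem8 {n m : ℕ} (hn : 1 ≤ n)
    {X : Type*} [TopologicalSpace X] [T2Space X] [SecondCountableTopology X]
    [ChartedSpace (Fin (n + m) → ℝ) X] [IsManifold 𝓘(ℝ, Fin (n + m) → ℝ) ∞ X]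
    {s t : ℕ} (hs : 1 ≤ s) (ht : 2 * s ≤ t)
    (T : HelmholtzSonin.DiffEq n m X s) (hT : T.IsHomogeneous) :
    -- the functions `T_σ` are well defined and smooth
    (∀ (c : HelmholtzSonin.AChart n m X) (σ : Fin m),
      ContDiffOn ℝ ∞ (T.nonhom c σ) (c.image s)) ∧
    (∀ (c : HelmholtzSonin.AChart n m X) (γ : HelmholtzSonin.ImmGerm n m X), c.InDom γ →
      ∀ σ : Fin m,
        HelmholtzSonin.component T.form c.ψ (c.e (Sum.inr σ)) (HelmholtzSonin.jet s γ)
          = c.detX γ * T.nonhom c σ (c.coord s (HelmholtzSonin.rho (HelmholtzSonin.jet s γ)))) ∧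
    -- the chart-change formulas
    (∀ (c c' : HelmholtzSonin.AChart n m X), ∀ k ∈ c.overlap c' t, ∀ σ ν : Fin m,
      HelmholtzSonin.HS (by omega : s ≤ t) (T.nonhom c) σ ν [] k
        = c.J c' t k * ∑ α, c.P c' t α σ k *
            ∑ j ∈ Finset.range (s + 1), ∑ J : Fin j → Fin n, ∑ β,
              (HelmholtzSonin.Del ν [] (c.yBar c' t β (List.ofFn J)) k
                - ∑ i, ∑ l, c.Pmat c' t k i l
                    * HelmholtzSonin.D i (c.yBar c' t β (List.ofFn J)) k
                    * HelmholtzSonin.Del ν [] (c.xBar c' t l) k)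
              * HelmholtzSonin.HS (by omega : s ≤ t) (T.nonhom c') α β (List.ofFn J)
                  (c.change c' t k)) ∧
    (∀ (c c' : HelmholtzSonin.AChart n m X), ∀ k ∈ c.overlap c' t, ∀ σ ν : Fin m,
      ∀ I : List (Fin n), I ≠ [] → I.length ≤ s →
        HelmholtzSonin.HS (by omega : s ≤ t) (T.nonhom c) σ ν I k
          = c.J c' t k * ∑ α, c.P c' t α σ k *
              ∑ j ∈ Finset.Icc I.length s, ∑ J : Fin j → Fin n, ∑ β,
                HelmholtzSonin.Del ν I (c.yBar c' t β (List.ofFn J)) k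
                * HelmholtzSonin.HS (by omega : s ≤ t) (T.nonhom c') α β (List.ofFn J)
                    (c.change c' t k)) ∧
    -- the global class
    (∃! h : HelmholtzSonin.Form n m X t (n + 2) ⧸ HelmholtzSonin.ContactForm n m X t 2,
      ∀ η : HelmholtzSonin.Form n m X t (n + 2), QuotientAddGroup.mk η = h →
        ∀ c : HelmholtzSonin.AChart n m X,
          HelmholtzSonin.StronglyContactOn (c.image t)
            (η.1 c - HelmholtzSonin.HSForm (by omega : s ≤ t) (T.nonhom c))) := by
  have hst : s ≤ t := by omega
  -- Local compactness together with second countability gives σ-compactness, hence a smooth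
  -- partition of unity subordinate to the charts, from which the metric is built.
  have : LocallyCompactSpace X := ChartedSpace.locallyCompactSpace (Fin (n + m) → ℝ) X
  obtain ⟨f, hf⟩ := SmoothPartitionOfUnity.exists_isSubordinate_chartAt_source
    𝓘(ℝ, Fin (n + m) → ℝ) X
  refine ⟨fun c σ => hT.contDiffOn_nonhom hs c σ, fun c γ h σ => ?_,
    fun c c' k hk σ ν => HelmholtzSonin.HS_change hs ht hst hT c c' hk σ ν (Nat.zero_le s),
    fun c c' k hk σ ν I hI0 hI =>
      HelmholtzSonin.HS_change_of_ne_nil hs ht hst hT c c' hk σ ν hI0 hI,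
    HelmholtzSonin.existsUnique_class
      ⟨HelmholtzSonin.globalForm hst T f, HelmholtzSonin.globalForm_mem hs ht hT hf hst⟩
      fun c => HelmholtzSonin.stronglyContactOn_globalForm_sub hs ht hT hf hn hst c⟩
  rw [HelmholtzSonin.AChart.coord_rho_jet hs h]
  exact hT.component_eq_nonhom hs h σ
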